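/- Let $\mathbb K$ be an algebraically closed field and let $(I,A,\cdot)$ be a Borcherds–Cartan datum: $I$ is a finite set, $A=(a_{ij})_{i,j\in I}$ is an integer matrix with $a_{ii}\in\{2,0,-2,-4,\dots\}$ and $a_{ij}\le 0$ for $i\ne j$, there are positive integers $r_i$ with $r_ia_{ij}=r_ja_{ji}$, and $\cdot$ is the bilinear form on $\mathbb Z[I]$ with $i\cdot j=r_ia_{ij}$. For $\nu\in\mathbb N[I]$ of height $n$ let $\mathrm{Seq}(\nu)$ be the set of sequences $\mathbf i=i_1\cdots i_n$ in $I$ with $i_1+\cdots+i_n=\nu$, and let $R(\nu)$ be the $\mathbb Z$-graded unital $\mathbb K$-algebra generated by $1_{\mathbf i}$ (degree $0$), $x_{k,\mathbf i}$ ($1\le k\le n$, degree $2r_{i_k}$) and $\tau_{k,\mathbf i}$ ($1\le k<n$, degree $-i_k\cdot i_{k+1}$) for $\mathbf i\in\mathrm{Seq}(\nu)$, with the following relations, in which $x_k=\sum_{\mathbf i}x_{k,\mathbf i}$ and $\tau_k=\sum_{\mathbf i}\tau_{k,\mathbf i}$: * the $1_{\mathbf i}$ are orthogonal idempotents with sum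 $1$; $x_{k,\mathbf i}=1_{\mathbf i}x_{k,\mathbf i}1_{\mathbf i}$ and $\tau_{k,\mathbf i}=1_{s_k\mathbf i}\tau_{k,\mathbf i}1_{\mathbf i}$; * $x_kx_l=x_lx_k$; $\tau_kx_l=x_l\tau_k$ if $l\ne k,k+1$; $\tau_k\tau_l=\tau_l\tau_k$ if $|k-l|>1$; * with $i=i_k$, $j=i_{k+1}$: $\tau_k^21_{\mathbf i}$ is $0$ if $i=j$, is $1_{\mathbf i}$ if $i\neq j$ and $i\cdot j=0$, and is $(x_k^{-a_{ij}}+x_{k+1}^{-a_{ji}})1_{\mathbf i}$ if $i\ne j$ and $i\cdot j\ne0$; * with $i=i_k$, $j=i_{k+1}$: $(x_k\tau_k-\tau_kx_{k+1})1_{\mathbf i}$ and $(\tau_kx_k-x_{k+1}\tau_k)1_{\mathbf i}$ are both $1_{\mathbf i}$ if $i=j$ and $a_{ii}=2$, and both $0$ otherwise; * with $i=i_k$, $j=i_{k+1}$: $(\tau_k\tau_{k+1}\tau_k-\tau_{k+1}\tau_k\tau_{k+1})1_{\mathbf i}$ is $\sum_{c=0}^{-a_{ij}-1}x_k^{c}x_{k+2}^{-a_{ij}-1-c}1_{\mathbf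 i}$ if $i_{k+2}=i\ne j$, $a_{ii}=2$ and $i\cdot j\neq 0$, and $0$ otherwise. Juxtaposition of sequences and diagrams gives a degree-preserving multiplicative map $R(\nu)\otimes R(\nu')\to R(\nu+\nu')$ sending $1$ to an idempotent $1_{\nu,\nu'}$. Define $\mathrm{Ind}_{\nu,\nu'}X=R(\nu+\nu')1_{\nu,\nu'}\otimes_{R(\nu)\otimes R(\nu')}X$ and $\mathrm{Res}_{\nu,\nu'}Y=1_{\nu,\nu'}Y$ on graded left modules, and define induction and restriction between $R(\alpha)\otimes R(\gamma)\otimes R(\beta)\otimes R(\delta)$ and $R(\alpha+\gamma)\otimes R(\beta+\delta)$ in the same way. For a graded module $M$ and $m\in\mathbb Z$, $M\{m\}$ is $M$ with the grading $M\{m\}_n=M_{n-m}$. (1) Let $\nu,\nu',\mu,\mu'\in\mathbb N[I]$ with $\nu+\nu'=\mu+\mu'$, let $M$ be a graded $R(\mu)$-module and $N$ a graded $R(\mu')$-module. Then $\mathrm{Res}_{\nu,\nu'}\mathrm{Ind}_{\mu,\mu'}(M\otimes N)$ has a finite filtration by graded $R(\nu)\otimes R(\nu')$-submodules whose successive subquotients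 are indexed, each index occurring exactly once, by the $\lambda\in\mathbb N[I]$ with $\nu-\lambda,\ \mu'-\lambda,\ \nu'+\lambda-\mu'\in\mathbb N[I]$, the one belonging to $\lambda$ being isomorphic as a graded module to $$\mathrm{Ind}^{\nu,\nu'}_{\nu-\lambda,\,\lambda,\,\nu'+\lambda-\mu',\,\mu'-\lambda}\;{}^\diamond\!\bigl(\mathrm{Res}^{\mu,\mu'}_{\nu-\lambda,\,\nu'+\lambda-\mu',\,\lambda,\,\mu'-\lambda}M\otimes N\bigr)\{-\lambda\cdot(\nu'+\lambda-\mu')\},$$ where ${}^\diamond$ turns a module over $R(\nu-\lambda)\otimes R(\nu'+\lambda-\mu')\otimes R(\lambda)\otimes R(\mu'-\lambda)$ into one over $R(\nu-\lambda)\otimes R(\lambda)\otimes R(\nu'+\lambda-\mu')\otimes R(\mu'-\lambda)$ by exchanging the two middle factors. (2) For a graded algebra $B$ let $K_0(B)$ be the Grothendieck group of finitely generated projective graded $B$-modules, a $\mathbb Z[q,q^{-1}]$-module with $q[P]=[P\{1\}]$, and let $K_0(R)=\bigoplus_{\nu}K_0(R(\nu))$; all tensor products of Grothendieck groups are over $\mathbb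 Z[q,q^{-1}]$. Then induction, restriction and outer tensor products preserve finitely generated projective graded modules; $[P]\otimes[Q]\mapsto[P\otimes Q]$ defines isomorphisms $K_0(R(\nu))\otimes K_0(R(\nu'))\cong K_0(R(\nu)\otimes R(\nu'))$; $[P][Q]=[\mathrm{Ind}_{\nu,\nu'}P\otimes Q]$ makes $K_0(R)$ an associative $\mathbb Z[q,q^{-1}]$-algebra with unit $1=[R(0)]$, where $R(0)=\mathbb K$; and the restrictions define a $\mathbb Z[q,q^{-1}]$-linear map $\widetilde{\mathrm{Res}}:K_0(R)\to K_0(R)\otimes K_0(R)$, $[P]\mapsto\sum_{\nu+\nu'=\omega}[\mathrm{Res}_{\nu,\nu'}P]$ for $P$ over $R(\omega)$. The twisted product $$(x_1\otimes x_2)(y_1\otimes y_2)=q^{-|x_2|\cdot|y_1|}\,x_1y_1\otimes x_2y_2$$ (for homogeneous elements, $|x|=\nu$ for $x\in K_0(R(\nu))$) makes $K_0(R)\otimes K_0(R)$ an associative algebra with unit $1\otimes1$, and $\widetilde{\mathrm{Res}}$ is a homomorphism of unital $\mathbb Z[q,q^{-1}]$-algebras for it. -/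

import Mathlib

set_option linter.unusedSectionVars false
noncomputable section

/-! ### Gradings -/

namespace GrAux
variable {K : Type*} [Field K] {M : Type*} [AddCommGroup M] [Module K M]

theorem isInternal_of (deg : ℤ → Submodule K M) (htop : ⨆ n, deg n = ⊤) (c : M →ₗ[K] (ℤ →₀ M))
    (hc : ∀ n, ∀ x ∈ deg n, c x = Finsupp.single n x) : DirectSum.IsInternal deg := by
  classical
  refine ⟨?_, ?_⟩
  · have key : ∀ y : DirectSum ℤ fun i => deg i, ∀ n,
        c (DirectSum.coeLinearMap deg y) n = (y n : M) := by
      intro y n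
      induction y using DirectSum.induction_on with
      | zero => simp
      | of i x =>
        rw [DirectSum.coeLinearMap_of, hc i _ x.2, Finsupp.single_apply]
        split_ifs with h
        · subst h; rw [DirectSum.of_eq_same]
        · rw [DirectSum.of_eq_of_ne _ _ _ (Ne.symm h)]; rfl
      | add a b ha hb => rw [map_add, map_add, Finsupp.add_apply, ha, hb]; rfl
    intro y z h
    refine DFinsupp.ext fun n => Subtype.ext ?_
    have h' : DirectSum.coeLinearMap deg y = DirectSum.coeLinearMap deg z := h
    exact (key y n).symm.trans ((congrArg (fun t => c t n) h').trans (key z n))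
  · intro x
    have hx : x ∈ ⨆ n, deg n := htop ▸ Submodule.mem_top
    rw [← DirectSum.range_coeLinearMap] at hx
    exact hx

theorem exists_coaction {deg : ℤ → Submodule K M} (h : DirectSum.IsInternal deg) :
    ∃ c : M →ₗ[K] (ℤ →₀ M), ∀ n, ∀ x ∈ deg n, c x = Finsupp.single n x := by
  classical
  let _ := h.chooseDecomposition
  refine ⟨(DirectSum.toModule K ℤ _ fun n => Finsupp.lsingle n ∘ₗ (deg n).subtype) ∘ₗ
    (DirectSum.decomposeLinearEquiv deg).toLinearMap, fun n x hx => ?_⟩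
  lift x to deg n using hx
  simp

theorem iSup_eq_top {deg : ℤ → Submodule K M} (h : DirectSum.IsInternal deg) :
    ⨆ n, deg n = ⊤ := h.submodule_iSup_eq_top

/-- Induction over a grading. -/
theorem induction {deg : ℤ → Submodule K M} (h : ⨆ n, deg n = ⊤) {P : M → Prop}
    (zero : P 0) (hom : ∀ n, ∀ x ∈ deg n, P x) (add : ∀ x y, P x → P y → P (x + y)) (x : M) :
    P x := by
  have hx : x ∈ ⨆ n, deg n := h ▸ Submodule.mem_top
  induction hx using Submodule.iSup_induction' with
  | mem n x h => exact hom n x h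
  | zero => exact zero
  | add a b _ _ ha hb => exact add a b ha hb

end GrAux


/-- A Borcherds–Cartan datum: an integer matrix `a` with diagonal entries in `{2, 0, -2, -4, …}` and
non-positive entries off the diagonal, made symmetric by positive integers `r i`. The associated
symmetric bilinear form is determined by `i · j = r i * a i j` (see `dot` and `pairing`). -/
structure BorcherdsDatum (I : Type*) where
  a : I → I → ℤ
  r : I → ℤ
  r_pos : ∀ i, 0 < r i
  diag : ∀ i, a i i = 2 ∨ (a i i ≤ 0 ∧ Even (a i i))
  offDiag : ∀ i j, i ≠ j → a i j ≤ 0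
  symm : ∀ i j, r i * a i j = r j * a j i

namespace BorcherdsDatum
variable {I : Type*} (D : BorcherdsDatum I)
/-- `i · j = rᵢ aᵢⱼ`. -/
def dot (i j : I) : ℤ := D.r i * D.a i j
/-- The bilinear extension `ν · μ` of the form to `ℕ[I]`. -/
def pairing (ν ν' : I →₀ ℕ) : ℤ := ν.sum fun i m => ν'.sum fun j n => (m : ℤ) * n * D.dot i j
theorem dot_comm (i j : I) : D.dot i j = D.dot j i := D.symm i j
end BorcherdsDatum

namespace QHA
variable {I : Type*}

/-- The weight `i₁ + ⋯ + iₙ ∈ ℕ[I]` of a sequence `i₁ … iₙ` in `I`. -/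
def wt (l : List I) : I →₀ ℕ := (l.map fun i => Finsupp.single i 1).sum

@[simp] theorem wt_nil : wt ([] : List I) = 0 := rfl
@[simp] theorem wt_append (l l' : List I) : wt (l ++ l') = wt l + wt l' := by simp [wt]
@[simp] theorem wt_cons (i : I) (l : List I) : wt (i :: l) = Finsupp.single i 1 + wt l := by
  simp [wt]

theorem degree_wt (l : List I) : (wt l).degree = l.length := by
  induction l with
  | nil => simp
  | cons i l ih => simp [ih, add_comm]

theorem finite_seq [Finite I] (ν : I →₀ ℕ) : {l : List I | wt l = ν}.Finite :=
  (List.finite_length_eq I ν.degree).subset fun l hl => by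
    change l.length = ν.degree
    rw [← show wt l = ν from hl, degree_wt]

/-- The finite set `Seq(ν)` of all sequences of weight `ν`. -/
def Seq [Finite I] (ν : I →₀ ℕ) : Finset (List I) := (finite_seq ν).toFinset
@[simp] theorem mem_Seq [Finite I] {ν : I →₀ ℕ} {l : List I} : l ∈ Seq ν ↔ wt l = ν := by
  simp [Seq]

/-- The elementary diagrams, for all sequences in `I`: vertical strands `e l`; the vertical strands of
the sequence `l i r` with a dot on the strand `i`; the crossing of the strands `i` and `j` of the
sequence `l i j r`, with bottom sequence `l i j r` and top sequence `l j i r`. So for a sequence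
`i₁ … iₙ` the diagram `x l i r` is `x_{k}` with `k = |l| + 1`, and likewise for `τ`. -/
inductive Gen (I : Type*) where
  | e (l : List I)
  | x (l : List I) (i : I) (r : List I)
  | τ (l : List I) (i j : I) (r : List I)

namespace Gen
/-- The bottom sequence. -/
def bot : Gen I → List I
  | e l => l
  | x l i r => l ++ i :: r
  | τ l i j r => l ++ i :: j :: r
/-- The top sequence. -/
def top : Gen I → List I
  | e l => l
  | x l i r => l ++ i :: r
  | τ l i j r => l ++ j :: i :: r
/-- The degree of an elementary diagram. -/
def deg (D : BorcherdsDatum I) : Gen I → ℤ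
  | e _ => 0
  | x _ i _ => 2 * D.r i
  | τ _ i j _ => - D.dot i j
/-- Add the vertical strands `p` on the left and `s` on the right. -/
def ctx (p : List I) (g : Gen I) (s : List I) : Gen I :=
  match g with
  | e l => e (p ++ l ++ s)
  | x l i r => x (p ++ l) i (r ++ s)
  | τ l i j r => τ (p ++ l) i j (r ++ s)
end Gen

theorem Gen.deg_ctx (D : BorcherdsDatum I) (p : List I) (g : Gen I) (s : List I) : (g.ctx p s).deg D = g.deg D := by
  cases g <;> rfl
theorem Gen.top_ctx (p : List I) (g : Gen I) (s : List I) : (g.ctx p s).top = p ++ g.top ++ s := by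
  cases g <;> simp [Gen.top, Gen.ctx]
theorem Gen.bot_ctx (p : List I) (g : Gen I) (s : List I) : (g.ctx p s).bot = p ++ g.bot ++ s := by
  cases g <;> simp [Gen.bot, Gen.ctx]
theorem Gen.ctx_ctx (p p' : List I) (g : Gen I) (s s' : List I) :
    (g.ctx p s).ctx p' s' = g.ctx (p' ++ p) (s ++ s') := by
  cases g <;> simp [Gen.ctx]
theorem Gen.ctx_nil (g : Gen I) : g.ctx [] [] = g := by
  cases g <;> simp [Gen.ctx]

theorem Gen.wt_bot (g : Gen I) : wt g.bot = wt g.top := by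
  cases g <;> simp [Gen.bot, Gen.top]; abel

section Algebra
variable (K : Type*) [Field K] [Finite I] (D : BorcherdsDatum I) (ν : I →₀ ℕ)

section
variable {I : Type*}
/-- The free generator `1_l`. -/
def fe (l : List I) : FreeAlgebra K (Gen I) := FreeAlgebra.ι K (Gen.e l)
/-- The free generator: a dot on the strand `i` of `l i r`. -/
def fx (l : List I) (i : I) (r : List I) : FreeAlgebra K (Gen I) := FreeAlgebra.ι K (Gen.x l i r)
/-- The free generator: the crossing of `i` and `j` in `l i j r`. -/
def fτ (l : List I) (i j : I) (r : List I) : FreeAlgebra K (Gen I) :=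
  FreeAlgebra.ι K (Gen.τ l i j r)
end

/-- The defining relations of `R(ν)`. The product `a * b` is the diagram `a` on top of `b`; every
local relation is imposed with arbitrary vertical strands `l` on the left and `r` on the right.
* `weight`: only sequences in `Seq(ν)` occur (diagrams on other sequences are zero);
* `one`, `orth`, `top`, `bot`: the `1_𝐢` are orthogonal idempotents with sum `1`, and a diagram with
  bottom `𝐢` and top `𝐣` lies in `1_𝐣 R(ν) 1_𝐢`;
* `interchange`: planar isotopy, distant dots and crossings slide past each other vertically;
* `quad…`: the value of a double crossing; `slide…`, `nil…`: moving a dot through a crossing;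
* `braid…`: the triple crossing relations. -/
inductive Rel : FreeAlgebra K (Gen I) → FreeAlgebra K (Gen I) → Prop
  | weight (l : List I) : wt l ≠ ν → Rel (fe K l) 0
  | one : Rel (∑ l ∈ Seq ν, fe K l) 1
  | orth (l l' : List I) : l ≠ l' → Rel (fe K l * fe K l') 0
  | top (g : Gen I) : Rel (fe K g.top * FreeAlgebra.ι K g) (FreeAlgebra.ι K g)
  | bot (g : Gen I) : Rel (FreeAlgebra.ι K g * fe K g.bot) (FreeAlgebra.ι K g)
  | interchange (g g' : Gen I) :
      Rel (FreeAlgebra.ι K (g.ctx [] g'.top) * FreeAlgebra.ι K (g'.ctx g.bot []))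
        (FreeAlgebra.ι K (g'.ctx g.top []) * FreeAlgebra.ι K (g.ctx [] g'.bot))
  | quad_same (l : List I) (i : I) (r : List I) : Rel (fτ K l i i r * fτ K l i i r) 0
  | quad_zero (l : List I) (i j : I) (r : List I) : i ≠ j → D.dot i j = 0 →
      Rel (fτ K l j i r * fτ K l i j r) (fe K (l ++ i :: j :: r))
  | quad (l : List I) (i j : I) (r : List I) : i ≠ j → D.dot i j ≠ 0 →
      Rel (fτ K l j i r * fτ K l i j r)
        (fe K (l ++ i :: j :: r) * fx K l i (j :: r) ^ (-D.a i j).toNat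
          + fe K (l ++ i :: j :: r) * fx K (l ++ [i]) j r ^ (-D.a j i).toNat)
  | slide_left (l : List I) (i j : I) (r : List I) : (i ≠ j ∨ D.a i i ≤ 0) →
      Rel (fx K l j (i :: r) * fτ K l i j r) (fτ K l i j r * fx K (l ++ [i]) j r)
  | slide_right (l : List I) (i j : I) (r : List I) : (i ≠ j ∨ D.a i i ≤ 0) →
      Rel (fτ K l i j r * fx K l i (j :: r)) (fx K (l ++ [j]) i r * fτ K l i j r)
  | nil_left (l : List I) (i : I) (r : List I) : D.a i i = 2 →
      Rel (fx K l i (i :: r) * fτ K l i i r - fτ K l i i r * fx K (l ++ [i]) i r)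
        (fe K (l ++ i :: i :: r))
  | nil_right (l : List I) (i : I) (r : List I) : D.a i i = 2 →
      Rel (fτ K l i i r * fx K l i (i :: r) - fx K (l ++ [i]) i r * fτ K l i i r)
        (fe K (l ++ i :: i :: r))
  | braid (l : List I) (i j : I) (r : List I) : D.a i i = 2 → i ≠ j → D.dot i j ≠ 0 →
      Rel (fτ K l j i (i :: r) * fτ K (l ++ [j]) i i r * fτ K l i j (i :: r)
          - fτ K (l ++ [i]) i j r * fτ K l i i (j :: r) * fτ K (l ++ [i]) j i r)
        (∑ c ∈ Finset.range (-D.a i j).toNat, fe K (l ++ i :: j :: i :: r) *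
          fx K l i (j :: i :: r) ^ c * fx K (l ++ [i, j]) i r ^ ((-D.a i j).toNat - 1 - c))
  | braid_zero (l : List I) (i j k : I) (r : List I) :
      ¬ (i = k ∧ D.a i i = 2 ∧ i ≠ j ∧ D.dot i j ≠ 0) →
      Rel (fτ K l j k (i :: r) * fτ K (l ++ [j]) i k r * fτ K l i j (k :: r))
        (fτ K (l ++ [k]) i j r * fτ K l i k (j :: r) * fτ K (l ++ [i]) j k r)

/-- The quiver Hecke algebra `R(ν)` of the datum `D` over the field `K`. -/
def Alg : Type _ := RingQuot (Rel K D ν)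
instance : Ring (Alg K D ν) := inferInstanceAs (Ring (RingQuot (Rel K D ν)))
instance : Algebra K (Alg K D ν) := inferInstanceAs (Algebra K (RingQuot (Rel K D ν)))

/-- The quotient map from the free algebra. -/
def proj : FreeAlgebra K (Gen I) →ₐ[K] Alg K D ν := RingQuot.mkAlgHom K (Rel K D ν)
/-- The class of an elementary diagram in `R(ν)`. -/
def gen (g : Gen I) : Alg K D ν := proj K D ν (FreeAlgebra.ι K g)

/-- Algebra maps out of `R(ν)`. -/
def lift {B : Type*} [Ring B] [Algebra K B] (f : Gen I → B)
    (hf : ∀ ⦃p q⦄, Rel K D ν p q → FreeAlgebra.lift K f p = FreeAlgebra.lift K f q) :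
    Alg K D ν →ₐ[K] B :=
  RingQuot.liftAlgHom K ⟨FreeAlgebra.lift K f, hf⟩


variable {K D ν}

theorem proj_rel {p q : FreeAlgebra K (Gen I)} (h : Rel K D ν p q) :
    proj K D ν p = proj K D ν q := RingQuot.mkAlgHom_rel K h

theorem proj_surjective : Function.Surjective (proj K D ν) := RingQuot.mkAlgHom_surjective K _

theorem lift_proj {B : Type*} [Ring B] [Algebra K B] (f : Gen I → B)
    (hf : ∀ ⦃p q⦄, Rel K D ν p q → FreeAlgebra.lift K f p = FreeAlgebra.lift K f q)
    (p : FreeAlgebra K (Gen I)) : lift K D ν f hf (proj K D ν p) = FreeAlgebra.lift K f p :=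
  RingQuot.liftAlgHom_mkAlgHom_apply K _ hf p

theorem lift_gen {B : Type*} [Ring B] [Algebra K B] (f : Gen I → B)
    (hf : ∀ ⦃p q⦄, Rel K D ν p q → FreeAlgebra.lift K f p = FreeAlgebra.lift K f q)
    (g : Gen I) : lift K D ν f hf (gen K D ν g) = f g := by
  rw [gen, lift_proj, FreeAlgebra.lift_ι_apply]

@[simp] theorem proj_ι (g : Gen I) : proj K D ν (FreeAlgebra.ι K g) = gen K D ν g := rfl
@[simp] theorem proj_fe (l : List I) : proj K D ν (fe K l) = gen K D ν (.e l) := rfl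
@[simp] theorem proj_fx (l : List I) (i : I) (r : List I) :
    proj K D ν (fx K l i r) = gen K D ν (.x l i r) := rfl
@[simp] theorem proj_fτ (l : List I) (i j : I) (r : List I) :
    proj K D ν (fτ K l i j r) = gen K D ν (.τ l i j r) := rfl

theorem e_weight {l : List I} (h : wt l ≠ ν) : gen K D ν (.e l) = 0 := by
  simpa using proj_rel (Rel.weight (K := K) (D := D) l h)
theorem sum_e : ∑ l ∈ Seq ν, gen K D ν (.e l) = 1 := by
  simpa using proj_rel (Rel.one (K := K) (D := D) (ν := ν))
theorem e_orth {l l' : List I} (h : l ≠ l') : gen K D ν (.e l) * gen K D ν (.e l') = 0 := by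
  simpa using proj_rel (Rel.orth (K := K) (D := D) (ν := ν) l l' h)
theorem top_mul (g : Gen I) : gen K D ν (.e g.top) * gen K D ν g = gen K D ν g := by
  simpa using proj_rel (Rel.top (K := K) (D := D) (ν := ν) g)
theorem mul_bot (g : Gen I) : gen K D ν g * gen K D ν (.e g.bot) = gen K D ν g := by
  simpa using proj_rel (Rel.bot (K := K) (D := D) (ν := ν) g)
theorem e_idem (l : List I) : gen K D ν (.e l) * gen K D ν (.e l) = gen K D ν (.e l) :=
  top_mul (.e l)

/-- Induction principle: a property stable under linear combinations and left multiplication by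
generators, and true for `1`, holds everywhere. -/
theorem Alg.induction {P : Alg K D ν → Prop} (one : P 1)
    (add : ∀ a b, P a → P b → P (a + b)) (smul : ∀ (c : K) a, P a → P (c • a))
    (mul : ∀ g a, P a → P (gen K D ν g * a)) (a : Alg K D ν) : P a := by
  obtain ⟨p, rfl⟩ := proj_surjective a
  suffices H : ∀ b, P b → P (proj K D ν p * b) by simpa using H 1 one
  induction p using FreeAlgebra.induction with
  | grade0 c => intro b hb; rw [AlgHom.commutes, ← Algebra.smul_def]; exact smul c b hb
  | grade1 g => intro b hb; exact mul g b hb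
  | mul p q hp hq => intro b hb; rw [map_mul, mul_assoc]; exact hp _ (hq _ hb)
  | add p q hp hq => intro b hb; rw [map_add, add_mul]; exact add _ _ (hp _ hb) (hq _ hb)

theorem gen_weight {g : Gen I} (h : wt g.top ≠ ν) : gen K D ν g = 0 := by
  rw [← top_mul, e_weight h, zero_mul]

variable (K D ν) in
/-- The homogeneous part of `R(ν)` of degree `d`, spanned by the products of elementary diagrams of
total degree `d`. -/
def deg (d : ℤ) : Submodule K (Alg K D ν) :=
  Submodule.span K {a | ∃ w : List (Gen I), (w.map (Gen.deg D)).sum = d ∧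
    a = (w.map (gen K D ν)).prod}

instance deg_gradedMonoid : SetLike.GradedMonoid (deg K D ν) where
  one_mem := Submodule.subset_span ⟨[], by simp, by simp⟩
  mul_mem := by
    intro i j a b ha hb
    have := Submodule.mul_mem_mul ha hb
    rw [deg, deg, Submodule.span_mul_span] at this
    refine Submodule.span_mono ?_ this
    rintro _ ⟨_, ⟨w, hw, rfl⟩, _, ⟨w', hw', rfl⟩, rfl⟩
    exact ⟨w ++ w', by simp [hw, hw'], by simp⟩

theorem gen_mem_deg (g : Gen I) : gen K D ν g ∈ deg K D ν (g.deg D) :=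
  Submodule.subset_span ⟨[g], by simp, by simp⟩

/-- An element of the free algebra whose image records the single degree `d`. -/
def IsHomog (D : BorcherdsDatum I) (ν : I →₀ ℕ) (d : ℤ) (p : FreeAlgebra K (Gen I)) : Prop :=
  FreeAlgebra.lift K (fun g : Gen I => AddMonoidAlgebra.single (g.deg D) (gen K D ν g)) p
    = AddMonoidAlgebra.single d (proj K D ν p)

namespace IsHomog
variable {d d' : ℤ} {p q : FreeAlgebra K (Gen I)}
theorem ι (g : Gen I) : IsHomog D ν (g.deg D) (FreeAlgebra.ι K g) := by
  simp [IsHomog]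
theorem zero : IsHomog D ν d (0 : FreeAlgebra K (Gen I)) := by simp [IsHomog]
theorem one : IsHomog D ν 0 (1 : FreeAlgebra K (Gen I)) := by
  rw [IsHomog, map_one, map_one, AddMonoidAlgebra.one_def]
theorem add (hp : IsHomog D ν d p) (hq : IsHomog D ν d q) : IsHomog D ν d (p + q) := by
  simp only [IsHomog, map_add] at *; rw [hp, hq, AddMonoidAlgebra.single_add]
theorem sub (hp : IsHomog D ν d p) (hq : IsHomog D ν d q) : IsHomog D ν d (p - q) := by
  simp only [IsHomog, map_sub] at *; rw [hp, hq, AddMonoidAlgebra.single_sub]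
theorem mul (hp : IsHomog D ν d p) (hq : IsHomog D ν d' q) : IsHomog D ν (d + d') (p * q) := by
  simp only [IsHomog, map_mul] at *; rw [hp, hq, AddMonoidAlgebra.single_mul_single]
theorem pow (hp : IsHomog D ν d p) (n : ℕ) : IsHomog D ν (n * d) (p ^ n) := by
  induction n with
  | zero => simpa using one
  | succ n ih => rw [pow_succ]; convert ih.mul hp using 1; push_cast; ring
theorem sum {ι : Type*} (s : Finset ι) (f : ι → FreeAlgebra K (Gen I))
    (h : ∀ i ∈ s, IsHomog D ν d (f i)) : IsHomog D ν d (∑ i ∈ s, f i) := by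
  classical
  induction s using Finset.induction_on with
  | empty => simpa using zero
  | insert a s ha ih =>
    rw [Finset.sum_insert ha]
    exact (h a (by simp)).add (ih fun i hi => h i (by simp [hi]))
theorem e (l : List I) : IsHomog D ν 0 (fe K l) := ι (.e l)
theorem x (l : List I) (i : I) (r : List I) : IsHomog D ν (2 * D.r i) (fx K l i r) := ι (.x l i r)
theorem τ (l : List I) (i j : I) (r : List I) : IsHomog D ν (-D.dot i j) (fτ K l i j r) :=
  ι (.τ l i j r)
theorem cast (hp : IsHomog D ν d p) (h : d' = d) : IsHomog D ν d' p := h ▸ hp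
end IsHomog

theorem rel_homog {p q : FreeAlgebra K (Gen I)} (h : Rel K D ν p q) :
    ∃ d, IsHomog D ν d p ∧ IsHomog D ν d q := by
  have hdot : ∀ i j, D.dot i j = D.r i * D.a i j := fun _ _ => rfl
  cases h with
  | weight l h => exact ⟨0, .e l, .zero⟩
  | one => exact ⟨0, .sum _ _ fun l _ => .e l, .one⟩
  | orth l l' h => exact ⟨0, ((IsHomog.e l).mul (.e l')).cast (by simp), .zero⟩
  | top g => exact ⟨g.deg D, ((IsHomog.e _).mul (.ι g)).cast (by simp), .ι g⟩
  | bot g => exact ⟨g.deg D, ((IsHomog.ι g).mul (.e _)).cast (by simp), .ι g⟩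
  | interchange g g' =>
    refine ⟨g.deg D + g'.deg D, ((IsHomog.ι _).mul (.ι _)).cast ?_, ((IsHomog.ι _).mul (.ι _)).cast ?_⟩
    · simp [Gen.deg_ctx]
    · simp [Gen.deg_ctx, add_comm]
  | quad_same l i r => exact ⟨_, (IsHomog.τ ..).mul (.τ ..), .zero⟩
  | quad_zero l i j r hij h =>
    exact ⟨0, ((IsHomog.τ ..).mul (.τ ..)).cast (by rw [D.dot_comm j i, h]; simp), .e _⟩
  | quad l i j r hij h =>
    have h1 := D.offDiag i j hij
    have h2 := D.offDiag j i hij.symm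
    refine ⟨-2 * D.dot i j, ((IsHomog.τ ..).mul (.τ ..)).cast (by rw [D.dot_comm j i]; ring), ?_⟩
    refine .add (((IsHomog.e _).mul ((IsHomog.x ..).pow _)).cast ?_)
      (((IsHomog.e _).mul ((IsHomog.x ..).pow _)).cast ?_)
    · rw [Int.toNat_of_nonneg (by omega), hdot]; ring
    · rw [Int.toNat_of_nonneg (by omega), D.dot_comm, hdot]; ring
  | slide_left l i j r h =>
    exact ⟨_, (IsHomog.x ..).mul (.τ ..), ((IsHomog.τ ..).mul (.x ..)).cast (by ring)⟩
  | slide_right l i j r h =>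
    exact ⟨_, (IsHomog.τ ..).mul (.x ..), ((IsHomog.x ..).mul (.τ ..)).cast (by ring)⟩
  | nil_left l i r h =>
    refine ⟨0, .sub (((IsHomog.x ..).mul (.τ ..)).cast ?_) (((IsHomog.τ ..).mul (.x ..)).cast ?_), .e _⟩
    all_goals rw [hdot, h]; ring
  | nil_right l i r h =>
    refine ⟨0, .sub (((IsHomog.τ ..).mul (.x ..)).cast ?_) (((IsHomog.x ..).mul (.τ ..)).cast ?_), .e _⟩
    all_goals rw [hdot, h]; ring
  | braid l i j r h hij hd =>
    have h1 := D.offDiag i j hij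
    refine ⟨-2 * D.dot i j - D.dot i i,
      .sub ((((IsHomog.τ ..).mul (.τ ..)).mul (.τ ..)).cast ?_)
        ((((IsHomog.τ ..).mul (.τ ..)).mul (.τ ..)).cast ?_),
      .sum _ _ fun c hc => (((IsHomog.e _).mul ((IsHomog.x ..).pow _)).mul
        ((IsHomog.x ..).pow _)).cast ?_⟩
    · rw [D.dot_comm j i]; ring
    · rw [D.dot_comm j i]; ring
    · rw [Finset.mem_range] at hc
      have : (((-D.a i j).toNat - 1 - c : ℕ) : ℤ) = -D.a i j - 1 - c := by omega
      rw [this, hdot, hdot, h]; ring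
  | braid_zero l i j k r h =>
    refine ⟨_, (((IsHomog.τ ..).mul (.τ ..)).mul (.τ ..)),
      (((IsHomog.τ ..).mul (.τ ..)).mul (.τ ..)).cast ?_⟩
    ring

variable (K D ν) in
/-- The coaction recording degrees. -/
def coact : Alg K D ν →ₐ[K] AddMonoidAlgebra (Alg K D ν) ℤ :=
  lift K D ν (fun g => AddMonoidAlgebra.single (g.deg D) (gen K D ν g)) (by
    intro p q h
    obtain ⟨d, hp, hq⟩ := rel_homog h
    rw [hp, hq, proj_rel h])

theorem coact_of_mem {d : ℤ} {a : Alg K D ν} (ha : a ∈ deg K D ν d) :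
    coact K D ν a = AddMonoidAlgebra.single d a := by
  induction ha using Submodule.span_induction with
  | mem a h =>
    obtain ⟨w, rfl, rfl⟩ := h
    induction w with
    | nil => rw [List.map_nil, List.prod_nil, map_one, AddMonoidAlgebra.one_def]; rfl
    | cons g w ih =>
      simp only [List.map_cons, List.prod_cons, map_mul, ih, List.sum_cons]
      rw [coact, lift_gen, AddMonoidAlgebra.single_mul_single]
  | zero => simp
  | add a b _ _ ha hb => rw [map_add, ha, hb, AddMonoidAlgebra.single_add]
  | smul c a _ ha => rw [map_smul, ha, AddMonoidAlgebra.smul_single]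

theorem iSup_deg : ⨆ d, deg K D ν d = ⊤ := by
  rw [eq_top_iff]
  rintro a -
  induction a using Alg.induction with
  | one => exact Submodule.mem_iSup_of_mem 0 deg_gradedMonoid.one_mem
  | add a b ha hb => exact add_mem ha hb
  | smul c a ha => exact Submodule.smul_mem _ c ha
  | mul g a ha =>
    induction ha using Submodule.iSup_induction' with
    | mem d a h => exact Submodule.mem_iSup_of_mem _ (SetLike.mul_mem_graded (gen_mem_deg g) h)
    | zero => simp
    | add a b _ _ ha hb => rw [mul_add]; exact add_mem ha hb

theorem deg_isInternal : DirectSum.IsInternal (deg K D ν) := by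
  let f : AddMonoidAlgebra (Alg K D ν) ℤ →ₗ[K] (ℤ →₀ Alg K D ν) :=
    { toFun := fun a => a.coeff
      map_add' := fun _ _ => rfl
      map_smul' := fun _ _ => rfl }
  exact GrAux.isInternal_of _ iSup_deg (f ∘ₗ (coact K D ν).toLinearMap) fun n x hx => by
    simp only [LinearMap.comp_apply, AlgHom.toLinearMap_apply, coact_of_mem hx]
    rfl

/-- `R(ν)` is a `ℤ`-graded algebra. -/
instance : GradedAlgebra (deg K D ν) where
  toGradedMonoid := deg_gradedMonoid
  toDecomposition := deg_isInternal.chooseDecomposition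

section Context
variable {ω : I →₀ ℕ} (p s : List I)

/-- The idempotent `1_p ⊗ 1_ν ⊗ 1_s` of `R(ω)`. -/
def ctxIdem (ν ω : I →₀ ℕ) (p s : List I) : Alg K D ω :=
  ∑ l ∈ Seq ν, gen K D ω (.e (p ++ l ++ s))

/-- Adding vertical strands, on the free algebra. -/
def ctxF : FreeAlgebra K (Gen I) →ₐ[K] FreeAlgebra K (Gen I) :=
  FreeAlgebra.lift K fun g => FreeAlgebra.ι K (g.ctx p s)

theorem ctxF_ι (g : Gen I) : ctxF (K := K) p s (FreeAlgebra.ι K g) = FreeAlgebra.ι K (g.ctx p s) := by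
  simp [ctxF]
@[simp] theorem ctxF_fe (l : List I) : ctxF (K := K) p s (fe K l) = fe K (p ++ l ++ s) := ctxF_ι ..
@[simp] theorem ctxF_fx (l : List I) (i : I) (r : List I) :
    ctxF (K := K) p s (fx K l i r) = fx K (p ++ l) i (r ++ s) := ctxF_ι ..
@[simp] theorem ctxF_fτ (l : List I) (i j : I) (r : List I) :
    ctxF (K := K) p s (fτ K l i j r) = fτ K (p ++ l) i j (r ++ s) := ctxF_ι ..

theorem ctxIdem_mul {l : List I} (h : wt l = ν) :
    ctxIdem ν ω p s * gen K D ω (.e (p ++ l ++ s)) = gen K D ω (.e (p ++ l ++ s)) := by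
  rw [ctxIdem, Finset.sum_mul, Finset.sum_eq_single l]
  · exact e_idem _
  · intro l' _ hl
    exact e_orth (by simpa using hl)
  · intro h'; exact absurd (mem_Seq.2 h) h'

theorem mul_ctxIdem {l : List I} (h : wt l = ν) :
    gen K D ω (.e (p ++ l ++ s)) * ctxIdem ν ω p s = gen K D ω (.e (p ++ l ++ s)) := by
  rw [ctxIdem, Finset.mul_sum, Finset.sum_eq_single l]
  · exact e_idem _
  · intro l' _ hl
    exact e_orth (by simpa using hl.symm)
  · intro h'; exact absurd (mem_Seq.2 h) h'

theorem ctxIdem_idem : ctxIdem (K := K) (D := D) ν ω p s * ctxIdem ν ω p s = ctxIdem ν ω p s := by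
  conv_lhs => enter [2]; rw [ctxIdem]
  rw [Finset.mul_sum]
  exact Finset.sum_congr rfl fun l hl => ctxIdem_mul p s (mem_Seq.1 hl)

variable {p s}

theorem ctx_rel (h : wt p + ν + wt s = ω) {a b : FreeAlgebra K (Gen I)} (hab : Rel K D ν a b) :
    proj K D ω (ctxF p s a) * ctxIdem ν ω p s = proj K D ω (ctxF p s b) * ctxIdem ν ω p s := by
  have cancel : ∀ l, wt l ≠ ν → wt (p ++ l ++ s) ≠ ω := by
    intro l hl h'
    rw [← h] at h'
    simp [add_assoc, hl] at h'
  by_cases hone : b = 1 ∧ a = ∑ l ∈ Seq ν, fe K l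
  · obtain ⟨rfl, rfl⟩ := hone
    rw [map_one, map_one, one_mul, map_sum, map_sum]
    simp only [ctxF_fe, proj_fe]
    exact ctxIdem_idem p s
  congr 1
  apply proj_rel
  cases hab with
  | weight l h => simpa using Rel.weight _ (cancel l h)
  | one => exact absurd ⟨rfl, rfl⟩ hone
  | orth l l' h =>
    simpa using Rel.orth (K := K) (D := D) (ν := ω) (p ++ l ++ s) (p ++ l' ++ s) (by simpa using h)
  | top g => simpa [ctxF_ι, Gen.top_ctx] using Rel.top (K := K) (D := D) (ν := ω) (g.ctx p s)
  | bot g => simpa [ctxF_ι, Gen.bot_ctx] using Rel.bot (K := K) (D := D) (ν := ω) (g.ctx p s)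
  | interchange g g' =>
    simpa [ctxF_ι, Gen.bot_ctx, Gen.top_ctx, Gen.ctx_ctx] using
      Rel.interchange (K := K) (D := D) (ν := ω) (g.ctx p []) (g'.ctx [] s)
  | quad_same l i r =>
    simpa using Rel.quad_same (K := K) (D := D) (ν := ω) (p ++ l) i (r ++ s)
  | quad_zero l i j r hij h =>
    simpa using Rel.quad_zero (K := K) (D := D) (ν := ω) (p ++ l) i j (r ++ s) hij h
  | quad l i j r hij h =>
    simpa using Rel.quad (K := K) (D := D) (ν := ω) (p ++ l) i j (r ++ s) hij h
  | slide_left l i j r h =>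
    simpa using Rel.slide_left (K := K) (D := D) (ν := ω) (p ++ l) i j (r ++ s) h
  | slide_right l i j r h =>
    simpa using Rel.slide_right (K := K) (D := D) (ν := ω) (p ++ l) i j (r ++ s) h
  | nil_left l i r h =>
    simpa using Rel.nil_left (K := K) (D := D) (ν := ω) (p ++ l) i (r ++ s) h
  | nil_right l i r h =>
    simpa using Rel.nil_right (K := K) (D := D) (ν := ω) (p ++ l) i (r ++ s) h
  | braid l i j r h hij hd =>
    simpa using Rel.braid (K := K) (D := D) (ν := ω) (p ++ l) i j (r ++ s) h hij hd
  | braid_zero l i j k r h =>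
    simpa using Rel.braid_zero (K := K) (D := D) (ν := ω) (p ++ l) i j k (r ++ s) h

theorem ctxIdem_mul_gen (h : wt p + ν + wt s = ω) (g : Gen I) :
    ctxIdem ν ω p s * gen K D ω (g.ctx p s) = gen K D ω (g.ctx p s) := by
  by_cases hg : wt g.top = ν
  · rw [← top_mul (g.ctx p s), ← mul_assoc, Gen.top_ctx, ctxIdem_mul p s hg]
  · rw [gen_weight, mul_zero]
    intro h'
    rw [Gen.top_ctx, ← h] at h'
    simp [add_assoc, hg] at h'

theorem gen_mul_ctxIdem (h : wt p + ν + wt s = ω) (g : Gen I) :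
    gen K D ω (g.ctx p s) * ctxIdem ν ω p s = gen K D ω (g.ctx p s) := by
  by_cases hg : wt g.bot = ν
  · rw [← mul_bot (g.ctx p s), mul_assoc, Gen.bot_ctx, mul_ctxIdem p s hg]
  · rw [gen_weight, zero_mul]
    intro h'
    rw [Gen.top_ctx, ← h] at h'
    simp [add_assoc, ← Gen.wt_bot, hg] at h'

/-- The subspace `E R(ω)` for the idempotent `E = ctxIdem`. -/
def ctxSpace (ν ω : I →₀ ℕ) (p s : List I) : Submodule K (Alg K D ω) :=
  LinearMap.range (LinearMap.mulLeft K (ctxIdem ν ω p s))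

theorem mem_ctxSpace {m : Alg K D ω} :
    m ∈ ctxSpace ν ω p s ↔ ctxIdem ν ω p s * m = m := by
  constructor
  · rintro ⟨m, rfl⟩
    rw [LinearMap.mulLeft_apply, ← mul_assoc, ctxIdem_idem]
  · intro h; exact ⟨m, h⟩

/-- The action of an elementary diagram, placed between `p` and `s`, on `E R(ω)`. -/
def ctxAct (h : wt p + ν + wt s = ω) (g : Gen I) :
    Module.End K (ctxSpace (K := K) (D := D) ν ω p s) :=
  (LinearMap.mulLeft K (gen K D ω (g.ctx p s))).restrict fun m _ => by
    rw [mem_ctxSpace, LinearMap.mulLeft_apply, ← mul_assoc, ctxIdem_mul_gen h]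

theorem ctxAct_lift (h : wt p + ν + wt s = ω) (a : FreeAlgebra K (Gen I))
    (m : ctxSpace (K := K) (D := D) ν ω p s) :
    (FreeAlgebra.lift K (ctxAct h) a m : Alg K D ω) = proj K D ω (ctxF p s a) * m := by
  induction a using FreeAlgebra.induction generalizing m with
  | grade0 c => simp only [AlgHom.commutes, ← Algebra.smul_def]; rfl
  | grade1 g => rw [FreeAlgebra.lift_ι_apply, ctxF_ι]; rfl
  | mul a b ha hb => simp only [map_mul, Module.End.mul_apply, ha, hb, mul_assoc]
  | add a b ha hb =>
    simp only [map_add, LinearMap.add_apply, Submodule.coe_add, ha, hb, add_mul]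

/-- The resulting action of `R(ν)`. -/
def ctxLift (h : wt p + ν + wt s = ω) :
    Alg K D ν →ₐ[K] Module.End K (ctxSpace (K := K) (D := D) ν ω p s) :=
  lift K D ν (ctxAct h) fun a b hab => by
    ext m
    have hm := mem_ctxSpace.1 m.2
    rw [ctxAct_lift, ctxAct_lift, ← hm, ← mul_assoc, ← mul_assoc, ctx_rel h hab]

/-- The map `R(ν) → R(ω)` placing a diagram between the vertical strands `p` and `s`
(see `ctxHom_gen`, `ctxHom_mul` and `ctxHom_one`). -/
def ctxHom (h : wt p + ν + wt s = ω) : Alg K D ν →ₗ[K] Alg K D ω :=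
  (ctxSpace ν ω p s).subtype ∘ₗ
    LinearMap.applyₗ ⟨ctxIdem ν ω p s, mem_ctxSpace.2 (ctxIdem_idem p s)⟩ ∘ₗ
    (ctxLift h).toLinearMap

theorem ctxHom_proj (h : wt p + ν + wt s = ω) (a : FreeAlgebra K (Gen I)) :
    ctxHom h (proj K D ν a) = proj K D ω (ctxF p s a) * ctxIdem ν ω p s := by
  rw [← ctxAct_lift h a ⟨ctxIdem ν ω p s, mem_ctxSpace.2 (ctxIdem_idem p s)⟩]
  change (ctxLift h (proj K D ν a) _ : Alg K D ω) = _
  rw [ctxLift, lift_proj]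

theorem ctxHom_one (h : wt p + ν + wt s = ω) :
    ctxHom h (1 : Alg K D ν) = ctxIdem ν ω p s := by
  simpa using ctxHom_proj (K := K) (D := D) h 1

theorem ctxHom_gen (h : wt p + ν + wt s = ω) (g : Gen I) :
    ctxHom h (gen K D ν g) = gen K D ω (g.ctx p s) := by
  rw [gen, ctxHom_proj, ctxF_ι, proj_ι, gen_mul_ctxIdem h]

theorem ctxIdem_mul_ctxHom (h : wt p + ν + wt s = ω) (a : Alg K D ν) :
    ctxIdem ν ω p s * ctxHom h a = ctxHom h a :=
  mem_ctxSpace.1 (Subtype.mem _)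

theorem ctxHom_mul (h : wt p + ν + wt s = ω) (a b : Alg K D ν) :
    ctxHom h (a * b) = ctxHom h a * ctxHom h b := by
  have hb := ctxIdem_mul_ctxHom h b
  obtain ⟨a, rfl⟩ := proj_surjective a
  obtain ⟨b, rfl⟩ := proj_surjective b
  rw [ctxHom_proj, mul_assoc, hb, ← map_mul, ctxHom_proj, ctxHom_proj, map_mul, map_mul, mul_assoc]

theorem ctxHom_mul_ctxIdem (h : wt p + ν + wt s = ω) (a : Alg K D ν) :
    ctxHom h a * ctxIdem ν ω p s = ctxHom h a := by
  rw [← ctxHom_one h, ← ctxHom_mul, mul_one]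

theorem ctxIdem_mem_deg (p s : List I) : ctxIdem ν ω p s ∈ deg K D ω 0 :=
  sum_mem fun l _ => gen_mem_deg (.e (p ++ l ++ s))

theorem ctxHom_mem_deg (h : wt p + ν + wt s = ω) {d : ℤ} {a : Alg K D ν} (ha : a ∈ deg K D ν d) :
    ctxHom h a ∈ deg K D ω d := by
  induction ha using Submodule.span_induction with
  | mem a ha =>
    obtain ⟨w, rfl, rfl⟩ := ha
    induction w with
    | nil => simpa [ctxHom_one] using ctxIdem_mem_deg p s
    | cons g w ih =>
      rw [List.map_cons, List.map_cons, List.prod_cons, List.sum_cons, ctxHom_mul, ctxHom_gen]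
      refine SetLike.mul_mem_graded ?_ ih
      rw [← Gen.deg_ctx D p g s]
      exact gen_mem_deg _
  | zero => simp
  | add a b _ _ ha hb => rw [map_add]; exact add_mem ha hb
  | smul c a _ ha => rw [map_smul]; exact Submodule.smul_mem _ c ha

theorem ctxIdem_orth {p' s' : List I}
    (h : ∀ l l', wt l = ν → wt l' = ν → p ++ l ++ s ≠ p' ++ l' ++ s') :
    ctxIdem (K := K) (D := D) ν ω p s * ctxIdem ν ω p' s' = 0 := by
  rw [ctxIdem, ctxIdem, Finset.sum_mul_sum]
  exact Finset.sum_eq_zero fun l hl => Finset.sum_eq_zero fun l' hl' =>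
    e_orth (h l l' (mem_Seq.1 hl) (mem_Seq.1 hl'))

theorem ctxHom_orth {p' s' : List I} (hh : wt p + ν + wt s = ω) (hh' : wt p' + ν + wt s' = ω)
    (h : ∀ l l', wt l = ν → wt l' = ν → p ++ l ++ s ≠ p' ++ l' ++ s') (a b : Alg K D ν) :
    ctxHom hh a * ctxHom hh' b = 0 := by
  rw [← ctxHom_mul_ctxIdem hh a, ← ctxIdem_mul_ctxHom hh' b, mul_assoc, ← mul_assoc (ctxIdem _ _ _ _),
    ctxIdem_orth h, zero_mul, mul_zero]

end Context

section Block
variable {ν' ω : I →₀ ℕ}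

theorem append_inj_of_wt {a b c d : List I} (h : a ++ b = c ++ d) (hw : wt a = wt c) :
    a = c ∧ b = d := by
  refine List.append_inj h ?_
  rw [← degree_wt, ← degree_wt, hw]

theorem append_inj_of_wt' {a b c d : List I} (h : a ++ b = c ++ d) (hw : wt b = wt d) :
    a = c ∧ b = d := by
  refine List.append_inj' h ?_
  rw [← degree_wt, ← degree_wt, hw]

/-- The map `a ↦ a ⊗ 1_{ν'}` from `R(ν)` to `R(ν + ν')`. -/
def leftHom (h : ν + ν' = ω) : Alg K D ν →ₗ[K] Alg K D ω :=
  ∑ s ∈ (Seq ν').attach, ctxHom (p := []) (s := s.1)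
    (by rw [wt_nil, zero_add, mem_Seq.1 s.2, h])

/-- The map `b ↦ 1_ν ⊗ b` from `R(ν')` to `R(ν + ν')`. -/
def rightHom (h : ν + ν' = ω) : Alg K D ν' →ₗ[K] Alg K D ω :=
  ∑ p ∈ (Seq ν).attach, ctxHom (p := p.1) (s := [])
    (by rw [wt_nil, add_zero, mem_Seq.1 p.2, h])

theorem leftHom_gen (h : ν + ν' = ω) (g : Gen I) :
    leftHom h (gen K D ν g) = ∑ s ∈ Seq ν', gen K D ω (g.ctx [] s) := by
  rw [leftHom, LinearMap.sum_apply,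
    ← Finset.sum_attach (Seq ν') fun s => gen K D ω (g.ctx [] s)]
  exact Finset.sum_congr rfl fun s _ => ctxHom_gen (K := K) (D := D) _ g

theorem rightHom_gen (h : ν + ν' = ω) (g : Gen I) :
    rightHom h (gen K D ν' g) = ∑ p ∈ Seq ν, gen K D ω (g.ctx p []) := by
  rw [rightHom, LinearMap.sum_apply,
    ← Finset.sum_attach (Seq ν) fun p => gen K D ω (g.ctx p [])]
  exact Finset.sum_congr rfl fun s _ => ctxHom_gen (K := K) (D := D) _ g

theorem leftHom_one (h : ν + ν' = ω) :
    leftHom h (1 : Alg K D ν) = ∑ l ∈ Seq ν, ∑ s ∈ Seq ν', gen K D ω (.e (l ++ s)) := by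
  rw [← sum_e, map_sum]
  exact Finset.sum_congr rfl fun l _ => by rw [leftHom_gen]; rfl

theorem rightHom_one (h : ν + ν' = ω) :
    rightHom h (1 : Alg K D ν') = ∑ l ∈ Seq ν, ∑ s ∈ Seq ν', gen K D ω (.e (l ++ s)) := by
  rw [← sum_e, map_sum, Finset.sum_comm]
  exact Finset.sum_congr rfl fun l _ => by
    rw [rightHom_gen]
    exact Finset.sum_congr rfl fun s _ => by simp [Gen.ctx]

theorem leftHom_mul (h : ν + ν' = ω) (a b : Alg K D ν) :
    leftHom h (a * b) = leftHom h a * leftHom h b := by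
  simp only [leftHom, LinearMap.sum_apply]
  rw [Finset.sum_mul_sum]
  refine Finset.sum_congr rfl fun s hs => ?_
  rw [Finset.sum_eq_single s, ctxHom_mul]
  · intro s' _ hne
    refine ctxHom_orth _ _ (fun l l' hl hl' heq => hne ?_) a b
    have := (append_inj_of_wt (by simpa using heq) (hl.trans hl'.symm)).2
    exact Subtype.ext this.symm
  · intro h'; exact absurd hs h'

theorem rightHom_mul (h : ν + ν' = ω) (a b : Alg K D ν') :
    rightHom h (a * b) = rightHom h a * rightHom h b := by
  simp only [rightHom, LinearMap.sum_apply]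
  rw [Finset.sum_mul_sum]
  refine Finset.sum_congr rfl fun s hs => ?_
  rw [Finset.sum_eq_single s, ctxHom_mul]
  · intro s' _ hne
    refine ctxHom_orth _ _ (fun l l' hl hl' heq => hne ?_) a b
    have := (append_inj_of_wt' (by simpa using heq) (hl.trans hl'.symm)).1
    exact Subtype.ext this.symm
  · intro h'; exact absurd hs h'

theorem leftHom_mem_deg (h : ν + ν' = ω) {d : ℤ} {a : Alg K D ν} (ha : a ∈ deg K D ν d) :
    leftHom h a ∈ deg K D ω d := by
  rw [leftHom, LinearMap.sum_apply]
  exact sum_mem fun s _ => ctxHom_mem_deg _ ha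

theorem rightHom_mem_deg (h : ν + ν' = ω) {d : ℤ} {a : Alg K D ν'} (ha : a ∈ deg K D ν' d) :
    rightHom h a ∈ deg K D ω d := by
  rw [rightHom, LinearMap.sum_apply]
  exact sum_mem fun s _ => ctxHom_mem_deg _ ha

theorem gen_mul_gen_eq_zero {g g' : Gen I} (h : g.bot ≠ g'.top) :
    gen K D ω g * gen K D ω g' = 0 := by
  rw [← mul_bot g, ← top_mul g', mul_assoc, ← mul_assoc (gen K D ω (.e g.bot)), e_orth h,
    zero_mul, mul_zero]

theorem leftHom_gen_zero (h : ν + ν' = ω) {g : Gen I} (hg : wt g.bot ≠ ν) :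
    leftHom h (gen K D ν g) = 0 := by
  rw [gen_weight (by rwa [← Gen.wt_bot]), map_zero]

theorem rightHom_gen_zero (h : ν + ν' = ω) {g : Gen I} (hg : wt g.bot ≠ ν') :
    rightHom h (gen K D ν' g) = 0 := by
  rw [gen_weight (by rwa [← Gen.wt_bot]), map_zero]

theorem left_right_gen (h : ν + ν' = ω) (g g' : Gen I) :
    leftHom h (gen K D ν g) * rightHom h (gen K D ν' g') =
      rightHom h (gen K D ν' g') * leftHom h (gen K D ν g) := by
  by_cases hg : wt g.bot = ν
  swap
  · rw [leftHom_gen_zero h hg, zero_mul, mul_zero]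
  by_cases hg' : wt g'.bot = ν'
  swap
  · rw [rightHom_gen_zero h hg', zero_mul, mul_zero]
  have ht := (Gen.wt_bot g).symm.trans hg
  have ht' := (Gen.wt_bot g').symm.trans hg'
  rw [leftHom_gen, rightHom_gen, Finset.sum_mul_sum, Finset.sum_mul_sum]
  rw [Finset.sum_eq_single g'.top, Finset.sum_eq_single g.bot, Finset.sum_eq_single g.top,
    Finset.sum_eq_single g'.bot]
  · simpa using proj_rel (Rel.interchange (K := K) (D := D) (ν := ω) g g')
  · intro s hs hne
    refine gen_mul_gen_eq_zero fun heq => hne ?_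
    simp only [Gen.bot_ctx, Gen.top_ctx, List.nil_append, List.append_nil] at heq
    exact (append_inj_of_wt heq rfl).2.symm
  · intro h'; exact absurd (mem_Seq.2 hg') h'
  · intro p hp hne
    refine Finset.sum_eq_zero fun s hs => gen_mul_gen_eq_zero fun heq => hne ?_
    simp only [Gen.bot_ctx, Gen.top_ctx, List.nil_append, List.append_nil] at heq
    exact (append_inj_of_wt heq ((mem_Seq.1 hp).trans ht.symm)).1
  · intro h'; exact absurd (mem_Seq.2 ht) h'
  · intro p hp hne
    refine gen_mul_gen_eq_zero fun heq => hne ?_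
    simp only [Gen.bot_ctx, Gen.top_ctx, List.nil_append, List.append_nil] at heq
    exact (append_inj_of_wt heq (hg.trans (mem_Seq.1 hp).symm)).1.symm
  · intro h'; exact absurd (mem_Seq.2 hg) h'
  · intro s hs hne
    refine Finset.sum_eq_zero fun p hp => gen_mul_gen_eq_zero fun heq => hne ?_
    simp only [Gen.bot_ctx, Gen.top_ctx, List.nil_append, List.append_nil] at heq
    exact (append_inj_of_wt heq (hg.trans (mem_Seq.1 hp).symm)).2
  · intro h'; exact absurd (mem_Seq.2 ht') h'

theorem left_right_comm (h : ν + ν' = ω) (a : Alg K D ν) (b : Alg K D ν') :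
    leftHom h a * rightHom h b = rightHom h b * leftHom h a := by
  have hone : leftHom h (1 : Alg K D ν) = rightHom h (1 : Alg K D ν') := by
    rw [leftHom_one, rightHom_one]
  induction a using Alg.induction with
  | one => rw [hone, ← rightHom_mul, ← rightHom_mul, one_mul, mul_one]
  | add a a' ha ha' => rw [map_add, add_mul, mul_add, ha, ha']
  | smul c a ha => rw [map_smul, smul_mul_assoc, mul_smul_comm, ha]
  | mul g a ha =>
    have hg : leftHom h (gen K D ν g) * rightHom h b = rightHom h b * leftHom h (gen K D ν g) := by
      clear ha
      induction b using Alg.induction with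
      | one => rw [← hone, ← leftHom_mul, ← leftHom_mul, one_mul, mul_one]
      | add a a' ha ha' => rw [map_add, add_mul, mul_add, ha, ha']
      | smul c a ha => rw [map_smul, smul_mul_assoc, mul_smul_comm, ha]
      | mul g' b hb =>
        rw [rightHom_mul, ← mul_assoc, left_right_gen, mul_assoc, hb, mul_assoc]
    rw [leftHom_mul, mul_assoc, ha, ← mul_assoc, hg, mul_assoc]

end Block
end Algebra
end QHA

/-! ### Graded modules over graded algebras -/
open scoped TensorProduct
namespace Gr
universe u v w x

section TensorDeg
variable {K : Type*} [Field K]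
  {V W : Type*} [AddCommGroup V] [Module K V] [AddCommGroup W] [Module K W]

/-- The tensor product grading on `V ⊗ W`. -/
def tensorDeg (𝒱 : ℤ → Submodule K V) (𝒲 : ℤ → Submodule K W) (n : ℤ) : Submodule K (V ⊗[K] W) :=
  Submodule.span K {t | ∃ i j : ℤ, ∃ a ∈ 𝒱 i, ∃ b ∈ 𝒲 j, i + j = n ∧ t = a ⊗ₜ[K] b}

variable {𝒱 : ℤ → Submodule K V} {𝒲 : ℤ → Submodule K W}

theorem tmul_mem {i j : ℤ} {a : V} {b : W} (ha : a ∈ 𝒱 i) (hb : b ∈ 𝒲 j) :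
    a ⊗ₜ[K] b ∈ tensorDeg 𝒱 𝒲 (i + j) :=
  Submodule.subset_span ⟨i, j, a, ha, b, hb, rfl, rfl⟩

theorem exists_tensor_coaction (h𝒱 : DirectSum.IsInternal 𝒱) (h𝒲 : DirectSum.IsInternal 𝒲) :
    ∃ c : V ⊗[K] W →ₗ[K] (ℤ →₀ V ⊗[K] W), ∀ i j, ∀ a ∈ 𝒱 i, ∀ b ∈ 𝒲 j,
      c (a ⊗ₜ b) = Finsupp.single (i + j) (a ⊗ₜ b) := by
  obtain ⟨c, hc⟩ := GrAux.exists_coaction h𝒱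
  obtain ⟨c', hc'⟩ := GrAux.exists_coaction h𝒲
  refine ⟨Finsupp.lmapDomain _ K (fun p : ℤ × ℤ => p.1 + p.2) ∘ₗ
    (finsuppTensorFinsupp K K V W ℤ ℤ).toLinearMap ∘ₗ TensorProduct.map c c', ?_⟩
  intro i j a ha b hb
  simp [hc i a ha, hc' j b hb, finsuppTensorFinsupp_single]

theorem iSup_tensorDeg (h𝒱 : ⨆ n, 𝒱 n = ⊤) (h𝒲 : ⨆ n, 𝒲 n = ⊤) :
    ⨆ n, tensorDeg 𝒱 𝒲 n = ⊤ := by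
  rw [eq_top_iff]
  rintro t -
  induction t using TensorProduct.induction_on with
  | zero => exact zero_mem _
  | add a b ha hb => exact add_mem ha hb
  | tmul a b =>
    induction a using GrAux.induction h𝒱 with
    | zero => simp
    | add a a' ha ha' => rw [TensorProduct.add_tmul]; exact add_mem ha ha'
    | hom i a ha =>
      induction b using GrAux.induction h𝒲 with
      | zero => simp
      | add a a' ha ha' => rw [TensorProduct.tmul_add]; exact add_mem ha ha'
      | hom j b hb => exact Submodule.mem_iSup_of_mem _ (tmul_mem ha hb)

theorem tensorDeg_isInternal (h𝒱 : DirectSum.IsInternal 𝒱) (h𝒲 : DirectSum.IsInternal 𝒲) :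
    DirectSum.IsInternal (tensorDeg 𝒱 𝒲) := by
  obtain ⟨c, hc⟩ := exists_tensor_coaction h𝒱 h𝒲
  refine GrAux.isInternal_of _
    (iSup_tensorDeg (GrAux.iSup_eq_top h𝒱) (GrAux.iSup_eq_top h𝒲)) c fun n t ht => ?_
  induction ht using Submodule.span_induction with
  | mem t ht => obtain ⟨i, j, a, ha, b, hb, rfl, rfl⟩ := ht; exact hc i j a ha b hb
  | zero => simp
  | add a b _ _ ha hb => rw [map_add, ha, hb, Finsupp.single_add]
  | smul k a _ ha => rw [map_smul, ha, Finsupp.smul_single]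

end TensorDeg

section Alg
variable {K : Type u} [Field K] {A B C A' B' C' : Type*} [Ring A] [Algebra K A]
  [Ring B] [Algebra K B] [Ring A'] [Algebra K A'] [Ring B'] [Algebra K B']
  [Ring C] [Algebra K C] [Ring C'] [Algebra K C']
  (𝒜 : ℤ → Submodule K A) (ℬ : ℤ → Submodule K B)
  (𝒜' : ℤ → Submodule K A') (ℬ' : ℤ → Submodule K B')
  (𝒞 : ℤ → Submodule K C) (𝒞' : ℤ → Submodule K C')

/-- The tensor product of two graded algebras is a graded algebra. -/
instance [GradedAlgebra 𝒜] [GradedAlgebra ℬ] : GradedAlgebra (tensorDeg 𝒜 ℬ) where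
  one_mem := by
    have := tmul_mem (K := K) (SetLike.one_mem_graded 𝒜) (SetLike.one_mem_graded ℬ)
    simpa [Algebra.TensorProduct.one_def] using this
  mul_mem := by
    intro i j a b ha hb
    have := Submodule.mul_mem_mul ha hb
    rw [tensorDeg, tensorDeg, Submodule.span_mul_span] at this
    clear ha hb
    refine Submodule.span_mono ?_ this
    rintro _ ⟨_, ⟨i, i', a, ha, a', ha', rfl, rfl⟩, _, ⟨j, j', b, hb, b', hb', rfl, rfl⟩, rfl⟩
    exact ⟨i + j, i' + j', a * b, SetLike.mul_mem_graded ha hb, a' * b',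
      SetLike.mul_mem_graded ha' hb', by ring, by simp⟩
  toDecomposition := (tensorDeg_isInternal (DirectSum.Decomposition.isInternal 𝒜)
    (DirectSum.Decomposition.isInternal ℬ)).chooseDecomposition

/-- A homomorphism of graded algebras, not required to send `1` to `1`. -/
structure Hom where
  toLin : A →ₗ[K] B
  map_mul : ∀ a a', toLin (a * a') = toLin a * toLin a'
  map_deg : ∀ n, ∀ a ∈ 𝒜 n, toLin a ∈ ℬ n

variable {𝒜 ℬ 𝒜' ℬ'}

/-- The tensor product of two homomorphisms. -/
def Hom.tensor (φ : Hom 𝒜 ℬ) (ψ : Hom 𝒜' ℬ') : Hom (tensorDeg 𝒜 𝒜') (tensorDeg ℬ ℬ') where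
  toLin := TensorProduct.map φ.toLin ψ.toLin
  map_mul a a' := by
    induction a using TensorProduct.induction_on with
    | zero => simp
    | add a b ha hb => rw [add_mul, _root_.map_add, ha, hb, _root_.map_add, add_mul]
    | tmul a b =>
      induction a' using TensorProduct.induction_on with
      | zero => simp
      | add a b ha hb => rw [mul_add, _root_.map_add, ha, hb, _root_.map_add, mul_add]
      | tmul a' b' => simp [φ.map_mul, ψ.map_mul]
  map_deg n a ha := by
    induction ha using Submodule.span_induction with
    | mem t ht =>
      obtain ⟨i, j, a, ha, b, hb, rfl, rfl⟩ := ht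
      exact tmul_mem (φ.map_deg i a ha) (ψ.map_deg j b hb)
    | zero => simp
    | add a b _ _ ha hb => rw [_root_.map_add]; exact add_mem ha hb
    | smul k a _ ha => rw [map_smul]; exact Submodule.smul_mem _ k ha

variable (𝒜 ℬ)

/-- The isomorphism `(A ⊗ B) ⊗ (C ⊗ D) → (A ⊗ C) ⊗ (B ⊗ D)` exchanging the two middle factors. -/
def Hom.swapMiddle : Hom (tensorDeg (tensorDeg 𝒜 ℬ) (tensorDeg 𝒞 𝒞'))
    (tensorDeg (tensorDeg 𝒜 𝒞) (tensorDeg ℬ 𝒞')) where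
  toLin := (Algebra.TensorProduct.tensorTensorTensorComm K K K K A B C C').toLinearMap
  map_mul a a' := _root_.map_mul
    (Algebra.TensorProduct.tensorTensorTensorComm K K K K A B C C') a a'
  map_deg n a ha := by
    induction ha using Submodule.span_induction with
    | mem t ht =>
      obtain ⟨i, j, s, hs, t, ht, rfl, rfl⟩ := ht
      induction hs using Submodule.span_induction with
      | zero => simp
      | add a b _ _ ha hb => rw [TensorProduct.add_tmul, _root_.map_add]; exact add_mem ha hb
      | smul k a _ ha =>
        rw [← TensorProduct.smul_tmul', map_smul]; exact Submodule.smul_mem _ k ha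
      | mem s hs =>
        obtain ⟨i, i', a, ha, b, hb, rfl, rfl⟩ := hs
        induction ht using Submodule.span_induction with
        | zero => simp
        | add a b _ _ ha hb => rw [TensorProduct.tmul_add, _root_.map_add]; exact add_mem ha hb
        | smul k a _ ha =>
          rw [TensorProduct.tmul_smul, map_smul]; exact Submodule.smul_mem _ k ha
        | mem t ht =>
          obtain ⟨j, j', c, hc, d, hd, rfl, rfl⟩ := ht
          have := tmul_mem (tmul_mem ha hc) (tmul_mem hb hd)
          rw [show i + i' + (j + j') = i + j + (i' + j') by ring]
          simpa using this
    | zero => simp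
    | add a b _ _ ha hb => rw [_root_.map_add]; exact add_mem ha hb
    | smul k a _ ha => rw [map_smul]; exact Submodule.smul_mem _ k ha

end Alg

section Mod
variable {K : Type u} [Field K] {A : Type v} [Ring A] [Algebra K A]

/-- A `ℤ`-graded left module over the algebra `A` with grading `𝒜`. -/
structure GrMod (𝒜 : ℤ → Submodule K A) where
  carrier : Type w
  [addCommGroup : AddCommGroup carrier]
  [moduleK : Module K carrier]
  [module : Module A carrier]
  [tower : IsScalarTower K A carrier]
  deg : ℤ → Submodule K carrier
  isInternal : DirectSum.IsInternal deg
  smul_mem : ∀ i j, ∀ a ∈ 𝒜 i, ∀ m ∈ deg j, a • m ∈ deg (i + j)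

attribute [instance] GrMod.addCommGroup GrMod.moduleK GrMod.module GrMod.tower

namespace GrMod
variable {𝒜 : ℤ → Submodule K A}

instance : CoeSort (GrMod.{u, v, w} 𝒜) (Type w) := ⟨carrier⟩

/-- Finitely generated and projective. -/
def IsFGProj (M : GrMod.{u, v, w} 𝒜) : Prop := Module.Finite A M ∧ Module.Projective A M

/-- The degree shift `M{m}`, with `M{m}_n = M_{n-m}`. -/
def shift (M : GrMod.{u, v, w} 𝒜) (m : ℤ) : GrMod.{u, v, w} 𝒜 where
  carrier := M
  deg n := M.deg (n - m)
  isInternal := by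
    obtain ⟨c, hc⟩ := GrAux.exists_coaction M.isInternal
    refine GrAux.isInternal_of _ ?_ (Finsupp.lmapDomain _ K (fun n => n + m) ∘ₗ c) ?_
    · rw [← GrAux.iSup_eq_top M.isInternal]
      exact (Equiv.subRight m).iSup_comp (g := M.deg)
    · intro n x hx
      simp [hc _ x hx]
  smul_mem i j a ha x hx := by
    rw [add_sub_assoc]; exact M.smul_mem i _ a ha x hx

/-- The regular module. -/
def self (𝒜 : ℤ → Submodule K A) [GradedAlgebra 𝒜] : GrMod.{u, v, v} 𝒜 where
  carrier := A
  deg := 𝒜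
  isInternal := DirectSum.Decomposition.isInternal 𝒜
  smul_mem _ _ _ ha _ hm := SetLike.mul_mem_graded ha hm

/-- A submodule is homogeneous when it is the sum of its homogeneous parts. -/
def IsHomogeneous (M : GrMod.{u, v, w} 𝒜) (F : Submodule A M) : Prop :=
  F.restrictScalars K = ⨆ n, F.restrictScalars K ⊓ M.deg n

/-- The subquotient `G / F` is isomorphic as a graded module to `N`. -/
def SubquotientIso (M : GrMod.{u, v, w} 𝒜) (F G : Submodule A M) (N : GrMod.{u, v, x} 𝒜) : Prop :=
  ∃ e : (G ⧸ F.submoduleOf G) ≃ₗ[A] N,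
    ∀ n, ∀ g : G, (g : M) ∈ M.deg n → e (Submodule.Quotient.mk g) ∈ N.deg n

end GrMod

section Box
variable {B : Type x} [Ring B] [Algebra K B] {𝒜 : ℤ → Submodule K A} {ℬ : ℤ → Submodule K B}

/-- The algebra map giving the action of `A ⊗ B` on `M ⊗ N`. -/
def boxAct (M : GrMod.{u, v, w} 𝒜) (N : GrMod.{u, x, w} ℬ) :
    A ⊗[K] B →ₐ[K] Module.End K (M ⊗[K] N) :=
  (Module.endTensorEndAlgHom (R := K) (S := K) (A := K) (M := M) (N := N)).comp
    (Algebra.TensorProduct.map (Algebra.lsmul K K M) (Algebra.lsmul K K N))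

@[simp] theorem boxAct_tmul (M : GrMod.{u, v, w} 𝒜) (N : GrMod.{u, x, w} ℬ) (a : A) (b : B)
    (m : M) (n : N) : boxAct M N (a ⊗ₜ b) (m ⊗ₜ n) = (a • m) ⊗ₜ (b • n) := by
  simp [boxAct, Module.endTensorEndAlgHom_apply]

/-- The outer tensor product. -/
def GrMod.box (M : GrMod.{u, v, w} 𝒜) (N : GrMod.{u, x, w} ℬ) :
    GrMod.{u, max v x, w} (tensorDeg 𝒜 ℬ) where
  carrier := M ⊗[K] N
  module := Module.compHom _ (boxAct M N).toRingHom
  tower := by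
    let _ : Module (A ⊗[K] B) (M ⊗[K] N) := Module.compHom _ (boxAct M N).toRingHom
    exact ⟨fun k a t => by
      change boxAct M N (k • a) t = k • boxAct M N a t
      rw [map_smul]; rfl⟩
  deg := tensorDeg M.deg N.deg
  isInternal := tensorDeg_isInternal M.isInternal N.isInternal
  smul_mem i j c hc t ht := by
    change boxAct M N c t ∈ _
    induction hc using Submodule.span_induction with
    | zero => simp
    | add a b _ _ ha hb => rw [map_add]; exact add_mem ha hb
    | smul k a _ ha => rw [map_smul]; exact Submodule.smul_mem _ k ha
    | mem s hs =>
      obtain ⟨i, i', a, ha, b, hb, rfl, rfl⟩ := hs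
      induction ht using Submodule.span_induction with
      | zero => simp
      | add a b _ _ ha hb => rw [map_add]; exact add_mem ha hb
      | smul k a _ ha => rw [map_smul]; exact Submodule.smul_mem _ k ha
      | mem t ht =>
        obtain ⟨j, j', m, hm, n, hn, rfl, rfl⟩ := ht
        rw [boxAct_tmul, show i + i' + (j + j') = i + j + (i' + j') by ring]
        exact tmul_mem (M.smul_mem i j a ha m hm) (N.smul_mem i' j' b hb n hn)

end Box

section IndRes
variable {B : Type x} [Ring B] [Algebra K B] {𝒜 : ℤ → Submodule K A} {ℬ : ℤ → Submodule K B}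
  [GradedAlgebra 𝒜] [GradedAlgebra ℬ] (φ : Hom 𝒜 ℬ)

/-- The `B`-submodule of `B ⊗_K N` spanned by the `b φ(a) ⊗ n - b ⊗ a n`. -/
def indRel (N : GrMod.{u, v, w} 𝒜) : Submodule B (B ⊗[K] N) :=
  Submodule.span B {t | ∃ (b : B) (a : A) (n : N),
    t = (b * φ.toLin a) ⊗ₜ[K] n - b ⊗ₜ[K] (a • n)}

theorem ind_coaction (N : GrMod.{u, v, w} 𝒜) {c : B ⊗[K] N →ₗ[K] (ℤ →₀ B ⊗[K] N)}
    (hc : ∀ i j, ∀ a ∈ ℬ i, ∀ b ∈ N.deg j, c (a ⊗ₜ b) = Finsupp.single (i + j) (a ⊗ₜ b))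
    {Q : Type*} [AddCommGroup Q] [Module K Q] (q : B ⊗[K] N →ₗ[K] Q)
    (hq : ∀ t ∈ indRel φ N, q t = 0) (t : B ⊗[K] N) (ht : t ∈ indRel φ N) :
    (Finsupp.mapRange.linearMap q ∘ₗ c) t = 0 := by
  have hℬ := DirectSum.Decomposition.isInternal ℬ
  have h𝒜 := DirectSum.Decomposition.isInternal 𝒜
  have hN := N.isInternal
  set F := Finsupp.mapRange.linearMap q ∘ₗ c with hF
  have key : ∀ (b : B) (a : A) (n : N), F ((b * φ.toLin a) ⊗ₜ[K] n - b ⊗ₜ[K] (a • n)) = 0 := by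
    intro b a n
    induction b using GrAux.induction (GrAux.iSup_eq_top hℬ) with
    | zero => simp
    | add b b' h h' =>
      rw [add_mul, TensorProduct.add_tmul, TensorProduct.add_tmul, add_sub_add_comm, map_add,
        h, h', add_zero]
    | hom i b hb =>
      induction a using GrAux.induction (GrAux.iSup_eq_top h𝒜) with
      | zero => simp
      | add a a' h h' =>
        rw [map_add, mul_add, add_smul, TensorProduct.add_tmul, TensorProduct.tmul_add,
          add_sub_add_comm, map_add, h, h', add_zero]
      | hom j a ha =>
        induction n using GrAux.induction (GrAux.iSup_eq_top hN) with
        | zero => simp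
        | add n n' h h' =>
          rw [smul_add, TensorProduct.tmul_add, TensorProduct.tmul_add, add_sub_add_comm,
            map_add, h, h', add_zero]
        | hom k n hn =>
          have h1 := hc _ _ _ (SetLike.mul_mem_graded hb (φ.map_deg j a ha)) n hn
          have h2 := hc _ _ b hb _ (N.smul_mem j k a ha n hn)
          have h3 : q ((b * φ.toLin a) ⊗ₜ[K] n - b ⊗ₜ[K] (a • n)) = 0 :=
            hq _ (Submodule.subset_span ⟨b, a, n, rfl⟩)
          rw [hF, LinearMap.comp_apply, map_sub, h1, h2, add_assoc, ← Finsupp.single_sub,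
            Finsupp.mapRange.linearMap_apply, Finsupp.mapRange_single, h3, Finsupp.single_zero]
  clear_value F
  induction ht using Submodule.closure_induction with
  | zero => simp
  | add a b _ _ ha hb => rw [map_add, ha, hb, add_zero]
  | smul_mem r t ht =>
    obtain ⟨b, a, n, rfl⟩ := ht
    rw [smul_sub, TensorProduct.smul_tmul', TensorProduct.smul_tmul', smul_eq_mul, smul_eq_mul,
      ← mul_assoc]
    exact key _ _ _

theorem exists_quot_lift (N : GrMod.{u, v, w} 𝒜) {X : Type*} [AddCommGroup X] [Module K X]
    (F : B ⊗[K] N →ₗ[K] X) (hF : ∀ t ∈ indRel φ N, F t = 0) :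
    ∃ G : ((B ⊗[K] N) ⧸ indRel φ N) →ₗ[K] X, ∀ t, G ((indRel φ N).mkQ t) = F t :=
  ⟨((indRel φ N).restrictScalars K).liftQ F hF ∘ₗ
    (Submodule.Quotient.restrictScalarsEquiv K (indRel φ N)).symm.toLinearMap, fun _ => rfl⟩

theorem ind_isInternal (N : GrMod.{u, v, w} 𝒜) :
    DirectSum.IsInternal fun n =>
      (tensorDeg ℬ N.deg n).map ((indRel φ N).mkQ.restrictScalars K) := by
  have hℬ := DirectSum.Decomposition.isInternal ℬ
  have hN := N.isInternal
  obtain ⟨c, hc⟩ := exists_tensor_coaction hℬ hN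
  obtain ⟨q, hq'⟩ : ∃ q : B ⊗[K] N →ₗ[K] (B ⊗[K] N) ⧸ indRel φ N,
    q = (indRel φ N).mkQ.restrictScalars K := ⟨_, rfl⟩
  have hq : ∀ t ∈ indRel φ N, q t = 0 := fun t ht => by
    rw [hq']; exact (Submodule.Quotient.mk_eq_zero (indRel φ N)).2 ht
  obtain ⟨G, hG⟩ := exists_quot_lift φ N _ (ind_coaction φ N hc q hq)
  have hG' : ∀ t, G (q t) = (Finsupp.mapRange.linearMap q ∘ₗ c) t := by
    intro t; rw [← hG, hq']; rfl
  have hsurj : Function.Surjective q := by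
    intro x
    obtain ⟨t, ht⟩ := Submodule.mkQ_surjective (indRel φ N) x
    exact ⟨t, by rw [hq']; exact ht⟩
  rw [← hq']
  refine GrAux.isInternal_of _ ?_ G ?_
  · rw [← Submodule.map_iSup, iSup_tensorDeg (GrAux.iSup_eq_top hℬ) (GrAux.iSup_eq_top hN),
      Submodule.map_top, LinearMap.range_eq_top]
    exact hsurj
  · rintro n _ ⟨t, ht, rfl⟩
    rw [hG']
    induction ht using Submodule.span_induction with
    | mem t ht =>
      obtain ⟨i, j, a, ha, b, hb, rfl, rfl⟩ := ht
      rw [LinearMap.comp_apply, hc i j a ha b hb, Finsupp.mapRange.linearMap_apply,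
        Finsupp.mapRange_single]
    | zero => simp
    | add a b _ _ ha hb => rw [map_add, ha, hb, map_add, Finsupp.single_add]
    | smul k a _ ha => rw [map_smul, ha, map_smul, Finsupp.smul_single]

/-- Induction along `φ : A → B`: the graded `B`-module `B ⊗_A N = B φ(1) ⊗_A N`, where `B` is a right
`A`-module through `φ`. In the quotient `b ⊗ n = b ⊗ 1 n = b φ(1) ⊗ n`, so that using `B` in place of
`B φ(1)` makes no difference. -/
def ind (N : GrMod.{u, v, w} 𝒜) : GrMod.{u, x, max x w} ℬ where
  carrier := (B ⊗[K] N) ⧸ indRel φ N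
  deg n := (tensorDeg ℬ N.deg n).map ((indRel φ N).mkQ.restrictScalars K)
  isInternal := ind_isInternal φ N
  smul_mem i j b hb := by
    rintro _ ⟨t, ht, rfl⟩
    refine ⟨b • t, ?_, rfl⟩
    induction ht using Submodule.span_induction with
    | mem t ht =>
      obtain ⟨j, k, b', hb', n, hn, rfl, rfl⟩ := ht
      rw [TensorProduct.smul_tmul', smul_eq_mul, ← add_assoc]
      exact tmul_mem (SetLike.mul_mem_graded hb hb') hn
    | zero => rw [smul_zero]; exact zero_mem _
    | add a b _ _ ha hb => rw [smul_add]; exact add_mem ha hb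
    | smul k a _ ha => rw [smul_comm]; exact Submodule.smul_mem _ k ha

/-- The subspace `φ(1) M` of `M`, for the idempotent `φ(1)`. -/
def resSpace (M : GrMod.{u, x, w} ℬ) : Submodule K M where
  carrier := {m | φ.toLin 1 • m = m}
  zero_mem' := smul_zero _
  add_mem' {a b} ha hb := by
    change _ • (a + b) = a + b
    rw [smul_add, show _ • a = a from ha, show _ • b = b from hb]
  smul_mem' k m hm := by
    change φ.toLin 1 • k • m = k • m
    rw [smul_comm, show _ • m = m from hm]

theorem smul_mem_resSpace (M : GrMod.{u, x, w} ℬ) (a : A) (m : M) :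
    φ.toLin a • m ∈ resSpace φ M := by
  change φ.toLin 1 • φ.toLin a • m = φ.toLin a • m
  rw [smul_smul, ← φ.map_mul, one_mul]

/-- The `A`-module structure on `φ(1)M`. -/
abbrev resModule (M : GrMod.{u, x, w} ℬ) : Module A (resSpace φ M) where
  smul a m := ⟨φ.toLin a • (m : M), smul_mem_resSpace φ M a m⟩
  one_smul m := Subtype.ext m.2
  mul_smul a b m := Subtype.ext (by
    change φ.toLin (a * b) • (m : M) = φ.toLin a • φ.toLin b • (m : M)
    rw [φ.map_mul, mul_smul])
  smul_zero a := Subtype.ext (smul_zero (φ.toLin a))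
  smul_add a m n := Subtype.ext (smul_add (φ.toLin a) (m : M) n)
  add_smul a b m := Subtype.ext (by
    change φ.toLin (a + b) • (m : M) = φ.toLin a • (m : M) + φ.toLin b • (m : M)
    rw [map_add, add_smul])
  zero_smul m := Subtype.ext (by
    change φ.toLin 0 • (m : M) = 0
    rw [map_zero, zero_smul])

theorem res_isInternal (M : GrMod.{u, x, w} ℬ) :
    DirectSum.IsInternal fun n => (M.deg n).comap (resSpace φ M).subtype := by
  obtain ⟨c, hc⟩ := GrAux.exists_coaction M.isInternal
  let P : M →ₗ[K] resSpace φ M :=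
    { toFun := fun m => ⟨φ.toLin 1 • m, smul_mem_resSpace φ M 1 m⟩
      map_add' := fun m n => Subtype.ext (smul_add _ _ _)
      map_smul' := fun k m => Subtype.ext (smul_comm _ _ _) }
  have hP : ∀ m : resSpace φ M, P m = m := fun m => Subtype.ext m.2
  refine GrAux.isInternal_of _ ?_ (Finsupp.mapRange.linearMap P ∘ₗ c ∘ₗ (resSpace φ M).subtype) ?_
  · rw [eq_top_iff]
    rintro m -
    rw [← hP m]
    generalize (m : M) = x
    induction x using GrAux.induction (GrAux.iSup_eq_top M.isInternal) with
    | zero => rw [map_zero]; exact zero_mem _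
    | add a b ha hb => rw [map_add]; exact add_mem ha hb
    | hom n x hx =>
      refine Submodule.mem_iSup_of_mem n ?_
      have := M.smul_mem 0 n _ (φ.map_deg 0 1 (SetLike.one_mem_graded 𝒜)) x hx
      rwa [zero_add] at this
  · intro n m hm
    simp only [LinearMap.comp_apply, Submodule.subtype_apply]
    rw [hc n m hm, Finsupp.mapRange.linearMap_apply, Finsupp.mapRange_single, hP]

/-- Restriction along `φ : A → B`: the graded `A`-module `φ(1) M`. -/
def res (M : GrMod.{u, x, w} ℬ) : GrMod.{u, v, w} 𝒜 where
  carrier := resSpace φ M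
  module := resModule φ M
  tower := by
    let _ := resModule φ M
    exact ⟨fun k a m => Subtype.ext (by
      change φ.toLin (k • a) • (m : M) = k • φ.toLin a • (m : M)
      rw [map_smul, smul_assoc])⟩
  deg n := (M.deg n).comap (resSpace φ M).subtype
  isInternal := res_isInternal φ M
  smul_mem i j a ha m hm := M.smul_mem i j _ (φ.map_deg i a ha) m hm

end IndRes

section K0
variable (𝒜 : ℤ → Submodule K A)

/-- Finitely generated projective graded modules. -/
def FGProj : Type (max u (v + 1)) := {M : GrMod.{u, v, v} 𝒜 // M.IsFGProj}

variable {𝒜}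

/-- Short exact sequences of graded modules with maps of degree `0`. -/
def IsShortExact (M' M M'' : GrMod.{u, v, w} 𝒜) : Prop :=
  ∃ (f : M' →ₗ[A] M) (g : M →ₗ[A] M''),
    (∀ n, ∀ m ∈ M'.deg n, f m ∈ M.deg n) ∧ (∀ n, ∀ m ∈ M.deg n, g m ∈ M''.deg n) ∧
    Function.Injective f ∧ Function.Exact f g ∧ Function.Surjective g

theorem IsShortExact.shift {M' M M'' : GrMod.{u, v, w} 𝒜} (h : IsShortExact M' M M'') (m : ℤ) :
    IsShortExact (M'.shift m) (M.shift m) (M''.shift m) := by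
  obtain ⟨f, g, hf, hg, h⟩ := h
  exact ⟨f, g, fun n => hf (n - m), fun n => hg (n - m), h⟩

theorem GrMod.shift_shift (M : GrMod.{u, v, w} 𝒜) (m n : ℤ) :
    (M.shift m).shift n = M.shift (n + m) := by
  unfold GrMod.shift
  congr 1
  funext k
  exact congrArg M.deg (by ring)

theorem GrMod.shift_zero (M : GrMod.{u, v, w} 𝒜) : M.shift 0 = M := by
  obtain ⟨c, d, h, h'⟩ := M
  unfold GrMod.shift
  congr 1
  funext k
  exact congrArg d (by ring)

/-- The degree shift. -/
def FGProj.shift (P : FGProj 𝒜) (m : ℤ) : FGProj 𝒜 := ⟨P.1.shift m, P.2⟩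

variable (𝒜) in
/-- The subgroup generated by `[P] - [P'] - [P'']` for all short exact sequences. -/
def k0Rel : AddSubgroup (FreeAbelianGroup (FGProj 𝒜)) :=
  AddSubgroup.closure {z | ∃ P' P P'' : FGProj 𝒜, IsShortExact P'.1 P.1 P''.1 ∧
    z = FreeAbelianGroup.of P - FreeAbelianGroup.of P' - FreeAbelianGroup.of P''}

variable (𝒜) in
/-- The Grothendieck group of the category of finitely generated projective graded `A`-modules. It is
a module over `ℤ[q, q⁻¹]` (`LaurentPolynomial ℤ` with `q = T 1`) through `q [P] = [P{1}]`, see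
`K0.T_smul_mk`. -/
def K0 : Type (max u (v + 1)) := FreeAbelianGroup (FGProj 𝒜) ⧸ k0Rel 𝒜

instance : AddCommGroup (K0 𝒜) :=
  inferInstanceAs (AddCommGroup (FreeAbelianGroup (FGProj 𝒜) ⧸ k0Rel 𝒜))

/-- The class `[P]`. -/
def K0.mk (P : FGProj 𝒜) : K0 𝒜 := QuotientAddGroup.mk (FreeAbelianGroup.of P)

/-- The additive map `[P] ↦ [P{m}]`. -/
def K0.shift (m : ℤ) : AddMonoid.End (K0 𝒜) :=
  QuotientAddGroup.map (k0Rel 𝒜) (k0Rel 𝒜) (FreeAbelianGroup.map fun P => P.shift m) <| by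
    rw [k0Rel, AddSubgroup.closure_le]
    rintro _ ⟨P', P, P'', h, rfl⟩
    refine AddSubgroup.subset_closure ⟨P'.shift m, P.shift m, P''.shift m, h.shift m, ?_⟩
    simp

@[simp] theorem K0.shift_mk (m : ℤ) (P : FGProj 𝒜) : K0.shift m (K0.mk P) = K0.mk (P.shift m) := by
  change QuotientAddGroup.mk _ = QuotientAddGroup.mk _
  rw [FreeAbelianGroup.map_of_apply]

theorem K0.hom_ext {G : Type*} [AddCommGroup G] {f g : K0 𝒜 →+ G}
    (h : ∀ P, f (K0.mk P) = g (K0.mk P)) : f = g :=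
  QuotientAddGroup.addMonoidHom_ext _ (FreeAbelianGroup.lift_ext _ _ h)

variable (𝒜) in
/-- The action of `ℤ` on `K0` by degree shifts. -/
def K0.shiftHom : Multiplicative ℤ →* AddMonoid.End (K0 𝒜) where
  toFun m := K0.shift m.toAdd
  map_one' := K0.hom_ext fun P => by
    refine (K0.shift_mk 0 P).trans ?_
    exact congrArg K0.mk (Subtype.ext (GrMod.shift_zero P.1))
  map_mul' m n := K0.hom_ext fun P => by
    refine (K0.shift_mk _ P).trans ?_
    change _ = K0.shift m.toAdd (K0.shift n.toAdd (K0.mk P))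
    rw [K0.shift_mk, K0.shift_mk]
    exact congrArg K0.mk (Subtype.ext (GrMod.shift_shift P.1 _ _).symm)

instance : Module (LaurentPolynomial ℤ) (K0 𝒜) :=
  Module.compHom (K0 𝒜)
    (AddMonoidAlgebra.lift ℤ (AddMonoid.End (K0 𝒜)) ℤ (K0.shiftHom 𝒜)).toRingHom

theorem K0.T_smul_mk (m : ℤ) (P : FGProj 𝒜) :
    (LaurentPolynomial.T m : LaurentPolynomial ℤ) • K0.mk P = K0.mk (P.shift m) := by
  change AddMonoidAlgebra.lift ℤ (AddMonoid.End (K0 𝒜)) ℤ (K0.shiftHom 𝒜)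
    (AddMonoidAlgebra.single m 1) (K0.mk P) = _
  rw [AddMonoidAlgebra.lift_single, one_smul]
  exact K0.shift_mk m P

end K0
end Mod

theorem isFGProj_self {K : Type*} [Field K] {A : Type*} [Ring A] [Algebra K A]
    (𝒜 : ℤ → Submodule K A) [GradedAlgebra 𝒜] : (GrMod.self 𝒜).IsFGProj :=
  ⟨inferInstanceAs (Module.Finite A A), inferInstanceAs (Module.Projective A A)⟩
end Gr

namespace QHA
open Gr LaurentPolynomial
open scoped TensorProduct
universe u v

variable {K : Type u} [Field K] {I : Type v} [Finite I] {D : BorcherdsDatum I}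

/-- Horizontal composition of diagrams `R(ν) ⊗ R(ν') → R(ν + ν')`, `a ⊗ b ↦ (a ⊗ 1_{ν'}) (1_ν ⊗ b)`.
It sends `1` to the idempotent `1_{ν,ν'}`. -/
def block {ν ν' ω : I →₀ ℕ} (h : ν + ν' = ω) :
    Hom (tensorDeg (deg K D ν) (deg K D ν')) (deg K D ω) where
  toLin := TensorProduct.lift ((LinearMap.mul K (Alg K D ω)).compl₁₂ (leftHom h) (rightHom h))
  map_mul a a' := by
    induction a using TensorProduct.induction_on with
    | zero => simp
    | add a b ha hb => rw [add_mul, map_add, ha, hb, map_add, add_mul]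
    | tmul a b =>
      induction a' using TensorProduct.induction_on with
      | zero => simp
      | add a b ha hb => rw [mul_add, map_add, ha, hb, map_add, mul_add]
      | tmul a' b' =>
        simp only [Algebra.TensorProduct.tmul_mul_tmul, TensorProduct.lift.tmul,
          LinearMap.compl₁₂_apply, LinearMap.mul_apply', leftHom_mul, rightHom_mul]
        rw [mul_assoc, ← mul_assoc (leftHom h a'), left_right_comm]
        simp only [mul_assoc]
  map_deg n a ha := by
    induction ha using Submodule.span_induction with
    | mem t ht =>
      obtain ⟨i, j, a, ha, b, hb, rfl, rfl⟩ := ht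
      exact SetLike.mul_mem_graded (leftHom_mem_deg h ha) (rightHom_mem_deg h hb)
    | zero => simp
    | add a b _ _ ha hb => rw [map_add]; exact add_mem ha hb
    | smul k a _ ha => rw [map_smul]; exact Submodule.smul_mem _ k ha

/-- Graded left `R(ν)`-modules. -/
abbrev RMod (K : Type u) [Field K] (D : BorcherdsDatum I) (ν : I →₀ ℕ) :=
  GrMod.{u, max u v, max u v} (deg K D ν)

/-- The induction functor from `R(ν) ⊗ R(ν')` to `R(ν + ν')`. -/
abbrev Ind {ν ν' ω : I →₀ ℕ} (h : ν + ν' = ω)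
    (X : GrMod.{u, max u v, max u v} (tensorDeg (deg K D ν) (deg K D ν'))) : RMod K D ω :=
  ind (block h) X

/-- The restriction functor from `R(ν + ν')` to `R(ν) ⊗ R(ν')`. -/
abbrev Res {ν ν' ω : I →₀ ℕ} (h : ν + ν' = ω) (X : RMod K D ω) :
    GrMod.{u, max u v, max u v} (tensorDeg (deg K D ν) (deg K D ν')) :=
  res (block h) X

/-- The `λ ∈ ℕ[I]` such that `ν - λ`, `μ' - λ` and `ν' + λ - μ'` lie in `ℕ[I]`. -/
structure MackeyIndex (ν ν' μ μ' : I →₀ ℕ) where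
  lam : I →₀ ℕ
  le_left : lam ≤ ν
  le_right : lam ≤ μ'
  le_add : μ' ≤ ν' + lam

section Mackey
variable {ν ν' μ μ' : I →₀ ℕ}

theorem mackey₁ (lam : MackeyIndex ν ν' μ μ') : ν - lam.lam + lam.lam = ν :=
  tsub_add_cancel_of_le lam.le_left
theorem mackey₂ (lam : MackeyIndex ν ν' μ μ') :
    (ν' + lam.lam - μ') + (μ' - lam.lam) = ν' := by
  have h1 := lam.le_right
  have h2 := lam.le_add
  ext i
  have := h1 i
  have := h2 i
  simp only [Finsupp.add_apply, Finsupp.tsub_apply] at *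
  omega
theorem mackey₃ (h : ν + ν' = μ + μ') (lam : MackeyIndex ν ν' μ μ') :
    ν - lam.lam + (ν' + lam.lam - μ') = μ := by
  have h1 := lam.le_left
  have h2 := lam.le_add
  ext i
  have := h1 i
  have := h2 i
  have := DFunLike.congr_fun h i
  simp only [Finsupp.add_apply, Finsupp.tsub_apply] at *
  omega
theorem mackey₄ (lam : MackeyIndex ν ν' μ μ') : lam.lam + (μ' - lam.lam) = μ' :=
  add_tsub_cancel_of_le lam.le_right

/-- The induction from `(R(ν - λ) ⊗ R(λ)) ⊗ (R(ν' + λ - μ') ⊗ R(μ' - λ))` to `R(ν) ⊗ R(ν')` of the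
twist, exchanging the two middle tensor factors, of the restriction of `M ⊗ N` from `R(μ) ⊗ R(μ')` to
`(R(ν - λ) ⊗ R(ν' + λ - μ')) ⊗ (R(λ) ⊗ R(μ' - λ))`, shifted by `-λ · (ν' + λ - μ')`. -/
def mackeyTerm (h : ν + ν' = μ + μ') (lam : MackeyIndex ν ν' μ μ')
    (M : RMod K D μ) (N : RMod K D μ') :
    GrMod.{u, max u v, max u v} (tensorDeg (deg K D ν) (deg K D ν')) :=
  (ind ((block (mackey₁ lam)).tensor (block (mackey₂ lam)))
    (res (Hom.swapMiddle _ _ _ _)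
      (res ((block (mackey₃ h lam)).tensor (block (mackey₄ lam))) (M.box N)))).shift
    (-D.pairing lam.lam (ν' + lam.lam - μ'))

end Mackey

section Bialgebra
variable (K D)

/-- `K_0(R) = ⨁_ν K_0(R(ν))`. -/
abbrev K0R : Type _ := DirectSum (I →₀ ℕ) fun ν => K0 (deg K D ν)

variable {K D}

open scoped Classical in
/-- The inclusion of the summand `K_0(R(ν))`. -/
def incl (ν : I →₀ ℕ) : K0 (deg K D ν) →ₗ[ℤ[T;T⁻¹]] K0R K D :=
  DirectSum.lof ℤ[T;T⁻¹] (I →₀ ℕ) (fun ν => K0 (deg K D ν)) ν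

/-- The projection to the summand `K_0(R(ν))`. -/
def comp (ν : I →₀ ℕ) : K0R K D →ₗ[ℤ[T;T⁻¹]] K0 (deg K D ν) :=
  DirectSum.component ℤ[T;T⁻¹] (I →₀ ℕ) (fun ν => K0 (deg K D ν)) ν

/-- The class of `P` in `K_0(R)`. -/
def cls {ν : I →₀ ℕ} (P : FGProj (deg K D ν)) : K0R K D := incl ν (K0.mk P)

variable (K D) in
/-- The class of `R(0) = K`. -/
def one : K0R K D := cls ⟨GrMod.self (deg K D 0), isFGProj_self _⟩

/-- `mul` is the multiplication of `K_0(R)` given by induction (the classes `[P]` generate `K_0(R)`, so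
this determines `mul`). -/
def IsIndProduct (mul : K0R K D →ₗ[ℤ[T;T⁻¹]] K0R K D →ₗ[ℤ[T;T⁻¹]] K0R K D) : Prop :=
  ∀ (ν ν' : I →₀ ℕ) (P : FGProj (deg K D ν)) (Q : FGProj (deg K D ν')),
    ∃ h : (Ind (rfl : ν + ν' = ν + ν') (P.1.box Q.1)).IsFGProj,
      mul (cls P) (cls Q) = cls ⟨Ind (rfl : ν + ν' = ν + ν') (P.1.box Q.1), h⟩

/-- `ext` is the identification of `K_0(R(ν)) ⊗ K_0(R(ν'))` with `K_0(R(ν) ⊗ R(ν'))` sending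
`[P] ⊗ [Q]` to `[P ⊗ Q]`. -/
def IsExternalProduct (ext : ∀ ν ν' : I →₀ ℕ, K0 (deg K D ν) ⊗[ℤ[T;T⁻¹]] K0 (deg K D ν')
    ≃ₗ[ℤ[T;T⁻¹]] K0 (tensorDeg (deg K D ν) (deg K D ν'))) : Prop :=
  ∀ (ν ν' : I →₀ ℕ) (P : FGProj (deg K D ν)) (Q : FGProj (deg K D ν')),
    ∃ h : (P.1.box Q.1).IsFGProj, ext ν ν' (K0.mk P ⊗ₜ K0.mk Q) = K0.mk ⟨P.1.box Q.1, h⟩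

/-- `Δ` is the map induced by all restriction functors: the component of `Δ [P]`, for an
`R(ω)`-module `P`, in `K_0(R(ν)) ⊗ K_0(R(ν'))` is the class of the restriction of `P` if `ν + ν' = ω`,
and zero otherwise. -/
def IsResCoproduct (ext : ∀ ν ν' : I →₀ ℕ, K0 (deg K D ν) ⊗[ℤ[T;T⁻¹]] K0 (deg K D ν')
    ≃ₗ[ℤ[T;T⁻¹]] K0 (tensorDeg (deg K D ν) (deg K D ν')))
    (Δ : K0R K D →ₗ[ℤ[T;T⁻¹]] K0R K D ⊗[ℤ[T;T⁻¹]] K0R K D) : Prop :=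
  ∀ (ω : I →₀ ℕ) (P : FGProj (deg K D ω)) (ν ν' : I →₀ ℕ),
    (∀ h : ν + ν' = ω, ∃ hP : (Res h P.1).IsFGProj,
      ext ν ν' (TensorProduct.map (comp ν) (comp ν') (Δ (cls P))) = K0.mk ⟨Res h P.1, hP⟩) ∧
    (ν + ν' ≠ ω → TensorProduct.map (comp ν) (comp ν') (Δ (cls P)) = 0)

/-- `tw` is the twisted product `(x₁ ⊗ x₂) (y₁ ⊗ y₂) = q^{-|x₂| · |y₁|} x₁ y₁ ⊗ x₂ y₂` on
`K_0(R) ⊗ K_0(R)`, for `x₂` of weight `ν` and `y₁` of weight `μ`. -/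
def IsTwistedProduct (mul : K0R K D →ₗ[ℤ[T;T⁻¹]] K0R K D →ₗ[ℤ[T;T⁻¹]] K0R K D)
    (tw : K0R K D ⊗[ℤ[T;T⁻¹]] K0R K D →ₗ[ℤ[T;T⁻¹]] K0R K D ⊗[ℤ[T;T⁻¹]] K0R K D
      →ₗ[ℤ[T;T⁻¹]] K0R K D ⊗[ℤ[T;T⁻¹]] K0R K D) : Prop :=
  ∀ (ν μ : I →₀ ℕ) (x₁ y₂ : K0R K D) (x₂ : K0 (deg K D ν)) (y₁ : K0 (deg K D μ)),
    tw (x₁ ⊗ₜ incl ν x₂) (incl μ y₁ ⊗ₜ y₂) =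
      (T (-D.pairing ν μ) : ℤ[T;T⁻¹]) • (mul x₁ (incl μ y₁) ⊗ₜ[ℤ[T;T⁻¹]] mul (incl ν x₂) y₂)

/-- The bilinear map `mul` is an associative multiplication with unit `e`. -/
structure IsAlgebraStructure {X : Type*} [AddCommGroup X] [Module ℤ[T;T⁻¹] X]
    (mul : X →ₗ[ℤ[T;T⁻¹]] X →ₗ[ℤ[T;T⁻¹]] X) (e : X) : Prop where
  assoc : ∀ x y z, mul (mul x y) z = mul x (mul y z)
  one_mul : ∀ x, mul e x = x
  mul_one : ∀ x, mul x e = x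

end Bialgebra
end QHA

end

open scoped TensorProduct LaurentPolynomial

set_option linter.unusedSimpArgs false
set_option linter.unusedSectionVars false
noncomputable section
universe u v w x
open LinearMap (comp_apply id_apply comp_assoc range mulLeft comp_add add_comp lcomp)
open TensorProduct (induction_on tmul_sum sum_tmul map_tmul zero_tmul tmul_zero add_tmul tmul_add smul_tmul' curry curry_apply assoc_tmul)
open Algebra.TensorProduct (tmul_mul_tmul one_def tensorTensorTensorComm)
open Submodule (subset_span span_induction span span_mono span_le mem_bot mem_top mem_iSup_of_mem)
open List (nil_append append_assoc cons_append append_nil finRange length_map map_eq_cons_iff map_eq_append_iff take_append_drop length_append map_cons)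
open Finset (sum_congr sum_eq_zero sum_add_distrib sum_eq_single sum_mul smul_sum mul_sum mem_univ sum_comm mem_product)
open Finset.HasAntidiagonal (mem_antidiagonal antidiagonal)
open Finsupp (single linearCombination)
open DirectSum (toModule)
open LinearMap renaming add_apply → ladd_apply, zero_apply → lzero_apply, sum_apply → lsum_apply, smul_apply → lsmul_apply, neg_apply → lneg_apply, sub_apply → lsub_apply, congr_fun → lcongr_fun, ext → lin_ext
open Module.End renaming mul_apply → end_mul

namespace QHA

section Words
variable {I : Type v}

/-- The strands of a shuffle coming from the left factor. -/
def lefts : List (I ⊕ I) → List I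
  | [] => []
  | .inl i :: s => i :: lefts s
  | .inr _ :: s => lefts s

/-- The strands of a shuffle coming from the right factor. -/
def rights : List (I ⊕ I) → List I
  | [] => []
  | .inl _ :: s => rights s
  | .inr i :: s => i :: rights s

/-- The colours of a shuffle. -/
def col (s : List (I ⊕ I)) : List I := s.map (Sum.elim id id)

@[simp] theorem lefts_nil : lefts ([] : List (I ⊕ I)) = [] := rfl
@[simp] theorem rights_nil : rights ([] : List (I ⊕ I)) = [] := rfl
@[simp] theorem col_nil : col ([] : List (I ⊕ I)) = [] := rfl
@[simp] theorem lefts_inl (i : I) (s : List (I ⊕ I)) : lefts (.inl i :: s) = i :: lefts s := rfl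
@[simp] theorem lefts_inr (i : I) (s : List (I ⊕ I)) : lefts (.inr i :: s) = lefts s := rfl
@[simp] theorem rights_inl (i : I) (s : List (I ⊕ I)) : rights (.inl i :: s) = rights s := rfl
@[simp] theorem rights_inr (i : I) (s : List (I ⊕ I)) : rights (.inr i :: s) = i :: rights s := rfl
@[simp] theorem col_cons (c : I ⊕ I) (s : List (I ⊕ I)) :
    col (c :: s) = c.elim id id :: col s := rfl
@[simp] theorem col_append (s t : List (I ⊕ I)) : col (s ++ t) = col s ++ col t := by simp [col]
@[simp] theorem lefts_append (s t : List (I ⊕ I)) : lefts (s ++ t) = lefts s ++ lefts t := by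
  induction s with
  | nil => rfl
  | cons c s ih => cases c <;> simp [ih]
@[simp] theorem rights_append (s t : List (I ⊕ I)) : rights (s ++ t) = rights s ++ rights t := by
  induction s with
  | nil => rfl
  | cons c s ih => cases c <;> simp [ih]
@[simp] theorem length_col (s : List (I ⊕ I)) : (col s).length = s.length := by simp [col]
@[simp] theorem lefts_map_inl (l : List I) : lefts (l.map Sum.inl) = l := by
  induction l <;> simp_all
@[simp] theorem lefts_map_inr (l : List I) : lefts (l.map Sum.inr) = [] := by
  induction l <;> simp_all
@[simp] theorem rights_map_inl (l : List I) : rights (l.map Sum.inl) = [] := by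
  induction l <;> simp_all
@[simp] theorem rights_map_inr (l : List I) : rights (l.map Sum.inr) = l := by
  induction l <;> simp_all
@[simp] theorem col_map_inl (l : List I) : col (l.map Sum.inl) = l := by
  induction l <;> simp_all
@[simp] theorem col_map_inr (l : List I) : col (l.map Sum.inr) = l := by
  induction l <;> simp_all

theorem wt_col (s : List (I ⊕ I)) : wt (col s) = wt (lefts s) + wt (rights s) := by
  induction s with
  | nil => simp
  | cons c s ih => cases c <;> simp [ih] <;> abel

theorem length_lefts_add (s : List (I ⊕ I)) : (lefts s).length + (rights s).length = s.length := by
  induction s with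
  | nil => rfl
  | cons c s ih => cases c <;> simp <;> omega

/-- The number of strands from the right factor among the first `k` strands. -/
def ht (s : List (I ⊕ I)) (k : ℕ) : ℕ := (rights (s.take k)).length

theorem ht_append (s t : List (I ⊕ I)) (k : ℕ) : ht (s ++ t) k = ht s k + ht t (k - s.length) := by
  simp [ht, List.take_append]

theorem ht_swap (u v : List (I ⊕ I)) (i j : I) :
    ht (u ++ .inr j :: .inl i :: v) =
      ht (u ++ .inl i :: .inr j :: v) + Pi.single (u.length + 1) 1 := by
  funext k
  rw [Pi.add_apply, ht_append, ht_append, Pi.single_apply]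
  obtain h | h | ⟨n, h⟩ : k - u.length = 0 ∨ k - u.length = 1 ∨ ∃ n, k - u.length = n + 2 := by
    rcases hk : k - u.length with _ | _ | n
    · simp
    · simp
    · right; right; exact ⟨n, rfl⟩
  · rw [h, if_neg (by omega)]; rfl
  · rw [h, if_pos (by omega)]; rfl
  · rw [h, if_neg (by omega)]; simp [ht]

theorem ht_left_swap (u v : List (I ⊕ I)) (i j : I) :
    ht (u ++ .inl j :: .inl i :: v) = ht (u ++ .inl i :: .inl j :: v) := by
  funext k
  rw [ht_append, ht_append]
  rcases k - u.length with _ | _ | n <;> simp [ht]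

theorem ht_right_swap (u v : List (I ⊕ I)) (i j : I) :
    ht (u ++ .inr j :: .inr i :: v) = ht (u ++ .inr i :: .inr j :: v) := by
  funext k
  rw [ht_append, ht_append]
  rcases k - u.length with _ | _ | n <;> simp [ht]

theorem ht_lt_swap (u v : List (I ⊕ I)) (i j : I) :
    ht (u ++ .inl i :: .inr j :: v) < ht (u ++ .inr j :: .inl i :: v) := by
  rw [ht_swap]
  refine lt_of_le_of_ne le_self_add fun h => ?_
  have := congrFun h (u.length + 1)
  simp at this

theorem ht_of_length_le (s : List (I ⊕ I)) {k : ℕ} (h : s.length ≤ k) :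
    ht s k = ht s s.length := by
  simp [ht, List.take_of_length_le h]

/-- Either all strands of the left factor come first, or there is a descent. -/
theorem sorted_or_descent (s : List (I ⊕ I)) :
    (∃ a b : List I, s = a.map .inl ++ b.map .inr) ∨
      ∃ u j i v, s = u ++ .inr j :: .inl i :: v := by
  induction s with
  | nil => exact .inl ⟨[], [], rfl⟩
  | cons c s ih =>
    obtain ⟨a, b, rfl⟩ | ⟨u, j, i, v, rfl⟩ := ih
    · cases c with
      | inl i => exact .inl ⟨i :: a, b, rfl⟩
      | inr j =>
        cases a with
        | nil => exact .inl ⟨[], j :: b, rfl⟩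
        | cons i a => exact .inr ⟨[], j, i, _, rfl⟩
    · exact .inr ⟨c :: u, j, i, v, rfl⟩

end Words

section Relations
variable {K : Type u} [Field K] {I : Type v} [Finite I] {D : BorcherdsDatum I} {ω : I →₀ ℕ}

theorem e_mul {g : Gen I} {l : List I} (h : g.top = l) :
    gen K D ω (.e l) * gen K D ω g = gen K D ω g := h ▸ top_mul g
theorem mul_e {g : Gen I} {l : List I} (h : g.bot = l) :
    gen K D ω g * gen K D ω (.e l) = gen K D ω g := h ▸ mul_bot g

theorem gen_interchange (g g' : Gen I) :
    gen K D ω (g.ctx [] g'.top) * gen K D ω (g'.ctx g.bot []) =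
      gen K D ω (g'.ctx g.top []) * gen K D ω (g.ctx [] g'.bot) := by
  simpa using proj_rel (Rel.interchange (ν := ω) g g')

theorem τ_comm_τ (l : List I) (i j : I) (m : List I) (i' j' : I) (r : List I) :
    gen K D ω (.τ l i j (m ++ j' :: i' :: r)) * gen K D ω (.τ (l ++ i :: j :: m) i' j' r) =
      gen K D ω (.τ (l ++ j :: i :: m) i' j' r) * gen K D ω (.τ l i j (m ++ i' :: j' :: r)) := by
  simpa [Gen.ctx, Gen.top, Gen.bot] using
    gen_interchange (.τ l i j m) (.τ [] i' j' r)

theorem τ_comm_x (l : List I) (i j : I) (m : List I) (k : I) (r : List I) :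
    gen K D ω (.τ l i j (m ++ k :: r)) * gen K D ω (.x (l ++ i :: j :: m) k r) =
      gen K D ω (.x (l ++ j :: i :: m) k r) * gen K D ω (.τ l i j (m ++ k :: r)) := by
  simpa [Gen.ctx, Gen.top, Gen.bot] using
    gen_interchange (.τ l i j m) (.x [] k r)

theorem x_comm_τ (l : List I) (k : I) (m : List I) (i j : I) (r : List I) :
    gen K D ω (.x l k (m ++ j :: i :: r)) * gen K D ω (.τ (l ++ k :: m) i j r) =
      gen K D ω (.τ (l ++ k :: m) i j r) * gen K D ω (.x l k (m ++ i :: j :: r)) := by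
  simpa [Gen.ctx, Gen.top, Gen.bot] using
    gen_interchange (.x l k m) (.τ [] i j r)

theorem x_comm_x (l : List I) (k : I) (m : List I) (i : I) (r : List I) :
    gen K D ω (.x l k (m ++ i :: r)) * gen K D ω (.x (l ++ k :: m) i r) = gen K D ω (.x (l ++ k :: m) i r) * gen K D ω (.x l k (m ++ i :: r)) := by
  simpa [Gen.ctx, Gen.top, Gen.bot] using
    gen_interchange (.x l k m) (.x [] i r)

variable (K D ω) in
/-- The subalgebra generated by the dots and the idempotents `1_𝐢`. -/
def dotAlg : Subalgebra K (Alg K D ω) :=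
  Algebra.adjoin K ({a | ∃ l, a = gen K D ω (.e l)} ∪ {a | ∃ l i r, a = gen K D ω (.x l i r)})

theorem e_mem_dotAlg (l : List I) : gen K D ω (.e l) ∈ dotAlg K D ω :=
  Algebra.subset_adjoin (.inl ⟨l, rfl⟩)
theorem x_mem_dotAlg (l : List I) (i : I) (r : List I) : gen K D ω (.x l i r) ∈ dotAlg K D ω :=
  Algebra.subset_adjoin (.inr ⟨l, i, r, rfl⟩)

theorem dotAlg_mul_mem {W : Submodule K (Alg K D ω)} (he : ∀ l, ∀ w ∈ W, gen K D ω (.e l) * w ∈ W)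
    (hx : ∀ l i r, ∀ w ∈ W, gen K D ω (.x l i r) * w ∈ W) {z : Alg K D ω} (hz : z ∈ dotAlg K D ω) :
    ∀ w ∈ W, z * w ∈ W := by
  induction hz using Algebra.adjoin_induction with
  | mem z hz =>
    obtain ⟨l, rfl⟩ | ⟨l, i, r, rfl⟩ := hz
    · exact he l
    · exact hx l i r
  | algebraMap c => intro w hw; rw [← Algebra.smul_def]; exact W.smul_mem c hw
  | add a b _ _ ha hb => intro w hw; rw [add_mul]; exact W.add_mem (ha w hw) (hb w hw)
  | mul a b _ _ ha hb => intro w hw; rw [mul_assoc]; exact ha _ (hb w hw)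

theorem quad_mem (l : List I) (i j : I) (r : List I) : gen K D ω (.τ l j i r) * gen K D ω (.τ l i j r) ∈ dotAlg K D ω := by
  have he := e_mem_dotAlg (K := K) (D := D) (ω := ω)
  have hx := x_mem_dotAlg (K := K) (D := D) (ω := ω)
  by_cases hij : i = j
  · subst hij
    have : gen K D ω (.τ l i i r) * gen K D ω (.τ l i i r) = 0 := by
      simpa using proj_rel (Rel.quad_same (K := K) (D := D) (ν := ω) l i r)
    rw [this]; exact zero_mem _
  by_cases hd : D.dot i j = 0
  · have : gen K D ω (.τ l j i r) * gen K D ω (.τ l i j r) = gen K D ω (.e (l ++ i :: j :: r)) := by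
      simpa using proj_rel (Rel.quad_zero (K := K) (D := D) (ν := ω) l i j r hij hd)
    rw [this]; exact he _
  · have := proj_rel (Rel.quad (K := K) (D := D) (ν := ω) l i j r hij hd)
    simp only [map_mul, map_add, map_pow, proj_fe, proj_fx, proj_fτ] at this
    change _ * _ ∈ _
    rw [this]
    exact add_mem (mul_mem (he _) (pow_mem (hx _ _ _) _)) (mul_mem (he _) (pow_mem (hx _ _ _) _))

theorem slide_left_mem (l : List I) (i j : I) (r : List I) :
    gen K D ω (.x l j (i :: r)) * gen K D ω (.τ l i j r) - gen K D ω (.τ l i j r) * gen K D ω (.x (l ++ [i]) j r) = 0 ∨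
      gen K D ω (.x l j (i :: r)) * gen K D ω (.τ l i j r) - gen K D ω (.τ l i j r) * gen K D ω (.x (l ++ [i]) j r) = gen K D ω (.e (l ++ i :: j :: r)) := by
  by_cases h : i ≠ j ∨ D.a i i ≤ 0
  · left
    rw [sub_eq_zero]
    simpa using proj_rel (Rel.slide_left (ν := ω) l i j r h)
  · right
    push Not at h
    obtain ⟨rfl, h⟩ := h
    have h2 : D.a i i = 2 := (D.diag i).resolve_right fun h' => absurd h'.1 (not_le.2 h)
    simpa using proj_rel (Rel.nil_left (ν := ω) l i r h2)

theorem slide_right_mem (l : List I) (i j : I) (r : List I) :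
    gen K D ω (.τ l i j r) * gen K D ω (.x l i (j :: r)) - gen K D ω (.x (l ++ [j]) i r) * gen K D ω (.τ l i j r) = 0 ∨
      gen K D ω (.τ l i j r) * gen K D ω (.x l i (j :: r)) - gen K D ω (.x (l ++ [j]) i r) * gen K D ω (.τ l i j r) = gen K D ω (.e (l ++ i :: j :: r)) := by
  by_cases h : i ≠ j ∨ D.a i i ≤ 0
  · left
    rw [sub_eq_zero]
    simpa using proj_rel (Rel.slide_right (ν := ω) l i j r h)
  · right
    push Not at h
    obtain ⟨rfl, h⟩ := h
    have h2 : D.a i i = 2 := (D.diag i).resolve_right fun h' => absurd h'.1 (not_le.2 h)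
    simpa using proj_rel (Rel.nil_right (ν := ω) l i r h2)

theorem braid_mem (l : List I) (i j k : I) (r : List I) :
    gen K D ω (.τ l j k (i :: r)) * gen K D ω (.τ (l ++ [j]) i k r) * gen K D ω (.τ l i j (k :: r)) -
      gen K D ω (.τ (l ++ [k]) i j r) * gen K D ω (.τ l i k (j :: r)) * gen K D ω (.τ (l ++ [i]) j k r) ∈ dotAlg K D ω := by
  have he := e_mem_dotAlg (K := K) (D := D) (ω := ω)
  have hx := x_mem_dotAlg (K := K) (D := D) (ω := ω)
  by_cases h : i = k ∧ D.a i i = 2 ∧ i ≠ j ∧ D.dot i j ≠ 0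
  · obtain ⟨rfl, h2, hij, hd⟩ := h
    have := proj_rel (Rel.braid (K := K) (D := D) (ν := ω) l i j r h2 hij hd)
    simp only [map_mul, map_sub, map_sum, map_pow, proj_fe, proj_fx, proj_fτ] at this
    change _ * _ * _ - _ ∈ _
    rw [this]
    exact sum_mem fun c _ => mul_mem (mul_mem (he _) (pow_mem (hx _ _ _) _)) (pow_mem (hx _ _ _) _)
  · have := proj_rel (Rel.braid_zero (K := K) (D := D) (ν := ω) l i j k r h)
    simp only [map_mul, proj_fτ] at this
    change _ * _ * _ - _ ∈ _
    rw [this, sub_self]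
    exact zero_mem _

/-- The diagram moving the strand `j` from the right of the strands `m` to their left. -/
def cross (K : Type u) [Field K] (D : BorcherdsDatum I) (ω : I →₀ ℕ) (p : List I) (j : I) :
    List I → List I → Alg K D ω
  | [], r => gen K D ω (.e (p ++ j :: r))
  | i :: m, r => gen K D ω (.τ p i j (m ++ r)) * cross K D ω (p ++ [i]) j m r

/-- The shuffle diagram: its top is `p`, the shuffle `s`, and `q`, its bottom is `p`, the strands of
`s` from the left factor, those from the right factor, and `q`. -/
def brd (K : Type u) [Field K] (D : BorcherdsDatum I) (ω : I →₀ ℕ) (p : List I) :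
    List (I ⊕ I) → List I → Alg K D ω
  | [], q => gen K D ω (.e (p ++ q))
  | .inl i :: s, q => brd K D ω (p ++ [i]) s q
  | .inr j :: s, q => brd K D ω (p ++ [j]) s q * cross K D ω p j (lefts s) (rights s ++ q)

theorem cross_bot (p : List I) (j : I) (m r : List I) :
    cross K D ω p j m r * gen K D ω (.e (p ++ m ++ j :: r)) = cross K D ω p j m r := by
  induction m generalizing p with
  | nil => simpa [cross] using e_idem (ν := ω) (p ++ j :: r)
  | cons i m ih =>
    have := ih (p ++ [i])
    simp only [append_assoc, cons_append, nil_append] at this ⊢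
    rw [cross, mul_assoc, this]

theorem brd_top (p : List I) (s : List (I ⊕ I)) (q : List I) :
    gen K D ω (.e (p ++ col s ++ q)) * brd K D ω p s q = brd K D ω p s q := by
  induction s generalizing p with
  | nil => simpa [brd] using e_idem (ν := ω) (p ++ q)
  | cons c s ih =>
    cases c with
    | inl i => simpa [brd] using ih (p ++ [i])
    | inr j =>
      have := ih (p ++ [j])
      simp only [append_assoc, cons_append, nil_append] at this
      simp [brd, ← mul_assoc, this]

theorem brd_bot (p : List I) (s : List (I ⊕ I)) (q : List I) :
    brd K D ω p s q * gen K D ω (.e (p ++ lefts s ++ rights s ++ q)) = brd K D ω p s q := by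
  induction s generalizing p with
  | nil => simpa [brd] using e_idem (ν := ω) (p ++ q)
  | cons c s ih =>
    cases c with
    | inl i => simpa [brd] using ih (p ++ [i])
    | inr j =>
      have := cross_bot (K := K) (D := D) (ω := ω) p j (lefts s) (rights s ++ q)
      simp only [append_assoc] at this
      simp [brd, mul_assoc, this]

theorem gen_mul_brd_eq_zero {g : Gen I} {p : List I} {s : List (I ⊕ I)} {q : List I}
    (h : g.bot ≠ p ++ col s ++ q) : gen K D ω g * brd K D ω p s q = 0 := by
  rw [← brd_top, ← mul_assoc, gen_mul_gen_eq_zero (g' := .e _) h, zero_mul]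

theorem brd_mul_gen_eq_zero {g : Gen I} {p : List I} {s : List (I ⊕ I)} {q : List I}
    (h : p ++ lefts s ++ rights s ++ q ≠ g.top) : brd K D ω p s q * gen K D ω g = 0 := by
  rw [← brd_bot, mul_assoc, gen_mul_gen_eq_zero (g := .e _) h, mul_zero]

theorem τ_cross (p : List I) (i j : I) (m : List I) (k : I) (n r : List I) :
    gen K D ω (.τ p i j (m ++ k :: n ++ r)) * cross K D ω (p ++ i :: j :: m) k n r =
      cross K D ω (p ++ j :: i :: m) k n r * gen K D ω (.τ p i j (m ++ n ++ k :: r)) := by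
  induction n generalizing m with
  | nil =>
    simp only [cross, append_nil, append_assoc, cons_append, nil_append]
    rw [e_mul (by simp [Gen.top]), mul_e (by simp [Gen.bot])]
  | cons a n ih =>
    have h1 := τ_comm_τ (K := K) (D := D) (ω := ω) p i j m a k (n ++ r)
    have h2 := ih (m ++ [a])
    simp only [cross, append_assoc, cons_append, nil_append] at h1 h2 ⊢
    rw [← mul_assoc, h1, mul_assoc, h2, mul_assoc]

theorem τ_brd (p : List I) (i j : I) (m : List I) (s : List (I ⊕ I)) (q : List I) :
    gen K D ω (.τ p i j (m ++ col s ++ q)) * brd K D ω (p ++ i :: j :: m) s q =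
      brd K D ω (p ++ j :: i :: m) s q * gen K D ω (.τ p i j (m ++ lefts s ++ rights s ++ q)) := by
  induction s generalizing m with
  | nil =>
    simp only [brd, col_nil, lefts_nil, rights_nil, append_nil, append_assoc,
      cons_append]
    rw [e_mul (by simp [Gen.top]), mul_e (by simp [Gen.bot])]
  | cons c s ih =>
    have h2 := ih (m ++ [c.elim id id])
    cases c with
    | inl a => simpa [brd] using h2
    | inr a =>
      have h1 := τ_cross (K := K) (D := D) (ω := ω) p i j m a (lefts s) (rights s ++ q)
      simp only [brd, col_cons, lefts_inr, rights_inr, Sum.elim_inr, id, append_assoc,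
        cons_append, nil_append] at h1 h2 ⊢
      rw [← mul_assoc, h2, mul_assoc, h1, mul_assoc]

theorem brd_descent (p : List I) (u : List (I ⊕ I)) (i j : I) (v : List (I ⊕ I)) (q : List I) :
    brd K D ω p (u ++ .inr j :: .inl i :: v) q =
      gen K D ω (.τ (p ++ col u) i j (col v ++ q)) * brd K D ω p (u ++ .inl i :: .inr j :: v) q := by
  induction u generalizing p with
  | nil =>
    have := τ_brd (K := K) (D := D) (ω := ω) p i j [] v q
    simp only [nil_append, append_assoc] at this
    simp only [nil_append, brd, lefts_inl, rights_inl, cross, append_assoc,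
      cons_append, col_nil, append_nil]
    rw [← mul_assoc, ← mul_assoc, ← this]
  | cons c u ih =>
    have := ih (p ++ [c.elim id id])
    cases c <;> simp only [cons_append, append_assoc, Sum.elim_inl, Sum.elim_inr, id,
      nil_append, lefts_append, lefts_inl, lefts_inr, rights_append, rights_inl, rights_inr,
      brd, col_cons] at this ⊢ <;> simp only [this, mul_assoc]

theorem brd_sorted (p a b q : List I) :
    brd K D ω p (a.map .inl ++ b.map .inr) q = gen K D ω (.e (p ++ a ++ b ++ q)) := by
  induction a generalizing p with
  | nil =>
    induction b generalizing p with
    | nil => simp [brd]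
    | cons j b ih =>
      have := ih (p ++ [j])
      simp only [List.map_nil, nil_append, map_cons, brd, lefts_map_inr, rights_map_inr,
        cross, append_assoc, cons_append, append_nil] at this ⊢
      rw [this]
      exact e_idem _
  | cons i a ih => simpa [brd] using ih (p ++ [i])

end Relations
end QHA

namespace QHA

section Straighten
variable {K : Type u} [Field K] {I : Type v} [Finite I] {D : BorcherdsDatum I} {μ μ' ω : I →₀ ℕ}

theorem block_tmul (h : μ + μ' = ω) (a : Alg K D μ) (b : Alg K D μ') :
    (block h).toLin (a ⊗ₜ b) = leftHom h a * rightHom h b := rfl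

theorem block_gen (h : μ + μ' = ω) {g g' : Gen I} (hg : wt g.bot = μ) (hg' : wt g'.bot = μ') :
    (block h).toLin (gen K D μ g ⊗ₜ gen K D μ' g') =
      gen K D ω (g.ctx [] g'.top) * gen K D ω (g'.ctx g.bot []) := by
  have ht' := (Gen.wt_bot g').symm.trans hg'
  rw [block_tmul, leftHom_gen, rightHom_gen, Finset.sum_mul_sum,
    sum_eq_single g'.top, sum_eq_single g.bot]
  · intro p hp hne
    refine gen_mul_gen_eq_zero fun heq => hne ?_
    simp only [Gen.bot_ctx, Gen.top_ctx, nil_append, append_nil] at heq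
    exact (append_inj_of_wt heq (hg.trans (mem_Seq.1 hp).symm)).1.symm
  · intro h'; exact absurd (mem_Seq.2 hg) h'
  · intro s hs hne
    refine sum_eq_zero fun p hp => gen_mul_gen_eq_zero fun heq => hne ?_
    simp only [Gen.bot_ctx, Gen.top_ctx, nil_append, append_nil] at heq
    exact (append_inj_of_wt heq (hg.trans (mem_Seq.1 hp).symm)).2
  · intro h'; exact absurd (mem_Seq.2 ht') h'

theorem block_left (h : μ + μ' = ω) {g : Gen I} {r : List I} (hg : wt g.bot = μ)
    (hr : wt r = μ') :
    (block h).toLin (gen K D μ g ⊗ₜ gen K D μ' (.e r)) = gen K D ω (g.ctx [] r) := by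
  rw [block_gen h (g' := .e r) hg hr]
  exact mul_e (by rw [Gen.bot_ctx]; simp [Gen.ctx, Gen.top])

theorem block_right (h : μ + μ' = ω) {g : Gen I} {l : List I} (hl : wt l = μ)
    (hg : wt g.bot = μ') :
    (block h).toLin (gen K D μ (.e l) ⊗ₜ gen K D μ' g) = gen K D ω (g.ctx l []) := by
  rw [block_gen h (g := .e l) hl hg]
  exact e_mul (by rw [Gen.top_ctx]; simp [Gen.ctx, Gen.bot])

theorem block_e (h : μ + μ' = ω) {l r : List I} (hl : wt l = μ) (hr : wt r = μ') :
    (block h).toLin (gen K D μ (.e l) ⊗ₜ gen K D μ' (.e r)) = gen K D ω (.e (l ++ r)) := by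
  simpa [Gen.ctx] using block_left h (g := .e l) hl hr

theorem block_one (h : μ + μ' = ω) : (block (K := K) (D := D) h).toLin 1 =
    ∑ l ∈ Seq μ, ∑ r ∈ Seq μ', gen K D ω (.e (l ++ r)) := by
  rw [one_def, ← sum_e, ← sum_e, sum_tmul, map_sum]
  refine sum_congr rfl fun l hl => ?_
  rw [tmul_sum, map_sum]
  exact sum_congr rfl fun r hr => block_e h (mem_Seq.1 hl) (mem_Seq.1 hr)

theorem range_block_mul (h : μ + μ' = ω) {y z : Alg K D ω}
    (hy : y ∈ range (block h).toLin) (hz : z ∈ range (block h).toLin) :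
    y * z ∈ range (block h).toLin := by
  obtain ⟨a, rfl⟩ := hy
  obtain ⟨b, rfl⟩ := hz
  exact ⟨a * b, (block h).map_mul a b⟩

/-- The span of the products of the shuffle diagrams satisfying `P` with the image of
`R(μ) ⊗ R(μ')`. -/
def shufSpan (K : Type u) [Field K] (D : BorcherdsDatum I) (h : μ + μ' = ω)
    (P : List (I ⊕ I) → Prop) : Submodule K (Alg K D ω) :=
  span K {z | ∃ s y, wt (lefts s) = μ ∧ wt (rights s) = μ' ∧ P s ∧
    y ∈ range (block h).toLin ∧ z = brd K D ω [] s [] * y}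

theorem shufSpan_mono (h : μ + μ' = ω) {P Q : List (I ⊕ I) → Prop} (hPQ : ∀ s, P s → Q s) :
    shufSpan K D h P ≤ shufSpan K D h Q :=
  span_mono fun _ ⟨s, y, h1, h2, h3, h4⟩ => ⟨s, y, h1, h2, hPQ s h3, h4⟩

theorem brd_mul_mem (h : μ + μ' = ω) {P : List (I ⊕ I) → Prop} {s : List (I ⊕ I)}
    (h1 : wt (lefts s) = μ) (h2 : wt (rights s) = μ') (h3 : P s) {y : Alg K D ω}
    (hy : y ∈ range (block h).toLin) : brd K D ω [] s [] * y ∈ shufSpan K D h P :=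
  subset_span ⟨s, y, h1, h2, h3, hy, rfl⟩

theorem brd_mem (h : μ + μ' = ω) {P : List (I ⊕ I) → Prop} {s : List (I ⊕ I)}
    (h1 : wt (lefts s) = μ) (h2 : wt (rights s) = μ') (h3 : P s) :
    brd K D ω [] s [] ∈ shufSpan K D h P := by
  have := brd_mul_mem h h1 h2 h3 ⟨_, block_e (K := K) (D := D) h h1 h2⟩
  have hb := brd_bot (K := K) (D := D) (ω := ω) [] s []
  simp only [nil_append, append_nil] at hb
  rwa [hb] at this

theorem shufSpan_mul (h : μ + μ' = ω) {P : List (I ⊕ I) → Prop} {y z : Alg K D ω}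
    (hz : z ∈ shufSpan K D h P) (hy : y ∈ range (block h).toLin) :
    z * y ∈ shufSpan K D h P := by
  induction hz using span_induction with
  | mem z hz =>
    obtain ⟨s, y', h1, h2, h3, h4, rfl⟩ := hz
    rw [mul_assoc]
    exact brd_mul_mem h h1 h2 h3 (range_block_mul h h4 hy)
  | zero | add => simp_all [add_mul, add_mem]
  | smul c a _ ha => rw [smul_mul_assoc]; exact Submodule.smul_mem _ c ha

theorem mul_shufSpan (h : μ + μ' = ω) {P Q : List (I ⊕ I) → Prop} {a z : Alg K D ω}
    (H : ∀ s, wt (lefts s) = μ → wt (rights s) = μ' → P s →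
      a * brd K D ω [] s [] ∈ shufSpan K D h Q) (hz : z ∈ shufSpan K D h P) :
    a * z ∈ shufSpan K D h Q := by
  induction hz using span_induction with
  | mem z hz =>
    obtain ⟨s, y', h1, h2, h3, h4, rfl⟩ := hz
    rw [← mul_assoc]
    exact shufSpan_mul h (H s h1 h2 h3) h4
  | zero | add => simp_all [mul_add, add_mem]
  | smul c a _ ha => rw [mul_smul_comm]; exact Submodule.smul_mem _ c ha

/-- The dot at the bottom of the strand `c` of the shuffle `u c v`. -/
def dotBot (K : Type u) [Field K] (D : BorcherdsDatum I) (ω : I →₀ ℕ) (u : List (I ⊕ I))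
    (c : I ⊕ I) (v : List (I ⊕ I)) : Alg K D ω :=
  match c with
  | .inl i => gen K D ω (.x (lefts u) i (lefts v ++ rights (u ++ v)))
  | .inr i => gen K D ω (.x (lefts (u ++ v) ++ rights u) i (rights v))

theorem dotBot_mem (h : μ + μ' = ω) {u : List (I ⊕ I)} {c : I ⊕ I} {v : List (I ⊕ I)}
    (h1 : wt (lefts (u ++ c :: v)) = μ) (h2 : wt (rights (u ++ c :: v)) = μ') :
    dotBot K D ω u c v ∈ range (block h).toLin := by
  cases c with
  | inl i =>
    have := block_left (K := K) (D := D) h (g := .x (lefts u) i (lefts v)) (r := rights (u ++ v))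
      (by simpa [Gen.bot] using h1) (by simpa using h2)
    exact ⟨_, this⟩
  | inr i =>
    have := block_right (K := K) (D := D) h (g := .x (rights u) i (rights v))
      (l := lefts (u ++ v)) (by simpa using h1) (by simpa [Gen.bot] using h2)
    exact ⟨_, this.trans (by simp [Gen.ctx, dotBot])⟩

/-- Dots and crossings of strands from the same factor move through the shuffle diagram `s` from its
top to its bottom, up to terms with smaller shuffle diagrams. -/
structure Straight (K : Type u) [Field K] (D : BorcherdsDatum I) (h : μ + μ' = ω)
    (s : List (I ⊕ I)) : Prop where
  dot : ∀ u c v, s = u ++ c :: v →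
    gen K D ω (.x (col u) (c.elim id id) (col v)) * brd K D ω [] s [] - brd K D ω [] s [] * dotBot K D ω u c v ∈
      shufSpan K D h fun t => ht t < ht s
  left : ∀ u i j v, s = u ++ .inl i :: .inl j :: v →
    gen K D ω (.τ (col u) i j (col v)) * brd K D ω [] s [] -
      brd K D ω [] (u ++ .inl j :: .inl i :: v) [] *
        gen K D ω (.τ (lefts u) i j (lefts v ++ rights (u ++ v))) ∈ shufSpan K D h fun t => ht t < ht s
  right : ∀ u i j v, s = u ++ .inr i :: .inr j :: v →
    gen K D ω (.τ (col u) i j (col v)) * brd K D ω [] s [] -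
      brd K D ω [] (u ++ .inr j :: .inr i :: v) [] *
        gen K D ω (.τ (lefts (u ++ v) ++ rights u) i j (rights v)) ∈ shufSpan K D h fun t => ht t < ht s

theorem shuffle_length (h : μ + μ' = ω) {s : List (I ⊕ I)} (h1 : wt (lefts s) = μ)
    (h2 : wt (rights s) = μ') : s.length = ω.degree := by
  rw [← h, map_add, ← h1, ← h2, degree_wt, degree_wt, length_lefts_add]

theorem shuffle_induction (h : μ + μ' = ω) {P : List (I ⊕ I) → Prop}
    (H : ∀ s, wt (lefts s) = μ → wt (rights s) = μ' →
      (∀ t, wt (lefts t) = μ → wt (rights t) = μ' → ht t < ht s → P t) → P s)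
    (s : List (I ⊕ I)) (h1 : wt (lefts s) = μ) (h2 : wt (rights s) = μ') : P s := by
  induction hn : ∑ k ∈ Finset.range (ω.degree + 1), ht s k using Nat.strong_induction_on
    generalizing s with
  | _ n ih =>
    subst hn
    refine H s h1 h2 fun t ht1 ht2 hts => ih _ ?_ t ht1 ht2 rfl
    obtain ⟨hle, k, hk⟩ := Pi.lt_def.1 hts
    refine Finset.sum_lt_sum (fun k _ => hle k) ?_
    by_cases hkn : k ≤ ω.degree
    · exact ⟨k, Finset.mem_range.2 (by omega), hk⟩
    · refine ⟨ω.degree, Finset.mem_range.2 (by omega), ?_⟩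
      have e1 := shuffle_length h h1 h2
      have e2 := shuffle_length h ht1 ht2
      rwa [ht_of_length_le s (by omega), ht_of_length_le t (by omega), e1, e2] at hk

theorem col_eq_append_cons {s : List (I ⊕ I)} {l r : List I} {i : I} (h : l ++ i :: r = col s) :
    ∃ u c v, s = u ++ c :: v ∧ col u = l ∧ c.elim id id = i ∧ col v = r := by
  obtain ⟨u, w, rfl, h1, h2⟩ := map_eq_append_iff.1 h.symm
  obtain ⟨c, v, rfl, h3, h4⟩ := map_eq_cons_iff.1 h2
  exact ⟨u, c, v, rfl, h1, h3, h4⟩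

theorem append_cons_cases {α : Type*} {u v u₀ v₀ : List α} {c d : α}
    (h : u ++ c :: v = u₀ ++ d :: v₀) :
    (u = u₀ ∧ c = d ∧ v = v₀) ∨ (∃ w, u₀ = u ++ c :: w ∧ v = w ++ d :: v₀) ∨
      ∃ w, u = u₀ ++ d :: w ∧ v₀ = w ++ c :: v := by
  obtain ⟨w, rfl, h2⟩ | ⟨w, rfl, h2⟩ := List.append_eq_append_iff.1 h
  all_goals cases w with
    | nil => simp_all
    | cons x w => simp_all

variable (h : μ + μ' = ω)

theorem Straight.x_mul_brd {s : List (I ⊕ I)} (hs : Straight K D h s)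
    (h1 : wt (lefts s) = μ) (h2 : wt (rights s) = μ') (l : List I) (i : I) (r : List I) :
    gen K D ω (.x l i r) * brd K D ω [] s [] ∈ shufSpan K D h fun t => ht t ≤ ht s := by
  by_cases hl : l ++ i :: r = col s
  · obtain ⟨u, c, v, rfl, rfl, rfl, rfl⟩ := col_eq_append_cons hl
    rw [← sub_add_cancel (_ * _) (brd K D ω [] (u ++ c :: v) [] * dotBot K D ω u c v)]
    exact add_mem (shufSpan_mono h (fun t hts => le_of_lt hts) (hs.dot u c v rfl))
      (brd_mul_mem h (P := fun t => ht t ≤ ht (u ++ c :: v)) h1 h2 le_rfl (dotBot_mem h h1 h2))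
  · rw [gen_mul_brd_eq_zero (by simpa [Gen.bot] using hl)]
    exact zero_mem _

theorem e_mul_brd {s : List (I ⊕ I)} {P : List (I ⊕ I) → Prop}
    (h1 : wt (lefts s) = μ) (h2 : wt (rights s) = μ') (h3 : P s) (l : List I) :
    gen K D ω (.e l) * brd K D ω [] s [] ∈ shufSpan K D h P := by
  by_cases hl : l = col s
  · have := brd_top (K := K) (D := D) (ω := ω) [] s []
    simp only [nil_append, append_nil] at this
    rw [hl, this]
    exact brd_mem h h1 h2 h3
  · rw [gen_mul_brd_eq_zero (by simpa [Gen.bot] using hl)]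
    exact zero_mem _

theorem dotAlg_mul_shufSpan {P : List (I ⊕ I) → Prop} (hP : ∀ s t, ht s ≤ ht t → P t → P s)
    (H : ∀ s, wt (lefts s) = μ → wt (rights s) = μ' → P s → Straight K D h s)
    {z : Alg K D ω} (hz : z ∈ dotAlg K D ω) {w : Alg K D ω} (hw : w ∈ shufSpan K D h P) :
    z * w ∈ shufSpan K D h P := by
  refine dotAlg_mul_mem (fun l w hw => ?_) (fun l i r w hw => ?_) hz w hw
  · exact mul_shufSpan h (fun s h1 h2 h3 => e_mul_brd h h1 h2 h3 l) hw
  · refine mul_shufSpan h (fun s h1 h2 h3 => ?_) hw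
    exact shufSpan_mono h (fun t hts => hP t s hts h3) ((H s h1 h2 h3).x_mul_brd h h1 h2 l i r)

theorem τ_mul_brd {s : List (I ⊕ I)} (h1 : wt (lefts s) = μ) (h2 : wt (rights s) = μ')
    (H : ∀ t, wt (lefts t) = μ → wt (rights t) = μ' → ht t ≤ ht s → Straight K D h t)
    (l : List I) (i j : I) (r : List I) :
    gen K D ω (.τ l i j r) * brd K D ω [] s [] ∈
      shufSpan K D h fun t => ht t ≤ ht s + Pi.single (l.length + 1) 1 := by
  by_cases hl : l ++ i :: j :: r = col s
  swap
  · rw [gen_mul_brd_eq_zero (by simpa [Gen.bot] using hl)]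
    exact zero_mem _
  have hmono : ∀ t : List (I ⊕ I), ht t ≤ ht s → ht t ≤ ht s + Pi.single (l.length + 1) 1 :=
    fun t hts => hts.trans le_self_add
  obtain ⟨u, c, v', rfl, rfl, rfl, hv⟩ := col_eq_append_cons hl
  obtain ⟨c', v, rfl, rfl, rfl⟩ := map_eq_cons_iff.1 hv
  change gen K D ω (.τ (col u) _ _ (col v)) * _ ∈ _
  have hs := H _ h1 h2 le_rfl
  rcases c with i | i <;> rcases c' with j | j
  · rw [← sub_add_cancel (_ * _) (brd K D ω [] (u ++ .inl j :: .inl i :: v) [] *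
        gen K D ω (.τ (lefts u) i j (lefts v ++ rights (u ++ v))))]
    refine add_mem (shufSpan_mono h (fun t hts => hmono t (le_of_lt hts)) (hs.left u i j v rfl))
      (brd_mul_mem h ?_ ?_ (hmono _ (ht_left_swap u v i j).le) ?_)
    · rw [← h1]; simp; abel
    · rw [← h2]; simp
    · have := block_left (K := K) (D := D) h (g := .τ (lefts u) i j (lefts v))
        (r := rights (u ++ v)) (by simpa [Gen.bot] using h1) (by simpa using h2)
      exact ⟨_, this⟩
  · have := brd_descent (K := K) (D := D) (ω := ω) [] u i j v []
    simp only [nil_append, append_nil] at this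
    change gen K D ω (.τ (col u) i j (col v)) * _ ∈ _
    rw [← this]
    refine brd_mem h ?_ ?_ ?_
    · rw [← h1]; simp
    · rw [← h2]; simp
    · rw [ht_swap, length_col]
  · have := brd_descent (K := K) (D := D) (ω := ω) [] u j i v []
    simp only [nil_append, append_nil] at this
    rw [this, ← mul_assoc]
    refine shufSpan_mono h hmono (dotAlg_mul_shufSpan h (P := fun t => ht t ≤ ht _)
      (fun _ _ => le_trans) H (quad_mem _ _ _ _) (brd_mem h ?_ ?_ (ht_lt_swap u v j i).le))
    · rw [← h1]; simp
    · rw [← h2]; simp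
  · rw [← sub_add_cancel (_ * _) (brd K D ω [] (u ++ .inr j :: .inr i :: v) [] *
        gen K D ω (.τ (lefts (u ++ v) ++ rights u) i j (rights v)))]
    refine add_mem (shufSpan_mono h (fun t hts => hmono t (le_of_lt hts)) (hs.right u i j v rfl))
      (brd_mul_mem h ?_ ?_ (hmono _ (ht_right_swap u v i j).le) ?_)
    · rw [← h1]; simp
    · rw [← h2]; simp; abel
    · have := block_right (K := K) (D := D) h (g := .τ (rights u) i j (rights v))
        (l := lefts (u ++ v)) (by simpa using h1) (by simpa [Gen.bot] using h2)
      exact ⟨_, this.trans (by simp [Gen.ctx])⟩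

theorem sorted_split {u v : List (I ⊕ I)} {c : I ⊕ I} {a b : List I}
    (hs : u ++ c :: v = a.map .inl ++ b.map .inr) :
    (∃ a₁ i a₂, c = .inl i ∧ a = a₁ ++ i :: a₂ ∧ u = a₁.map .inl ∧
      v = a₂.map .inl ++ b.map .inr) ∨
    (∃ b₁ i b₂, c = .inr i ∧ b = b₁ ++ i :: b₂ ∧ u = a.map .inl ++ b₁.map .inr ∧
      v = b₂.map .inr) := by
  obtain ⟨w, h1, h2⟩ | ⟨w, rfl, h2⟩ := List.append_eq_append_iff.1 hs
  · obtain ⟨a₁, a', rfl, rfl, rfl⟩ := map_eq_append_iff.1 h1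
    cases a' with
    | nil =>
      obtain ⟨i, b₂, rfl, rfl, rfl⟩ := map_eq_cons_iff.1 h2.symm
      exact .inr ⟨[], i, b₂, rfl, rfl, by simp, rfl⟩
    | cons i a₂ =>
      simp only [map_cons, cons_append, List.cons.injEq] at h2
      exact .inl ⟨a₁, i, a₂, h2.1, rfl, rfl, h2.2⟩
  · obtain ⟨b₁, b', rfl, rfl, h3⟩ := map_eq_append_iff.1 h2
    obtain ⟨i, b₂, rfl, rfl, rfl⟩ := map_eq_cons_iff.1 h3
    exact .inr ⟨b₁, i, b₂, rfl, rfl, rfl, rfl⟩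

theorem straight_sorted (a b : List I) : Straight K D h (a.map .inl ++ b.map .inr) where
  dot u c v hs := by
    obtain ⟨a₁, i, a₂, rfl, rfl, rfl, rfl⟩ | ⟨a₁, i, a₂, rfl, rfl, rfl, rfl⟩ :=
      sorted_split hs.symm
    all_goals
      rw [brd_sorted, dotBot, mul_e (by simp [Gen.bot]), e_mul (by simp [Gen.top])]
      simp
  left u i j v hs := by
    obtain ⟨a₁, _, a', hi, rfl, rfl, hv⟩ | ⟨a₁, _, a₂, hi, rfl, rfl, hv⟩ := sorted_split hs.symm
    · cases hi
      obtain ⟨a₂, _, a₃, hj, rfl, hu, rfl⟩ | ⟨a₂, _, a₃, hj, _⟩ :=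
        sorted_split (u := []) hv
      · cases hj
        obtain rfl : a₂ = [] := by simpa using hu.symm
        have e1 := brd_sorted (K := K) (D := D) (ω := ω) [] (a₁ ++ j :: i :: a₃) b []
        simp only [List.map_append, map_cons, append_assoc, cons_append] at e1
        rw [brd_sorted, nil_append, e1,
          mul_e (by simp [Gen.bot]), e_mul (by simp [Gen.top])]
        simp
      · cases hj
    · cases hi
  right u i j v hs := by
    obtain ⟨a₁, _, a', hi, rfl, rfl, hv⟩ | ⟨a₁, _, a₂, hi, rfl, rfl, hv⟩ := sorted_split hs.symm
    · cases hi
    · cases hi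
      obtain ⟨j, a₃, rfl, hj, rfl⟩ := map_eq_cons_iff.1 hv.symm
      cases hj
      have e1 := brd_sorted (K := K) (D := D) (ω := ω) [] a (a₁ ++ j :: i :: a₃) []
      simp only [List.map_append, map_cons, append_assoc, cons_append] at e1
      rw [brd_sorted, append_assoc (List.map _ _) _ (_ :: _), e1, mul_e (by simp [Gen.bot]),
        e_mul (by simp [Gen.top])]
      simp

theorem brd_descent' (u : List (I ⊕ I)) (i j : I) (v : List (I ⊕ I)) :
    brd K D ω [] (u ++ .inr j :: .inl i :: v) [] =
      gen K D ω (.τ (col u) i j (col v)) * brd K D ω [] (u ++ .inl i :: .inr j :: v) [] := by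
  simpa using brd_descent [] u i j v []

/-- Multiplication by a crossing preserves the terms that are lower than a shuffle with a descent. -/
theorem τ_mul_low {u v : List (I ⊕ I)} {i j : I}
    (IH : ∀ t, wt (lefts t) = μ → wt (rights t) = μ' → ht t < ht (u ++ .inr j :: .inl i :: v) →
      Straight K D h t) {l : List I} (hl : l.length = u.length) (a b : I) (r : List I)
    {z : Alg K D ω}
    (hz : z ∈ shufSpan K D h fun t => ht t < ht (u ++ .inl i :: .inr j :: v)) :
    gen K D ω (.τ l a b r) * z ∈ shufSpan K D h fun t => ht t < ht (u ++ .inr j :: .inl i :: v) := by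
  refine mul_shufSpan h (fun t h1 h2 hlt => ?_) hz
  refine shufSpan_mono h (fun t' ht' => lt_of_le_of_lt ht' ?_)
    (τ_mul_brd h h1 h2 (fun t' h1' h2' ht' => IH t' h1' h2' ?_) l a b r)
  · rw [ht_swap, hl]
    exact add_lt_add_left hlt _
  · exact (ht'.trans_lt hlt).trans (ht_lt_swap u v i j)

theorem straight_descent {u₀ v₀ : List (I ⊕ I)} {i₀ j₀ : I}
    (h1 : wt (lefts (u₀ ++ .inr j₀ :: .inl i₀ :: v₀)) = μ)
    (h2 : wt (rights (u₀ ++ .inr j₀ :: .inl i₀ :: v₀)) = μ')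
    (IH : ∀ t, wt (lefts t) = μ → wt (rights t) = μ' →
      ht t < ht (u₀ ++ .inr j₀ :: .inl i₀ :: v₀) → Straight K D h t) :
    Straight K D h (u₀ ++ .inr j₀ :: .inl i₀ :: v₀) := by
  have hb := brd_descent' (K := K) (D := D) (ω := ω) u₀ i₀ j₀ v₀
  have h1' : wt (lefts (u₀ ++ .inl i₀ :: .inr j₀ :: v₀)) = μ := by rw [← h1]; simp
  have h2' : wt (rights (u₀ ++ .inl i₀ :: .inr j₀ :: v₀)) = μ' := by rw [← h2]; simp
  have hlt := ht_lt_swap u₀ v₀ i₀ j₀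
  have IH0 := IH _ h1' h2' hlt
  have hlift : ∀ (l : List I) (a b : I) (r : List I) (z : Alg K D ω), l.length = u₀.length →
      (z ∈ shufSpan K D h fun t => ht t < ht (u₀ ++ .inl i₀ :: .inr j₀ :: v₀)) →
      gen K D ω (.τ l a b r) * z ∈ shufSpan K D h fun t => ht t < ht (u₀ ++ .inr j₀ :: .inl i₀ :: v₀) :=
    fun l a b r z hl hz => τ_mul_low h IH hl a b r hz
  have hdot : ∀ z ∈ dotAlg K D ω, ∀ w, (w ∈ shufSpan K D h fun t =>
      ht t < ht (u₀ ++ .inr j₀ :: .inl i₀ :: v₀)) → z * w ∈ shufSpan K D h fun t =>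
      ht t < ht (u₀ ++ .inr j₀ :: .inl i₀ :: v₀) := fun z hz w hw =>
    dotAlg_mul_shufSpan h (fun s t hst => lt_of_le_of_lt hst) IH hz hw
  have hlow : ∀ (z : Alg K D ω), z = 0 ∨ z = gen K D ω (.e (col u₀ ++ i₀ :: j₀ :: col v₀)) →
      z * brd K D ω [] (u₀ ++ .inl i₀ :: .inr j₀ :: v₀) [] ∈ shufSpan K D h fun t =>
        ht t < ht (u₀ ++ .inr j₀ :: .inl i₀ :: v₀) := by
    rintro z (rfl | rfl)
    · rw [zero_mul]; exact zero_mem _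
    · exact hdot _ (e_mem_dotAlg _) _ (brd_mem h h1' h2' hlt)
  refine ⟨fun u c v hs => ?_, fun u i j v hs => ?_, fun u i j v hs => ?_⟩
  · obtain ⟨rfl, rfl, rfl⟩ | ⟨w, rfl, rfl⟩ | ⟨w, rfl, hw⟩ := append_cons_cases hs.symm
    · have hd := IH0.dot (u ++ [.inl i₀]) (.inr j₀) v₀ (by simp)
      have hx := slide_left_mem (K := K) (D := D) (ω := ω) (col u) i₀ j₀ (col v₀)
      have := add_mem (hlift (col u) i₀ j₀ (col v₀) _ (by simp) hd) (hlow _ hx)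
      convert this using 1
      rw [hb]
      simp only [dotBot, lefts_append, rights_append, lefts_inl, rights_inl, lefts_inr,
        rights_inr, lefts_nil, rights_nil, col_append, col_cons, Sum.elim_inl, Sum.elim_inr, id,
        col_nil, append_nil, append_assoc, cons_append, nil_append]
      noncomm_ring
    · have hd := IH0.dot u c (w ++ .inl i₀ :: .inr j₀ :: v₀) (by simp)
      have hc := x_comm_τ (K := K) (D := D) (ω := ω) (col u) (c.elim id id) (col w) i₀ j₀ (col v₀)
      have := hlift (col (u ++ c :: w)) i₀ j₀ (col v₀) _ (by simp) hd
      convert this using 1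
      have e1 : dotBot K D ω u c (w ++ .inl i₀ :: .inr j₀ :: v₀) =
        dotBot K D ω u c (w ++ .inr j₀ :: .inl i₀ :: v₀) := by cases c <;> simp [dotBot]
      rw [hb, e1]
      simp only [col_append, col_cons, Sum.elim_inl, Sum.elim_inr, id] at hc ⊢
      rw [← mul_assoc, hc]
      noncomm_ring
    · rcases w with _ | ⟨y, w⟩
      · simp only [nil_append, List.cons.injEq] at hw
        obtain ⟨rfl, rfl⟩ := hw
        have hd := IH0.dot u₀ (.inl i₀) (.inr j₀ :: v₀) rfl
        have hx := slide_right_mem (K := K) (D := D) (ω := ω) (col u₀) i₀ j₀ (col v₀)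
        have := sub_mem (hlift (col u₀) i₀ j₀ (col v₀) _ (by simp) hd) (hlow _ hx)
        convert this using 1
        rw [hb]
        simp only [dotBot, lefts_append, rights_append, lefts_inl, rights_inl, lefts_inr,
          rights_inr, lefts_nil, rights_nil, col_append, col_cons, Sum.elim_inl, Sum.elim_inr, id,
          col_nil, append_nil, append_assoc, cons_append, nil_append]
        noncomm_ring
      · simp only [cons_append, List.cons.injEq] at hw
        obtain ⟨rfl, rfl⟩ := hw
        have hd := IH0.dot (u₀ ++ .inl i₀ :: .inr j₀ :: w) c v (by simp)
        have hc := τ_comm_x (K := K) (D := D) (ω := ω) (col u₀) i₀ j₀ (col w) (c.elim id id) (col v)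
        have := hlift (col u₀) i₀ j₀ (col (w ++ c :: v)) _ (by simp) hd
        convert this using 1
        have e1 : dotBot K D ω (u₀ ++ .inl i₀ :: .inr j₀ :: w) c v =
          dotBot K D ω (u₀ ++ .inr j₀ :: .inl i₀ :: w) c v := by cases c <;> simp [dotBot]
        rw [hb, e1]
        simp only [col_append, col_cons, Sum.elim_inl, Sum.elim_inr, id] at hc ⊢
        rw [← mul_assoc, ← hc]
        noncomm_ring
  · obtain ⟨_, hc, _⟩ | ⟨w, rfl, hw⟩ | ⟨w, rfl, hw⟩ := append_cons_cases hs.symm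
    · cases hc
    · rcases w with _ | ⟨y, w⟩
      · simp at hw
      · simp only [cons_append, List.cons.injEq] at hw
        obtain ⟨rfl, rfl⟩ := hw
        have hd := IH0.left u i j (w ++ .inl i₀ :: .inr j₀ :: v₀) (by simp)
        have hc := τ_comm_τ (K := K) (D := D) (ω := ω) (col u) i j (col w) i₀ j₀ (col v₀)
        have hb' := brd_descent' (K := K) (D := D) (ω := ω) (u ++ .inl j :: .inl i :: w) i₀ j₀ v₀
        have := hlift (col (u ++ .inl j :: .inl i :: w)) i₀ j₀ (col v₀) _ (by simp) hd
        convert this using 1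
        rw [hb]
        simp only [col_append, col_cons, Sum.elim_inl, Sum.elim_inr, id, lefts_append, lefts_inl,
          lefts_inr, rights_append, rights_inl, rights_inr, append_assoc, cons_append]
          at hc hb' ⊢
        rw [← mul_assoc, hc, hb']
        noncomm_ring
    · rcases w with _ | ⟨y, w⟩
      · simp only [nil_append, List.cons.injEq, Sum.inl.injEq] at hw
        obtain ⟨rfl, rfl⟩ := hw
        have d2 := brd_descent' (K := K) (D := D) (ω := ω) (u₀ ++ [.inl i₀]) j j₀ v
        have e1 := brd_descent' (K := K) (D := D) (ω := ω) u₀ j j₀ (.inl i₀ :: v)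
        have e2 := brd_descent' (K := K) (D := D) (ω := ω) (u₀ ++ [.inl j]) i₀ j₀ v
        have hlt' := ht_lt_swap (u₀ ++ [.inl i₀]) v j j₀
        have l1 := fun z => τ_mul_low h (z := z) (u := u₀ ++ [.inl i₀]) (v := v) (i := j) (j := j₀)
          (fun t g1 g2 g3 => IH t g1 g2 (lt_trans g3 (by simpa using hlt)))
          (l := col u₀ ++ [j]) (by simp) i₀ j₀ (col v)
        have hz := braid_mem (K := K) (D := D) (ω := ω) (col u₀) i₀ j j₀ (col v)
        simp only [append_assoc, cons_append, nil_append, col_append, col_cons,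
          col_nil, Sum.elim_inl, Sum.elim_inr, id] at d2 e1 e2 hlt' l1
        have w1 : wt (lefts (u₀ ++ .inl i₀ :: .inl j :: .inr j₀ :: v)) = μ := by
          rw [← h1']; simp
        have w2 : wt (rights (u₀ ++ .inl i₀ :: .inl j :: .inr j₀ :: v)) = μ' := by
          rw [← h2']; simp
        have hd := (IH _ w1 w2 (hlt'.trans hlt)).left u₀ i₀ j _ rfl
        have := sub_mem (hlift (col u₀) j j₀ (i₀ :: col v) _ (by simp) (l1 _ hd))
          (hdot _ hz _ (brd_mem h w1 w2 (hlt'.trans hlt)))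
        convert this using 1
        simp only [append_assoc, cons_append, nil_append, col_append, col_cons,
          col_nil, Sum.elim_inl, Sum.elim_inr, id, lefts_append, lefts_inl, lefts_inr, lefts_nil,
          append_nil, rights_append, rights_inl, rights_inr, rights_nil] at hb ⊢
        rw [hb, d2, e1, e2]
        noncomm_ring
      · simp only [cons_append, List.cons.injEq] at hw
        obtain ⟨rfl, rfl⟩ := hw
        have hd := IH0.left (u₀ ++ .inl i₀ :: .inr j₀ :: w) i j v (by simp)
        have hc := τ_comm_τ (K := K) (D := D) (ω := ω) (col u₀) i₀ j₀ (col w) i j (col v)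
        have hb' := brd_descent' (K := K) (D := D) (ω := ω) u₀ i₀ j₀ (w ++ .inl j :: .inl i :: v)
        have := hlift (col u₀) i₀ j₀ (col (w ++ .inl j :: .inl i :: v)) _ (by simp) hd
        convert this using 1
        rw [hb]
        simp only [col_append, col_cons, Sum.elim_inl, Sum.elim_inr, id, lefts_append, lefts_inl,
          lefts_inr, rights_append, rights_inl, rights_inr, append_assoc, cons_append]
          at hc hb' ⊢
        rw [← mul_assoc, ← hc, hb']
        noncomm_ring
  · obtain ⟨_, _, hc⟩ | ⟨w, rfl, hw⟩ | ⟨w, rfl, hw⟩ := append_cons_cases hs.symm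
    · simp at hc
    · rcases w with _ | ⟨y, w⟩
      · simp only [nil_append, List.cons.injEq, Sum.inr.injEq] at hw
        obtain ⟨rfl, rfl⟩ := hw
        have d2 := brd_descent' (K := K) (D := D) (ω := ω) u i₀ i (.inr j :: v₀)
        have e1 := brd_descent' (K := K) (D := D) (ω := ω) (u ++ [.inr j]) i₀ i v₀
        have e2 := brd_descent' (K := K) (D := D) (ω := ω) u i₀ j (.inr i :: v₀)
        have hlt' := ht_lt_swap u (.inr j :: v₀) i₀ i
        simp only [append_assoc, cons_append, nil_append, col_append, col_cons,
          col_nil, Sum.elim_inl, Sum.elim_inr, id] at hlt IH d2 e1 e2 hlt'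
        have l1 := fun z => τ_mul_low h (z := z) (u := u) (v := .inr j :: v₀) (i := i₀) (j := i)
          (fun t g1 g2 g3 => IH t g1 g2 (lt_trans g3 hlt))
          (l := col u) (by simp) i₀ j (i :: col v₀)
        have hz := braid_mem (K := K) (D := D) (ω := ω) (col u) i₀ i j (col v₀)
        have w1 : wt (lefts (u ++ .inl i₀ :: .inr i :: .inr j :: v₀)) = μ := by
          rw [← h1']; simp
        have w2 : wt (rights (u ++ .inl i₀ :: .inr i :: .inr j :: v₀)) = μ' := by
          rw [← h2']; simp
        have hd := (IH _ w1 w2 (hlt'.trans hlt)).right (u ++ [.inl i₀]) i j v₀ (by simp)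
        simp only [append_assoc, cons_append, nil_append, col_append, col_cons,
          col_nil, Sum.elim_inl, Sum.elim_inr, id] at hd hlift hdot hb
        have := add_mem (hlift (col u ++ [j]) i₀ i (col v₀) _ (by simp) (l1 _ hd))
          (hdot _ hz _ (brd_mem h w1 w2 (hlt'.trans hlt)))
        simp only [append_assoc, cons_append, nil_append]
        convert this using 1
        simp only [append_assoc, cons_append, nil_append, col_append, col_cons,
          col_nil, Sum.elim_inl, Sum.elim_inr, id, lefts_append, lefts_inl, lefts_inr, lefts_nil,
          append_nil, rights_append, rights_inl, rights_inr, rights_nil]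
        rw [hb, d2, e1, e2]
        noncomm_ring
      · simp only [cons_append, List.cons.injEq] at hw
        obtain ⟨rfl, rfl⟩ := hw
        have hd := IH0.right u i j (w ++ .inl i₀ :: .inr j₀ :: v₀) (by simp)
        have hc := τ_comm_τ (K := K) (D := D) (ω := ω) (col u) i j (col w) i₀ j₀ (col v₀)
        have hb' := brd_descent' (K := K) (D := D) (ω := ω) (u ++ .inr j :: .inr i :: w) i₀ j₀ v₀
        have := hlift (col (u ++ .inr j :: .inr i :: w)) i₀ j₀ (col v₀) _ (by simp) hd
        convert this using 1
        rw [hb]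
        simp only [col_append, col_cons, Sum.elim_inl, Sum.elim_inr, id, lefts_append, lefts_inl,
          lefts_inr, rights_append, rights_inl, rights_inr, append_assoc, cons_append]
          at hc hb' ⊢
        rw [← mul_assoc, hc, hb']
        noncomm_ring
    · rcases w with _ | ⟨y, w⟩
      · simp at hw
      · simp only [cons_append, List.cons.injEq] at hw
        obtain ⟨rfl, rfl⟩ := hw
        have hd := IH0.right (u₀ ++ .inl i₀ :: .inr j₀ :: w) i j v (by simp)
        have hc := τ_comm_τ (K := K) (D := D) (ω := ω) (col u₀) i₀ j₀ (col w) i j (col v)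
        have hb' := brd_descent' (K := K) (D := D) (ω := ω) u₀ i₀ j₀ (w ++ .inr j :: .inr i :: v)
        have := hlift (col u₀) i₀ j₀ (col (w ++ .inr j :: .inr i :: v)) _ (by simp) hd
        convert this using 1
        rw [hb]
        simp only [col_append, col_cons, Sum.elim_inl, Sum.elim_inr, id, lefts_append, lefts_inl,
          lefts_inr, rights_append, rights_inl, rights_inr, append_assoc, cons_append]
          at hc hb' ⊢
        rw [← mul_assoc, ← hc, hb']
        noncomm_ring

theorem straight (s : List (I ⊕ I)) (h1 : wt (lefts s) = μ) (h2 : wt (rights s) = μ') :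
    Straight K D h s := by
  refine shuffle_induction h (fun s h1 h2 IH => ?_) s h1 h2
  obtain ⟨a, b, rfl⟩ | ⟨u, j, i, v, rfl⟩ := sorted_or_descent s
  · exact straight_sorted h a b
  · exact straight_descent h h1 h2 IH

/-- The shuffle diagrams generate `R(ω) 1_{μ,μ'}` over `R(μ) ⊗ R(μ')`. -/
theorem mul_one_mem_shufSpan (a : Alg K D ω) :
    a * (block h).toLin 1 ∈ shufSpan K D h fun _ => True := by
  have hT : ∀ (P : List (I ⊕ I) → Prop), shufSpan K D h P ≤ shufSpan K D h fun _ => True :=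
    fun P => shufSpan_mono h fun _ _ => trivial
  induction a using Alg.induction with
  | one =>
    rw [one_mul, block_one]
    refine sum_mem fun l hl => sum_mem fun r hr => ?_
    have := brd_sorted (K := K) (D := D) (ω := ω) [] l r []
    simp only [nil_append, append_nil] at this
    rw [← this]
    exact brd_mem h (by simpa using hl) (by simpa using hr) trivial
  | add a b ha hb => rw [add_mul]; exact add_mem ha hb
  | smul c a ha => rw [smul_mul_assoc]; exact Submodule.smul_mem _ c ha
  | mul g a ha =>
    rw [mul_assoc]
    refine mul_shufSpan h (fun s h1 h2 _ => ?_) ha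
    cases g with
    | e l => exact e_mul_brd h h1 h2 trivial l
    | x l i r => exact hT _ ((straight h s h1 h2).x_mul_brd h h1 h2 l i r)
    | τ l i j r => exact hT _ (τ_mul_brd h h1 h2 (fun t g1 g2 _ => straight h t g1 g2) l i j r)

end Straighten
end QHA

namespace QHA

namespace Poly
variable (K : Type u) [Field K] {I : Type v} [Finite I] (D : BorcherdsDatum I) {n : ℕ} (c : Fin n → I)

/-- The field of rational functions in variables indexed by the labels. -/
abbrev F (n : ℕ) : Type u := FractionRing (MvPolynomial (Fin n) K)

/-- The space with basis the orderings of the labels. -/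
abbrev V (n : ℕ) : Type u := {w : List (Fin n) // w.Perm (finRange n)} →₀ F K n

/-- The variable belonging to a label. -/
def y (a : Fin n) : F K n := algebraMap (MvPolynomial (Fin n) K) _ (MvPolynomial.X a)

theorem y_injective : Function.Injective (y K (n := n)) := fun _ _ h =>
  MvPolynomial.X_injective (IsFractionRing.injective (MvPolynomial (Fin n) K) _ h)

open scoped Classical in
/-- The basis vector of an ordering, zero on lists which are not orderings of the labels. -/
def vec (w : List (Fin n)) : V K n :=
  if h : w.Perm (finRange n) then single ⟨w, h⟩ 1 else 0

/-- The linear map with prescribed values on the basis. -/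
def op (f : List (Fin n) → V K n) : Module.End (F K n) (V K n) :=
  linearCombination (F K n) fun w => f w.1

variable {K}

theorem op_vec (f : List (Fin n) → V K n) {w : List (Fin n)} (h : w.Perm (finRange n)) :
    op K f (vec K w) = f w := by
  simp [op, vec, h]

theorem end_ext {f g : Module.End (F K n) (V K n)}
    (h : ∀ w : List (Fin n), w.Perm (finRange n) → f (vec K w) = g (vec K w)) : f = g := by
  refine Finsupp.lhom_ext' fun w => LinearMap.ext_ring ?_
  simpa [vec, w.2] using h w.1 w.2

theorem vec_of_not {w : List (Fin n)} (h : ¬ w.Perm (finRange n)) : vec K w = 0 := by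
  simp [vec, h]

variable (K)

open scoped Classical in
/-- The projection to the orderings with colour sequence `l`. -/
def P (l : List I) : Module.End (F K n) (V K n) := op K fun w => if w.map c = l then vec K w else 0

/-- Multiplication by the variable of the label in position `k`. -/
def dotOp (k : ℕ) : Module.End (F K n) (V K n) :=
  op K fun w => (w[k]?.elim 0 (y K)) • vec K w

open scoped Classical in
/-- The diagonal coefficient of a crossing. -/
def β (a b : Fin n) : F K n :=
  if c a = c b ∧ D.a (c a) (c a) = 2 then (y K a - y K b)⁻¹ else 0

open scoped Classical in
/-- The value of a double crossing. -/
def qq (a b : Fin n) : F K n :=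
  if c a = c b then 0 else if D.dot (c a) (c b) = 0 then 1 else
    y K a ^ (-D.a (c a) (c b)).toNat + y K b ^ (-D.a (c b) (c a)).toNat

/-- The off-diagonal coefficient of a crossing. -/
def α (a b : Fin n) : F K n := if a < b then 1 else qq K D c a b - β K D c a b ^ 2

/-- The crossing in positions `k`, `k + 1`. -/
def crossOp (k : ℕ) : Module.End (F K n) (V K n) := op K fun w =>
  match w.drop k with
  | a :: b :: v => α K D c a b • vec K (w.take k ++ b :: a :: v) + β K D c a b • vec K w
  | _ => 0

variable {K c D}

theorem P_vec (l : List I) (w : List (Fin n)) [Decidable (w.map c = l)] :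
    P K c l (vec K w) = if w.map c = l then vec K w else 0 := by
  by_cases h : w.Perm (finRange n)
  · rw [P, op_vec _ h]; congr
  · simp [vec_of_not h]

theorem P_same {l : List I} {w : List (Fin n)} (h : w.map c = l) : P K c l (vec K w) = vec K w := by
  classical simp [P_vec, h]
theorem P_ne {l : List I} {w : List (Fin n)} (h : w.map c ≠ l) : P K c l (vec K w) = 0 := by
  classical simp [P_vec, h]

theorem dotOp_vec (k : ℕ) (w : List (Fin n)) :
    dotOp K k (vec K w) = (w[k]?.elim 0 (y K)) • vec K w := by
  by_cases h : w.Perm (finRange n)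
  · rw [dotOp, op_vec _ h]
  · simp [vec_of_not h]

theorem dotOp_at {u : List (Fin n)} {k : ℕ} (hk : u.length = k) (a : Fin n) (v : List (Fin n)) :
    dotOp K k (vec K (u ++ a :: v)) = y K a • vec K (u ++ a :: v) := by
  subst hk; simp [dotOp_vec]

theorem crossOp_at {u : List (Fin n)} {k : ℕ} (hk : u.length = k) (a b : Fin n)
    (v : List (Fin n)) : crossOp K D c k (vec K (u ++ a :: b :: v)) =
      α K D c a b • vec K (u ++ b :: a :: v) + β K D c a b • vec K (u ++ a :: b :: v) := by
  subst hk
  have hp : (u ++ a :: b :: v).Perm (u ++ b :: a :: v) :=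
    List.Perm.append_left u (List.Perm.swap b a v)
  by_cases h : (u ++ a :: b :: v).Perm (finRange n)
  · rw [crossOp, op_vec _ h]; simp
  · have h' : ¬ (u ++ b :: a :: v).Perm (finRange n) := fun h' => h (hp.trans h')
    simp [vec_of_not h, vec_of_not h']

theorem split_one {w : List (Fin n)} {l : List I} {i : I} {r : List I}
    (h : w.map c = l ++ i :: r) : ∃ u a v, w = u ++ a :: v ∧ u.map c = l ∧ c a = i ∧ v.map c = r := by
  obtain ⟨u, w', rfl, hu, hw⟩ := map_eq_append_iff.1 h
  obtain ⟨a, v, rfl, ha, hv⟩ := map_eq_cons_iff.1 hw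
  exact ⟨u, a, v, rfl, hu, ha, hv⟩

theorem split_two {w : List (Fin n)} {l : List I} {i j : I} {r : List I}
    (h : w.map c = l ++ i :: j :: r) : ∃ u a b v, w = u ++ a :: b :: v ∧ u.map c = l ∧ c a = i ∧
      c b = j ∧ v.map c = r := by
  obtain ⟨u, a, w', rfl, hu, ha, hw⟩ := split_one h
  obtain ⟨b, v, rfl, hb, hv⟩ := map_eq_cons_iff.1 hw
  exact ⟨u, a, b, v, rfl, hu, ha, hb, hv⟩

variable (K D c) in
/-- The operator of an elementary diagram, regardless of colours. -/
def raw : Gen I → Module.End (F K n) (V K n)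
  | .e _ => 1
  | .x l _ _ => dotOp K l.length
  | .τ l _ _ _ => crossOp K D c l.length

variable (K D c) in
/-- The action of an elementary diagram. -/
def act (g : Gen I) : Module.End (F K n) (V K n) := raw K D c g * P K c g.bot

theorem β_eq_zero {a b : Fin n} (h : c a ≠ c b) : β K D c a b = 0 := by simp [β, h]

theorem act_mul_P (g : Gen I) : act K D c g * P K c g.bot = act K D c g := by
  refine end_ext fun w _ => ?_
  by_cases h : w.map c = g.bot
  · simp [P_same h]
  · cases g <;> simp only [Gen.bot] at h <;> simp [act, raw, Gen.bot, P_ne h]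

theorem top_mul_act (g : Gen I) : P K c g.top * act K D c g = act K D c g := by
  refine end_ext fun w _ => ?_
  by_cases h : w.map c = g.bot
  · cases g with
    | e l => simp only [Gen.bot] at h; simp [act, raw, Gen.top, Gen.bot, P_same h]
    | x l i r =>
      simp only [Gen.bot] at h
      simp [act, raw, Gen.top, Gen.bot, P_same h, dotOp_vec]
    | τ l i j r =>
      simp only [Gen.bot] at h
      obtain ⟨u, a, b, v, rfl, rfl, rfl, rfl, rfl⟩ := split_two h
      simp only [act, raw, Gen.top, Gen.bot, end_mul, P_same h,
        crossOp_at (length_map c).symm, map_add, map_smul]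
      rw [P_same (by simp)]
      by_cases hc : c a = c b
      · rw [P_same (by simp [hc])]
      · simp [β_eq_zero hc]
  · cases g <;> simp only [Gen.bot] at h <;> simp [act, raw, Gen.bot, P_ne h]

theorem act_apply_ne (g : Gen I) {w : List (Fin n)} (h : w.map c ≠ g.bot) :
    act K D c g (vec K w) = 0 := by
  rw [← act_mul_P]; simp [P_ne h]

/-- Extensionality for operators supported on a colour sequence. -/
theorem end_ext_on (l : List I) {f g : Module.End (F K n) (V K n)} (hf : f * P K c l = f)
    (hg : g * P K c l = g) (h : ∀ w : List (Fin n), w.Nodup → w.map c = l →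
      f (vec K w) = g (vec K w)) : f = g := by
  refine end_ext fun w hw => ?_
  by_cases hl : w.map c = l
  · exact h w (hw.nodup_iff.2 (List.nodup_finRange n)) hl
  · rw [← hf, ← hg]; simp [P_ne hl]

theorem β_antisymm (a b : Fin n) : β K D c b a = -β K D c a b := by
  simp only [β]
  split_ifs with h1 h2 h2
  · rw [← neg_sub (y K a), inv_neg]
  · exact absurd ⟨h1.1.symm, h1.1 ▸ h1.2⟩ h2
  · exact absurd ⟨h2.1.symm, h2.1 ▸ h2.2⟩ h1
  · simp

theorem qq_symm (a b : Fin n) : qq K D c b a = qq K D c a b := by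
  simp only [qq, D.dot_comm (c b) (c a), eq_comm (a := c b)]
  by_cases h : c a = c b
  · simp [h]
  · by_cases h' : D.dot (c a) (c b) = 0
    · simp [h, h', Ne.symm h]
    · simp only [h, h', Ne.symm h, if_false]; exact add_comm _ _

theorem α_mul_α {a b : Fin n} (h : a ≠ b) :
    α K D c a b * α K D c b a = qq K D c a b - β K D c a b ^ 2 := by
  have e := β_antisymm (K := K) (D := D) (c := c) a b
  have e' := qq_symm (K := K) (D := D) (c := c) a b
  rcases lt_or_gt_of_ne h with h | h
  · simp [α, h, h.not_gt, e, e']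
  · simp [α, h, h.not_gt]

theorem y_sub_ne {a b : Fin n} (h : a ≠ b) : y K a - y K b ≠ 0 :=
  sub_ne_zero.2 fun e => h (y_injective K e)

theorem β_mul_β {a b d : Fin n} (hab : a ≠ b) (hbd : b ≠ d) (had : a ≠ d) :
    β K D c a b * β K D c b d = β K D c a d * (β K D c a b + β K D c b d) := by
  have h1 := y_sub_ne (K := K) hab
  have h2 := y_sub_ne (K := K) hbd
  have h3 := y_sub_ne (K := K) had
  simp only [β]
  by_cases e1 : c a = c b
  · by_cases e2 : c b = c d
    · by_cases e3 : D.a (c d) (c d) = 2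
      · simp only [e1, e2, e3, and_self, if_true]
        field_simp
        ring
      · simp [e1, e2, e3]
    · simp [e1, e2]
  · by_cases e2 : c b = c d
    · have : c a ≠ c d := fun h => e1 (h.trans e2.symm)
      simp [e1, this]
    · simp [e1, e2]

theorem cross_quad {u v : List (Fin n)} {k : ℕ} (hk : u.length = k) {a b : Fin n} (h : a ≠ b) :
    crossOp K D c k (crossOp K D c k (vec K (u ++ a :: b :: v))) =
      qq K D c a b • vec K (u ++ a :: b :: v) := by
  simp only [crossOp_at hk, map_add, map_smul, smul_add, smul_smul]
  have e : β K D c a b * α K D c a b = - (α K D c a b * β K D c b a) := by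
    rw [β_antisymm a b]; ring
  have e2 : qq K D c a b = α K D c a b * α K D c b a + β K D c a b * β K D c a b := by
    rw [α_mul_α h]; ring
  rw [e, e2, add_smul, neg_smul]
  abel

theorem braid_aux {R W : Type*} [Field R] [AddCommGroup W] [Module R W] (t₁ t₂ : Module.End R W)
    {abd bad adb bda dab dba : W} {αab αba αad αbd αdb βab βba βad βbd βdb qab qbd : R}
    (h1 : t₁ abd = αab • bad + βab • abd) (h2 : t₁ bad = αba • abd + βba • bad)
    (h3 : t₁ adb = αad • dab + βad • adb) (h4 : t₁ bda = αbd • dba + βbd • bda)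
    (k1 : t₂ abd = αbd • adb + βbd • abd) (k2 : t₂ bad = αad • bda + βad • bad)
    (k3 : t₂ adb = αdb • abd + βdb • adb) (k4 : t₂ dab = αab • dba + βab • dab)
    (e1 : qab = αab * αba + βab ^ 2) (e2 : qbd = αbd * αdb + βbd ^ 2)
    (e3 : βab * βbd = βad * (βab + βbd)) (e4 : βba = -βab) (e5 : βdb = -βbd) :
    t₁ (t₂ (t₁ abd)) = t₂ (t₁ (t₂ abd)) + (βad * (qab - qbd)) • abd := by
  subst e1 e2 e4 e5
  simp only [h1, h2, h3, h4, k1, k2, k3, k4, map_add, map_smul, smul_add, smul_smul]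
  match_scalars <;> first
    | ring1 | linear_combination αab * e3 | linear_combination -αab * e3
    | linear_combination αbd * e3 | linear_combination -αbd * e3
    | linear_combination (βab - βbd) * e3

theorem cross_braid {u v : List (Fin n)} {k : ℕ} (hk : u.length = k) {a b d : Fin n}
    (hab : a ≠ b) (hbd : b ≠ d) (had : a ≠ d) :
    crossOp K D c k (crossOp K D c (k + 1) (crossOp K D c k (vec K (u ++ a :: b :: d :: v)))) =
    crossOp K D c (k + 1) (crossOp K D c k (crossOp K D c (k + 1) (vec K (u ++ a :: b :: d :: v)))) +
      (β K D c a d * (qq K D c a b - qq K D c b d)) • vec K (u ++ a :: b :: d :: v) := by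
  have key : ∀ p q r : Fin n, crossOp K D c (k + 1) (vec K (u ++ p :: q :: r :: v)) =
      α K D c q r • vec K (u ++ p :: r :: q :: v) + β K D c q r • vec K (u ++ p :: q :: r :: v) := by
    intro p q r
    have := crossOp_at (K := K) (D := D) (c := c) (u := u ++ [p]) (k := k + 1) (by simp [hk]) q r v
    simpa using this
  refine braid_aux _ _ (crossOp_at hk a b _) (crossOp_at hk b a _) (crossOp_at hk a d _)
    (crossOp_at hk b d _) (key a b d) (key b a d) (key a d b) (key d a b) ?_ ?_
    (β_mul_β hab hbd had) (β_antisymm a b) (β_antisymm b d)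
  · rw [α_mul_α hab]; ring
  · rw [α_mul_α hbd]; ring

theorem mul_P {f g : Module.End (F K n) (V K n)} {l : List I} (h : g * P K c l = g) :
    f * g * P K c l = f * g := by rw [mul_assoc, h]

theorem act_vec (g : Gen I) {w : List (Fin n)} (h : w.map c = g.bot) :
    act K D c g (vec K w) = raw K D c g (vec K w) := by
  rw [act, end_mul, P_same h]

theorem act_mul_act {g g' : Gen I} (h : g.bot = g'.top) :
    act K D c g * act K D c g' = raw K D c g * act K D c g' := by
  rw [act, h, mul_assoc, top_mul_act]

theorem act_mul_act_apply {g g' : Gen I} (h : g.bot = g'.top) {w : List (Fin n)}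
    (hw : w.map c = g'.bot) :
    (act K D c g * act K D c g') (vec K w) = raw K D c g (raw K D c g' (vec K w)) := by
  rw [act_mul_act h, end_mul, act_vec _ hw]

theorem act_mul_act_mul_act_apply {g g' g'' : Gen I} (h : g.bot = g'.top) (h' : g'.bot = g''.top)
    {w : List (Fin n)} (hw : w.map c = g''.bot) :
    (act K D c g * act K D c g' * act K D c g'') (vec K w) =
      raw K D c g (raw K D c g' (raw K D c g'' (vec K w))) := by
  rw [act_mul_act h, mul_assoc, act_mul_act h', end_mul, end_mul,
    act_vec _ hw]

theorem act_e {l : List I} {w : List (Fin n)} (h : w.map c = l) :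
    act K D c (.e l) (vec K w) = vec K w := act_vec (.e l) h

theorem act_x_pow {l : List I} {i : I} {r : List I} {u : List (Fin n)} {a : Fin n}
    {v : List (Fin n)} {w : List (Fin n)} (h : w = u ++ a :: v) (hu : u.map c = l) (ha : c a = i)
    (hv : v.map c = r) (m : ℕ) :
    (act K D c (.x l i r) ^ m) (vec K w) = y K a ^ m • vec K w := by
  subst h hu ha hv
  induction m with
  | zero => simp
  | succ m ih => rw [pow_succ, end_mul, act_vec _ (by simp [Gen.bot]), raw,
      dotOp_at (by simp), map_smul, ih, smul_smul, pow_succ']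

theorem cross_dist {u v w : List (Fin n)} {k k' : ℕ} (hk : u.length = k) (a b : Fin n)
    (hk' : u.length + 2 + w.length = k') (a' b' : Fin n) :
    crossOp K D c k (crossOp K D c k' (vec K (u ++ a :: b :: (w ++ a' :: b' :: v)))) =
    crossOp K D c k' (crossOp K D c k (vec K (u ++ a :: b :: (w ++ a' :: b' :: v)))) := by
  have key : ∀ p q p' q', crossOp K D c k' (vec K (u ++ p :: q :: (w ++ p' :: q' :: v))) =
      α K D c p' q' • vec K (u ++ p :: q :: (w ++ q' :: p' :: v)) +
      β K D c p' q' • vec K (u ++ p :: q :: (w ++ p' :: q' :: v)) := by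
    intro p q p' q'
    have := crossOp_at (K := K) (D := D) (c := c) (u := u ++ p :: q :: w) (k := k')
      (by simp; omega) p' q' v
    simpa using this
  simp only [key, crossOp_at hk, map_add, map_smul, smul_add, smul_smul]
  rw [mul_comm (α K D c a' b'), mul_comm (α K D c a' b'), mul_comm (β K D c a' b'),
    mul_comm (β K D c a' b')]
  abel

theorem act_same_P {l : List I} {g : Gen I} (h : g.bot = l) : act K D c g * P K c l = act K D c g :=
  h ▸ act_mul_P g

theorem act_interchange (g g' : Gen I) :
    act K D c (g.ctx [] g'.top) * act K D c (g'.ctx g.bot []) =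
      act K D c (g'.ctx g.top []) * act K D c (g.ctx [] g'.bot) := by
  refine end_ext_on (c := c) (g.bot ++ g'.bot) (mul_P (act_same_P (by simp [Gen.bot_ctx])))
    (mul_P (act_same_P (by simp [Gen.bot_ctx]))) fun w _ hl => ?_
  rw [act_mul_act_apply (by simp [Gen.bot_ctx, Gen.top_ctx]) (by simpa [Gen.bot_ctx] using hl),
    act_mul_act_apply (by simp [Gen.bot_ctx, Gen.top_ctx]) (by simpa [Gen.bot_ctx] using hl)]
  cases g with
  | e l => cases g' <;> simp [raw, Gen.ctx, Gen.bot, Gen.top]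
  | x l i r =>
    cases g' with
    | e l' => simp [raw, Gen.ctx, Gen.bot, Gen.top]
    | x l' i' r' =>
      simp only [raw, Gen.ctx, Gen.bot, Gen.top, dotOp_vec, map_smul, nil_append,
        append_nil]
      rw [smul_comm]
    | τ l' i' j' r' =>
      simp only [Gen.bot, append_assoc, cons_append] at hl
      obtain ⟨u, a, w', rfl, rfl, rfl, hw⟩ := split_one hl
      obtain ⟨v, w'', rfl, rfl, hw₂⟩ := map_eq_append_iff.1 hw
      obtain ⟨u', a', b', v', rfl, rfl, rfl, rfl, rfl⟩ := split_two hw₂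
      simp only [raw, Gen.ctx, Gen.bot, Gen.top, nil_append]
      have e : ∀ p q, u ++ a :: (v ++ (u' ++ p :: q :: v')) = (u ++ a :: (v ++ u')) ++ p :: q :: v' := by
        simp
      have h1 : ∀ p q, dotOp K (u.map c).length (vec K ((u ++ a :: (v ++ u')) ++ p :: q :: v')) =
          y K a • vec K ((u ++ a :: (v ++ u')) ++ p :: q :: v') := fun p q => by
        simpa using dotOp_at (u := u) (k := (u.map c).length) (by simp) a (v ++ u' ++ p :: q :: v')
      rw [e, h1, map_smul, crossOp_at (by simp), map_add, map_smul, map_smul, h1, h1, smul_add,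
        smul_comm (y K a) (α K D c _ _), smul_comm (y K a) (β K D c _ _)]
  | τ l i j r =>
    cases g' with
    | e l' => simp [raw, Gen.ctx, Gen.bot, Gen.top]
    | x l' i' r' =>
      simp only [Gen.bot, append_assoc, cons_append] at hl
      obtain ⟨u, a, b, w', rfl, rfl, rfl, rfl, hw⟩ := split_two hl
      obtain ⟨v, w'', rfl, rfl, hw₂⟩ := map_eq_append_iff.1 hw
      obtain ⟨u', a', v', rfl, rfl, rfl, rfl⟩ := split_one hw₂
      simp only [raw, Gen.ctx, Gen.bot, Gen.top, nil_append]
      have h1 : ∀ x z, dotOp K ((u.map c ++ x :: z :: v.map c) ++ u'.map c).length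
          (vec K (u ++ a :: b :: (v ++ (u' ++ a' :: v')))) =
          y K a' • vec K (u ++ a :: b :: (v ++ (u' ++ a' :: v'))) := fun x z => by
        simpa using dotOp_at (u := u ++ a :: b :: (v ++ u'))
          (k := ((u.map c ++ x :: z :: v.map c) ++ u'.map c).length) (by simp) a' v'
      have h2 : ∀ x z, dotOp K ((u.map c ++ x :: z :: v.map c) ++ u'.map c).length
          (vec K (u ++ b :: a :: (v ++ (u' ++ a' :: v')))) =
          y K a' • vec K (u ++ b :: a :: (v ++ (u' ++ a' :: v'))) := fun x z => by
        simpa using dotOp_at (u := u ++ b :: a :: (v ++ u'))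
          (k := ((u.map c ++ x :: z :: v.map c) ++ u'.map c).length) (by simp) a' v'
      rw [h1, map_smul, crossOp_at (by simp), map_add, map_smul, map_smul, h1, h2, smul_add,
        smul_comm (y K a') (α K D c _ _), smul_comm (y K a') (β K D c _ _)]
    | τ l' i' j' r' =>
      simp only [Gen.bot, append_assoc, cons_append] at hl
      obtain ⟨u, a, b, w', rfl, rfl, rfl, rfl, hw⟩ := split_two hl
      obtain ⟨v, w'', rfl, rfl, hw₂⟩ := map_eq_append_iff.1 hw
      obtain ⟨u', a', b', v', rfl, rfl, rfl, rfl, rfl⟩ := split_two hw₂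
      simp only [raw, Gen.ctx, Gen.bot, Gen.top, nil_append]
      have := cross_dist (K := K) (D := D) (c := c) (u := u) (w := v ++ u') (v := v')
        (k := (u.map c).length) (by simp) a b
        (k' := ((u.map c ++ c a :: c b :: v.map c) ++ u'.map c).length) (by simp; omega) a' b'
      simpa using this

theorem act_quad (l : List I) (i j : I) (r : List I) {u v : List (Fin n)} {a b : Fin n}
    (hu : u.map c = l) (ha : c a = i) (hb : c b = j) (hv : v.map c = r) (hab : a ≠ b) :
    (act K D c (.τ l j i r) * act K D c (.τ l i j r)) (vec K (u ++ a :: b :: v)) =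
      qq K D c a b • vec K (u ++ a :: b :: v) := by
  subst hu ha hb hv
  rw [act_mul_act_apply rfl (by simp [Gen.bot]), raw, raw, cross_quad (by simp) hab]

theorem act_slide {u v : List (Fin n)} {a b : Fin n} {l r : List I} {i j : I}
    (hu : u.map c = l) (ha : c a = i) (hb : c b = j) (hv : v.map c = r) :
    ((act K D c (.x l j (i :: r)) * act K D c (.τ l i j r)) (vec K (u ++ a :: b :: v)) =
      (act K D c (.τ l i j r) * act K D c (.x (l ++ [i]) j r)) (vec K (u ++ a :: b :: v)) +
      (β K D c a b * (y K a - y K b)) • vec K (u ++ a :: b :: v)) ∧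
    (act K D c (.τ l i j r) * act K D c (.x l i (j :: r))) (vec K (u ++ a :: b :: v)) =
      (act K D c (.x (l ++ [j]) i r) * act K D c (.τ l i j r)) (vec K (u ++ a :: b :: v)) +
      (β K D c a b * (y K a - y K b)) • vec K (u ++ a :: b :: v) := by
  subst hu ha hb hv
  have key : ∀ (x : I) p q, dotOp K (u.map c ++ [x]).length (vec K (u ++ p :: q :: v)) =
      y K q • vec K (u ++ p :: q :: v) := fun x p q => by
    simpa using dotOp_at (u := u ++ [p]) (k := (u.map c ++ [x]).length) (by simp) q v
  constructor
  · rw [act_mul_act_apply (by simp [Gen.bot, Gen.top]) (by simp [Gen.bot]),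
      act_mul_act_apply (by simp [Gen.bot, Gen.top]) (by simp [Gen.bot])]
    simp only [raw, key, map_smul, crossOp_at (length_map c).symm, map_add,
      dotOp_at (length_map c).symm, smul_add, smul_smul, mul_sub, sub_smul]
    rw [mul_comm (y K b), mul_comm (y K b)]
    abel
  · rw [act_mul_act_apply (by simp [Gen.bot, Gen.top]) (by simp [Gen.bot]),
      act_mul_act_apply (by simp [Gen.bot, Gen.top]) (by simp [Gen.bot])]
    simp only [raw, key, map_smul, crossOp_at (length_map c).symm, map_add,
      dotOp_at (length_map c).symm, smul_add, smul_smul, mul_sub, sub_smul]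
    rw [mul_comm (y K a), mul_comm (y K a)]
    abel

theorem act_braid {u v : List (Fin n)} {a b d : Fin n} {l r : List I} {i j k : I}
    (hu : u.map c = l) (ha : c a = i) (hb : c b = j) (hd : c d = k) (hv : v.map c = r)
    (hab : a ≠ b) (hbd : b ≠ d) (had : a ≠ d) :
    (act K D c (.τ l j k (i :: r)) * act K D c (.τ (l ++ [j]) i k r) *
        act K D c (.τ l i j (k :: r))) (vec K (u ++ a :: b :: d :: v)) =
      (act K D c (.τ (l ++ [k]) i j r) * act K D c (.τ l i k (j :: r)) *
        act K D c (.τ (l ++ [i]) j k r)) (vec K (u ++ a :: b :: d :: v)) +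
      (β K D c a d * (qq K D c a b - qq K D c b d)) • vec K (u ++ a :: b :: d :: v) := by
  subst hu ha hb hd hv
  rw [act_mul_act_mul_act_apply (by simp [Gen.bot, Gen.top]) (by simp [Gen.bot, Gen.top])
      (by simp [Gen.bot]),
    act_mul_act_mul_act_apply (by simp [Gen.bot, Gen.top]) (by simp [Gen.bot, Gen.top])
      (by simp [Gen.bot])]
  have := cross_braid (K := K) (D := D) (c := c) (u := u) (v := v) (k := (u.map c).length)
    (by simp) hab hbd had
  simpa [raw] using this

end Poly
end QHA

namespace QHA

theorem wt_perm {I : Type*} {l l' : List I} (h : l.Perm l') : wt l = wt l' :=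
  (h.map _).sum_eq

namespace Poly
variable {K : Type u} [Field K] {I : Type v} [Finite I] {D : BorcherdsDatum I} {n : ℕ}
  {c : Fin n → I} {ω : I →₀ ℕ}

theorem end_ext_two {l : List I} {i j : I} {r : List I} {f g : Module.End (F K n) (V K n)}
    (hf : f * P K c (l ++ i :: j :: r) = f) (hg : g * P K c (l ++ i :: j :: r) = g)
    (h : ∀ (u v : List (Fin n)) (a b : Fin n), u.map c = l → c a = i → c b = j → v.map c = r →
      a ≠ b → f (vec K (u ++ a :: b :: v)) = g (vec K (u ++ a :: b :: v))) : f = g := by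
  refine end_ext_on _ hf hg fun w hn hw => ?_
  obtain ⟨u, a, b, v, rfl, hu, ha, hb, hv⟩ := split_two hw
  refine h u v a b hu ha hb hv fun e => ?_
  subst e
  simp [List.nodup_append] at hn

theorem end_ext_three {l : List I} {i j k : I} {r : List I} {f g : Module.End (F K n) (V K n)}
    (hf : f * P K c (l ++ i :: j :: k :: r) = f) (hg : g * P K c (l ++ i :: j :: k :: r) = g)
    (h : ∀ (u v : List (Fin n)) (a b d : Fin n), u.map c = l → c a = i → c b = j → c d = k →
      v.map c = r → a ≠ b → b ≠ d → a ≠ d →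
      f (vec K (u ++ a :: b :: d :: v)) = g (vec K (u ++ a :: b :: d :: v))) : f = g := by
  refine end_ext_on _ hf hg fun w hn hw => ?_
  obtain ⟨u, a, b, v, rfl, hu, ha, hb, hv⟩ := split_two hw
  obtain ⟨d, v, rfl, hd, hv⟩ := map_eq_cons_iff.1 hv
  simp only [List.nodup_append, List.nodup_cons, List.mem_cons, not_or] at hn
  exact h u v a b d hu ha hb hd hv hn.2.1.1.1 hn.2.1.2.1.1 hn.2.1.1.2.1

theorem pow_mul_P {f : Module.End (F K n) (V K n)} {l : List I} (h : f * P K c l = P K c l * f)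
    (m : ℕ) : f ^ m * P K c l = P K c l * f ^ m := Commute.pow_left h m

theorem x_comm_P (l : List I) (i : I) (r l' : List I) :
    act K D c (.x l i r) * P K c l' = P K c l' * act K D c (.x l i r) := by
  by_cases h : l ++ i :: r = l'
  · subst h; exact (act_mul_P (.x l i r)).trans (top_mul_act (.x l i r)).symm
  · refine end_ext fun w _ => ?_
    by_cases hw : w.map c = l'
    · rw [end_mul, P_same hw, end_mul,
        act_apply_ne _ (by rw [hw]; exact Ne.symm h), map_zero]
    · rw [end_mul, P_ne hw, map_zero, end_mul]
      by_cases hw' : w.map c = l ++ i :: r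
      · rw [act_vec (.x l i r) hw', raw, dotOp_vec]
        simp [P_ne hw]
      · rw [act_apply_ne _ hw', map_zero]

theorem act_e_mul_P (l : List I) : act K D c (.e l) * P K c l = act K D c (.e l) :=
  act_same_P rfl

theorem sub_mul_P {f g : Module.End (F K n) (V K n)} {l : List I} (hf : f * P K c l = f)
    (hg : g * P K c l = g) : (f - g) * P K c l = f - g :=
  lin_ext fun x => congrArg₂ (· - ·) (lcongr_fun hf x) (lcongr_fun hg x)

theorem sum_P (hc : wt ((finRange n).map c) = ω) : ∑ l ∈ Seq ω, P K c l = 1 := by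
  classical
  refine end_ext fun w hw => ?_
  have h : w.map c ∈ Seq ω := by
    rw [mem_Seq, ← hc]; exact wt_perm (hw.map c)
  rw [lsum_apply]
  simp_rw [P_vec]
  simp [h]

theorem P_weight (hc : wt ((finRange n).map c) = ω) {l : List I} (h : wt l ≠ ω) : P K c l = 0 := by
  refine end_ext fun w hw => ?_
  rw [P_ne, lzero_apply]
  rintro rfl
  exact h (by rw [← hc]; exact wt_perm (hw.map c))

theorem act_rel (hc : wt ((finRange n).map c) = ω) ⦃p q : FreeAlgebra K (Gen I)⦄ (h : Rel K D ω p q) :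
    FreeAlgebra.lift K (act K D c) p = FreeAlgebra.lift K (act K D c) q := by
  have hP : ∀ l, act K D c (.e l) = P K c l := fun l => by simp [act, raw, Gen.bot]
  cases h with
  | weight l h => simp [fe, hP, P_weight hc h]
  | one => simp [fe, hP, sum_P hc]
  | orth l l' h =>
    simp only [fe, map_mul, FreeAlgebra.lift_ι_apply, hP, map_zero]
    refine end_ext fun w _ => ?_
    by_cases hw : w.map c = l'
    · simp [P_same hw, P_ne (fun e => h (e.symm.trans hw))]
    · simp [P_ne hw]
  | top g => simp [fe, hP, top_mul_act]
  | bot g => simp [fe, hP, act_mul_P]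
  | interchange g g' => simp [act_interchange]
  | quad_same l i r =>
    simp only [fτ, map_mul, FreeAlgebra.lift_ι_apply, map_zero]
    refine end_ext_two (mul_P (act_mul_P (.τ l i i r))) (zero_mul _) fun u v a b hu ha hb hv hab => ?_
    rw [act_quad l i i r hu ha hb hv hab, qq, if_pos (ha.trans hb.symm), zero_smul,
      lzero_apply]
  | quad_zero l i j r hij h0 =>
    simp only [fτ, fe, map_mul, FreeAlgebra.lift_ι_apply]
    refine end_ext_two (mul_P (act_mul_P (.τ l i j r))) (act_e_mul_P _) fun u v a b hu ha hb hv hab => ?_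
    rw [act_quad l i j r hu ha hb hv hab, act_e (by simp [hu, ha, hb, hv]), qq,
      if_neg (by rwa [ha, hb]), if_pos (by rwa [ha, hb]), one_smul]
  | quad l i j r hij h0 =>
    simp only [fτ, fe, fx, map_mul, map_add, map_pow, FreeAlgebra.lift_ι_apply]
    refine end_ext_two (mul_P (act_mul_P (.τ l i j r))) ?_ fun u v a b hu ha hb hv hab => ?_
    · rw [add_mul, mul_assoc, mul_assoc, pow_mul_P (x_comm_P _ _ _ _),
        pow_mul_P (x_comm_P _ _ _ _), ← mul_assoc, ← mul_assoc, act_e_mul_P]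
    · rw [act_quad l i j r hu ha hb hv hab, ladd_apply, end_mul,
        end_mul, act_x_pow rfl hu ha (by simp [hb, hv]),
        act_x_pow (u := u ++ [a]) (a := b) (v := v) (by simp) (by simp [hu, ha]) hb hv, map_smul,
        map_smul, act_e (by simp [hu, ha, hb, hv]), qq,
        if_neg (by rwa [ha, hb]), if_neg (by rwa [ha, hb]), add_smul, ha, hb]
  | slide_left l i j r h =>
    simp only [fτ, fx, map_mul, FreeAlgebra.lift_ι_apply]
    refine end_ext_two (mul_P (act_mul_P (.τ l i j r))) (mul_P (act_same_P (by simp [Gen.bot])))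
      fun u v a b hu ha hb hv hab => ?_
    have hβ : β K D c a b = 0 := by
      rw [β, if_neg]; rintro ⟨h1, h2⟩
      rcases h with h | h
      · exact h (ha ▸ hb ▸ h1)
      · rw [ha] at h2; omega
    rw [(act_slide hu ha hb hv).1, hβ, zero_mul, zero_smul, add_zero]
  | slide_right l i j r h =>
    simp only [fτ, fx, map_mul, FreeAlgebra.lift_ι_apply]
    refine end_ext_two (mul_P (act_same_P (by simp [Gen.bot]))) (mul_P (act_mul_P (.τ l i j r)))
      fun u v a b hu ha hb hv hab => ?_
    have hβ : β K D c a b = 0 := by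
      rw [β, if_neg]; rintro ⟨h1, h2⟩
      rcases h with h | h
      · exact h (ha ▸ hb ▸ h1)
      · rw [ha] at h2; omega
    rw [(act_slide hu ha hb hv).2, hβ, zero_mul, zero_smul, add_zero]
  | nil_left l i r h =>
    simp only [fτ, fx, fe, map_mul, map_sub, FreeAlgebra.lift_ι_apply]
    refine end_ext_two ?_ (act_e_mul_P _) fun u v a b hu ha hb hv hab => ?_
    · exact sub_mul_P (mul_P (act_same_P (by simp [Gen.bot]))) (mul_P (act_same_P (by simp [Gen.bot])))
    · rw [lsub_apply, (act_slide hu ha hb hv).1, add_sub_cancel_left, β,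
        if_pos ⟨ha.trans hb.symm, ha ▸ h⟩, inv_mul_cancel₀ (y_sub_ne hab), one_smul,
        act_e (by simp [hu, ha, hb, hv])]
  | nil_right l i r h =>
    simp only [fτ, fx, fe, map_mul, map_sub, FreeAlgebra.lift_ι_apply]
    refine end_ext_two ?_ (act_e_mul_P _) fun u v a b hu ha hb hv hab => ?_
    · exact sub_mul_P (mul_P (act_same_P (by simp [Gen.bot]))) (mul_P (act_same_P (by simp [Gen.bot])))
    · rw [lsub_apply, (act_slide hu ha hb hv).2, add_sub_cancel_left, β,
        if_pos ⟨ha.trans hb.symm, ha ▸ h⟩, inv_mul_cancel₀ (y_sub_ne hab), one_smul,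
        act_e (by simp [hu, ha, hb, hv])]
  | braid l i j r hi hij h0 =>
    simp only [fτ, fx, fe, map_mul, map_sub, map_sum, map_pow, FreeAlgebra.lift_ι_apply]
    refine end_ext_three (c := c) (l := l) (i := i) (j := j) (k := i) (r := r) ?_ ?_ fun u v a b d hu ha hb hd hv hab hbd had => ?_
    · exact sub_mul_P (mul_P (act_same_P (by simp [Gen.bot]))) (mul_P (act_same_P (by simp [Gen.bot])))
    · rw [sum_mul]
      refine sum_congr rfl fun m _ => ?_
      rw [mul_assoc, pow_mul_P (x_comm_P _ _ _ _), mul_assoc, ← mul_assoc (_ ^ m),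
        pow_mul_P (x_comm_P _ _ _ _), ← mul_assoc, ← mul_assoc, act_e_mul_P, mul_assoc]
    · rw [lsub_apply, act_braid hu ha hb hd hv hab hbd had, add_sub_cancel_left,
        lsum_apply]
      have : ∀ m ∈ Finset.range (-D.a i j).toNat, (act K D c (.e (l ++ i :: j :: i :: r)) *
          act K D c (.x l i (j :: i :: r)) ^ m *
            act K D c (.x (l ++ [i, j]) i r) ^ ((-D.a i j).toNat - 1 - m))
          (vec K (u ++ a :: b :: d :: v)) = (y K a ^ m * y K d ^ ((-D.a i j).toNat - 1 - m)) •
            vec K (u ++ a :: b :: d :: v) := by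
        intro m _
        rw [end_mul, end_mul,
          act_x_pow (u := u ++ [a, b]) (a := d) (v := v) (by simp) (by simp [hu, ha, hb]) hd hv,
          map_smul, act_x_pow rfl hu ha (by simp [hb, hd, hv]), smul_smul, map_smul,
          act_e (by simp [hu, ha, hb, hd, hv]), mul_comm]
      rw [sum_congr rfl this, ← Finset.sum_smul]
      congr 1
      have hab' : c a ≠ c b := by rwa [ha, hb]
      have hbd' : c b ≠ c d := by rw [hb, hd]; exact Ne.symm hij
      rw [← geom_sum₂_comm]
      rw [β, if_pos ⟨ha.trans hd.symm, ha ▸ hi⟩, qq, if_neg hab', if_neg (by rwa [ha, hb]), qq,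
        if_neg hbd', if_neg (by rwa [hb, hd, D.dot_comm]), ha, hb, hd, inv_mul_eq_iff_eq_mul₀ (y_sub_ne had),
        mul_comm, geom_sum₂_comm, geom_sum₂_mul]
      ring
  | braid_zero l i j k r h =>
    simp only [fτ, map_mul, FreeAlgebra.lift_ι_apply]
    refine end_ext_three (mul_P (act_mul_P (.τ l i j (k :: r)))) (mul_P (act_same_P (by simp [Gen.bot])))
      fun u v a b d hu ha hb hd hv hab hbd had => ?_
    rw [act_braid hu ha hb hd hv hab hbd had]
    convert add_zero _ using 2
    convert zero_smul _ _ using 2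
    by_cases h1 : i = k ∧ D.a i i = 2
    · have h2 : c a = c d := by rw [ha, hd, h1.1]
      by_cases h3 : i = j
      · rw [qq, if_pos (by rw [ha, hb, h3]), qq, if_pos (by rw [hb, hd, ← h3, h1.1]), sub_self, mul_zero]
      · have h4 : D.dot i j = 0 := by
          by_contra h4; exact h ⟨h1.1, h1.2, h3, h4⟩
        rw [qq, if_neg (by rwa [ha, hb]), if_pos (by rwa [ha, hb]), qq,
          if_neg (by rw [← h2, ha, hb]; exact Ne.symm h3),
          if_pos (by rw [← h2, ha, hb, D.dot_comm, h4]), sub_self, mul_zero]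
    · rw [β, if_neg, zero_mul]
      rintro ⟨e1, e2⟩
      exact h1 ⟨by rw [← ha, ← hd, e1], ha ▸ e2⟩

variable (K D c) in
/-- The polynomial representation over the field of rational functions. -/
def rep (hc : wt ((finRange n).map c) = ω) : Alg K D ω →ₐ[K] Module.End (F K n) (V K n) := lift K D ω (act K D c) (act_rel hc)

theorem rep_gen (hc : wt ((finRange n).map c) = ω) (g : Gen I) : rep K D c hc (gen K D ω g) = act K D c g := lift_gen _ _ g
end Poly
end QHA

namespace QHA
open scoped Nat

variable {K : Type u} [Field K] {I : Type v} [Finite I] {D : BorcherdsDatum I} {ω : I →₀ ℕ}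

variable (K D ω) in
/-- The monomial in the dots on the strands of `z`, with exponents the second components of `z`,
between the vertical strands `p` and `q`. -/
def xm (p : List I) : List (I × ℕ) → List I → Alg K D ω
  | [], q => gen K D ω (.e (p ++ q))
  | a :: z, q => gen K D ω (.x p a.1 (z.map Prod.fst ++ q)) ^ a.2 * xm (p ++ [a.1]) z q

theorem e_mul_x_pow {l : List I} {p : List I} {i : I} {r : List I} (h : l = p ++ i :: r) (m : ℕ) :
    gen K D ω (.e l) * gen K D ω (.x p i r) ^ m = gen K D ω (.x p i r) ^ m * gen K D ω (.e l) := by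
  subst h
  have h : Commute (gen K D ω (.e (p ++ i :: r))) (gen K D ω (.x p i r)) :=
    (top_mul (.x p i r)).trans (mul_bot (.x p i r)).symm
  exact h.pow_right m

theorem e_mul_xm (p : List I) (z : List (I × ℕ)) (q : List I) :
    gen K D ω (.e (p ++ z.map Prod.fst ++ q)) * xm K D ω p z q = xm K D ω p z q := by
  induction z generalizing p with
  | nil => simpa [xm] using e_idem (ν := ω) (p ++ q)
  | cons a z ih =>
    rw [xm, ← mul_assoc, e_mul_x_pow (by simp), mul_assoc]
    congr 1
    simpa using ih (p ++ [a.1])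

theorem xm_append (p : List I) (z z' : List (I × ℕ)) (q : List I) :
    xm K D ω p (z ++ z') q =
      xm K D ω p z (z'.map Prod.fst ++ q) * xm K D ω (p ++ z.map Prod.fst) z' q := by
  induction z generalizing p with
  | nil =>
    have := e_mul_xm (K := K) (D := D) (ω := ω) p z' q
    rw [append_assoc] at this
    simpa [xm] using this.symm
  | cons a z ih => simp [xm, ih, mul_assoc]

namespace Poly
variable {n : ℕ} {c : Fin n → I}

/-- The action on the vector of the identity ordering. -/
def ev (hc : wt ((finRange n).map c) = ω) : Alg K D ω →ₗ[K] V K n where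
  toFun r := rep K D c hc r (vec K (finRange n))
  map_add' r s := by rw [map_add, ladd_apply]
  map_smul' k r := by rw [map_smul]; rfl

theorem ev_apply (hc : wt ((finRange n).map c) = ω) (r : Alg K D ω) :
    ev hc r = rep K D c hc r (vec K (finRange n)) := rfl

theorem ev_mul (hc : wt ((finRange n).map c) = ω) (r s : Alg K D ω) :
    ev hc (r * s) = rep K D c hc r (ev hc s) := by
  rw [ev_apply, map_mul, end_mul, ev_apply]

theorem sorted_or_adjacent_descent (w : List (Fin n)) :
    w.Pairwise (· ≤ ·) ∨ ∃ u a b v, a < b ∧ w = u ++ b :: a :: v := by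
  rw [← List.isChain_iff_pairwise]
  induction w with
  | nil => exact .inl List.IsChain.nil
  | cons x w ih =>
    rcases ih with h | ⟨u, a, b, v, hab, rfl⟩
    · cases w with
      | nil => exact .inl (List.isChain_singleton x)
      | cons z w =>
        by_cases hx : x ≤ z
        · exact .inl (List.isChain_cons_cons.2 ⟨hx, h⟩)
        · exact .inr ⟨[], z, x, w, not_le.1 hx, rfl⟩
    · exact .inr ⟨x :: u, a, b, v, hab, rfl⟩

theorem span_range_ev (hc : wt ((finRange n).map c) = ω) :
    span (F K n) (Set.range (ev (K := K) (D := D) hc)) = ⊤ := by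
  set S := span (F K n) (Set.range (ev (K := K) (D := D) hc)) with hS
  have hact : ∀ g : Gen I, ∀ x ∈ S, act K D c g x ∈ S := by
    intro g x hx
    have : S ≤ S.comap (act K D c g) := by
      rw [hS, span_le]
      rintro _ ⟨r, rfl⟩
      refine subset_span ⟨gen K D ω g * r, ?_⟩
      rw [ev_mul, rep_gen]
    exact this hx
  have key : ∀ w : {w : List (Fin n) // w.Perm (finRange n)}, vec K w.1 ∈ S := by
    have wf : WellFounded fun a b : {w : List (Fin n) // w.Perm (finRange n)} => a.1 < b.1 := by
      have : Finite {w : List (Fin n) // w.Perm (finRange n)} :=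
        Set.Finite.to_subtype ((List.finite_length_eq (Fin n) n).subset fun w hw => by
          simpa using List.Perm.length_eq hw)
      have : IsTrans _ fun a b : {w : List (Fin n) // w.Perm (finRange n)} => a.1 < b.1 :=
        ⟨fun a b c h h' => lt_trans h h'⟩
      have : Std.Irrefl fun a b : {w : List (Fin n) // w.Perm (finRange n)} => a.1 < b.1 :=
        ⟨fun a h => lt_irrefl _ h⟩
      exact Finite.wellFounded_of_trans_of_irrefl _
    intro w
    induction w using wf.induction with
    | _ w ih =>
      obtain ⟨w, hw⟩ := w
      rcases sorted_or_adjacent_descent w with h | ⟨u, a, b, v, hab, rfl⟩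
      · have : w = finRange n :=
          hw.eq_of_pairwise (le := (· ≤ ·)) (fun a b _ _ h1 h2 => le_antisymm h1 h2) h
            ((List.pairwise_lt_finRange n).imp fun h => le_of_lt h)
        subst this
        exact subset_span ⟨1, by rw [ev_apply, map_one, Module.End.one_apply]⟩
      · have hp : (u ++ a :: b :: v).Perm (finRange n) :=
          (List.Perm.append_left u (List.Perm.swap b a v)).trans hw
        have h1 := ih ⟨u ++ a :: b :: v, hp⟩ (List.append_left_lt (List.Lex.rel hab))
        have h2 := hact (.τ (u.map c) (c a) (c b) (v.map c)) _ h1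
        rw [act_vec _ (by simp [Gen.bot]), raw, crossOp_at (by simp), α, if_pos hab, one_smul] at h2
        exact (Submodule.add_mem_iff_left _ (Submodule.smul_mem _ _ h1)).1 h2
  rw [eq_top_iff]
  intro x _
  induction x using Finsupp.induction_linear with
  | zero => exact zero_mem _
  | add x y hx hy => exact add_mem (hx trivial) (hy trivial)
  | single w k =>
    have := S.smul_mem k (key w)
    simpa [vec, w.2] using this

theorem finrank_V : Module.finrank (F K n) (V K n) = n ! := by
  classical
  have : Fintype {w : List (Fin n) // w.Perm (finRange n)} :=
    Fintype.subtype ((finRange n).permutations.toFinset) (by simp)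
  rw [Module.finrank_finsupp_self, Fintype.card_of_subtype ((finRange n).permutations.toFinset)
    (by simp), List.toFinset_card_of_nodup (List.nodup_permutations _ (List.nodup_finRange n)),
    List.length_permutations, List.length_finRange]

/-- The monomial in the variables given by a list of exponents. -/
def mono (u : List (Fin n)) (z : List (I × ℕ)) : F K n :=
  (List.zipWith (fun a (b : I × ℕ) => y K a ^ b.2) u z).prod

theorem rep_xm (hc : wt ((finRange n).map c) = ω) (p : List I) (z : List (I × ℕ)) (q : List I)
    {w u v : List (Fin n)} (hw : w.map c = p) (hu : u.map c = z.map Prod.fst) (hv : v.map c = q) :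
    rep K D c hc (xm K D ω p z q) (vec K (w ++ u ++ v)) =
      mono (K := K) u z • vec K (w ++ u ++ v) := by
  induction z generalizing p w u with
  | nil =>
    have : u = [] := by simpa using hu
    subst this
    rw [xm, rep_gen, act_e (by simp [hw, hv])]
    simp [mono]
  | cons b z ih =>
    obtain ⟨a, u, rfl, ha, hu⟩ := map_eq_cons_iff.1 hu
    have e : w ++ a :: u ++ v = (w ++ [a]) ++ u ++ v := by simp
    rw [xm, map_mul, end_mul, e, ih (p ++ [b.1]) (by simp [hw, ha]) hu, map_smul, ← e,
      map_pow, rep_gen, act_x_pow (u := w) (a := a) (v := u ++ v) (by simp) hw ha (by simp [hu, hv]),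
      smul_smul, mono, mono, List.zipWith_cons_cons, List.prod_cons, mul_comm]

theorem mono_eq (z : List (I × ℕ)) (hz : z.length = n) :
    mono (finRange n) z = algebraMap (MvPolynomial (Fin n) K) (F K n)
      (MvPolynomial.monomial (Finsupp.equivFunOnFinite.symm fun a : Fin n =>
        (z[a.1]'(by rw [hz]; exact a.2)).2) 1) := by
  have e : List.zipWith (fun a (b : I × ℕ) => y K a ^ b.2) (finRange n) z =
      List.ofFn fun a : Fin n => y K a ^ (z[a.1]'(by rw [hz]; exact a.2)).2 := by
    refine List.ext_getElem (by simp [hz]) fun i h1 h2 => ?_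
    simp
  rw [mono, e, List.prod_ofFn, MvPolynomial.monomial_eq, map_one, one_mul,
    Finsupp.prod_fintype _ _ (by simp), map_prod]
  simp [y]

theorem linearIndependent_mono (l : List I) (hl : l.length = n) :
    LinearIndependent K fun z : {z : List (I × ℕ) // z.map Prod.fst = l} =>
      mono (K := K) (finRange n) z.1 := by
  have hz : ∀ z : {z : List (I × ℕ) // z.map Prod.fst = l}, z.1.length = n := fun z => by
    rw [← length_map (f := Prod.fst), z.2, hl]
  simp_rw [mono_eq _ (hz _)]
  have h1 : LinearIndependent K fun m : Fin n →₀ ℕ => algebraMap (MvPolynomial (Fin n) K) (F K n)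
      (MvPolynomial.monomial m 1) := by
    have := (MvPolynomial.basisMonomials (Fin n) K).linearIndependent.map'
      (Algebra.linearMap (MvPolynomial (Fin n) K) (F K n) |>.restrictScalars K)
      (LinearMap.ker_eq_bot.2 (IsFractionRing.injective (MvPolynomial (Fin n) K) (F K n)))
    simpa [Function.comp_def] using this
  refine h1.comp _ fun z z' h => Subtype.ext (List.ext_getElem ((hz z).trans (hz z').symm)
    fun i h1 h2 => Prod.ext ?_ ?_)
  · have h3 : (z.1.map Prod.fst)[i]'(by simpa using h1) = (z'.1.map Prod.fst)[i]'(by simpa using h2) := by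
      simp only [z.2, z'.2]
    simpa using h3
  · have := DFunLike.congr_fun h ⟨i, (hz z).symm ▸ h1⟩
    simpa using this

end Poly

/-- A family of at most `n!` elements which spans `R 1_l` over the polynomials in the dots, acting from
the right, is independent over them. -/
theorem linearIndependent_mul_xm {l : List I} (hl : wt l = ω) {σ : Type*} [Fintype σ]
    (t : σ → Alg K D ω) (hcard : Fintype.card σ ≤ l.length !)
    (hspan : ∀ r : Alg K D ω, r * gen K D ω (.e l) ∈ span K {a | ∃ (s : σ) (z : List (I × ℕ)),
      z.map Prod.fst = l ∧ a = t s * xm K D ω [] z []}) :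
    LinearIndependent K fun p : {z : List (I × ℕ) // z.map Prod.fst = l} × σ =>
      t p.2 * xm K D ω [] p.1.1 [] := by
  have hcl : (finRange l.length).map l.get = l := List.map_get_finRange l
  have hc : wt ((finRange l.length).map l.get) = ω := by rw [hcl, hl]
  have hxm : ∀ (s : σ) (z : List (I × ℕ)), z.map Prod.fst = l →
      Poly.ev hc (t s * xm K D ω [] z []) =
        Poly.mono (K := K) (finRange l.length) z • Poly.ev hc (t s) := by
    intro s z hz
    rw [Poly.ev_mul, Poly.ev_apply]
    have := Poly.rep_xm (K := K) (D := D) hc [] z [] (w := []) (u := finRange l.length) (v := [])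
      rfl (by rw [hcl, hz]) rfl
    rw [nil_append, append_nil] at this
    rw [this, map_smul, Poly.ev_apply]
  have htop : ⊤ ≤ span (Poly.F K l.length)
      (Set.range fun s => Poly.ev (K := K) (D := D) hc (t s)) := by
    rw [← Poly.span_range_ev hc, span_le]
    rintro _ ⟨r, rfl⟩
    have h1 : Poly.ev hc r = Poly.ev hc (r * gen K D ω (.e l)) := by
      rw [Poly.ev_mul, Poly.ev_apply, Poly.ev_apply, Poly.rep_gen, Poly.act_e hcl]
    rw [SetLike.mem_coe, h1]
    have h2 := hspan r
    generalize r * gen K D ω (.e l) = r' at h2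
    induction h2 using span_induction with
    | mem a ha =>
      obtain ⟨s, z, hz, rfl⟩ := ha
      rw [hxm s z hz]
      exact Submodule.smul_mem _ _ (subset_span ⟨s, rfl⟩)
    | zero | add => simp_all [add_mem]
    | smul k a _ ha =>
      rw [map_smul, ← algebraMap_smul (Poly.F K l.length) k]
      exact Submodule.smul_mem _ _ ha
  have hrank : Fintype.card σ = Module.finrank (Poly.F K l.length) (Poly.V K l.length) := by
    refine le_antisymm (hcard.trans_eq Poly.finrank_V.symm) ?_
    rw [← finrank_top, ← top_le_iff.1 htop]
    exact finrank_range_le_card _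
  have hind := linearIndependent_of_top_le_span_of_card_eq_finrank htop hrank
  have h := linearIndependent_smul (Poly.linearIndependent_mono (K := K) l rfl) hind
  refine LinearIndependent.of_comp (Poly.ev hc) ?_
  convert h using 2 with p
  exact hxm p.2 p.1.1 p.1.2

end QHA

namespace QHA
open scoped Nat

section Shuffles
variable {I : Type*}

/-- All shuffles of two sequences. -/
def shuffles : List I → List I → List (List (I ⊕ I))
  | [], b => [b.map .inr]
  | a, [] => [a.map .inl]
  | i :: a, j :: b =>
    (shuffles a (j :: b)).map (.inl i :: ·) ++ (shuffles (i :: a) b).map (.inr j :: ·)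

theorem mem_shuffles (s : List (I ⊕ I)) : s ∈ shuffles (lefts s) (rights s) := by
  induction s with
  | nil => simp [shuffles, lefts, rights]
  | cons c s ih =>
    cases c with
    | inl i =>
      have h : lefts (.inl i :: s) = i :: lefts s := rfl
      have h' : rights (.inl i :: s) = rights s := rfl
      rw [h, h']
      cases hr : rights s with
      | nil =>
        rw [hr] at ih
        cases hl : lefts s <;> rw [hl] at ih <;> simp_all [shuffles]
      | cons j b =>
        rw [hr] at ih
        simp [shuffles, ih]
    | inr j =>
      have h : lefts (.inr j :: s) = lefts s := rfl
      have h' : rights (.inr j :: s) = j :: rights s := rfl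
      rw [h, h']
      cases hl : lefts s with
      | nil =>
        rw [hl] at ih
        cases hr : rights s <;> rw [hr] at ih <;> simp_all [shuffles]
      | cons i a =>
        rw [hl] at ih
        simp [shuffles, ih]

theorem length_shuffles (a b : List I) :
    (shuffles a b).length = (a.length + b.length).choose a.length := by
  induction a, b using shuffles.induct with
  | case1 b => simp [shuffles]
  | case2 a h => cases a <;> simp_all [shuffles]
  | case3 i a j b h1 h2 =>
    simp only [shuffles, length_append, length_map, h1, h2, List.length_cons]
    rw [show a.length + 1 + (b.length + 1) = (a.length + (b.length + 1)) + 1 by omega,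
      Nat.choose_succ_succ, show a.length + 1 + b.length = a.length + (b.length + 1) by omega]

/-- The shuffles of `a` and `b`. -/
abbrev Shuf (a b : List I) := {s : List (I ⊕ I) // lefts s = a ∧ rights s = b}

instance (a b : List I) : Finite (Shuf a b) :=
  Set.Finite.to_subtype ((List.finite_toSet (shuffles a b)).subset fun s hs => by
    obtain ⟨rfl, rfl⟩ := hs; exact mem_shuffles s)

instance (a b : List I) : Fintype (Shuf a b) := Fintype.ofFinite _

theorem card_shuf_le (a b : List I) :
    Fintype.card (Shuf a b) ≤ (a.length + b.length).choose a.length := by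
  classical
  rw [← length_shuffles]
  refine (Fintype.card_le_of_injective (β := (shuffles a b).toFinset) (fun s => ⟨s.1, ?_⟩) ?_).trans ?_
  · obtain ⟨s, rfl, rfl⟩ := s; simpa using mem_shuffles s
  · intro s t h; exact Subtype.ext (by simpa using h)
  · rw [Fintype.card_coe]; exact List.toFinset_card_le _

end Shuffles

variable {K : Type u} [Field K] {I : Type v} [Finite I] {D : BorcherdsDatum I} {μ μ' ω : I →₀ ℕ}

variable (K D ω) in
/-- A spanning family of `R(ω) 1_l` over polynomials in the dots with at most `n!` elements, each with
a prescribed top sequence. -/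
structure Pbw (l : List I) where
  σ : Type v
  fin : Fintype σ
  t : σ → Alg K D ω
  top : σ → List I
  wt_top : ∀ s, wt (top s) = ω
  e_mul : ∀ s, gen K D ω (.e (top s)) * t s = t s
  card_le : Fintype.card σ ≤ (l.length)!
  spans : ∀ r : Alg K D ω, r * gen K D ω (.e l) ∈
    span K {a | ∃ (s : σ) (z : List (I × ℕ)),
      z.map Prod.fst = l ∧ a = t s * xm K D ω [] z []}

attribute [instance] Pbw.fin

theorem Pbw.linearIndependent {l : List I} (B : Pbw K D ω l) (hl : wt l = ω) :
    LinearIndependent K fun p : {z : List (I × ℕ) // z.map Prod.fst = l} × B.σ =>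
      B.t p.2 * xm K D ω [] p.1.1 [] :=
  linearIndependent_mul_xm hl B.t B.card_le B.spans

theorem block_xm_left (h : μ + μ' = ω) (p : List I) (z : List (I × ℕ)) (q : List I) {r : List I}
    (hz : wt (p ++ z.map Prod.fst ++ q) = μ) (hr : wt r = μ') :
    (block h).toLin (xm K D μ p z q ⊗ₜ gen K D μ' (.e r)) = xm K D ω p z (q ++ r) := by
  induction z generalizing p with
  | nil => simpa [xm] using block_e h (l := p ++ q) (by simpa using hz) hr
  | cons b z ih =>
    have e : xm K D μ p (b :: z) q ⊗ₜ[K] gen K D μ' (.e r) =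
        (gen K D μ (.x p b.1 (z.map Prod.fst ++ q)) ⊗ₜ[K] gen K D μ' (.e r)) ^ b.2 *
          (xm K D μ (p ++ [b.1]) z q ⊗ₜ[K] gen K D μ' (.e r)) := by
      have he : ∀ m : ℕ, gen K D μ' (.e r) ^ m * gen K D μ' (.e r) = gen K D μ' (.e r) := fun m => by
        induction m with
        | zero => simp
        | succ m ih => rw [pow_succ, mul_assoc, e_idem, ih]
      rw [Algebra.TensorProduct.tmul_pow, tmul_mul_tmul, he, xm]
    have hp : ∀ (t : Alg K D μ ⊗[K] Alg K D μ') (m : ℕ) t', (block h).toLin (t ^ m * t') =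
        (block h).toLin t ^ m * (block h).toLin t' := fun t m t' => by
      induction m with
      | zero => simp
      | succ m ih => rw [pow_succ', mul_assoc, Gr.Hom.map_mul, ih, pow_succ', mul_assoc]
    rw [e, hp, block_left h (by simpa [Gen.bot] using hz) hr, ih _ (by simpa using hz), xm]
    simp [Gen.ctx]

theorem block_xm_right (h : μ + μ' = ω) {l : List I} (p : List I) (z : List (I × ℕ)) (q : List I)
    (hl : wt l = μ) (hz : wt (p ++ z.map Prod.fst ++ q) = μ') :
    (block h).toLin (gen K D μ (.e l) ⊗ₜ xm K D μ' p z q) = xm K D ω (l ++ p) z q := by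
  induction z generalizing p with
  | nil => simpa [xm] using block_e h (r := p ++ q) hl (by simpa using hz)
  | cons b z ih =>
    have e : gen K D μ (.e l) ⊗ₜ[K] xm K D μ' p (b :: z) q =
        (gen K D μ (.e l) ⊗ₜ[K] gen K D μ' (.x p b.1 (z.map Prod.fst ++ q))) ^ b.2 *
          (gen K D μ (.e l) ⊗ₜ[K] xm K D μ' (p ++ [b.1]) z q) := by
      have he : ∀ m : ℕ, gen K D μ (.e l) ^ m * gen K D μ (.e l) = gen K D μ (.e l) := fun m => by
        induction m with
        | zero => simp
        | succ m ih => rw [pow_succ, mul_assoc, e_idem, ih]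
      rw [Algebra.TensorProduct.tmul_pow, tmul_mul_tmul, he, xm]
    have hp : ∀ (t : Alg K D μ ⊗[K] Alg K D μ') (m : ℕ) t', (block h).toLin (t ^ m * t') =
        (block h).toLin t ^ m * (block h).toLin t' := fun t m t' => by
      induction m with
      | zero => simp
      | succ m ih => rw [pow_succ', mul_assoc, Gr.Hom.map_mul, ih, pow_succ', mul_assoc]
    rw [e, hp, block_right h hl (by simpa [Gen.bot] using hz), ih _ (by simpa using hz), xm]
    simp [Gen.ctx]

theorem block_xm (h : μ + μ' = ω) (z z' : List (I × ℕ)) (hz : wt (z.map Prod.fst) = μ)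
    (hz' : wt (z'.map Prod.fst) = μ') :
    (block h).toLin (xm K D μ [] z [] ⊗ₜ xm K D μ' [] z' []) = xm K D ω [] (z ++ z') [] := by
  have e1 : gen K D μ (.e (z.map Prod.fst)) * xm K D μ [] z [] = xm K D μ [] z [] := by
    simpa using e_mul_xm (ω := μ) [] z []
  have e2 : gen K D μ' (.e (z'.map Prod.fst)) * xm K D μ' [] z' [] = xm K D μ' [] z' [] := by
    simpa using e_mul_xm (ω := μ') [] z' []
  have e3 : xm K D μ [] z [] * gen K D μ (.e (z.map Prod.fst)) = xm K D μ [] z [] := by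
    have := xm_append (K := K) (D := D) (ω := μ) [] z [] []
    simpa [xm] using this.symm
  have : xm K D μ [] z [] ⊗ₜ[K] xm K D μ' [] z' [] =
      (xm K D μ [] z [] ⊗ₜ[K] gen K D μ' (.e (z'.map Prod.fst))) *
      (gen K D μ (.e (z.map Prod.fst)) ⊗ₜ[K] xm K D μ' [] z' []) := by
    rw [tmul_mul_tmul, e2, e3]
  rw [this, Gr.Hom.map_mul, block_xm_left h _ _ _ (by simpa using hz) hz',
    block_xm_right h _ _ _ hz (by simpa using hz'), xm_append]
  simp

theorem brd_mul_block_eq_zero (h : μ + μ' = ω) {s : List (I ⊕ I)} (hs : wt (lefts s) = μ)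
    {l l' : List I} (hl : wt l = μ) (hl' : wt l' = μ') (hne : ¬ (lefts s = l ∧ rights s = l')) :
    brd K D ω [] s [] * (block h).toLin (gen K D μ (.e l) ⊗ₜ gen K D μ' (.e l')) = 0 := by
  rw [block_e h hl hl', ← brd_bot, mul_assoc, e_orth, mul_zero]
  intro e
  refine hne (List.append_inj (by simpa using e) ?_)
  rw [← degree_wt, ← degree_wt, hs, hl]

theorem xm_smul_one_mem {l : List I} {S : Submodule K (Alg K D ω)}
    (h1 : gen K D ω (.e l) ∈ S)
    (hg : ∀ g : Gen I, g.bot = l → ∀ a ∈ S, gen K D ω g * a ∈ S)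
    (hl : ∀ a ∈ S, gen K D ω (.e l) * a = a) (r : Alg K D ω) : r * gen K D ω (.e l) ∈ S := by
  induction r using Alg.induction with
  | one => rwa [one_mul]
  | add a b ha hb => rw [add_mul]; exact add_mem ha hb
  | smul k a ha => rw [smul_mul_assoc]; exact Submodule.smul_mem _ _ ha
  | mul g a ha =>
    rw [mul_assoc]
    by_cases h : g.bot = l
    · exact hg g h _ ha
    · rw [← hl _ ha, ← mul_assoc, ← mul_bot g, mul_assoc _ _ (gen K D ω (.e l)), e_orth h, mul_zero,
        zero_mul]
      exact zero_mem _

/-- The spanning family for the empty sequence. -/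
def Pbw.nil (h : wt ([] : List I) = ω) : Pbw K D ω ([] : List I) where
  σ := PUnit
  fin := inferInstance
  t _ := gen K D ω (.e [])
  top _ := []
  wt_top _ := h
  e_mul _ := e_idem _
  card_le := by simp
  spans := by
    have hx : xm K D ω ([] : List I) [] [] = gen K D ω (.e []) := rfl
    refine xm_smul_one_mem ?_ ?_ ?_
    · exact subset_span ⟨⟨⟩, [], rfl, by rw [hx, e_idem]⟩
    · intro g hg a ha
      have : g = .e [] := by cases g <;> simp_all [Gen.bot]
      subst this
      induction ha using span_induction with
      | mem a ha =>
        obtain ⟨s, z, hz, rfl⟩ := ha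
        rw [← mul_assoc, e_idem]
        exact subset_span ⟨s, z, hz, rfl⟩
      | zero | add => simp_all [mul_add, add_mem]
      | smul k a _ ha => rw [mul_smul_comm]; exact Submodule.smul_mem _ _ ha
    · intro a ha
      induction ha using span_induction with
      | mem a ha =>
        obtain ⟨s, z, hz, rfl⟩ := ha
        rw [← mul_assoc, e_idem]
      | zero | add => simp_all [mul_add]
      | smul k a _ ha => rw [mul_smul_comm, ha]

/-- The spanning family for a sequence of length one. -/
def Pbw.single (i : I) (h : wt [i] = ω) : Pbw K D ω [i] where
  σ := PUnit
  fin := inferInstance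
  t _ := gen K D ω (.e [i])
  top _ := [i]
  wt_top _ := h
  e_mul _ := e_idem _
  card_le := by simp
  spans := by
    have hx : ∀ k, gen K D ω (.e [i]) * xm K D ω [] [(i, k)] [] =
        gen K D ω (.x [] i []) ^ k * gen K D ω (.e [i]) := fun k => by
      simp only [xm, List.map_nil, nil_append, append_nil]
      rw [← mul_assoc, e_mul_x_pow (by simp), mul_assoc, e_idem]
    refine xm_smul_one_mem ?_ ?_ ?_
    · exact subset_span ⟨⟨⟩, [(i, 0)], rfl, by rw [hx, pow_zero, one_mul]⟩
    · intro g hg a ha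
      have hg' : g = .e [i] ∨ g = .x [] i [] := by
        cases g with
        | e l => simp_all [Gen.bot]
        | x l j r =>
          simp only [Gen.bot] at hg
          rcases l with _ | ⟨_, l⟩ <;> simp_all
        | τ l j k r =>
          simp only [Gen.bot] at hg
          rcases l with _ | ⟨_, l⟩ <;> simp_all
      induction ha using span_induction with
      | mem a ha =>
        obtain ⟨s, z, hz, rfl⟩ := ha
        obtain ⟨⟨j, k⟩, z', rfl, rfl, hz'⟩ := map_eq_cons_iff.1 hz
        obtain rfl : z' = [] := by simpa using hz'
        rcases hg' with rfl | rfl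
        · rw [← mul_assoc, e_idem]
          exact subset_span ⟨s, _, hz, rfl⟩
        · rw [hx, ← mul_assoc, ← pow_succ', ← hx]
          exact subset_span ⟨s, _, rfl, rfl⟩
      | zero | add => simp_all [mul_add, add_mem]
      | smul k a _ ha => rw [mul_smul_comm]; exact Submodule.smul_mem _ _ ha
    · intro a ha
      induction ha using span_induction with
      | mem a ha =>
        obtain ⟨s, z, hz, rfl⟩ := ha
        rw [← mul_assoc, e_idem]
      | zero | add => simp_all [mul_add]
      | smul k a _ ha => rw [mul_smul_comm, ha]

theorem brd_mul_block_tmul_eq_zero (h : μ + μ' = ω) {s : List (I ⊕ I)} (hs : wt (lefts s) = μ)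
    {l l' : List I} (hl : wt l = μ) (hl' : wt l' = μ') {a : Alg K D μ} {a' : Alg K D μ'}
    (ha : gen K D μ (.e l) * a = a) (ha' : gen K D μ' (.e l') * a' = a')
    (hne : ¬ (lefts s = l ∧ rights s = l')) :
    brd K D ω [] s [] * (block h).toLin (a ⊗ₜ a') = 0 := by
  rw [← ha, ← ha', ← tmul_mul_tmul, Gr.Hom.map_mul, ← mul_assoc,
    brd_mul_block_eq_zero h hs hl hl' hne, zero_mul]

theorem block_one_mul_e (h : μ + μ' = ω) {l l' : List I} (hl : wt l = μ) (hl' : wt l' = μ') :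
    (block h).toLin 1 * gen K D ω (.e (l ++ l')) = gen K D ω (.e (l ++ l')) := by
  rw [← block_e h hl hl', ← Gr.Hom.map_mul, one_mul]

/-- The spanning family for a juxtaposition. -/
def Pbw.append (h : μ + μ' = ω) {l l' : List I} (hl : wt l = μ) (hl' : wt l' = μ')
    (B : Pbw K D μ l) (B' : Pbw K D μ' l') : Pbw K D ω (l ++ l') where
  σ := Σ p : B.σ × B'.σ, Shuf (B.top p.1) (B'.top p.2)
  fin := inferInstance
  t p := brd K D ω [] p.2.1 [] * (block h).toLin (B.t p.1.1 ⊗ₜ B'.t p.1.2)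
  top p := col p.2.1
  wt_top p := by
    obtain ⟨p, s, h1, h2⟩ := p
    have := wt_col s
    rw [h1, h2, B.wt_top, B'.wt_top, h] at this
    exact this
  e_mul p := by
    rw [← mul_assoc]
    congr 1
    simpa using brd_top [] p.2.1 []
  card_le := by
    rw [Fintype.card_sigma]
    have h1 : ∀ p : B.σ × B'.σ, Fintype.card (Shuf (B.top p.1) (B'.top p.2)) ≤
        (l.length + l'.length).choose l.length := fun p => by
      have e1 : (B.top p.1).length = l.length := by
        rw [← degree_wt, ← degree_wt, B.wt_top, hl]
      have e2 : (B'.top p.2).length = l'.length := by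
        rw [← degree_wt, ← degree_wt, B'.wt_top, hl']
      simpa [e1, e2] using card_shuf_le (B.top p.1) (B'.top p.2)
    refine (Finset.sum_le_sum fun p _ => h1 p).trans ?_
    rw [Finset.sum_const, smul_eq_mul, Finset.card_univ, Fintype.card_prod, length_append,
      ← Nat.add_choose_mul_factorial_mul_factorial]
    have := Nat.mul_le_mul B.card_le B'.card_le
    rw [← Nat.choose_symm_add, mul_comm, mul_assoc]
    exact Nat.mul_le_mul_left _ this
  spans r := by
    set S := span K {a | ∃ (p : Σ p : B.σ × B'.σ, Shuf (B.top p.1) (B'.top p.2))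
      (z : List (I × ℕ)), z.map Prod.fst = l ++ l' ∧
      a = brd K D ω [] p.2.1 [] * (block h).toLin (B.t p.1.1 ⊗ₜ B'.t p.1.2) * xm K D ω [] z []}
    have key : ∀ s : List (I ⊕ I), wt (lefts s) = μ → wt (rights s) = μ' →
        ∀ a ∈ span K {a | ∃ (s : B.σ) (z : List (I × ℕ)),
          z.map Prod.fst = l ∧ a = B.t s * xm K D μ [] z []},
        ∀ a' ∈ span K {a | ∃ (s : B'.σ) (z : List (I × ℕ)),
          z.map Prod.fst = l' ∧ a = B'.t s * xm K D μ' [] z []},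
        brd K D ω [] s [] * (block h).toLin (a ⊗ₜ a') ∈ S := by
      intro s hs hs' a ha a' ha'
      induction ha using span_induction with
      | zero | add => simp_all [mul_add, add_tmul, add_mem]
      | smul k a _ ha =>
        rw [← smul_tmul', map_smul, mul_smul_comm]; exact Submodule.smul_mem _ _ ha
      | mem a ha =>
        obtain ⟨p, z, hz, rfl⟩ := ha
        induction ha' using span_induction with
        | zero | add => simp_all [mul_add, tmul_add, add_mem]
        | smul k a _ ha =>
          rw [TensorProduct.tmul_smul, map_smul, mul_smul_comm]; exact Submodule.smul_mem _ _ ha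
        | mem a ha =>
          obtain ⟨p', z', hz', rfl⟩ := ha
          by_cases hne : lefts s = B.top p ∧ rights s = B'.top p'
          · refine subset_span ⟨⟨(p, p'), s, hne⟩, z ++ z', by simp [hz, hz'], ?_⟩
            rw [← tmul_mul_tmul, Gr.Hom.map_mul,
              block_xm h _ _ (by rw [hz, hl]) (by rw [hz', hl']), mul_assoc]
          · rw [brd_mul_block_tmul_eq_zero h hs (B.wt_top p) (B'.wt_top p')
              (by rw [← mul_assoc, B.e_mul]) (by rw [← mul_assoc, B'.e_mul]) hne]
            exact zero_mem _
    rw [← block_one_mul_e h hl hl', ← mul_assoc]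
    have h1 := mul_one_mem_shufSpan h r
    generalize r * (block h).toLin 1 = r' at h1
    induction h1 using span_induction with
    | zero | add => simp_all [add_mul, add_mem]
    | smul k a _ ha => rw [smul_mul_assoc]; exact Submodule.smul_mem _ _ ha
    | mem a ha =>
      obtain ⟨s, _, hs, hs', -, ⟨y, rfl⟩, rfl⟩ := ha
      rw [mul_assoc, ← block_e h hl hl', ← Gr.Hom.map_mul]
      induction y using induction_on with
      | zero | add => simp_all [add_mul, mul_add, add_mem]
      | tmul a a' =>
        rw [tmul_mul_tmul]
        exact key s hs hs' _ (B.spans a) _ (B'.spans a')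

theorem nonempty_pbw (l : List I) : ∀ {ω : I →₀ ℕ}, wt l = ω → Nonempty (Pbw K D ω l) := by
  induction l using List.reverseRecOn with
  | nil => exact fun h => ⟨.nil h⟩
  | append_singleton l i ih =>
    intro ω h
    obtain ⟨B⟩ := ih rfl
    exact ⟨B.append (by simpa using h) rfl rfl (.single i rfl)⟩

/-- The shuffles of sequences of weights `μ` and `μ'`. -/
abbrev WtShuf (μ μ' : I →₀ ℕ) := {s : List (I ⊕ I) // wt (lefts s) = μ ∧ wt (rights s) = μ'}

instance (μ μ' : I →₀ ℕ) : Finite (WtShuf μ μ') :=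
  Set.Finite.to_subtype ((List.finite_length_eq (I ⊕ I) (μ.degree + μ'.degree)).subset fun s hs => by
    obtain ⟨rfl, rfl⟩ := hs
    simpa [degree_wt] using (length_lefts_add s).symm)

instance (μ μ' : I →₀ ℕ) : Fintype (WtShuf μ μ') := Fintype.ofFinite _

variable (K D) in
/-- The idempotent at the bottom of a shuffle. -/
def shufIdem (s : List (I ⊕ I)) (μ μ' : I →₀ ℕ) : Alg K D μ ⊗[K] Alg K D μ' :=
  gen K D μ (.e (lefts s)) ⊗ₜ gen K D μ' (.e (rights s))

theorem brd_mul_shufIdem (h : μ + μ' = ω) (s : WtShuf μ μ') :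
    brd K D ω [] s.1 [] * (block h).toLin (shufIdem K D s.1 μ μ') = brd K D ω [] s.1 [] := by
  rw [shufIdem, block_e h s.2.1 s.2.2]
  simpa using brd_bot [] s.1 []

/-- The shuffle diagrams are independent over `R(μ) ⊗ R(μ')`, up to the idempotents at their bottoms. -/
theorem shufIdem_mul_eq_zero (h : μ + μ' = ω) (x : WtShuf μ μ' → Alg K D μ ⊗[K] Alg K D μ')
    (hx : ∑ s, brd K D ω [] s.1 [] * (block h).toLin (x s) = 0) (s : WtShuf μ μ') :
    shufIdem K D s.1 μ μ' * x s = 0 := by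
  classical
  suffices H : ∀ l ∈ Seq μ, ∀ l' ∈ Seq μ', shufIdem K D s.1 μ μ' * x s *
      (gen K D μ (.e l) ⊗ₜ gen K D μ' (.e l')) = 0 by
    rw [← mul_one (_ * x s), one_def, ← sum_e, ← sum_e,
      sum_tmul, mul_sum]
    refine sum_eq_zero fun l hl => ?_
    rw [tmul_sum, mul_sum]
    exact sum_eq_zero fun l' hl' => H l hl l' hl'
  intro l hl l' hl'
  rw [mem_Seq] at hl hl'
  obtain ⟨B⟩ := nonempty_pbw (K := K) (D := D) l hl
  obtain ⟨B'⟩ := nonempty_pbw (K := K) (D := D) l' hl'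
  let Z := {z : List (I × ℕ) // z.map Prod.fst = l}
  let Z' := {z : List (I × ℕ) // z.map Prod.fst = l'}
  let T : Z × B.σ → Alg K D μ := fun p => B.t p.2 * xm K D μ [] p.1.1 []
  let T' : Z' × B'.σ → Alg K D μ' := fun p => B'.t p.2 * xm K D μ' [] p.1.1 []
  have hT : ∀ p, gen K D μ (.e (B.top p.2)) * T p = T p := fun p => by
    rw [← mul_assoc, B.e_mul]
  have hT' : ∀ p, gen K D μ' (.e (B'.top p.2)) * T' p = T' p := fun p => by
    rw [← mul_assoc, B'.e_mul]
  have hspan : ∀ y : Alg K D μ ⊗[K] Alg K D μ', ∃ c : (Z × B.σ) × (Z' × B'.σ) →₀ K,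
      y * (gen K D μ (.e l) ⊗ₜ gen K D μ' (.e l')) =
        linearCombination K (fun q : (Z × B.σ) × (Z' × B'.σ) => T q.1 ⊗ₜ[K] T' q.2) c := by
    have h1 : ∀ a, a * gen K D μ (.e l) ∈ span K (Set.range T) := fun a =>
      span_mono (by rintro _ ⟨p, z, hz, rfl⟩; exact ⟨(⟨z, hz⟩, p), rfl⟩) (B.spans a)
    have h2 : ∀ a, a * gen K D μ' (.e l') ∈ span K (Set.range T') := fun a =>
      span_mono (by rintro _ ⟨p, z, hz, rfl⟩; exact ⟨(⟨z, hz⟩, p), rfl⟩) (B'.spans a)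
    suffices H : ∀ y : Alg K D μ ⊗[K] Alg K D μ', y * (gen K D μ (.e l) ⊗ₜ gen K D μ' (.e l')) ∈
        span K (Set.range fun q : (Z × B.σ) × (Z' × B'.σ) => T q.1 ⊗ₜ[K] T' q.2) by
      intro y
      obtain ⟨c, hc⟩ := (Finsupp.mem_span_range_iff_exists_finsupp).1 (H y)
      exact ⟨c, hc.symm⟩
    intro y
    induction y using induction_on with
    | zero | add => simp_all [add_mul, add_mem]
    | tmul a a' =>
      rw [tmul_mul_tmul]
      have := Submodule.apply_mem_map₂ (TensorProduct.mk K _ _) (h1 a) (h2 a')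
      rw [Submodule.map₂_span_span] at this
      refine span_mono ?_ this
      rintro _ ⟨_, ⟨p, rfl⟩, _, ⟨p', rfl⟩, rfl⟩
      exact ⟨(p, p'), rfl⟩
  choose c hc using fun s => hspan (x s)
  let Q := WtShuf μ μ' × ((Z × B.σ) × (Z' × B'.σ))
  let v : Q → Alg K D ω := fun q =>
    brd K D ω [] q.1.1 [] * (block h).toLin (T q.2.1 ⊗ₜ T' q.2.2)
  let m : Set Q := {q | lefts q.1.1 = B.top q.2.1.2 ∧ rights q.1.1 = B'.top q.2.2.2}
  have hv0 : ∀ q, q ∉ m → v q = 0 := fun q hq =>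
    brd_mul_block_tmul_eq_zero h q.1.2.1 (B.wt_top _) (B'.wt_top _) (hT _) (hT' _) hq
  have hind : LinearIndepOn K v m := by
    have h1 := (B.append h hl hl' B').linearIndependent (by simp [hl, hl', h])
    let f : m → {z : List (I × ℕ) // z.map Prod.fst = l ++ l'} × (B.append h hl hl' B').σ :=
      fun q => (⟨q.1.2.1.1.1 ++ q.1.2.2.1.1, by simp [q.1.2.1.1.2, q.1.2.2.1.2]⟩,
        ⟨(q.1.2.1.2, q.1.2.2.2), q.1.1.1, q.2⟩)
    have hf : Function.Injective f := by
      rintro ⟨⟨s₁, ⟨⟨z₁, hz₁⟩, p₁⟩, ⟨z₁', hz₁'⟩, p₁'⟩, hq₁⟩ ⟨⟨s₂, ⟨⟨z₂, hz₂⟩, p₂⟩, ⟨z₂', hz₂'⟩, p₂'⟩, hq₂⟩ e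
      have e1 : z₁ ++ z₁' = z₂ ++ z₂' := congrArg (fun y => y.1.1) e
      have e2 : (p₁, p₁') = (p₂, p₂') := congrArg (fun y => y.2.1) e
      have e3 : s₁.1 = s₂.1 := congrArg (fun y => y.2.2.1) e
      obtain ⟨rfl, rfl⟩ := List.append_inj e1 (by
        rw [← length_map (f := Prod.fst), hz₁, ← hz₂, length_map])
      obtain ⟨rfl, rfl⟩ := Prod.mk.inj e2
      obtain rfl := Subtype.ext e3
      rfl
    have h2 := h1.comp f hf
    have h3 : (fun q : m => v q) = (fun p : {z : List (I × ℕ) // z.map Prod.fst = l ++ l'} ×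
        (B.append h hl hl' B').σ => (B.append h hl hl' B').t p.2 * xm K D ω [] p.1.1 []) ∘ f := by
      funext q
      symm
      change brd K D ω [] q.1.1.1 [] * (block h).toLin (B.t q.1.2.1.2 ⊗ₜ B'.t q.1.2.2.2) *
        xm K D ω [] (q.1.2.1.1.1 ++ q.1.2.2.1.1) [] = brd K D ω [] q.1.1.1 [] * (block h).toLin _
      rw [← tmul_mul_tmul, Gr.Hom.map_mul,
        block_xm h _ _ (by rw [q.1.2.1.1.2, hl]) (by rw [q.1.2.2.1.2, hl']), mul_assoc]
    change LinearIndependent K fun q : m => v q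
    rwa [h3]
  let F : Q →₀ K := ∑ s, (c s).mapDomain (Prod.mk s)
  have hF : ∀ s q, F (s, q) = c s q := fun s q => by
    simp only [F, Finsupp.finsetSum_apply]
    rw [sum_eq_single s]
    · exact Finsupp.mapDomain_apply (fun _ _ h => (Prod.mk.inj h).2) _ _
    · intro t _ ht
      refine Finsupp.mapDomain_of_notMem_range _ _ ?_
      rintro ⟨_, h⟩; exact ht (Prod.mk.inj h).1
    · simp
  have hlin : linearCombination K v F = 0 := by
    have h1 : ∀ s, linearCombination K v ((c s).mapDomain (Prod.mk s)) =
        brd K D ω [] s.1 [] * (block h).toLin (x s) * gen K D ω (.e (l ++ l')) := fun s => by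
      rw [mul_assoc, ← block_e h hl hl', ← Gr.Hom.map_mul, hc, Finsupp.linearCombination_mapDomain,
        Finsupp.apply_linearCombination, Finsupp.linearCombination_apply,
        Finsupp.linearCombination_apply, Finsupp.mul_sum]
      refine Finsupp.sum_congr fun q _ => ?_
      rw [mul_smul_comm]; rfl
    rw [map_sum, sum_congr rfl fun s _ => h1 s, ← sum_mul, hx, zero_mul]
  have hfil : F.filter (· ∈ m) = 0 := by
    refine (linearIndepOn_iff.1 hind) _ ?_ ?_
    · rw [Finsupp.mem_supported]
      intro q hq
      exact ((Finsupp.mem_support_iff.1 hq |> fun h' => by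
        by_contra hq'; exact h' (Finsupp.filter_apply_neg _ _ hq')))
    · rw [← Finsupp.filter_add_filter_not F (· ∈ m), map_add] at hlin
      have h2 : linearCombination K v (F.filter fun q => ¬ q ∈ m) = 0 := by
        rw [Finsupp.linearCombination_apply]
        refine sum_eq_zero fun q hq => ?_
        have : q ∉ m := by
          by_contra hq'
          exact (Finsupp.mem_support_iff.1 hq) (Finsupp.filter_apply_neg _ _ (not_not.2 hq'))
        change _ • v q = 0
        rw [hv0 q this, smul_zero]
      rwa [h2, add_zero] at hlin
  rw [mul_assoc, hc, Finsupp.linearCombination_apply, Finsupp.mul_sum]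
  refine sum_eq_zero fun q _ => ?_
  by_cases hq : (s, q) ∈ m
  · have := DFunLike.congr_fun hfil (s, q)
    rw [Finsupp.filter_apply_pos _ _ hq, hF] at this
    change _ * (c s q • _) = 0
    rw [this, Finsupp.zero_apply, zero_smul, mul_zero]
  · change _ * (c s q • (T q.1 ⊗ₜ[K] T' q.2)) = 0
    rw [mul_smul_comm, ← hT, ← hT', shufIdem, tmul_mul_tmul]
    generalize T q.1 = a, T' q.2 = a'
    rw [← mul_assoc, ← mul_assoc]
    by_cases h1 : lefts s.1 = B.top q.1.2
    · have h2 : rights s.1 ≠ B'.top q.2.2 := fun h2 => hq ⟨h1, h2⟩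
      rw [e_orth h2, zero_mul, tmul_zero, smul_zero]
    · rw [e_orth h1, zero_mul, zero_tmul, smul_zero]
end QHA

namespace GrAux
variable {K : Type*} [Field K] {M : Type*} [AddCommGroup M] [Module K M]
  {deg : ℤ → Submodule K M} (h : DirectSum.IsInternal deg)

/-- The projection to the homogeneous part of degree `n`. -/
def proj (n : ℤ) : M →ₗ[K] M := Finsupp.lapply n ∘ₗ (exists_coaction h).choose

theorem proj_same {n : ℤ} {x : M} (hx : x ∈ deg n) : proj h n x = x := by
  simp [proj, (exists_coaction h).choose_spec n x hx]

theorem proj_ne {m n : ℤ} (hmn : m ≠ n) {x : M} (hx : x ∈ deg m) : proj h n x = 0 := by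
  simp [proj, (exists_coaction h).choose_spec m x hx, Finsupp.single_apply, hmn]

theorem proj_mem (n : ℤ) (x : M) : proj h n x ∈ deg n := by
  induction x using GrAux.induction (iSup_eq_top h) with
  | zero | add => simp_all [add_mem]
  | hom m x hx =>
    by_cases hmn : m = n
    · subst hmn; rwa [proj_same h hx]
    · rw [proj_ne h hmn hx]; exact zero_mem _

theorem exists_sum_proj (x : M) : ∃ S : Finset ℤ, ∀ T : Finset ℤ, S ⊆ T → ∑ n ∈ T, proj h n x = x := by
  classical
  induction x using GrAux.induction (iSup_eq_top h) with
  | zero => exact ⟨∅, by simp⟩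
  | add a b ha hb =>
    obtain ⟨S, hS⟩ := ha
    obtain ⟨S', hS'⟩ := hb
    refine ⟨S ∪ S', fun T hT => ?_⟩
    simp only [map_add, sum_add_distrib]
    rw [hS T (Finset.union_subset_left hT), hS' T (Finset.union_subset_right hT)]
  | hom m x hx =>
    refine ⟨{m}, fun T hT => ?_⟩
    rw [sum_eq_single m, proj_same h hx]
    · intro n _ hn; exact proj_ne h (Ne.symm hn) hx
    · intro hm; exact absurd (hT (Finset.mem_singleton_self m)) hm

theorem eq_zero_of_proj {x : M} (hx : ∀ n, proj h n x = 0) : x = 0 := by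
  obtain ⟨S, hS⟩ := exists_sum_proj h x
  rw [← hS S subset_rfl]
  exact sum_eq_zero fun n _ => hx n

theorem mem_of_proj {n : ℤ} {x : M} (hx : ∀ m, m ≠ n → proj h m x = 0) : x ∈ deg n := by
  have : x = proj h n x := by
    refine sub_eq_zero.1 (eq_zero_of_proj h fun m => ?_)
    rw [map_sub]
    by_cases hm : m = n
    · subst hm; rw [proj_same h (proj_mem h m x), sub_self]
    · rw [hx m hm, proj_ne h (Ne.symm hm) (proj_mem h n x), sub_zero]
  rw [this]; exact proj_mem h n x

/-- A linear map of degree `d` commutes with the projections. -/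
theorem proj_map {M' : Type*} [AddCommGroup M'] [Module K M'] {deg' : ℤ → Submodule K M'}
    (h' : DirectSum.IsInternal deg') (f : M →ₗ[K] M') (d : ℤ)
    (hf : ∀ n, ∀ x ∈ deg n, f x ∈ deg' (n + d)) (n : ℤ) (x : M) :
    proj h' (n + d) (f x) = f (proj h n x) := by
  induction x using GrAux.induction (iSup_eq_top h) with
  | zero | add => simp_all
  | hom m x hx =>
    by_cases hmn : m = n
    · subst hmn; rw [proj_same h hx, proj_same h' (hf m x hx)]
    · rw [proj_ne h hmn hx, proj_ne h' (by omega) (hf m x hx), map_zero]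

end GrAux

namespace Gr

section RB
variable {K : Type u} [Field K] {A B : Type*} [Ring A] [Algebra K A] [Ring B] [Algebra K B]
  {𝒜 : ℤ → Submodule K A} {ℬ : ℤ → Submodule K B} [GradedAlgebra 𝒜] [GradedAlgebra ℬ]

/-- A decomposition `B φ(1) = ⨁ b_s φ(e_s A)` as a right module, with homogeneous `b_s` and
idempotents `e_s`. -/
structure RightBasis (φ : Hom 𝒜 ℬ) where
  ι : Type w
  fin : Fintype ι
  b : ι → B
  d : ι → ℤ
  e : ι → A
  coord : ι → B →ₗ[K] A
  b_mem : ∀ s, b s ∈ ℬ (d s)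
  e_mem : ∀ s, e s ∈ 𝒜 0
  b_mul : ∀ s, b s * φ.toLin (e s) = b s
  coord_mul : ∀ s x a, coord s (x * φ.toLin a) = coord s x * a
  e_coord : ∀ s x, e s * coord s x = coord s x
  sum_coord : ∀ x, ∑ s, b s * φ.toLin (coord s x) = x * φ.toLin 1
  coord_b : ∀ s, coord s (b s) = e s
  coord_b_ne : ∀ s t, s ≠ t → coord s (b t) = 0

attribute [instance] RightBasis.fin

namespace RightBasis
variable {φ : Hom 𝒜 ℬ} (R : RightBasis φ)

theorem coord_mem (s : R.ι) (n : ℤ) {x : B} (hx : x ∈ ℬ n) : R.coord s x ∈ 𝒜 (n - R.d s) := by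
  classical
  have h𝒜 := DirectSum.Decomposition.isInternal 𝒜
  have hℬ := DirectSum.Decomposition.isInternal ℬ
  have h1 : x * φ.toLin 1 ∈ ℬ n := by
    simpa using SetLike.mul_mem_graded hx (φ.map_deg 0 1 (SetLike.one_mem_graded 𝒜))
  have h2 : ∀ t, GrAux.proj hℬ n (R.b t * φ.toLin (R.coord t x)) =
      R.b t * φ.toLin (GrAux.proj h𝒜 (n - R.d t) (R.coord t x)) := by
    intro t
    have := GrAux.proj_map h𝒜 hℬ (mulLeft K (R.b t) ∘ₗ φ.toLin) (R.d t) (fun m a ha => by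
      rw [add_comm]; exact SetLike.mul_mem_graded (R.b_mem t) (φ.map_deg m a ha)) (n - R.d t) (R.coord t x)
    simpa using this
  have h3 : x * φ.toLin 1 =
      ∑ t, R.b t * φ.toLin (GrAux.proj h𝒜 (n - R.d t) (R.coord t x)) := by
    rw [← GrAux.proj_same hℬ h1, ← R.sum_coord, map_sum]
    exact sum_congr rfl fun t _ => h2 t
  have h4 := congrArg (R.coord s) h3
  rw [R.coord_mul, mul_one, map_sum, sum_eq_single s, R.coord_mul, R.coord_b] at h4
  · rw [h4]
    simpa using SetLike.mul_mem_graded (R.e_mem s) (GrAux.proj_mem h𝒜 (n - R.d s) (R.coord s x))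
  · intro t _ ht; rw [R.coord_mul, R.coord_b_ne s t (Ne.symm ht), zero_mul]
  · simp

end RightBasis

variable {A' B' : Type*} [Ring A'] [Algebra K A'] [Ring B'] [Algebra K B']
  {𝒜' : ℤ → Submodule K A'} {ℬ' : ℤ → Submodule K B'} [GradedAlgebra 𝒜'] [GradedAlgebra ℬ']

/-- The tensor product of two right bases. -/
def RightBasis.tensor {φ : Hom 𝒜 ℬ} {ψ : Hom 𝒜' ℬ'} (R : RightBasis.{u, w} φ) (S : RightBasis.{u, w} ψ) :
    RightBasis.{u, w} (φ.tensor ψ) where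
  ι := R.ι × S.ι
  fin := inferInstance
  b p := R.b p.1 ⊗ₜ S.b p.2
  d p := R.d p.1 + S.d p.2
  e p := R.e p.1 ⊗ₜ S.e p.2
  coord p := TensorProduct.map (R.coord p.1) (S.coord p.2)
  b_mem p := tmul_mem (R.b_mem _) (S.b_mem _)
  e_mem p := by simpa using tmul_mem (R.e_mem p.1) (S.e_mem p.2)
  b_mul p := by simp [Hom.tensor, R.b_mul, S.b_mul]
  coord_mul p x a := by
    induction x using induction_on with
    | zero | add => simp_all [add_mul]
    | tmul x y =>
      induction a using induction_on with
      | zero | add => simp_all [mul_add]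
      | tmul a b => simp [Hom.tensor, R.coord_mul, S.coord_mul]
  e_coord p x := by
    induction x using induction_on with
    | zero | add => simp_all [mul_add]
    | tmul x y => simp [R.e_coord, S.e_coord]
  sum_coord x := by
    induction x using induction_on with
    | zero | add => simp_all [add_mul, mul_add, sum_add_distrib]
    | tmul x y =>
      simp only [Hom.tensor, map_tmul, tmul_mul_tmul,
        one_def, ← R.sum_coord x, ← S.sum_coord y]
      rw [Fintype.sum_prod_type, sum_tmul]
      exact sum_congr rfl fun s _ => by rw [tmul_sum]
  coord_b p := by simp [R.coord_b, S.coord_b]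
  coord_b_ne p q h := by
    by_cases h1 : p.1 = q.1
    · have h2 : p.2 ≠ q.2 := fun h2 => h (Prod.ext h1 h2)
      simp [S.coord_b_ne _ _ h2]
    · simp [R.coord_b_ne _ _ h1]
end RB

section IndCoord
variable {K : Type u} [Field K] {A : Type v} {B : Type w} [Ring A] [Algebra K A] [Ring B] [Algebra K B]
  {𝒜 : ℤ → Submodule K A} {ℬ : ℤ → Submodule K B} [GradedAlgebra 𝒜] [GradedAlgebra ℬ]
  (φ : Hom 𝒜 ℬ)

/-- The canonical map `n ↦ 1 ⊗ n` from `N` to the induced module. -/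
def indUnit (N : GrMod.{u, v, w} 𝒜) : N →ₗ[K] ind φ N :=
  ((indRel φ N).mkQ.restrictScalars K) ∘ₗ TensorProduct.mk K B N 1

variable {φ} {N : GrMod.{u, v, w} 𝒜}

theorem mk_tmul (b : B) (n : N) :
    (indRel φ N).mkQ (b ⊗ₜ n) = (b • indUnit φ N n : ind φ N) := by
  change _ = b • (indRel φ N).mkQ (1 ⊗ₜ n)
  rw [← map_smul, smul_tmul', smul_eq_mul, mul_one]

theorem smul_indUnit (a : A) (n : N) : indUnit φ N (a • n) = φ.toLin a • indUnit φ N n := by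
  rw [← mk_tmul]
  refine ((Submodule.Quotient.eq (indRel φ N)).2 ?_).symm
  exact subset_span ⟨1, a, n, by rw [one_mul]; rfl⟩

theorem one_smul_indUnit (n : N) : φ.toLin 1 • indUnit φ N n = indUnit φ N n := by
  rw [← smul_indUnit, one_smul]

theorem indUnit_mem {k : ℤ} {n : N} (hn : n ∈ N.deg k) : indUnit φ N n ∈ (ind φ N).deg k := by
  refine ⟨1 ⊗ₜ n, ?_, rfl⟩
  simpa using tmul_mem (SetLike.one_mem_graded ℬ) hn

theorem ind_induction {P : ind φ N → Prop} (zero : P 0) (smul : ∀ (b : B) (n : N), P (b • indUnit φ N n))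
    (add : ∀ x y, P x → P y → P (x + y)) (x : ind φ N) : P x := by
  obtain ⟨t, rfl⟩ := (indRel φ N).mkQ_surjective x
  induction t using induction_on with
  | zero => rw [map_zero]; exact zero
  | add a b ha hb => rw [map_add]; exact add _ _ ha hb
  | tmul b n => rw [mk_tmul]; exact smul b n

theorem ind_deg_induction {k : ℤ} {P : ind φ N → Prop} (zero : P 0)
    (smul : ∀ i j, i + j = k → ∀ b ∈ ℬ i, ∀ n ∈ N.deg j, P (b • indUnit φ N n))
    (add : ∀ x y, P x → P y → P (x + y)) (ksmul : ∀ (c : K) x, P x → P (c • x))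
    {x : ind φ N} (hx : x ∈ (ind φ N).deg k) : P x := by
  obtain ⟨t, ht, rfl⟩ := hx
  induction ht using span_induction with
  | zero => rw [map_zero]; exact zero
  | add a b _ _ ha hb => rw [map_add]; exact add _ _ ha hb
  | smul c a _ ha => rw [map_smul]; exact ksmul c _ ha
  | mem t ht =>
    obtain ⟨i, j, b, hb, n, hn, hij, rfl⟩ := ht
    have := smul i j hij b hb n hn
    rwa [← mk_tmul] at this

/-- A `K`-linear map out of an induced module. -/
theorem exists_ind_lift {X : Type*} [AddCommGroup X] [Module K X] (f : B →ₗ[K] N →ₗ[K] X)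
    (hf : ∀ b a n, f (b * φ.toLin a) n = f b (a • n)) :
    ∃ g : ind φ N →ₗ[K] X, ∀ b n, g (b • indUnit φ N n) = f b n := by
  have key : ∀ t ∈ indRel φ N, TensorProduct.lift f t = 0 := by
    intro t ht
    induction ht using Submodule.closure_induction with
    | zero | add => simp_all
    | smul_mem r t ht =>
      obtain ⟨b, a, n, rfl⟩ := ht
      rw [smul_sub, smul_tmul', smul_tmul', smul_eq_mul, smul_eq_mul,
        ← mul_assoc, map_sub, TensorProduct.lift.tmul, TensorProduct.lift.tmul, hf, sub_self]
  obtain ⟨g, hg⟩ := exists_quot_lift φ N _ key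
  exact ⟨g, fun b n => by rw [← mk_tmul]; exact hg (b ⊗ₜ n)⟩

/-- The universal property of induction. -/
theorem exists_ind_lift' {X : Type*} [AddCommGroup X] [Module K X] [Module B X] [IsScalarTower K B X]
    (f : N →ₗ[K] X) (hf : ∀ a n, f (a • n) = φ.toLin a • f n) :
    ∃ g : ind φ N →ₗ[B] X, ∀ n, g (indUnit φ N n) = f n := by
  obtain ⟨g, hg⟩ := exists_ind_lift (φ := φ) (N := N)
    ((lcomp K X f).comp (Algebra.lsmul K K X).toLinearMap) (fun b a n => by
      simp [hf, mul_smul])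
  have hg' : ∀ b n, g (b • indUnit φ N n) = b • f n := fun b n => by rw [hg]; rfl
  refine ⟨{ g with map_smul' := fun b x => ?_ }, fun n => ?_⟩
  · change g (b • x) = b • g x
    induction x using ind_induction with
    | zero | add => simp_all [smul_add]
    | smul c n => rw [smul_smul, hg', hg', smul_smul]
  · simpa using hg' 1 n

variable (R : RightBasis φ)
theorem RightBasis.exists_coordInd (N : GrMod.{u, v, w} 𝒜) (s : R.ι) :
    ∃ g : ind φ N →ₗ[K] N, ∀ b n, g (b • indUnit φ N n) = R.coord s b • n :=
  exists_ind_lift (φ := φ) (N := N) ((Algebra.lsmul K K N).toLinearMap.comp (R.coord s))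
    (fun b a n => by simp [R.coord_mul, mul_smul])

/-- The coordinates of the elements of an induced module. -/
def RightBasis.coordInd (N : GrMod.{u, v, w} 𝒜) (s : R.ι) : ind φ N →ₗ[K] N :=
  (R.exists_coordInd N s).choose

@[simp] theorem RightBasis.coordInd_smul (s : R.ι) (b : B) (n : N) :
    R.coordInd N s (b • indUnit φ N n) = R.coord s b • n := (R.exists_coordInd N s).choose_spec b n

theorem RightBasis.e_smul_coordInd (s : R.ι) (x : ind φ N) :
    R.e s • R.coordInd N s x = R.coordInd N s x := by
  induction x using ind_induction with
  | zero | add => simp_all [smul_add]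
  | smul b n => rw [R.coordInd_smul, smul_smul, R.e_coord]

theorem RightBasis.sum_coordInd (x : ind φ N) :
    ∑ s, R.b s • indUnit φ N (R.coordInd N s x) = x := by
  induction x using ind_induction with
  | zero | add => simp_all [smul_add, sum_add_distrib]
  | smul b n =>
    simp only [R.coordInd_smul, smul_indUnit, smul_smul]
    rw [← Finset.sum_smul, R.sum_coord, ← smul_smul, one_smul_indUnit]

theorem RightBasis.coordInd_same (s : R.ι) (n : N) :
    R.coordInd N s (R.b s • indUnit φ N n) = R.e s • n := by
  rw [R.coordInd_smul, R.coord_b]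

theorem RightBasis.coordInd_ne {s t : R.ι} (h : s ≠ t) (n : N) :
    R.coordInd N s (R.b t • indUnit φ N n) = 0 := by
  rw [R.coordInd_smul, R.coord_b_ne s t h, zero_smul]

theorem RightBasis.coordInd_mem (s : R.ι) {k : ℤ} {x : ind φ N} (hx : x ∈ (ind φ N).deg k) :
    R.coordInd N s x ∈ N.deg (k - R.d s) := by
  refine ind_deg_induction (P := fun x => R.coordInd N s x ∈ N.deg (k - R.d s)) ?_ ?_ ?_ ?_ hx
  · rw [map_zero]; exact zero_mem _
  · intro i j hij b hb n hn
    rw [R.coordInd_smul, show k - R.d s = (i - R.d s) + j by omega]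
    exact N.smul_mem _ _ _ (R.coord_mem s i hb) _ hn
  · intro x y hx hy; rw [map_add]; exact add_mem hx hy
  · intro c x hx; rw [map_smul]; exact Submodule.smul_mem _ c hx
end IndCoord
end Gr

namespace QHA
open Gr

variable {K : Type u} [Field K] {I : Type v} [Finite I] {D : BorcherdsDatum I} {μ μ' ν ν' ω : I →₀ ℕ}

/-- The degree of the diagram `cross`. -/
def crossDeg (D : BorcherdsDatum I) (j : I) (m : List I) : ℤ := (m.map fun i => -D.dot i j).sum

/-- The degree of a shuffle diagram. -/
def brdDeg (D : BorcherdsDatum I) : List (I ⊕ I) → ℤ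
  | [] => 0
  | .inl _ :: s => brdDeg D s
  | .inr j :: s => brdDeg D s + crossDeg D j (lefts s)

theorem cross_mem_deg (p : List I) (j : I) (m r : List I) :
    cross K D ω p j m r ∈ deg K D ω (crossDeg D j m) := by
  induction m generalizing p with
  | nil => exact gen_mem_deg (.e _)
  | cons i m ih =>
    rw [cross, crossDeg, map_cons, List.sum_cons]
    exact SetLike.mul_mem_graded (gen_mem_deg (.τ _ _ _ _)) (ih _)

theorem brd_mem_deg (p : List I) (s : List (I ⊕ I)) (q : List I) :
    brd K D ω p s q ∈ deg K D ω (brdDeg D s) := by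
  induction s generalizing p with
  | nil => exact gen_mem_deg (.e _)
  | cons c s ih =>
    cases c with
    | inl i => exact ih _
    | inr j => exact SetLike.mul_mem_graded (ih _) (cross_mem_deg _ _ _ _)

theorem shufIdem_mem (s : List (I ⊕ I)) : shufIdem K D s μ μ' ∈
    tensorDeg (deg K D μ) (deg K D μ') 0 := by
  simpa [Gen.deg, shufIdem] using tmul_mem (gen_mem_deg (ν := μ) (.e (lefts s)))
    (gen_mem_deg (ν := μ') (.e (rights s)))

theorem exists_shuf_sum (h : μ + μ' = ω) (x : Alg K D ω) :
    ∃ c : WtShuf μ μ' → Alg K D μ ⊗[K] Alg K D μ',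
      ∑ s, brd K D ω [] s.1 [] * (block h).toLin (c s) = x * (block h).toLin 1 := by
  classical
  have := mul_one_mem_shufSpan h x
  generalize x * (block h).toLin 1 = x' at this
  induction this using span_induction with
  | zero => exact ⟨0, by simp⟩
  | add a b _ _ ha hb =>
    obtain ⟨c, rfl⟩ := ha
    obtain ⟨c', rfl⟩ := hb
    exact ⟨c + c', by simp [mul_add, sum_add_distrib]⟩
  | smul k a _ ha =>
    obtain ⟨c, rfl⟩ := ha
    exact ⟨k • c, by simp [smul_sum]⟩
  | mem a ha =>
    obtain ⟨s, _, h1, h2, -, ⟨y, rfl⟩, rfl⟩ := ha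
    refine ⟨Pi.single ⟨s, h1, h2⟩ y, ?_⟩
    rw [sum_eq_single ⟨s, h1, h2⟩, Pi.single_eq_same]
    · intro t _ ht; rw [Pi.single_eq_of_ne ht, map_zero, mul_zero]
    · simp

theorem shuf_unique (h : μ + μ' = ω) {c c' : WtShuf μ μ' → Alg K D μ ⊗[K] Alg K D μ'}
    (hc : ∑ s, brd K D ω [] s.1 [] * (block h).toLin (c s) =
      ∑ s, brd K D ω [] s.1 [] * (block h).toLin (c' s)) (s : WtShuf μ μ') :
    shufIdem K D s.1 μ μ' * c s = shufIdem K D s.1 μ μ' * c' s := by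
  have := shufIdem_mul_eq_zero h (c - c') (by
    simp only [Pi.sub_apply, map_sub, mul_sub, Finset.sum_sub_distrib, hc, sub_self]) s
  rwa [Pi.sub_apply, mul_sub, sub_eq_zero] at this

/-- The coordinates with respect to the shuffle diagrams. -/
def shufCoord (h : μ + μ' = ω) (s : WtShuf μ μ') :
    Alg K D ω →ₗ[K] Alg K D μ ⊗[K] Alg K D μ' where
  toFun x := shufIdem K D s.1 μ μ' * (exists_shuf_sum h x).choose s
  map_add' x y := by
    rw [← mul_add]
    refine shuf_unique h (c' := (exists_shuf_sum h x).choose + (exists_shuf_sum h y).choose) ?_ s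
    simp only [Pi.add_apply, map_add, mul_add, sum_add_distrib,
      (exists_shuf_sum h _).choose_spec, add_mul]
  map_smul' k x := by
    rw [← mul_smul_comm]
    refine shuf_unique h (c' := k • (exists_shuf_sum h x).choose) ?_ s
    simp only [Pi.smul_apply, map_smul, mul_smul_comm, ← smul_sum,
      (exists_shuf_sum h _).choose_spec, smul_mul_assoc]

theorem shufCoord_eq (h : μ + μ' = ω) {x : Alg K D ω} {c : WtShuf μ μ' → Alg K D μ ⊗[K] Alg K D μ'}
    (hc : ∑ s, brd K D ω [] s.1 [] * (block h).toLin (c s) = x * (block h).toLin 1)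
    (s : WtShuf μ μ') : shufCoord h s x = shufIdem K D s.1 μ μ' * c s :=
  shuf_unique h ((exists_shuf_sum h x).choose_spec.trans hc.symm) s

theorem shufIdem_idem (s : List (I ⊕ I)) :
    shufIdem K D s μ μ' * shufIdem K D s μ μ' = shufIdem K D s μ μ' := by
  rw [shufIdem, tmul_mul_tmul, e_idem, e_idem]

theorem shufCoord_brd (h : μ + μ' = ω) (s t : WtShuf μ μ') [Decidable (s = t)] :
    shufCoord h s (brd K D ω [] t.1 []) =
      if s = t then shufIdem K D s.1 μ μ' else 0 := by
  classical
  rw [shufCoord_eq h (c := Pi.single t (shufIdem K D t.1 μ μ'))]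
  · split_ifs with hst
    · subst hst; rw [Pi.single_eq_same, shufIdem_idem]
    · rw [Pi.single_eq_of_ne hst, mul_zero]
  · rw [sum_eq_single t, Pi.single_eq_same, brd_mul_shufIdem]
    · rw [← brd_mul_shufIdem h t, mul_assoc, ← (block h).map_mul, mul_one]
    · intro s _ hs; rw [Pi.single_eq_of_ne hs, map_zero, mul_zero]
    · simp

variable (K D) in
/-- The shuffle diagrams form a right basis of `R(μ + μ') 1_{μ,μ'}` over `R(μ) ⊗ R(μ')`. -/
def blockBasis (h : μ + μ' = ω) : RightBasis.{u, v} (block (K := K) (D := D) h) where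
  ι := WtShuf μ μ'
  fin := inferInstance
  b s := brd K D ω [] s.1 []
  d s := brdDeg D s.1
  e s := shufIdem K D s.1 μ μ'
  coord := shufCoord h
  b_mem s := brd_mem_deg _ _ _
  e_mem s := shufIdem_mem _
  b_mul s := brd_mul_shufIdem h s
  coord_mul s x a := by
    rw [shufCoord_eq h (c := fun s => (exists_shuf_sum h x).choose s * a), ← mul_assoc]; rfl
    simp only [(block h).map_mul, ← mul_assoc, ← sum_mul, (exists_shuf_sum h x).choose_spec]
    rw [mul_assoc, mul_assoc, ← (block h).map_mul, ← (block h).map_mul, one_mul, mul_one]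
  e_coord s x := by
    change shufIdem K D s.1 μ μ' * (shufIdem K D s.1 μ μ' * (exists_shuf_sum h x).choose s) =
      shufIdem K D s.1 μ μ' * (exists_shuf_sum h x).choose s
    rw [← mul_assoc, shufIdem_idem]
  sum_coord x := by
    rw [← (exists_shuf_sum h x).choose_spec]
    refine sum_congr rfl fun s _ => ?_
    change _ * (block h).toLin (shufIdem K D s.1 μ μ' * (exists_shuf_sum h x).choose s) = _
    rw [(block h).map_mul, ← mul_assoc, brd_mul_shufIdem]
  coord_b s := by classical rw [shufCoord_brd, if_pos rfl]
  coord_b_ne s t hst := by classical rw [shufCoord_brd, if_neg hst]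

section Factor
variable {a l c d : I →₀ ℕ}

/-- The shuffle exchanging the two middle blocks of strands. -/
def sh4 (i₁ j₁ i₂ j₂ : List I) : List (I ⊕ I) :=
  i₁.map .inl ++ j₁.map .inr ++ (i₂.map .inl ++ j₂.map .inr)

@[simp] theorem lefts_sh4 (i₁ j₁ i₂ j₂ : List I) : lefts (sh4 i₁ j₁ i₂ j₂) = i₁ ++ i₂ := by
  simp [sh4]
@[simp] theorem rights_sh4 (i₁ j₁ i₂ j₂ : List I) : rights (sh4 i₁ j₁ i₂ j₂) = j₁ ++ j₂ := by
  simp [sh4]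
@[simp] theorem col_sh4 (i₁ j₁ i₂ j₂ : List I) : col (sh4 i₁ j₁ i₂ j₂) = i₁ ++ j₁ ++ (i₂ ++ j₂) := by
  simp [sh4, col]

theorem ht_map_inr (l : List I) (k : ℕ) : ht (l.map .inr) k = min k l.length := by
  simp [ht, ← List.map_take]
theorem ht_map_inl (l : List I) (k : ℕ) : ht (l.map .inl) k = 0 := by
  simp [ht, ← List.map_take]

theorem ht_sh4 (i₁ j₁ i₂ j₂ : List I) (k : ℕ) : ht (sh4 i₁ j₁ i₂ j₂) k =
    min (k - i₁.length) j₁.length + min (k - i₁.length - j₁.length - i₂.length) j₂.length := by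
  simp only [sh4, ht_append, ht_map_inr, ht_map_inl, length_append, length_map]
  omega

theorem ht_mono (s : List (I ⊕ I)) {k m : ℕ} (h : k ≤ m) : ht s k ≤ ht s m := by
  obtain ⟨r, rfl⟩ := Nat.exists_eq_add_of_le h
  rw [ht, ht, List.take_add, rights_append, length_append]
  omega

theorem ht_add_le (s : List (I ⊕ I)) (k m : ℕ) : ht s (k + m) ≤ ht s k + m := by
  rw [ht, ht, List.take_add, rights_append, length_append]
  have := length_lefts_add ((s.drop k).take m)
  have := List.length_take_le m (s.drop k)
  omega

theorem ht_lt_sh4 {i₁ j₁ i₂ j₂ : List I} {t : List (I ⊕ I)}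
    (h1 : wt (lefts t) = wt (i₁ ++ i₂)) (h2 : wt (rights t) = wt (j₁ ++ j₂))
    (ht' : ht t < ht (sh4 i₁ j₁ i₂ j₂)) : ht t (i₁.length + j₁.length) < j₁.length := by
  have e1 : (lefts t).length = i₁.length + i₂.length := by
    rw [← degree_wt, h1, degree_wt, length_append]
  have e2 : (rights t).length = j₁.length + j₂.length := by
    rw [← degree_wt, h2, degree_wt, length_append]
  have e3 := length_lefts_add t
  have e4 : ht t t.length = j₁.length + j₂.length := by simp [ht, e2]
  by_contra hcon
  have hcon := not_lt.1 hcon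
  refine absurd ht' (not_lt_of_ge fun k => ?_)
  change ht (sh4 i₁ j₁ i₂ j₂) k ≤ ht t k
  rw [ht_sh4]
  by_cases hk : k ≤ i₁.length + j₁.length
  · have h3 := ht_add_le t k (i₁.length + j₁.length - k)
    rw [show k + (i₁.length + j₁.length - k) = i₁.length + j₁.length by omega] at h3
    omega
  · have h4 := ht_mono t (show i₁.length + j₁.length ≤ k by omega)
    by_cases hk' : k ≤ t.length
    · have h3 := ht_add_le t k (t.length - k)
      rw [show k + (t.length - k) = t.length by omega] at h3
      omega
    · have h3 := ht_mono t (show t.length ≤ k by omega)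
      omega

/-- The shuffle diagram of a juxtaposition factors through `sh4`. -/
theorem brd_append (hν : a + l = ν) (hν' : c + d = ν') (hω : ν + ν' = ω) (s₁ s₂ : List (I ⊕ I))
    (h1 : wt (lefts s₁) = a) (h2 : wt (rights s₁) = l) (h3 : wt (lefts s₂) = c)
    (h4 : wt (rights s₂) = d) :
    (block hω).toLin (brd K D ν [] s₁ [] ⊗ₜ brd K D ν' [] s₂ []) *
      brd K D ω [] (sh4 (lefts s₁) (rights s₁) (lefts s₂) (rights s₂)) [] =
        brd K D ω [] (s₁ ++ s₂) [] := by
  have key : ∀ s₂, wt (lefts s₂) = c → wt (rights s₂) = d → ∀ s₁, wt (lefts s₁) = a →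
      wt (rights s₁) = l → s₂ = (lefts s₂).map .inl ++ (rights s₂).map .inr →
      (block hω).toLin (brd K D ν [] s₁ [] ⊗ₜ brd K D ν' [] s₂ []) *
      brd K D ω [] (sh4 (lefts s₁) (rights s₁) (lefts s₂) (rights s₂)) [] =
        brd K D ω [] (s₁ ++ s₂) [] := by
    intro s₂ h3 h4 s₁ h1 h2 hs₂
    have hc₂ : wt (col s₂) = ν' := by rw [wt_col, h3, h4, hν']
    have hb₂ : brd K D ν' [] s₂ [] = gen K D ν' (.e (col s₂)) := by
      rw [hs₂, brd_sorted]; simp [col]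
    rw [hb₂]
    refine shuffle_induction hν (P := fun s₁ => (block hω).toLin (brd K D ν [] s₁ [] ⊗ₜ
      gen K D ν' (.e (col s₂))) *
      brd K D ω [] (sh4 (lefts s₁) (rights s₁) (lefts s₂) (rights s₂)) [] =
        brd K D ω [] (s₁ ++ s₂) []) (fun s₁ h1 h2 ih => ?_) s₁ h1 h2
    · rcases sorted_or_descent s₁ with ⟨x, y, rfl⟩ | ⟨u, j, i, v, rfl⟩
      · have hc₁ : wt (x ++ y) = ν := by simpa [← hν] using congrArg₂ (· + ·) h1 h2
        rw [brd_sorted, nil_append, append_nil, block_e hω hc₁ hc₂, hs₂]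
        have := brd_top (K := K) (D := D) (ω := ω) [] (x.map .inl ++ y.map .inr ++ s₂) []
        rw [hs₂] at this
        simpa [sh4, col] using this
      · have ih' := ih (u ++ .inl i :: .inr j :: v) (by simpa using h1) (by simpa using h2)
          (ht_lt_swap u v i j)
        have hc₁ : wt (col u ++ i :: j :: col v) = ν := by
          rw [← hν, ← h1, ← h2]; simp [wt_col]; abel
        have e1 : brd K D ν [] (u ++ .inr j :: .inl i :: v) [] ⊗ₜ[K] gen K D ν' (.e (col s₂)) =
            (gen K D ν (.τ (col u) i j (col v)) ⊗ₜ gen K D ν' (.e (col s₂))) *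
            (brd K D ν [] (u ++ .inl i :: .inr j :: v) [] ⊗ₜ[K] gen K D ν' (.e (col s₂))) := by
          rw [brd_descent, tmul_mul_tmul, e_idem]; simp
        have e2 := brd_descent (K := K) (D := D) (ω := ω) [] u i j (v ++ s₂) []
        rw [e1, (block hω).map_mul, block_left hω (by simpa [Gen.bot] using hc₁) hc₂, mul_assoc]
        simp only [lefts_append, lefts_inl, lefts_inr, rights_append, rights_inl, rights_inr,
          append_assoc, cons_append] at ih' ⊢
        rw [ih', e2]
        simp [Gen.ctx]
  refine shuffle_induction hν' (P := fun s₂ => (block hω).toLin (brd K D ν [] s₁ [] ⊗ₜ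
    brd K D ν' [] s₂ []) * brd K D ω [] (sh4 (lefts s₁) (rights s₁) (lefts s₂) (rights s₂)) [] =
        brd K D ω [] (s₁ ++ s₂) []) (fun s₂ h3 h4 ih => ?_) s₂ h3 h4
  · rcases sorted_or_descent s₂ with ⟨x, y, rfl⟩ | ⟨u, j, i, v, rfl⟩
    · exact key _ h3 h4 s₁ h1 h2 (by simp)
    · have ih' := ih (u ++ .inl i :: .inr j :: v) (by simpa using h3) (by simpa using h4)
        (ht_lt_swap u v i j)
      have hc₁ : wt (col s₁) = ν := by rw [wt_col, h1, h2, hν]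
      have hc₂ : wt (col u ++ i :: j :: col v) = ν' := by
        rw [← hν', ← h3, ← h4]; simp [wt_col]; abel
      have ht : gen K D ν (.e (col s₁)) * brd K D ν [] s₁ [] = brd K D ν [] s₁ [] := by
        simpa using brd_top (K := K) (D := D) (ω := ν) [] s₁ []
      have e1 : brd K D ν [] s₁ [] ⊗ₜ[K] brd K D ν' [] (u ++ .inr j :: .inl i :: v) [] =
          (gen K D ν (.e (col s₁)) ⊗ₜ gen K D ν' (.τ (col u) i j (col v))) *
          (brd K D ν [] s₁ [] ⊗ₜ[K] brd K D ν' [] (u ++ .inl i :: .inr j :: v) []) := by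
        rw [brd_descent, tmul_mul_tmul, ht]; simp
      have e2 := brd_descent (K := K) (D := D) (ω := ω) [] (s₁ ++ u) i j v []
      rw [e1, (block hω).map_mul, block_right hω hc₁ (by simpa [Gen.bot] using hc₂), mul_assoc]
      simp only [lefts_append, lefts_inl, lefts_inr, rights_append, rights_inl, rights_inr,
        append_assoc, cons_append] at ih' e2 ⊢
      rw [ih', e2]
      simp [Gen.ctx]
end Factor
end QHA

namespace QHA
open Gr

variable {K : Type u} [Field K] {I : Type v} [Finite I] {D : BorcherdsDatum I} {μ μ' ν ν' ω : I →₀ ℕ}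

theorem straight_gen_left (h : μ + μ' = ω) (g : Gen I) (u v : List (I ⊕ I))
    (h1 : wt (lefts (u ++ g.bot.map .inl ++ v)) = μ) (h2 : wt (rights (u ++ g.bot.map .inl ++ v)) = μ') :
    gen K D ω (g.ctx (col u) (col v)) * brd K D ω [] (u ++ g.bot.map .inl ++ v) [] -
      brd K D ω [] (u ++ g.top.map .inl ++ v) [] *
        gen K D ω (g.ctx (lefts u) (lefts v ++ rights (u ++ v))) ∈
      shufSpan K D h fun t => ht t < ht (u ++ g.bot.map .inl ++ v) := by
  have hs := straight (K := K) (D := D) h _ h1 h2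
  cases g with
  | e l =>
    have e1 := brd_top (K := K) (D := D) (ω := ω) [] (u ++ l.map .inl ++ v) []
    have e2 := brd_bot (K := K) (D := D) (ω := ω) [] (u ++ l.map .inl ++ v) []
    simp only [col_append, col_map_inl, lefts_append, rights_append, lefts_map_inl, rights_map_inl,
      nil_append, append_nil, append_assoc] at e1 e2
    simp only [Gen.ctx, Gen.bot, Gen.top, rights_append, append_assoc, e1, e2, sub_self]
    exact zero_mem _
  | x l i r =>
    have := hs.dot (u ++ l.map .inl) (.inl i) (r.map .inl ++ v) (by simp [Gen.bot])
    simpa [Gen.ctx, Gen.bot, Gen.top, dotBot] using this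
  | τ l i j r =>
    have := hs.left (u ++ l.map .inl) i j (r.map .inl ++ v) (by simp [Gen.bot])
    simpa [Gen.ctx, Gen.bot, Gen.top] using this

theorem straight_gen_right (h : μ + μ' = ω) (g : Gen I) (u v : List (I ⊕ I))
    (h1 : wt (lefts (u ++ g.bot.map .inr ++ v)) = μ) (h2 : wt (rights (u ++ g.bot.map .inr ++ v)) = μ') :
    gen K D ω (g.ctx (col u) (col v)) * brd K D ω [] (u ++ g.bot.map .inr ++ v) [] -
      brd K D ω [] (u ++ g.top.map .inr ++ v) [] *
        gen K D ω (g.ctx (lefts (u ++ v) ++ rights u) (rights v)) ∈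
      shufSpan K D h fun t => ht t < ht (u ++ g.bot.map .inr ++ v) := by
  have hs := straight (K := K) (D := D) h _ h1 h2
  cases g with
  | e l =>
    have e1 := brd_top (K := K) (D := D) (ω := ω) [] (u ++ l.map .inr ++ v) []
    have e2 := brd_bot (K := K) (D := D) (ω := ω) [] (u ++ l.map .inr ++ v) []
    simp only [col_append, col_map_inr, lefts_append, rights_append, lefts_map_inr, rights_map_inr,
      nil_append, append_nil, append_assoc] at e1 e2
    simp only [Gen.ctx, Gen.bot, Gen.top, lefts_append, append_assoc, e1, e2, sub_self]
    exact zero_mem _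
  | x l i r =>
    have := hs.dot (u ++ l.map .inr) (.inr i) (r.map .inr ++ v) (by simp [Gen.bot])
    simpa [Gen.ctx, Gen.bot, Gen.top, dotBot] using this
  | τ l i j r =>
    have := hs.right (u ++ l.map .inr) i j (r.map .inr ++ v) (by simp [Gen.bot])
    simpa [Gen.ctx, Gen.bot, Gen.top] using this

section Degree
variable (D)
theorem pairing_add_left (a b c : I →₀ ℕ) : D.pairing (a + b) c = D.pairing a c + D.pairing b c := by
  classical
  rw [BorcherdsDatum.pairing, Finsupp.sum_add_index' (by simp)]; rfl
  intro i m n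
  rw [← Finsupp.sum_add]
  exact Finsupp.sum_congr fun j _ => by push_cast; ring

theorem pairing_add_right (a b c : I →₀ ℕ) : D.pairing a (b + c) = D.pairing a b + D.pairing a c := by
  classical
  rw [BorcherdsDatum.pairing, BorcherdsDatum.pairing, BorcherdsDatum.pairing, ← Finsupp.sum_add]
  refine Finsupp.sum_congr fun i _ => ?_
  rw [Finsupp.sum_add_index' (by simp)]
  intro j m n
  push_cast; ring

@[simp] theorem pairing_zero_left (a : I →₀ ℕ) : D.pairing 0 a = 0 := by simp [BorcherdsDatum.pairing]
@[simp] theorem pairing_zero_right (a : I →₀ ℕ) : D.pairing a 0 = 0 := by simp [BorcherdsDatum.pairing]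

theorem pairing_single (i j : I) : D.pairing (single i 1) (single j 1) = D.dot i j := by
  simp [BorcherdsDatum.pairing]

theorem crossDeg_eq (j : I) (m : List I) : crossDeg D j m = -D.pairing (single j 1) (wt m) := by
  induction m with
  | nil => simp [crossDeg]
  | cons i m ih =>
    rw [crossDeg, map_cons, List.sum_cons, ← crossDeg, ih, wt_cons, pairing_add_right,
      pairing_single, D.dot_comm]
    ring

end Degree

section Layer
variable (K D) in
/-- The span of the shuffle diagrams with a top sequence in `Seq(ν) Seq(ν')` for which fewer than `m`
of the `|ν|` leftmost strands at the top come from the right. -/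
def layer (hω' : μ + μ' = ω) (ν : I →₀ ℕ) (m : ℕ) : Submodule K (Alg K D ω) :=
  shufSpan K D hω' fun s => wt (col (s.take ν.degree)) = ν ∧ ht s ν.degree < m

theorem wt_col_take_drop (hω : ν + ν' = ω) {s : List (I ⊕ I)} (hs : wt (col s) = ω) :
    wt (col (s.take ν.degree)) = ν → wt (col (s.drop ν.degree)) = ν' := by
  intro h
  rw [← take_append_drop ν.degree s, col_append, wt_append, h, ← hω] at hs
  exact add_left_cancel hs

theorem block_one_mul_brd (hω : ν + ν' = ω) {s : List (I ⊕ I)} (hs : wt (col s) = ω)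
    (h : wt (col (s.take ν.degree)) = ν) :
    (block hω).toLin 1 * brd K D ω [] s [] = brd K D ω [] s [] := by
  have h1 := brd_top (K := K) (D := D) (ω := ω) [] s []
  simp only [nil_append, append_nil] at h1
  rw [← take_append_drop ν.degree s, col_append,
    ← block_e hω h (wt_col_take_drop hω hs h), take_append_drop] at h1
  rw [← h1, ← mul_assoc, ← (block hω).map_mul, one_mul]

theorem block_one_mul_brd_eq_zero (hω : ν + ν' = ω) {s : List (I ⊕ I)}
    (h : wt (col (s.take ν.degree)) ≠ ν) :
    (block hω).toLin 1 * brd K D ω [] s [] = 0 := by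
  rw [block_one, sum_mul]
  refine sum_eq_zero fun l hl => ?_
  rw [sum_mul]
  refine sum_eq_zero fun r hr => gen_mul_brd_eq_zero fun heq => h ?_
  have hl := mem_Seq.1 hl
  simp only [Gen.bot, nil_append, append_nil] at heq
  have := congrArg (List.take ν.degree) heq
  rw [← hl, degree_wt, List.take_left] at this
  have e : col (s.take l.length) = l := by
    conv_rhs => rw [this]
    simp [col, List.map_take]
  rw [← hl, degree_wt, e]

theorem layer_of_mem (hω : ν + ν' = ω) (hω' : μ + μ' = ω) {P : List (I ⊕ I) → Prop} {m : ℕ}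
    (hP : ∀ s, wt (lefts s) = μ → wt (rights s) = μ' → P s → ht s ν.degree < m) {z : Alg K D ω}
    (hz : z ∈ shufSpan K D hω' P) (h1 : (block hω).toLin 1 * z = z) : z ∈ layer K D hω' ν m := by
  rw [← h1]
  refine mul_shufSpan hω' (fun s hs hs' hPs => ?_) hz
  by_cases h : wt (col (s.take ν.degree)) = ν
  · rw [block_one_mul_brd hω (by rw [wt_col, hs, hs', hω']) h]
    exact brd_mem hω' hs hs' ⟨h, hP s hs hs' hPs⟩
  · rw [block_one_mul_brd_eq_zero hω h]
    exact zero_mem _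
end Layer

section Middle
variable {a l c d : I →₀ ℕ}

variable (K D) in
/-- The crossing of the two middle blocks of strands, of weights `l` and `c`. -/
def middle (ω a l c d : I →₀ ℕ) : Alg K D ω :=
  ∑ i₁ ∈ Seq a, ∑ j₁ ∈ Seq l, ∑ i₂ ∈ Seq c, ∑ j₂ ∈ Seq d, brd K D ω [] (sh4 i₁ j₁ i₂ j₂) []

variable {i₁ j₁ i₂ j₂ : List I} (h1 : wt i₁ = a) (h2 : wt j₁ = l) (h3 : wt i₂ = c) (h4 : wt j₂ = d)
include h1 h2 h3 h4

theorem sum_seq_eq {M : Type*} [AddCommMonoid M] {f : List I → List I → List I → List I → M}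
    (h : ∀ i₁' ∈ Seq a, ∀ j₁' ∈ Seq l, ∀ i₂' ∈ Seq c, ∀ j₂' ∈ Seq d,
      ¬ (i₁' = i₁ ∧ j₁' = j₁ ∧ i₂' = i₂ ∧ j₂' = j₂) → f i₁' j₁' i₂' j₂' = 0) :
    ∑ i ∈ Seq a, ∑ j ∈ Seq l, ∑ k ∈ Seq c, ∑ m ∈ Seq d, f i j k m = f i₁ j₁ i₂ j₂ := by
  have := sum_eq_single (s := ((Seq a ×ˢ Seq l) ×ˢ Seq c) ×ˢ Seq d)
    (f := fun p => f p.1.1.1 p.1.1.2 p.1.2 p.2) (((i₁, j₁), i₂), j₂) (fun p hp hne => ?_) ?_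
  · simpa only [Finset.sum_product] using this
  · simp only [mem_product] at hp
    exact h _ hp.1.1.1 _ hp.1.1.2 _ hp.1.2 _ hp.2 fun ⟨e1, e2, e3, e4⟩ => hne (by simp [← e1, ← e2, ← e3, ← e4])
  · simp [h1, h2, h3, h4]

theorem e_mul_middle : gen K D ω (.e (i₁ ++ j₁ ++ (i₂ ++ j₂))) * middle K D ω a l c d =
    brd K D ω [] (sh4 i₁ j₁ i₂ j₂) [] := by
  simp only [middle, mul_sum]
  refine (sum_seq_eq (M := Alg K D ω) h1 h2 h3 h4 fun i₁' hi₁ j₁' hj₁ i₂' hi₂ j₂' hj₂ hne =>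
    gen_mul_brd_eq_zero fun heq => hne ?_).trans ?_
  rotate_left
  · simpa using brd_top [] (sh4 i₁ j₁ i₂ j₂) []
  simp only [Gen.bot, col_sh4, nil_append, append_nil, append_assoc] at heq
  obtain ⟨e1, heq⟩ := append_inj_of_wt heq (h1.trans (mem_Seq.1 hi₁).symm)
  obtain ⟨e2, heq⟩ := append_inj_of_wt heq (h2.trans (mem_Seq.1 hj₁).symm)
  obtain ⟨e3, e4⟩ := append_inj_of_wt heq (h3.trans (mem_Seq.1 hi₂).symm)
  exact ⟨e1.symm, e2.symm, e3.symm, e4.symm⟩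

theorem middle_mul_e : middle K D ω a l c d * gen K D ω (.e (i₁ ++ i₂ ++ (j₁ ++ j₂))) =
    brd K D ω [] (sh4 i₁ j₁ i₂ j₂) [] := by
  simp only [middle, sum_mul]
  refine (sum_seq_eq (M := Alg K D ω) h1 h2 h3 h4 fun i₁' hi₁ j₁' hj₁ i₂' hi₂ j₂' hj₂ hne =>
    brd_mul_gen_eq_zero fun heq => hne ?_).trans ?_
  rotate_left
  · simpa using brd_bot [] (sh4 i₁ j₁ i₂ j₂) []
  simp only [Gen.top, lefts_sh4, rights_sh4, nil_append, append_nil, append_assoc] at heq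
  obtain ⟨e1, heq⟩ := append_inj_of_wt heq ((mem_Seq.1 hi₁).trans h1.symm)
  obtain ⟨e3, heq⟩ := append_inj_of_wt heq ((mem_Seq.1 hi₂).trans h3.symm)
  obtain ⟨e2, e4⟩ := append_inj_of_wt heq ((mem_Seq.1 hj₁).trans h2.symm)
  exact ⟨e1, e2, e3, e4⟩
end Middle

section Commute
variable {a l c d : I →₀ ℕ} (h1 : a + l = ν) (h2 : c + d = ν') (h3 : a + c = μ) (h4 : l + d = μ')
  (hω : ν + ν' = ω) (hω' : μ + μ' = ω)

variable (K D) in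
/-- The map `(R(a) ⊗ R(l)) ⊗ (R(c) ⊗ R(d)) → R(ω)`. -/
def topMap : (Alg K D a ⊗[K] Alg K D l) ⊗[K] (Alg K D c ⊗[K] Alg K D d) →ₗ[K] Alg K D ω :=
  (block hω).toLin ∘ₗ ((block h1).tensor (block h2)).toLin

variable (K D) in
/-- The map `(R(a) ⊗ R(l)) ⊗ (R(c) ⊗ R(d)) → R(ω)` exchanging the middle factors. -/
def botMap : (Alg K D a ⊗[K] Alg K D l) ⊗[K] (Alg K D c ⊗[K] Alg K D d) →ₗ[K] Alg K D ω :=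
  (block hω').toLin ∘ₗ ((block h3).tensor (block h4)).toLin ∘ₗ
    (Hom.swapMiddle (deg K D a) (deg K D l) (deg K D c) (deg K D d)).toLin

theorem topMap_mul (x y) : topMap K D h1 h2 hω (x * y) = topMap K D h1 h2 hω x * topMap K D h1 h2 hω y := by
  simp only [topMap, comp_apply, Hom.map_mul]
theorem botMap_mul (x y) : botMap K D h3 h4 hω' (x * y) = botMap K D h3 h4 hω' x * botMap K D h3 h4 hω' y := by
  simp only [botMap, comp_apply, Hom.map_mul]

theorem topMap_tmul (x : Alg K D a) (y : Alg K D l) (z : Alg K D c) (w : Alg K D d) :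
    topMap K D h1 h2 hω ((x ⊗ₜ y) ⊗ₜ (z ⊗ₜ w)) =
      (block hω).toLin ((block h1).toLin (x ⊗ₜ y) ⊗ₜ (block h2).toLin (z ⊗ₜ w)) := rfl
theorem botMap_tmul (x : Alg K D a) (y : Alg K D l) (z : Alg K D c) (w : Alg K D d) :
    botMap K D h3 h4 hω' ((x ⊗ₜ y) ⊗ₜ (z ⊗ₜ w)) =
      (block hω').toLin ((block h3).toLin (x ⊗ₜ z) ⊗ₜ (block h4).toLin (y ⊗ₜ w)) := rfl

variable (K D) in
/-- The idempotent of four sequences. -/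
def e4 (i₁ j₁ i₂ j₂ : List I) : (Alg K D a ⊗[K] Alg K D l) ⊗[K] (Alg K D c ⊗[K] Alg K D d) :=
  (gen K D a (.e i₁) ⊗ₜ gen K D l (.e j₁)) ⊗ₜ (gen K D c (.e i₂) ⊗ₜ gen K D d (.e j₂))

variable (K D a l c d) in
theorem sum_e4 : ∑ i₁ ∈ Seq a, ∑ j₁ ∈ Seq l, ∑ i₂ ∈ Seq c, ∑ j₂ ∈ Seq d, e4 K D i₁ j₁ i₂ j₂ =
    (1 : (Alg K D a ⊗[K] Alg K D l) ⊗[K] (Alg K D c ⊗[K] Alg K D d)) := by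
  simp only [e4, ← tmul_sum, sum_e, ← sum_tmul]
  rfl

theorem topMap_e4_mul {i₁ j₁ i₂ j₂ : List I} (k1 : wt i₁ = a) (k2 : wt j₁ = l) (k3 : wt i₂ = c)
    (k4 : wt j₂ = d) : topMap K D h1 h2 hω (e4 K D i₁ j₁ i₂ j₂) * middle K D ω a l c d =
      brd K D ω [] (sh4 i₁ j₁ i₂ j₂) [] := by
  rw [e4, topMap_tmul, block_e h1 k1 k2, block_e h2 k3 k4, block_e hω (by simp [k1, k2, h1])
    (by simp [k3, k4, h2]), e_mul_middle k1 k2 k3 k4]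

theorem topMap_one_mul : topMap K D h1 h2 hω 1 * middle K D ω a l c d = middle K D ω a l c d := by
  rw [← sum_e4]
  simp only [map_sum, sum_mul]
  rw [middle]
  refine sum_congr rfl fun i₁ k1 => sum_congr rfl fun j₁ k2 =>
    sum_congr rfl fun i₂ k3 => sum_congr rfl fun j₂ k4 => ?_
  rw [← middle, topMap_e4_mul h1 h2 hω (mem_Seq.1 k1) (mem_Seq.1 k2) (mem_Seq.1 k3) (mem_Seq.1 k4)]

include h1 h2 in
theorem block_one_mul_middle : (block hω).toLin 1 * middle K D ω a l c d = middle K D ω a l c d := by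
  conv_lhs => rw [← topMap_one_mul h1 h2 hω]
  rw [topMap, comp_apply, ← mul_assoc, ← (block hω).map_mul, one_mul]
  exact topMap_one_mul h1 h2 hω

variable (K D) in
/-- The elements commuting with the middle crossing up to lower terms. -/
def Commuting : Submodule K ((Alg K D a ⊗[K] Alg K D l) ⊗[K] (Alg K D c ⊗[K] Alg K D d)) :=
  (layer K D hω' ν l.degree).comap (LinearMap.mulRight K (middle K D ω a l c d) ∘ₗ topMap K D h1 h2 hω -
    mulLeft K (middle K D ω a l c d) ∘ₗ botMap K D h3 h4 hω')

variable {h1 h2 h3 h4 hω hω'}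

theorem Commuting.mul (hst : ∀ x, ∀ z ∈ layer K D hω' ν l.degree,
      (block hω).toLin x * z ∈ layer K D hω' ν l.degree) {x y}
    (hx : x ∈ Commuting K D h1 h2 h3 h4 hω hω') (hy : y ∈ Commuting K D h1 h2 h3 h4 hω hω') :
    x * y ∈ Commuting K D h1 h2 h3 h4 hω hω' := by
  have e : topMap K D h1 h2 hω (x * y) * middle K D ω a l c d -
      middle K D ω a l c d * botMap K D h3 h4 hω' (x * y) =
    topMap K D h1 h2 hω x * (topMap K D h1 h2 hω y * middle K D ω a l c d -
      middle K D ω a l c d * botMap K D h3 h4 hω' y) +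
    (topMap K D h1 h2 hω x * middle K D ω a l c d -
      middle K D ω a l c d * botMap K D h3 h4 hω' x) * botMap K D h3 h4 hω' y := by
    rw [topMap_mul, botMap_mul]; noncomm_ring
  change _ ∈ layer _ _ _ _ _
  rw [LinearMap.sub_apply]; erw [e]
  exact add_mem (hst _ _ hy) (shufSpan_mul _ hx ⟨_, rfl⟩)

theorem commutes_of_straight {x} {i₁ j₁ i₂ j₂ : List I} (k1 : wt i₁ = a) (k2 : wt j₁ = l)
    (k3 : wt i₂ = c) (k4 : wt j₂ = d)
    (hx : topMap K D h1 h2 hω x * middle K D ω a l c d -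
      middle K D ω a l c d * botMap K D h3 h4 hω' x ∈
        shufSpan K D hω' fun t => ht t < ht (sh4 i₁ j₁ i₂ j₂)) :
    x ∈ Commuting K D h1 h2 h3 h4 hω hω' := by
  refine layer_of_mem (z := topMap K D h1 h2 hω x * middle K D ω a l c d - middle K D ω a l c d * botMap K D h3 h4 hω' x) hω hω' (fun s e1 e2 hs => ?_) hx ?_
  · have := ht_lt_sh4 (by rw [e1, wt_append, k1, k3, h3]) (by rw [e2, wt_append, k2, k4, h4]) hs
    rwa [← k2, degree_wt, ← h1, map_add, ← k1, ← k2, degree_wt, degree_wt]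
  · rw [mul_sub, ← mul_assoc, ← mul_assoc, block_one_mul_middle h1 h2 hω, topMap,
      comp_apply, ← (block hω).map_mul, one_mul]

theorem gen_mul_middle {g : Gen I} {i₁ j₁ i₂ j₂ : List I} (hg : g.bot = i₁ ++ j₁ ++ (i₂ ++ j₂))
    (k1 : wt i₁ = a) (k2 : wt j₁ = l) (k3 : wt i₂ = c) (k4 : wt j₂ = d) :
    gen K D ω g * middle K D ω a l c d = gen K D ω g * brd K D ω [] (sh4 i₁ j₁ i₂ j₂) [] := by
  rw [← e_mul_middle k1 k2 k3 k4, ← mul_assoc, ← hg, mul_bot]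

theorem middle_mul_gen {g : Gen I} {i₁ j₁ i₂ j₂ : List I} (hg : g.top = i₁ ++ i₂ ++ (j₁ ++ j₂))
    (k1 : wt i₁ = a) (k2 : wt j₁ = l) (k3 : wt i₂ = c) (k4 : wt j₂ = d) :
    middle K D ω a l c d * gen K D ω g = brd K D ω [] (sh4 i₁ j₁ i₂ j₂) [] * gen K D ω g := by
  rw [← middle_mul_e k1 k2 k3 k4, mul_assoc, ← hg, top_mul]

theorem commutes_gen₁ (g : Gen I) {j₁ i₂ j₂ : List I} (k1 : wt g.bot = a) (k2 : wt j₁ = l)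
    (k3 : wt i₂ = c) (k4 : wt j₂ = d) :
    (gen K D a g ⊗ₜ gen K D l (.e j₁)) ⊗ₜ (gen K D c (.e i₂) ⊗ₜ gen K D d (.e j₂))
      ∈ Commuting K D h1 h2 h3 h4 hω hω' := by
  refine commutes_of_straight k1 k2 k3 k4 ?_
  have k1' : wt g.top = a := by rw [← Gen.wt_bot, k1]
  rw [topMap_tmul, botMap_tmul, block_left h1 k1 k2, block_e h2 k3 k4, block_left h3 k1 k3,
    block_e h4 k2 k4, block_left hω (by simp [Gen.bot_ctx, k1, k2, h1]) (by simp [k3, k4, h2]),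
    block_left hω' (by simp [Gen.bot_ctx, k1, k3, h3]) (by simp [k2, k4, h4]),
    gen_mul_middle (by simp [Gen.bot_ctx]) k1 k2 k3 k4,
    middle_mul_gen (by simp [Gen.top_ctx]) k1' k2 k3 k4]
  have := straight_gen_left (K := K) (D := D) hω' g [] (j₁.map .inr ++ (i₂.map .inl ++ j₂.map .inr))
    (by simp [k1, k3, h3]) (by simp [k2, k4, h4])
  simpa [sh4, Gen.ctx_ctx] using this

theorem commutes_gen₂ (g : Gen I) {i₁ i₂ j₂ : List I} (k1 : wt i₁ = a) (k2 : wt g.bot = l)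
    (k3 : wt i₂ = c) (k4 : wt j₂ = d) :
    (gen K D a (.e i₁) ⊗ₜ gen K D l g) ⊗ₜ (gen K D c (.e i₂) ⊗ₜ gen K D d (.e j₂))
      ∈ Commuting K D h1 h2 h3 h4 hω hω' := by
  refine commutes_of_straight k1 k2 k3 k4 ?_
  have k2' : wt g.top = l := by rw [← Gen.wt_bot, k2]
  rw [topMap_tmul, botMap_tmul, block_right h1 k1 k2, block_e h2 k3 k4, block_e h3 k1 k3,
    block_left h4 k2 k4, block_left hω (by simp [Gen.bot_ctx, k1, k2, h1]) (by simp [k3, k4, h2]),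
    block_right hω' (by simp [k1, k3, h3]) (by simp [Gen.bot_ctx, k2, k4, h4]),
    gen_mul_middle (by simp [Gen.bot_ctx]) k1 k2 k3 k4,
    middle_mul_gen (by simp [Gen.top_ctx]) k1 k2' k3 k4]
  have := straight_gen_right (K := K) (D := D) hω' g (i₁.map .inl) (i₂.map .inl ++ j₂.map .inr)
    (by simp [k1, k3, h3]) (by simp [k2, k4, h4])
  simpa [sh4, Gen.ctx_ctx] using this

theorem commutes_gen₃ (g : Gen I) {i₁ j₁ j₂ : List I} (k1 : wt i₁ = a) (k2 : wt j₁ = l)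
    (k3 : wt g.bot = c) (k4 : wt j₂ = d) :
    (gen K D a (.e i₁) ⊗ₜ gen K D l (.e j₁)) ⊗ₜ (gen K D c g ⊗ₜ gen K D d (.e j₂))
      ∈ Commuting K D h1 h2 h3 h4 hω hω' := by
  refine commutes_of_straight k1 k2 k3 k4 ?_
  have k3' : wt g.top = c := by rw [← Gen.wt_bot, k3]
  rw [topMap_tmul, botMap_tmul, block_e h1 k1 k2, block_left h2 k3 k4, block_right h3 k1 k3,
    block_e h4 k2 k4, block_right hω (by simp [k1, k2, h1]) (by simp [Gen.bot_ctx, k3, k4, h2]),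
    block_left hω' (by simp [Gen.bot_ctx, k1, k3, h3]) (by simp [k2, k4, h4]),
    gen_mul_middle (by simp [Gen.bot_ctx]) k1 k2 k3 k4,
    middle_mul_gen (by simp [Gen.top_ctx]) k1 k2 k3' k4]
  have := straight_gen_left (K := K) (D := D) hω' g (i₁.map .inl ++ j₁.map .inr) (j₂.map .inr)
    (by simp [k1, k3, h3]) (by simp [k2, k4, h4])
  simpa [sh4, Gen.ctx_ctx] using this

theorem commutes_gen₄ (g : Gen I) {i₁ j₁ i₂ : List I} (k1 : wt i₁ = a) (k2 : wt j₁ = l)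
    (k3 : wt i₂ = c) (k4 : wt g.bot = d) :
    (gen K D a (.e i₁) ⊗ₜ gen K D l (.e j₁)) ⊗ₜ (gen K D c (.e i₂) ⊗ₜ gen K D d g)
      ∈ Commuting K D h1 h2 h3 h4 hω hω' := by
  refine commutes_of_straight k1 k2 k3 k4 ?_
  have k4' : wt g.top = d := by rw [← Gen.wt_bot, k4]
  rw [topMap_tmul, botMap_tmul, block_e h1 k1 k2, block_right h2 k3 k4, block_e h3 k1 k3,
    block_right h4 k2 k4, block_right hω (by simp [k1, k2, h1]) (by simp [Gen.bot_ctx, k3, k4, h2]),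
    block_right hω' (by simp [k1, k3, h3]) (by simp [Gen.bot_ctx, k2, k4, h4]),
    gen_mul_middle (by simp [Gen.bot_ctx]) k1 k2 k3 k4,
    middle_mul_gen (by simp [Gen.top_ctx]) k1 k2 k3 k4']
  have := straight_gen_right (K := K) (D := D) hω' g (i₁.map .inl ++ j₁.map .inr ++ i₂.map .inl) []
    (by simp [k1, k3, h3]) (by simp [k2, k4, h4])
  simpa [sh4, Gen.ctx_ctx] using this

/-- A property of the elements of a tensor product with `R(ν)` which is linear, multiplicative and
holds for generators. -/
theorem Alg.sum_gen_e_induction {P : Alg K D ν → Prop} (add : ∀ x y, P x → P y → P (x + y))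
    (smul : ∀ (k : K) x, P x → P (k • x)) (zero : P 0) (mul : ∀ x y, P x → P y → P (x * y))
    (gen : ∀ g : Gen I, wt g.bot = ν → P (gen K D ν g)) (x : Alg K D ν) : P x := by
  have hg : ∀ g : Gen I, P (QHA.gen K D ν g) := by
    intro g
    by_cases h : wt g.bot = ν
    · exact gen g h
    · rw [gen_weight (by rwa [← Gen.wt_bot])]; exact zero
  induction x using Alg.induction with
  | one =>
    rw [← sum_e]
    classical
    refine Finset.sum_induction _ P add zero fun l _ => hg _
  | add a b ha hb => exact add _ _ ha hb
  | smul k a ha => exact smul k a ha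
  | mul g a ha => exact mul _ _ (hg g) ha

theorem commutes_of_stable (hst : ∀ x, ∀ z ∈ layer K D hω' ν l.degree,
      (block hω).toLin x * z ∈ layer K D hω' ν l.degree) (x) :
    x ∈ Commuting K D h1 h2 h3 h4 hω hω' := by
  have key : ∀ {β : I →₀ ℕ} (f : Alg K D β →ₐ[K] (Alg K D a ⊗[K] Alg K D l) ⊗[K] (Alg K D c ⊗[K] Alg K D d)),
      (∀ g : Gen I, wt g.bot = β → f (gen K D β g) ∈ Commuting K D h1 h2 h3 h4 hω hω') →
      ∀ y, f y ∈ Commuting K D h1 h2 h3 h4 hω hω' := fun f hf y =>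
    Alg.sum_gen_e_induction (P := fun y => f y ∈ Commuting K D h1 h2 h3 h4 hω hω')
      (fun x y hx hy => by rw [map_add]; exact add_mem hx hy) (fun k x hx => by rw [map_smul]; exact Submodule.smul_mem _ k hx)
      (by rw [map_zero]; exact zero_mem _) (fun x y hx hy => by rw [map_mul]; exact Commuting.mul hst hx hy) hf y
  have H1 := key (Algebra.TensorProduct.includeLeft.comp Algebra.TensorProduct.includeLeft) fun g hg => by
    change (_ ⊗ₜ 1) ⊗ₜ (1 ⊗ₜ 1) ∈ Commuting K D h1 h2 h3 h4 hω hω'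
    simp only [← sum_e, tmul_sum, sum_tmul]
    exact sum_mem fun i hi => sum_mem fun j hj => sum_mem fun k hk =>
      commutes_gen₁ g hg (mem_Seq.1 hk) (mem_Seq.1 hj) (mem_Seq.1 hi)
  have H2 := key (Algebra.TensorProduct.includeLeft.comp Algebra.TensorProduct.includeRight) fun g hg => by
    change (1 ⊗ₜ _) ⊗ₜ (1 ⊗ₜ 1) ∈ Commuting K D h1 h2 h3 h4 hω hω'
    simp only [← sum_e, tmul_sum, sum_tmul]
    exact sum_mem fun i hi => sum_mem fun j hj => sum_mem fun k hk =>
      commutes_gen₂ g (mem_Seq.1 hk) hg (mem_Seq.1 hj) (mem_Seq.1 hi)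
  have H3 := key (Algebra.TensorProduct.includeRight.comp Algebra.TensorProduct.includeLeft) fun g hg => by
    change (1 ⊗ₜ 1) ⊗ₜ (_ ⊗ₜ 1) ∈ Commuting K D h1 h2 h3 h4 hω hω'
    simp only [← sum_e, tmul_sum, sum_tmul]
    exact sum_mem fun i hi => sum_mem fun j hj => sum_mem fun k hk =>
      commutes_gen₃ g (mem_Seq.1 hk) (mem_Seq.1 hj) hg (mem_Seq.1 hi)
  have H4 := key (Algebra.TensorProduct.includeRight.comp Algebra.TensorProduct.includeRight) fun g hg => by
    change (1 ⊗ₜ 1) ⊗ₜ (1 ⊗ₜ _) ∈ Commuting K D h1 h2 h3 h4 hω hω'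
    simp only [← sum_e, tmul_sum, sum_tmul]
    exact sum_mem fun i hi => sum_mem fun j hj => sum_mem fun k hk =>
      commutes_gen₄ g (mem_Seq.1 hk) (mem_Seq.1 hj) (mem_Seq.1 hi) hg
  induction x using induction_on with
  | zero => exact zero_mem _
  | add x y hx hy => exact add_mem hx hy
  | tmul x y =>
    induction x using induction_on with
    | zero => rw [zero_tmul]; exact zero_mem _
    | add x y hx hy => rw [add_tmul]; exact add_mem hx hy
    | tmul p q =>
      induction y using induction_on with
      | zero => rw [tmul_zero]; exact zero_mem _
      | add x y hx hy => rw [tmul_add]; exact add_mem hx hy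
      | tmul r s =>
        have := Commuting.mul hst (Commuting.mul hst (H1 p) (H2 q)) (Commuting.mul hst (H3 r) (H4 s))
        simpa using this

end Commute

section Stable
variable (hω : ν + ν' = ω) (hω' : μ + μ' = ω)

theorem block_brd_mul_middle {a l c d : I →₀ ℕ} (h1 : a + l = ν) (h2 : c + d = ν')
    (s₁ : WtShuf a l) (s₂ : WtShuf c d) :
    (block hω).toLin (brd K D ν [] s₁.1 [] ⊗ₜ brd K D ν' [] s₂.1 []) * middle K D ω a l c d =
      brd K D ω [] (s₁.1 ++ s₂.1) [] := by
  obtain ⟨s₁, k1, k2⟩ := s₁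
  obtain ⟨s₂, k3, k4⟩ := s₂
  have b1 := brd_mul_shufIdem (K := K) (D := D) h1 ⟨s₁, k1, k2⟩
  have b2 := brd_mul_shufIdem (K := K) (D := D) h2 ⟨s₂, k3, k4⟩
  have e := brd_append (K := K) (D := D) h1 h2 hω s₁ s₂ k1 k2 k3 k4
  rw [← topMap_e4_mul h1 h2 hω k1 k2 k3 k4, ← mul_assoc, topMap, comp_apply,
    ← (block hω).map_mul] at e
  rw [← e]
  congr 2
  change _ = _ * ((block h1).toLin (shufIdem K D s₁ a l) ⊗ₜ (block h2).toLin (shufIdem K D s₂ c d))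
  rw [tmul_mul_tmul, b1, b2]

theorem take_append_shuf {a l : I →₀ ℕ} (h1 : a + l = ν) {s₁ s₂ : List (I ⊕ I)}
    (k1 : wt (lefts s₁) = a) (k2 : wt (rights s₁) = l) : (s₁ ++ s₂).take ν.degree = s₁ := by
  have : s₁.length = ν.degree := shuffle_length h1 k1 k2
  rw [← this, List.take_left]

/-- The weight of the strands from the right among the `|ν|` leftmost strands at the top. -/
def topWt (ν : I →₀ ℕ) (s : List (I ⊕ I)) : I →₀ ℕ := wt (rights (s.take ν.degree))

theorem degree_topWt (s : List (I ⊕ I)) : (topWt ν s).degree = ht s ν.degree := degree_wt _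

theorem topWt_append {a l : I →₀ ℕ} (h1 : a + l = ν) {s₁ s₂ : List (I ⊕ I)}
    (k1 : wt (lefts s₁) = a) (k2 : wt (rights s₁) = l) : topWt ν (s₁ ++ s₂) = l := by
  rw [topWt, take_append_shuf h1 k1 k2, k2]

/-- A shuffle with top sequence in `Seq(ν) Seq(ν')` is a juxtaposition. -/
theorem exists_append_of_top (hω : ν + ν' = ω) (hω' : μ + μ' = ω) {s : List (I ⊕ I)}
    (k1 : wt (lefts s) = μ) (k2 : wt (rights s) = μ') (hs : wt (col (s.take ν.degree)) = ν) :
    ∃ (a l c d : I →₀ ℕ) (s₁ : WtShuf a l) (s₂ : WtShuf c d), a + l = ν ∧ c + d = ν' ∧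
      a + c = μ ∧ l + d = μ' ∧ s = s₁.1 ++ s₂.1 := by
  have hs' := wt_col_take_drop hω (by rw [wt_col, k1, k2, hω']) hs
  rw [wt_col] at hs hs'
  rw [← take_append_drop ν.degree s, lefts_append, wt_append] at k1
  rw [← take_append_drop ν.degree s, rights_append, wt_append] at k2
  exact ⟨_, _, _, _, ⟨s.take ν.degree, rfl, rfl⟩, ⟨s.drop ν.degree, rfl, rfl⟩, hs, hs', k1, k2,
    (take_append_drop ν.degree s).symm⟩

theorem block_mul_brd_of_stable {s : List (I ⊕ I)} (k1 : wt (lefts s) = μ) (k2 : wt (rights s) = μ')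
    (hs : wt (col (s.take ν.degree)) = ν)
    (hst : ∀ x, ∀ z ∈ layer K D hω' ν (topWt ν s).degree,
      (block hω).toLin x * z ∈ layer K D hω' ν (topWt ν s).degree) (x) :
    (block hω).toLin x * brd K D ω [] s [] ∈ shufSpan K D hω' fun t =>
      wt (col (t.take ν.degree)) = ν ∧ (ht t ν.degree < (topWt ν s).degree ∨ topWt ν t = topWt ν s) := by
  obtain ⟨a, l, c, d, s₁, s₂, h1, h2, h3, h4, rfl⟩ := exists_append_of_top hω hω' k1 k2 hs
  rw [topWt_append h1 s₁.2.1 s₁.2.2] at hst ⊢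
  have hb := block_brd_mul_middle (K := K) (D := D) hω h1 h2 s₁ s₂
  set T := middle K D ω a l c d with hT
  set R := (blockBasis K D h1).tensor (blockBasis K D h2) with hR
  set y := x * (brd K D ν [] s₁.1 [] ⊗ₜ brd K D ν' [] s₂.1 []) with hy
  have hsum := R.sum_coord y
  have htop : (block hω).toLin (((block h1).tensor (block h2)).toLin 1) * T = T :=
    topMap_one_mul h1 h2 hω
  rw [← hb, ← mul_assoc, ← (block hω).map_mul, ← hy, ← htop, ← mul_assoc, ← (block hω).map_mul,
    ← hsum, map_sum, sum_mul]
  refine sum_mem fun u _ => ?_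
  have hc := commutes_of_stable (h1 := h1) (h2 := h2) (h3 := h3) (h4 := h4) (hω := hω)
    (hω' := hω') hst (R.coord u y)
  have hlow := hst (R.b u) _ hc
  have hb' := block_brd_mul_middle (K := K) (D := D) hω h1 h2 u.1 u.2
  have e : (block hω).toLin (R.b u * ((block h1).tensor (block h2)).toLin (R.coord u y)) *
      T = (block hω).toLin (R.b u) *
        (topMap K D h1 h2 hω (R.coord u y) * T - T * botMap K D h3 h4 hω' (R.coord u y)) +
        brd K D ω [] (u.1.1 ++ u.2.1) [] * botMap K D h3 h4 hω' (R.coord u y) := by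
    rw [← hb', (block hω).map_mul, mul_sub, mul_assoc, mul_assoc]
    exact (sub_add_cancel _ _).symm
  rw [e]
  refine add_mem (shufSpan_mono hω' (fun t ht => ⟨ht.1, Or.inl ht.2⟩) hlow)
    (brd_mul_mem hω' ?_ ?_ ⟨?_, Or.inr (topWt_append h1 u.1.2.1 u.1.2.2)⟩ ⟨_, rfl⟩)
  · rw [lefts_append, wt_append, u.1.2.1, u.2.2.1, h3]
  · rw [rights_append, wt_append, u.1.2.2, u.2.2.2, h4]
  · rw [take_append_shuf h1 u.1.2.1 u.1.2.2, wt_col, u.1.2.1, u.1.2.2, h1]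

theorem layer_stable (m : ℕ) : ∀ x, ∀ z ∈ layer K D hω' ν m, (block hω).toLin x * z ∈ layer K D hω' ν m := by
  induction m using Nat.strong_induction_on with
  | _ m ih =>
    intro x z hz
    refine mul_shufSpan hω' (fun s k1 k2 hs => ?_) hz
    obtain ⟨hs, hm⟩ := hs
    rw [← degree_topWt] at hm
    refine shufSpan_mono hω' ?_ (block_mul_brd_of_stable hω hω' k1 k2 hs (ih _ hm) x)
    rintro t ⟨ht1, ht2⟩
    refine ⟨ht1, ?_⟩
    rcases ht2 with h | h
    · exact h.trans hm
    · rwa [← degree_topWt, h]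

theorem block_mul_brd {s : List (I ⊕ I)} (k1 : wt (lefts s) = μ) (k2 : wt (rights s) = μ')
    (hs : wt (col (s.take ν.degree)) = ν) (x) :
    (block hω).toLin x * brd K D ω [] s [] ∈ shufSpan K D hω' fun t =>
      wt (col (t.take ν.degree)) = ν ∧ (ht t ν.degree < (topWt ν s).degree ∨ topWt ν t = topWt ν s) :=
  block_mul_brd_of_stable hω hω' k1 k2 hs (layer_stable hω hω' _) x

theorem brdDeg_append (s t : List (I ⊕ I)) :
    brdDeg D (s ++ t) = brdDeg D s + brdDeg D t - D.pairing (wt (rights s)) (wt (lefts t)) := by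
  induction s with
  | nil => simp [brdDeg]
  | cons c s ih =>
    cases c with
    | inl i => exact ih
    | inr j =>
      change brdDeg D (s ++ t) + crossDeg D j (lefts (s ++ t)) = brdDeg D s + crossDeg D j (lefts s) + _ - _
      rw [ih, crossDeg_eq, crossDeg_eq, lefts_append, wt_append, pairing_add_right, rights_inr, wt_cons,
        pairing_add_left]
      ring

theorem commutes {a l c d : I →₀ ℕ} (h1 : a + l = ν) (h2 : c + d = ν') (h3 : a + c = μ)
    (h4 : l + d = μ') (x) : x ∈ Commuting K D h1 h2 h3 h4 hω hω' :=
  commutes_of_stable (layer_stable hω hω' _) x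
end Stable
end QHA

namespace Gr
section Res
variable {K : Type u} [Field K] {A : Type v} {B : Type x} [Ring A] [Algebra K A] [Ring B] [Algebra K B]
  {𝒜 : ℤ → Submodule K A} {ℬ : ℤ → Submodule K B} [GradedAlgebra 𝒜] [GradedAlgebra ℬ]
  {φ : Hom 𝒜 ℬ}

/-- The inclusion of a restriction. -/
def resIncl (φ : Hom 𝒜 ℬ) (M : GrMod.{u, x, w} ℬ) : res φ M →ₗ[K] M := (resSpace φ M).subtype

variable {M : GrMod.{u, x, w} ℬ}

theorem resIncl_injective : Function.Injective (resIncl φ M) := Subtype.val_injective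
theorem resIncl_smul (a : A) (m : res φ M) : resIncl φ M (a • m) = φ.toLin a • resIncl φ M m := rfl
theorem one_smul_resIncl (m : res φ M) : φ.toLin 1 • resIncl φ M m = resIncl φ M m := m.2
theorem exists_resIncl {m : M} (h : φ.toLin 1 • m = m) : ∃ x : res φ M, resIncl φ M x = m := ⟨⟨m, h⟩, rfl⟩
theorem mem_res_deg {n : ℤ} {m : res φ M} : m ∈ (res φ M).deg n ↔ resIncl φ M m ∈ M.deg n := Iff.rfl

/-- The projection to a restriction. -/
def resProj (φ : Hom 𝒜 ℬ) (M : GrMod.{u, x, w} ℬ) : M →ₗ[K] res φ M where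
  toFun m := ⟨φ.toLin 1 • m, smul_mem_resSpace φ M 1 m⟩
  map_add' _ _ := Subtype.ext (smul_add _ _ _)
  map_smul' _ _ := Subtype.ext (smul_comm _ _ _)

@[simp] theorem resIncl_resProj (m : M) : resIncl φ M (resProj φ M m) = φ.toLin 1 • m := rfl

theorem GrMod.isHomogeneous_of_proj {M : GrMod.{u, v, w} 𝒜} {F : Submodule A M}
    (h : ∀ x ∈ F, ∀ n, GrAux.proj M.isInternal n x ∈ F) : M.IsHomogeneous F := by
  refine le_antisymm (fun x hx => ?_) (iSup_le fun n => inf_le_left)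
  obtain ⟨S, hS⟩ := GrAux.exists_sum_proj M.isInternal x
  rw [← hS S subset_rfl]
  exact sum_mem fun n _ => mem_iSup_of_mem n ⟨h x hx n, GrAux.proj_mem _ n x⟩

theorem mem_submoduleOf_iff {A M : Type*} [Ring A] [AddCommGroup M] [Module A M] {F G : Submodule A M}
    {x : G} : x ∈ F.submoduleOf G ↔ (x : M) ∈ F := Iff.rfl

end Res
end Gr

namespace QHA
open Gr

variable {K : Type u} [Field K] {I : Type v} [Finite I] {D : BorcherdsDatum I} {μ μ' ν ν' ω : I →₀ ℕ}
  (hω : ν + ν' = ω) (hω' : μ + μ' = ω)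
  (X : GrMod.{u, max u v, max u v} (tensorDeg (deg K D μ) (deg K D μ')))

/-- The coordinates in an induced module. -/
abbrev shufC (s : WtShuf μ μ') : Ind hω' X →ₗ[K] X := (blockBasis K D hω').coordInd X s

variable {X}

theorem shufC_mul_eq_zero {P : List (I ⊕ I) → Prop} {z : Alg K D ω} (hz : z ∈ shufSpan K D hω' P) (x : X)
    {s : WtShuf μ μ'} (hs : ¬ P s.1) : shufC hω' X s (z • indUnit _ X x) = 0 := by
  induction hz using span_induction generalizing x with
  | zero | add => simp_all [add_smul]
  | smul k a _ ha => rw [smul_assoc, map_smul, ha, smul_zero]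
  | mem z hz =>
    obtain ⟨t, y, k1, k2, ht, ⟨w, rfl⟩, rfl⟩ := hz
    rw [mul_smul, ← smul_indUnit]
    refine (blockBasis K D hω').coordInd_ne (s := s) (t := ⟨t, k1, k2⟩) (fun h => hs ?_) _
    rw [h]; exact ht

theorem top_of_shufC_ne (z : Res hω (Ind hω' X)) (s : WtShuf μ μ')
    (hs : shufC hω' X s (resIncl _ _ z) ≠ 0) : wt (col (s.1.take ν.degree)) = ν := by
  by_contra hcon
  refine hs ?_
  rw [← one_smul_resIncl z, ← (blockBasis K D hω').sum_coordInd (N := X) (resIncl _ _ z), smul_sum, map_sum]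
  refine sum_eq_zero fun t _ => ?_
  by_cases ht : wt (col (t.1.take ν.degree)) = ν
  · rw [smul_smul]
    refine shufC_mul_eq_zero hω' (block_mul_brd hω hω' t.2.1 t.2.2 ht 1) _
      fun h => hcon h.1
  · rw [smul_smul]
    change shufC hω' X s (((block hω).toLin 1 * brd K D ω [] t.1 []) • _) = 0
    rw [block_one_mul_brd_eq_zero hω ht, zero_smul, map_zero]

include hω hω' in
theorem index_of_top {s : List (I ⊕ I)}
    (k1 : wt (lefts s) = μ) (k2 : wt (rights s) = μ') (hs : wt (col (s.take ν.degree)) = ν) :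
    ∃ i : MackeyIndex ν ν' μ μ', i.lam = topWt ν s := by
  obtain ⟨a, l, c, d, s₁, s₂, h1, h2, h3, h4, rfl⟩ := exists_append_of_top hω hω' k1 k2 hs
  rw [topWt_append h1 s₁.2.1 s₁.2.2]
  exact ⟨⟨l, h1 ▸ le_add_self, h4 ▸ le_self_add, by
    rw [← h2, ← h4, add_assoc, add_comm l d]; exact le_add_self⟩, rfl⟩

theorem exists_append_of_topWt {a l c d : I →₀ ℕ} (h1 : a + l = ν) (h3 : a + c = μ) (h4 : l + d = μ')
    {s : List (I ⊕ I)} (k1 : wt (lefts s) = μ) (k2 : wt (rights s) = μ')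
    (hs : wt (col (s.take ν.degree)) = ν) (hl : topWt ν s = l) :
    ∃ (s₁ : WtShuf a l) (s₂ : WtShuf c d), s = s₁.1 ++ s₂.1 := by
  obtain ⟨s₁, hs₁⟩ : ∃ s₁, s₁ = s.take ν.degree := ⟨_, rfl⟩
  have hs12 := take_append_drop ν.degree s
  rw [topWt, ← hs₁] at hl
  rw [← hs₁, wt_col, hl, ← h1] at hs
  have ha := add_right_cancel hs
  rw [← hs₁] at hs12
  rw [← hs12, lefts_append, wt_append, ha, ← h3] at k1
  rw [← hs12, rights_append, wt_append, hl, ← h4] at k2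
  exact ⟨⟨s₁, ha, hl⟩, ⟨_, add_left_cancel k1, add_left_cancel k2⟩, hs12.symm⟩

/-- A set of weights closed under smaller degrees. -/
def IsLower (ν ν' μ μ' : I →₀ ℕ) (P : (I →₀ ℕ) → Prop) : Prop :=
  ∀ i j : MackeyIndex ν ν' μ μ', P i.lam → j.lam.degree < i.lam.degree → P j.lam

variable (X) in
/-- The elements of the restriction of the induced module supported on the shuffles whose type satisfies `P`. -/
def mackeyFilt (P : (I →₀ ℕ) → Prop) (hP : IsLower ν ν' μ μ' P) :
    Submodule (Alg K D ν ⊗[K] Alg K D ν') (Res hω (Ind hω' X)) where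
  carrier := {z | ∀ s, shufC hω' X s (resIncl _ _ z) ≠ 0 → P (topWt ν s.1)}
  zero_mem' s h := by rw [map_zero, map_zero] at h; exact absurd rfl h
  add_mem' {a b} ha hb s h := by
    rw [map_add, map_add] at h
    by_cases h' : shufC hω' X s (resIncl _ _ a) = 0
    · rw [h', zero_add] at h; exact hb s h
    · exact ha s h'
  smul_mem' x z hz s h := by
    by_contra hs
    have htop := top_of_shufC_ne hω hω' (x • z) s h
    refine h ?_
    rw [resIncl_smul, ← (blockBasis K D hω').sum_coordInd (N := X) (resIncl _ _ z), smul_sum, map_sum]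
    refine sum_eq_zero fun t _ => ?_
    by_cases ht : shufC hω' X t (resIncl _ _ z) = 0
    · rw [ht, map_zero, smul_zero, smul_zero, map_zero]
    · have htop' := top_of_shufC_ne hω hω' z t ht
      rw [smul_smul]
      refine shufC_mul_eq_zero hω' (block_mul_brd hω hω' t.2.1 t.2.2 htop' x) _
        fun hst => hs ?_
      have hPt := hz t ht
      rcases hst.2 with h' | h'
      · obtain ⟨i, hi⟩ := index_of_top hω hω' t.2.1 t.2.2 htop'
        obtain ⟨j, hj⟩ := index_of_top hω hω' s.2.1 s.2.2 htop
        rw [← hj]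
        refine hP i j (by rwa [hi]) ?_
        rwa [hj, degree_topWt, hi]
      · rwa [h']

theorem mackeyFilt_isHomogeneous (P : (I →₀ ℕ) → Prop) (hP : IsLower ν ν' μ μ' P) :
    (Res hω (Ind hω' X)).IsHomogeneous (mackeyFilt hω hω' X P hP) := by
  refine GrMod.isHomogeneous_of_proj fun z hz n s hs => hz s fun h0 => hs ?_
  have h1 := GrAux.proj_map (Res hω (Ind hω' X)).isInternal (Ind hω' X).isInternal (resIncl _ _) 0
    (fun m x hx => by rw [add_zero]; exact hx) n z
  have h2 := GrAux.proj_map (Ind hω' X).isInternal X.isInternal (shufC hω' X s)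
    (-(blockBasis K D hω').d s) (fun m x hx => by
      rw [← sub_eq_add_neg]; exact (blockBasis K D hω').coordInd_mem s hx) n (resIncl _ _ z)
  rw [add_zero] at h1
  rw [← h1, ← h2, h0, map_zero]

section Layers
variable {a l c d : I →₀ ℕ} (h1 : a + l = ν) (h2 : c + d = ν') (h3 : a + c = μ) (h4 : l + d = μ')

variable (X) in
/-- The restriction of `X` with the two middle factors exchanged. -/
abbrev swapRes :=
  res (Hom.swapMiddle (deg K D a) (deg K D l) (deg K D c) (deg K D d)) (res ((block h3).tensor (block h4)) X)

variable (X) in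
/-- The inclusion of `swapRes` in `X`. -/
def swapIncl : swapRes X h3 h4 →ₗ[K] X := resIncl _ X ∘ₗ resIncl _ _

/-- The action of the fourfold tensor product on `X`. -/
def swapAct (w : (Alg K D a ⊗[K] Alg K D l) ⊗[K] (Alg K D c ⊗[K] Alg K D d)) :
    Alg K D μ ⊗[K] Alg K D μ' :=
  ((block h3).tensor (block h4)).toLin ((Hom.swapMiddle (deg K D a) (deg K D l) (deg K D c) (deg K D d)).toLin w)

theorem swapMiddle_one : (Hom.swapMiddle (deg K D a) (deg K D l) (deg K D c) (deg K D d)).toLin 1 = 1 :=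
  map_one (tensorTensorTensorComm K K K K _ _ _ _)

theorem swapIncl_injective : Function.Injective (swapIncl X h3 h4) :=
  resIncl_injective.comp resIncl_injective

theorem swapIncl_smul (w : (Alg K D a ⊗[K] Alg K D l) ⊗[K] (Alg K D c ⊗[K] Alg K D d)) (x : swapRes X h3 h4) :
    swapIncl X h3 h4 (w • x) = swapAct h3 h4 w • swapIncl X h3 h4 x := rfl

theorem one_mul_swapAct (w : (Alg K D a ⊗[K] Alg K D l) ⊗[K] (Alg K D c ⊗[K] Alg K D d)) :
    swapAct h3 h4 (1 : (Alg K D a ⊗[K] Alg K D l) ⊗[K] (Alg K D c ⊗[K] Alg K D d)) * swapAct h3 h4 w =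
      swapAct h3 h4 w := by
  rw [swapAct, swapAct, ← Hom.map_mul, ← Hom.map_mul]
  exact congrArg _ (congrArg _ (one_mul w))

theorem exists_swapIncl {x : X} (hx : swapAct h3 h4 (1 : (Alg K D a ⊗[K] Alg K D l) ⊗[K] _) • x = x) :
    ∃ y, swapIncl X h3 h4 y = x := by
  rw [swapAct, swapMiddle_one] at hx
  obtain ⟨y, rfl⟩ := exists_resIncl hx
  obtain ⟨z, rfl⟩ := exists_resIncl (φ := Hom.swapMiddle (deg K D a) (deg K D l) (deg K D c) (deg K D d))
    (m := y) (by rw [swapMiddle_one]; exact one_smul ((Alg K D a ⊗[K] Alg K D c) ⊗[K] (Alg K D l ⊗[K] Alg K D d)) y)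
  exact ⟨z, rfl⟩

theorem mem_swapRes_deg {n : ℤ} {x : swapRes X h3 h4} :
    x ∈ (swapRes X h3 h4).deg n ↔ swapIncl X h3 h4 x ∈ X.deg n := Iff.rfl

theorem middle_smul_swapAct (w : (Alg K D a ⊗[K] Alg K D l) ⊗[K] (Alg K D c ⊗[K] Alg K D d)) (x : X) :
    middle K D ω a l c d • indUnit (block hω') X (swapAct h3 h4 w • x) =
      (middle K D ω a l c d * botMap K D h3 h4 hω' w) • indUnit (block hω') X x := by
  rw [smul_indUnit, smul_smul]; rfl

variable (X) in
/-- The map `x ↦ T ⊗ x` for the middle crossing `T`. -/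
def middleMap : swapRes X h3 h4 →ₗ[K] Res hω (Ind hω' X) :=
  resProj _ _ ∘ₗ Algebra.lsmul K K (Ind hω' X) (middle K D ω a l c d) ∘ₗ indUnit _ X ∘ₗ swapIncl X h3 h4

include h1 h2 in
theorem resIncl_middleMap (x : swapRes X h3 h4) : resIncl _ _ (middleMap hω hω' X h3 h4 x) =
    middle K D ω a l c d • indUnit _ X (swapIncl X h3 h4 x) := by
  change (block (K := K) (D := D) hω).toLin 1 • middle K D ω a l c d • indUnit (block hω') X (swapIncl X h3 h4 x) = _
  rw [smul_smul, block_one_mul_middle h1 h2]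

include h1 h3 h4 in
theorem middle_mem_shufSpan : middle K D ω a l c d ∈ shufSpan K D hω' fun s => topWt ν s = l := by
  refine sum_mem fun i₁ k1 => sum_mem fun j₁ k2 => sum_mem fun i₂ k3 => sum_mem fun j₂ k4 => ?_
  rw [mem_Seq] at k1 k2 k3 k4
  refine brd_mem hω' (by simp [k1, k3, h3]) (by simp [k2, k4, h4]) ?_
  exact topWt_append h1 (by simp [k1]) (by simp [k2])

variable (X) in
theorem swapAct_e (s₁ : WtShuf a l) (s₂ : WtShuf c d) :
    swapAct h3 h4 (shufIdem K D s₁.1 a l ⊗ₜ shufIdem K D s₂.1 c d) =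
      shufIdem K D (s₁.1 ++ s₂.1) μ μ' := by
  change (block h3).toLin (gen K D a (.e _) ⊗ₜ gen K D c (.e _)) ⊗ₜ
    (block h4).toLin (gen K D l (.e _) ⊗ₜ gen K D d (.e _)) = _
  rw [block_e h3 s₁.2.1 s₂.2.1, block_e h4 s₁.2.2 s₂.2.2, shufIdem, lefts_append, rights_append]

theorem append_shuf (s₁ : WtShuf a l) (s₂ : WtShuf c d) :
    wt (lefts (s₁.1 ++ s₂.1)) = a + c ∧ wt (rights (s₁.1 ++ s₂.1)) = l + d := by
  rw [lefts_append, rights_append, wt_append, wt_append, s₁.2.1, s₁.2.2, s₂.2.1, s₂.2.2]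
  exact ⟨rfl, rfl⟩

variable {P P' : (I →₀ ℕ) → Prop} (hP : IsLower ν ν' μ μ' P) (hP' : IsLower ν ν' μ μ' P')

include h1 h2 in
theorem middleMap_mem (hl : P' l) (x : swapRes X h3 h4) :
    middleMap hω hω' X h3 h4 x ∈ mackeyFilt hω hω' X P' hP' := by
  intro s hs
  by_contra hcon
  refine hs ?_
  rw [resIncl_middleMap hω hω' h1 h2]
  refine shufC_mul_eq_zero hω' (middle_mem_shufSpan hω' h1 h3 h4) _ fun h => hcon ?_
  rwa [h]

variable (X) in
/-- The map to the layer of the filtration. -/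
def layerMap (hl : P' l) : swapRes X h3 h4 →ₗ[K] (mackeyFilt hω hω' X P' hP' ⧸
    (mackeyFilt hω hω' X P hP).submoduleOf (mackeyFilt hω hω' X P' hP')) where
  toFun x := Submodule.Quotient.mk ⟨middleMap hω hω' X h3 h4 x, middleMap_mem hω hω' h1 h2 h3 h4 hP' hl x⟩
  map_add' x y := congrArg Submodule.Quotient.mk (Subtype.ext (map_add _ x y))
  map_smul' k x := congrArg Submodule.Quotient.mk (Subtype.ext (map_smul _ k x))

theorem layerMap_smul (hl : P' l) (hPl : ∀ j : MackeyIndex ν ν' μ μ', j.lam.degree < l.degree → P j.lam)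
    (w : (Alg K D a ⊗[K] Alg K D l) ⊗[K] (Alg K D c ⊗[K] Alg K D d)) (x : swapRes X h3 h4) :
    layerMap hω hω' X h1 h2 h3 h4 hP hP' hl (w • x) =
      ((block h1).tensor (block h2)).toLin w • layerMap hω hω' X h1 h2 h3 h4 hP hP' hl x := by
  symm
  refine (Submodule.Quotient.eq _).2 ?_
  change ((block h1).tensor (block h2)).toLin w • middleMap hω hω' X h3 h4 x -
    middleMap hω hω' X h3 h4 (w • x) ∈ mackeyFilt hω hω' X P hP
  intro s hs
  have htop := top_of_shufC_ne hω hω' _ s hs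
  obtain ⟨i, hi⟩ := index_of_top hω hω' s.2.1 s.2.2 htop
  by_contra hcon
  refine hs ?_
  rw [map_sub, resIncl_smul, resIncl_middleMap hω hω' h1 h2, resIncl_middleMap hω hω' h1 h2, swapIncl_smul,
    middle_smul_swapAct, smul_smul, ← sub_smul]
  refine shufC_mul_eq_zero hω' (commutes hω hω' h1 h2 h3 h4 w) _ fun h => hcon ?_
  rw [← hi]
  refine hPl i ?_
  rw [hi, degree_topWt]; exact h.2

include h1 h2 in
theorem resIncl_brd_smul_middleMap (s₁ : WtShuf a l) (s₂ : WtShuf c d) (x : swapRes X h3 h4) :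
    resIncl _ _ ((brd K D ν [] s₁.1 [] ⊗ₜ[K] brd K D ν' [] s₂.1 []) • middleMap hω hω' X h3 h4 x) =
      brd K D ω [] (s₁.1 ++ s₂.1) [] • indUnit _ X (swapIncl X h3 h4 x) := by
  rw [resIncl_smul, resIncl_middleMap hω hω' h1 h2, smul_smul, block_brd_mul_middle hω h1 h2]

/-- The layers of the filtration are the induced modules. -/
theorem mackeyFilt_subquotientIso (hl : P' l) (hnl : ¬ P l)
    (hPP' : ∀ i : MackeyIndex ν ν' μ μ', P' i.lam → P i.lam ∨ i.lam = l)
    (hPl : ∀ j : MackeyIndex ν ν' μ μ', j.lam.degree < l.degree → P j.lam) :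
    (Res hω (Ind hω' X)).SubquotientIso (mackeyFilt hω hω' X P hP) (mackeyFilt hω hω' X P' hP')
      ((ind ((block h1).tensor (block h2)) (swapRes X h3 h4)).shift (-D.pairing l c)) := by
  classical
  obtain ⟨Θ, hΘ⟩ := exists_ind_lift' (φ := (block (K := K) (D := D) h1).tensor (block h2))
    (N := swapRes X h3 h4) (layerMap hω hω' X h1 h2 h3 h4 hP hP' hl)
    (layerMap_smul hω hω' h1 h2 h3 h4 hP hP' hl hPl)
  set R := (blockBasis K D h1).tensor (blockBasis K D h2) with hR
  let J : R.ι → WtShuf μ μ' := fun u => ⟨u.1.1 ++ u.2.1, by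
    have := append_shuf u.1 u.2; rwa [h3, h4] at this⟩
  have hJinj : Function.Injective J := by
    intro u u' h
    have h := congrArg Subtype.val h
    have e1 : u.1.1.length = u'.1.1.length := by
      rw [shuffle_length h1 u.1.2.1 u.1.2.2, shuffle_length h1 u'.1.2.1 u'.1.2.2]
    obtain ⟨e2, e3⟩ := List.append_inj h e1
    exact Prod.ext (Subtype.ext e2) (Subtype.ext e3)
  have hJtop : ∀ u, topWt ν (J u).1 = l := fun u => topWt_append h1 u.1.2.1 u.1.2.2
  have hJ : ∀ s : WtShuf μ μ', wt (col (s.1.take ν.degree)) = ν → topWt ν s.1 = l → ∃ u, J u = s := by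
    intro s hs hsl
    obtain ⟨s₁, s₂, h⟩ := exists_append_of_topWt (c := c) (d := d) h1 h3 h4 s.2.1 s.2.2 hs hsl
    exact ⟨(s₁, s₂), Subtype.ext h.symm⟩
  have hΘb : ∀ (u : R.ι) (x : swapRes X h3 h4), Θ (R.b u • indUnit _ _ x) =
      Submodule.Quotient.mk (R.b u •
        ⟨middleMap hω hω' X h3 h4 x, middleMap_mem hω hω' h1 h2 h3 h4 hP' hl x⟩) := by
    intro u x
    rw [map_smul, hΘ]; rfl
  have hΘb' : ∀ (u : R.ι) (x : swapRes X h3 h4), resIncl _ _ (R.b u • middleMap hω hω' X h3 h4 x) =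
      brd K D ω [] (J u).1 [] • indUnit _ X (swapIncl X h3 h4 x) := fun u x =>
    resIncl_brd_smul_middleMap hω hω' h1 h2 h3 h4 u.1 u.2 x
  have hecoord : ∀ (u : R.ι) (x : swapRes X h3 h4), R.e u • x = x →
      shufIdem K D (J u).1 μ μ' • swapIncl X h3 h4 x = swapIncl X h3 h4 x := by
    intro u x hx
    have := swapAct_e (K := K) (D := D) h3 h4 u.1 u.2
    conv_rhs => rw [← hx, swapIncl_smul]
    rw [← this]; rfl
  have hcoordJ : ∀ (t u : R.ι) (x : swapRes X h3 h4), R.e u • x = x →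
      shufC hω' X (J t) (resIncl _ _ (R.b u • middleMap hω hω' X h3 h4 x)) =
        if t = u then swapIncl X h3 h4 x else 0 := by
    intro t u x hx
    rw [hΘb']
    split_ifs with h
    · subst h
      exact ((blockBasis K D hω').coordInd_same (N := X) (J t) _).trans (hecoord t x hx)
    · exact (blockBasis K D hω').coordInd_ne (N := X) (fun h' => h (hJinj h')) _
  have hinj : Function.Injective Θ := by
    rw [injective_iff_map_eq_zero]
    intro y hy
    rw [← R.sum_coordInd y, map_sum] at hy
    simp only [hΘb] at hy
    rw [← R.sum_coordInd y]
    have hy' : (∑ u, R.b u • middleMap hω hω' X h3 h4 (R.coordInd _ u y)) ∈ mackeyFilt hω hω' X P hP := by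
      have e : (∑ u, (Submodule.Quotient.mk (R.b u • ⟨middleMap hω hω' X h3 h4 (R.coordInd _ u y),
          middleMap_mem hω hω' h1 h2 h3 h4 hP' hl _⟩) : mackeyFilt hω hω' X P' hP' ⧸
          (mackeyFilt hω hω' X P hP).submoduleOf (mackeyFilt hω hω' X P' hP'))) =
          Submodule.Quotient.mk (∑ u, (R.b u • ⟨middleMap hω hω' X h3 h4 (R.coordInd _ u y),
          middleMap_mem hω hω' h1 h2 h3 h4 hP' hl _⟩)) :=
        (map_sum (Submodule.mkQ _) _ _).symm
      rw [e, Submodule.Quotient.mk_eq_zero, mem_submoduleOf_iff] at hy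
      convert hy using 1
      rw [AddSubmonoidClass.coe_finsetSum]
      rfl
    refine sum_eq_zero fun t _ => ?_
    have hz : swapIncl X h3 h4 (R.coordInd _ t y) = 0 := by
      by_contra hne
      refine hnl ?_
      rw [← hJtop t]
      refine hy' (J t) ?_
      rw [map_sum, map_sum, sum_congr rfl fun u _ => hcoordJ t u _ (R.e_smul_coordInd u y),
        Finset.sum_ite_eq, if_pos (mem_univ t)]
      exact hne
    rw [(injective_iff_map_eq_zero _).1 (swapIncl_injective h3 h4) _ hz, map_zero, smul_zero]
  have hsurj : ∀ (g : mackeyFilt hω hω' X P' hP'), ∃ x : R.ι → swapRes X h3 h4,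
      (∀ u, swapIncl X h3 h4 (x u) = shufC hω' X (J u) (resIncl _ _ g.1)) ∧
      Θ (∑ u, R.b u • indUnit _ _ (x u)) = Submodule.Quotient.mk g := by
    intro g
    have hx : ∀ u, ∃ x, swapIncl X h3 h4 x = shufC hω' X (J u) (resIncl _ _ g.1) := by
      intro u
      refine exists_swapIncl h3 h4 ?_
      have e1 := swapAct_e (K := K) (D := D) h3 h4 u.1 u.2
      have e2 := (blockBasis K D hω').e_smul_coordInd (J u) (resIncl _ _ g.1)
      rw [← e2]
      change _ • shufIdem K D (J u).1 μ μ' • _ = shufIdem K D (J u).1 μ μ' • _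
      rw [smul_smul]
      congr 1
      rw [← e1]
      exact one_mul_swapAct h3 h4 _
    choose x hx using hx
    refine ⟨x, hx, ?_⟩
    rw [map_sum]
    simp only [hΘb]
    have e : (∑ u, (Submodule.Quotient.mk (R.b u • ⟨middleMap hω hω' X h3 h4 (x u),
          middleMap_mem hω hω' h1 h2 h3 h4 hP' hl _⟩) : mackeyFilt hω hω' X P' hP' ⧸
          (mackeyFilt hω hω' X P hP).submoduleOf (mackeyFilt hω hω' X P' hP'))) =
          Submodule.Quotient.mk (∑ u, (R.b u • ⟨middleMap hω hω' X h3 h4 (x u),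
          middleMap_mem hω hω' h1 h2 h3 h4 hP' hl _⟩)) :=
        (map_sum (Submodule.mkQ _) _ _).symm
    rw [e, Submodule.Quotient.eq, mem_submoduleOf_iff]
    have e' : ((∑ u, (R.b u • ⟨middleMap hω hω' X h3 h4 (x u),
          middleMap_mem hω hω' h1 h2 h3 h4 hP' hl _⟩) - g : mackeyFilt hω hω' X P' hP') :
          Res hω (Ind hω' X)) = (∑ u, R.b u • middleMap hω hω' X h3 h4 (x u)) - g.1 := by
      rw [Submodule.coe_sub, AddSubmonoidClass.coe_finsetSum]; rfl
    rw [e']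
    have hex : ∀ u, R.e u • x u = x u := by
      intro u
      refine swapIncl_injective h3 h4 ?_
      rw [swapIncl_smul, hx]
      refine Eq.trans ?_ ((blockBasis K D hω').e_smul_coordInd (J u) (resIncl _ _ g.1))
      exact congrArg (· • _) (swapAct_e (K := K) (D := D) h3 h4 u.1 u.2)
    intro s hs
    have htop := top_of_shufC_ne hω hω' _ s hs
    obtain ⟨i, hi⟩ := index_of_top hω hω' s.2.1 s.2.2 htop
    by_cases hsl : topWt ν s.1 = l
    · exfalso
      obtain ⟨t, rfl⟩ := hJ s htop hsl
      refine hs ?_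
      rw [map_sub, map_sub, map_sum, map_sum, sum_congr rfl fun u _ => hcoordJ t u _ (hex u),
        Finset.sum_ite_eq, if_pos (mem_univ t), hx, sub_self]
    · rw [← hi]
      refine (hPP' i ?_).resolve_right (by rwa [hi])
      rw [hi]
      refine g.2 s fun h0 => hs ?_
      rw [map_sub, map_sub, h0, sub_zero, map_sum, map_sum]
      refine sum_eq_zero fun u _ => ?_
      rw [hΘb']
      refine (blockBasis K D hω').coordInd_ne (N := X) (fun h' => hsl ?_) _
      rw [h', hJtop]
  let e := LinearEquiv.ofBijective Θ ⟨hinj, fun q => by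
    obtain ⟨g, rfl⟩ := Submodule.Quotient.mk_surjective _ q
    obtain ⟨x, -, hx⟩ := hsurj g
    exact ⟨_, hx⟩⟩
  refine ⟨e.symm, fun n g hg => ?_⟩
  obtain ⟨x, hx1, hx2⟩ := hsurj g
  have : e.symm (Submodule.Quotient.mk g) = ∑ u, R.b u • indUnit _ _ (x u) :=
    e.symm_apply_eq.2 hx2.symm
  change e.symm (Submodule.Quotient.mk g) ∈
    (ind ((block h1).tensor (block h2)) (swapRes X h3 h4)).deg (n - -D.pairing l c)
  rw [this]
  refine sum_mem fun u _ => ?_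
  have hxu : x u ∈ (swapRes X h3 h4).deg (n - brdDeg D (J u).1) := by
    rw [mem_swapRes_deg, hx1]
    exact (blockBasis K D hω').coordInd_mem (J u) hg
  have hdeg : R.d u + (n - brdDeg D (J u).1) = n - -D.pairing l c := by
    change brdDeg D u.1.1 + brdDeg D u.2.1 + (n - brdDeg D (u.1.1 ++ u.2.1)) = _
    rw [brdDeg_append, u.1.2.2, u.2.2.1]
    ring
  rw [← hdeg]
  exact (ind _ _).smul_mem _ _ _ (R.b_mem u) _ (indUnit_mem hxu)

end Layers
end QHA

namespace QHA
open Gr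

variable {K : Type u} [Field K] {I : Type v} [Finite I] {D : BorcherdsDatum I} {μ μ' ν ν' ω : I →₀ ℕ}

theorem MackeyIndex.ext' {i j : MackeyIndex ν ν' μ μ'} (h : i.lam = j.lam) : i = j := by
  cases i; cases j; cases h; rfl

instance : Finite (MackeyIndex ν ν' μ μ') := by
  classical
  exact Finite.of_injective (β := Set.Icc (0 : I →₀ ℕ) ν) (fun i => ⟨i.lam, zero_le, i.le_left⟩)
    fun _ _ h => MackeyIndex.ext' (congrArg Subtype.val h)

theorem exists_sorted_index (ν ν' μ μ' : I →₀ ℕ) : ∃ (r : ℕ) (lam : Fin r ≃ MackeyIndex ν ν' μ μ'),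
    ∀ i j, (lam i).lam.degree < (lam j).lam.degree → i < j := by
  let _ := Fintype.ofFinite (MackeyIndex ν ν' μ μ')
  let e := (Fintype.equivFin (MackeyIndex ν ν' μ μ')).symm
  refine ⟨_, (Tuple.sort fun i => (e i).lam.degree).trans e, fun i j h => ?_⟩
  by_contra hcon
  have := Tuple.monotone_sort (fun i => (e i).lam.degree) (not_lt.1 hcon)
  exact absurd h (not_lt.2 this)

/-- The subquotient belonging to an index of the Mackey filtration. -/
abbrev mackeyLayer (h : ν + ν' = μ + μ') (lam : MackeyIndex ν ν' μ μ')
    (X : GrMod.{u, max u v, max u v} (tensorDeg (deg K D μ) (deg K D μ'))) :=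
  (ind ((block (mackey₁ lam)).tensor (block (mackey₂ lam)))
    (swapRes X (mackey₃ h lam) (mackey₄ lam))).shift (-D.pairing lam.lam (ν' + lam.lam - μ'))

/-- The Mackey filtration. -/
theorem exists_mackeyFilt (h : ν + ν' = μ + μ')
    (X : GrMod.{u, max u v, max u v} (tensorDeg (deg K D μ) (deg K D μ'))) :
    ∃ (r : ℕ) (lam : Fin r ≃ MackeyIndex ν ν' μ μ')
        (F : Fin (r + 1) → Submodule (Alg K D ν ⊗[K] Alg K D ν')
          (Res h (Ind (rfl : μ + μ' = μ + μ') X))),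
        Monotone F ∧ F 0 = ⊥ ∧ F (Fin.last r) = ⊤ ∧
        (∀ k, (Res h (Ind (rfl : μ + μ' = μ + μ') X)).IsHomogeneous (F k)) ∧
        ∀ k : Fin r, (Res h (Ind (rfl : μ + μ' = μ + μ') X)).SubquotientIso
          (F k.castSucc) (F k.succ) (mackeyLayer h (lam k) X) := by
  obtain ⟨r, lam, hlam⟩ := exists_sorted_index ν ν' μ μ'
  let P : Fin (r + 1) → (I →₀ ℕ) → Prop := fun k l => ∀ j : Fin r, (lam j).lam = l → j.1 < k.1
  have hP : ∀ k, IsLower ν ν' μ μ' (P k) := by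
    intro k i j hi hij j' hj'
    obtain ⟨i, rfl⟩ := lam.surjective i
    rw [← hj'] at hij
    exact lt_trans (hlam _ _ hij) (hi i rfl)
  refine ⟨r, lam, fun k => mackeyFilt h rfl X (P k) (hP k), ?_, ?_, ?_, ?_, ?_⟩
  · intro k k' hk z hz s hs j hj
    exact (hz s hs j hj).trans_le hk
  · rw [eq_bot_iff]
    intro z hz
    rw [mem_bot]
    refine (injective_iff_map_eq_zero _).1 (resIncl_injective (φ := block h)) z ?_
    rw [← (blockBasis K D (rfl : μ + μ' = μ + μ')).sum_coordInd (N := X) (resIncl _ _ z)]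
    refine sum_eq_zero fun s _ => ?_
    by_cases hs : shufC rfl X s (resIncl _ _ z) = 0
    · rw [hs, map_zero, smul_zero]
    · obtain ⟨i, hi⟩ := index_of_top h rfl s.2.1 s.2.2 (top_of_shufC_ne h rfl z s hs)
      obtain ⟨j, rfl⟩ := lam.surjective i
      exact absurd (hz s hs j hi) (Nat.not_lt_zero _)
  · rw [eq_top_iff]
    intro z _ s hs j hj
    exact j.2
  · intro k
    exact mackeyFilt_isHomogeneous h rfl (P k) (hP k)
  · intro k
    refine mackeyFilt_subquotientIso h rfl (mackey₁ (lam k)) (mackey₂ (lam k)) (mackey₃ h (lam k))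
      (mackey₄ (lam k)) (hP _) (hP _) ?_ ?_ ?_ ?_
    · intro j hj
      rw [lam.injective (MackeyIndex.ext' hj)]
      exact Nat.lt_succ_self _
    · intro hcon
      exact lt_irrefl _ (hcon k rfl)
    · intro i hi
      obtain ⟨j, rfl⟩ := lam.surjective i
      have hj := hi j rfl
      rcases Nat.lt_succ_iff_lt_or_eq.1 hj with hj | hj
      · left
        intro j' hj'
        rwa [lam.injective (MackeyIndex.ext' hj')]
      · right
        rw [Fin.ext hj]
    · intro i hi j hj
      obtain ⟨i, rfl⟩ := lam.surjective i
      rw [lam.injective (MackeyIndex.ext' hj)]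
      exact hlam _ _ hi

end QHA

namespace Gr

section Hom0
variable {K : Type u} [Field K] {A : Type v} [Ring A] [Algebra K A] {𝒜 : ℤ → Submodule K A}

/-- The homomorphisms of degree `0`. -/
def Hom0 (M N : GrMod.{u, v, v} 𝒜) : Submodule K (M →ₗ[A] N) where
  carrier := {f | ∀ n, ∀ m ∈ M.deg n, f m ∈ N.deg n}
  zero_mem' _ _ _ := zero_mem _
  add_mem' hf hg n m hm := add_mem (hf n m hm) (hg n m hm)
  smul_mem' c _ hf n m hm := Submodule.smul_mem _ c (hf n m hm)

variable {L M N P : GrMod.{u, v, v} 𝒜}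

theorem id_mem_Hom0 : (LinearMap.id : M →ₗ[A] M) ∈ Hom0 M M := fun _ _ h => h
theorem comp_mem_Hom0 {g : N →ₗ[A] P} {f : M →ₗ[A] N} (hg : g ∈ Hom0 N P) (hf : f ∈ Hom0 M N) :
    g ∘ₗ f ∈ Hom0 M P := fun n m hm => hg n _ (hf n m hm)

theorem proj_hom {f : M →ₗ[A] N} (hf : f ∈ Hom0 M N) (n : ℤ) (m : M) :
    GrAux.proj N.isInternal n (f m) = f (GrAux.proj M.isInternal n m) := by
  have := GrAux.proj_map M.isInternal N.isInternal (f.restrictScalars K) 0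
    (fun k x hx => by rw [add_zero]; exact hf k x hx) n m
  rwa [add_zero] at this

theorem hom_ext_deg {X : Type*} [AddCommGroup X] [Module K X] {f g : M →ₗ[K] X}
    (h : ∀ n, ∀ m ∈ M.deg n, f m = g m) : f = g := by
  ext m
  induction m using GrAux.induction (GrAux.iSup_eq_top M.isInternal) with
  | zero => rw [map_zero, map_zero]
  | hom n x hx => exact h n x hx
  | add x y hx hy => rw [map_add, map_add, hx, hy]

/-- The degree `0` part of a linear map. -/
theorem exists_degZero [GradedAlgebra 𝒜] (f : M →ₗ[A] N) :
    ∃ f₀ ∈ Hom0 M N, ∀ n, ∀ m ∈ M.deg n, f₀ m = GrAux.proj N.isInternal n (f m) := by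
  classical
  let _ := M.isInternal.chooseDecomposition
  let g : M →ₗ[K] N := (toModule K ℤ _ fun n =>
    GrAux.proj N.isInternal n ∘ₗ f.restrictScalars K ∘ₗ (M.deg n).subtype) ∘ₗ
    (DirectSum.decomposeLinearEquiv M.deg).toLinearMap
  have hg : ∀ n, ∀ m ∈ M.deg n, g m = GrAux.proj N.isInternal n (f m) := by
    intro n m hm
    lift m to M.deg n using hm
    simp [g]
  have hlin : ∀ (a : A) (m : M), g (a • m) = a • g m := by
    intro a m
    induction m using GrAux.induction (GrAux.iSup_eq_top M.isInternal) with
    | zero | add => simp_all [smul_add]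
    | hom n m hm =>
      induction a using GrAux.induction (GrAux.iSup_eq_top (DirectSum.Decomposition.isInternal 𝒜)) with
      | zero | add => simp_all [add_smul]
      | hom i a ha =>
        rw [hg _ _ (M.smul_mem i n a ha m hm), hg n m hm, map_smul]
        have := GrAux.proj_map N.isInternal N.isInternal (Algebra.lsmul K K N a) i
          (fun k x hx => by rw [add_comm]; exact N.smul_mem i k a ha x hx) n (f m)
        rw [add_comm] at this
        exact this
  exact ⟨{ g with map_smul' := hlin }, fun n m hm => by
    change g m ∈ _
    rw [hg n m hm]; exact GrAux.proj_mem _ _ _, hg⟩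

/-- Isomorphism of graded modules. -/
def GrIso (M N : GrMod.{u, v, v} 𝒜) : Prop := ∃ e : M ≃ₗ[A] N, ∀ n, ∀ m ∈ M.deg n, e m ∈ N.deg n

theorem symm_mem_Hom0 {e : M ≃ₗ[A] N} (he : e.toLinearMap ∈ Hom0 M N) : e.symm.toLinearMap ∈ Hom0 N M := by
  intro n y hy
  refine GrAux.mem_of_proj M.isInternal fun k hk => ?_
  have h := proj_hom he k (e.symm y)
  change GrAux.proj N.isInternal k (e (e.symm y)) = e _ at h
  rw [e.apply_symm_apply, GrAux.proj_ne N.isInternal (Ne.symm hk) hy] at h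
  exact e.map_eq_zero_iff.1 h.symm

theorem GrIso.refl (M : GrMod.{u, v, v} 𝒜) : GrIso M M := ⟨.refl A M, fun _ _ h => h⟩
theorem GrIso.symm (h : GrIso M N) : GrIso N M := by
  obtain ⟨e, he⟩ := h
  exact ⟨e.symm, symm_mem_Hom0 he⟩
theorem GrIso.trans (h : GrIso M N) (h' : GrIso N P) : GrIso M P := by
  obtain ⟨e, he⟩ := h
  obtain ⟨e', he'⟩ := h'
  exact ⟨e.trans e', fun n m hm => he' n _ (he n m hm)⟩
theorem GrIso.shift (h : GrIso M N) (k : ℤ) : GrIso (M.shift k) (N.shift k) := by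
  obtain ⟨e, he⟩ := h
  exact ⟨e, fun n => he (n - k)⟩
theorem GrIso.of_comp {f : M →ₗ[A] N} {g : N →ₗ[A] M} (hf : f ∈ Hom0 M N) (h1 : g ∘ₗ f = .id)
    (h2 : f ∘ₗ g = .id) : GrIso M N :=
  ⟨.ofLinearMap f g h2 h1, hf⟩
theorem GrIso.isFGProj (h : GrIso M N) (hM : M.IsFGProj) : N.IsFGProj := by
  obtain ⟨e, -⟩ := h
  obtain ⟨h1, h2⟩ := hM
  exact ⟨.equiv e, .of_equiv e⟩

/-- `M` is the direct sum of `M'` and `M''`, by maps of degree `0`. -/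
def IsBiprod (M' M M'' : GrMod.{u, v, v} 𝒜) : Prop :=
  ∃ i ∈ Hom0 M' M, ∃ p ∈ Hom0 M M', ∃ j ∈ Hom0 M'' M, ∃ q ∈ Hom0 M M'',
    p ∘ₗ i = .id ∧ q ∘ₗ j = .id ∧ i ∘ₗ p + j ∘ₗ q = .id

theorem isBiprod_comp {M' M M'' : GrMod.{u, v, v} 𝒜} {i : M' →ₗ[A] M} {p : M →ₗ[A] M'} {j : M'' →ₗ[A] M}
    {q : M →ₗ[A] M''} (h1 : p ∘ₗ i = .id) (h2 : q ∘ₗ j = .id) (h3 : i ∘ₗ p + j ∘ₗ q = .id) :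
    q ∘ₗ i = 0 ∧ p ∘ₗ j = 0 := by
  have e1 : ∀ x, q (j x) = x := fun x => lcongr_fun h2 x
  have e2 : ∀ x, p (i x) = x := fun x => lcongr_fun h1 x
  have e3 : ∀ x, i (p x) + j (q x) = x := fun x => lcongr_fun h3 x
  constructor
  · ext x
    have := e3 (i x)
    rw [e2, add_eq_left] at this
    have := congrArg q this
    rwa [e1, map_zero] at this
  · ext x
    have := e3 (j x)
    rw [e1, add_eq_right] at this
    have := congrArg p this
    rwa [e2, map_zero] at this

theorem IsBiprod.isShortExact {M' M M'' : GrMod.{u, v, v} 𝒜} (h : IsBiprod M' M M'') : IsShortExact M' M M'' := by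
  obtain ⟨i, hi, p, hp, j, hj, q, hq, h1, h2, h3⟩ := h
  refine ⟨i, q, hi, hq, fun x y h => ?_, fun x => ⟨fun h => ?_, ?_⟩, fun x => ⟨j x, lcongr_fun h2 x⟩⟩
  · have := congrArg p h
    rwa [← comp_apply, ← comp_apply, h1] at this
  · refine ⟨p x, ?_⟩
    have := lcongr_fun h3 x
    simpa [h] using this
  · rintro ⟨y, rfl⟩
    exact lcongr_fun (isBiprod_comp h1 h2 h3).1 y

theorem IsShortExact.isBiprod [GradedAlgebra 𝒜] {M' M M'' : GrMod.{u, v, v} 𝒜} (h : IsShortExact M' M M'')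
    (hM : M''.IsFGProj) : IsBiprod M' M M'' := by
  obtain ⟨i, q, hi, hq, hinj, hex, hsurj⟩ := h
  obtain ⟨-, hP⟩ := hM
  obtain ⟨s, hs⟩ := Module.projective_lifting_property q LinearMap.id hsurj
  obtain ⟨j, hj, hjs⟩ := exists_degZero s
  have hqj : q ∘ₗ j = .id := by
    have : (q ∘ₗ j).restrictScalars K = LinearMap.id := by
      refine hom_ext_deg fun n m hm => ?_
      change q (j m) = m
      rw [hjs n m hm, ← proj_hom hq, ← comp_apply, hs]
      exact GrAux.proj_same _ hm
    ext m
    exact lcongr_fun this m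
  have hr : ∀ x, ∃ y, i y = x - j (q x) := fun x => (hex _).1 (by
    rw [map_sub, ← comp_apply q j, hqj]; exact sub_self _)
  choose r hr using hr
  let p : M →ₗ[A] M' :=
    { toFun := r
      map_add' := fun x y => hinj (by rw [map_add, hr, hr, hr]; simp only [map_add]; abel)
      map_smul' := fun a x => hinj (by simp only [RingHom.id_apply, map_smul, hr, smul_sub]) }
  have hp : ∀ x, i (p x) = x - j (q x) := hr
  refine ⟨i, hi, p, ?_, j, hj, q, hq, ?_, hqj, ?_⟩
  · intro n m hm
    refine GrAux.mem_of_proj M'.isInternal fun k hk => hinj ?_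
    rw [← proj_hom hi, hp, map_zero]
    exact GrAux.proj_ne _ (Ne.symm hk) (sub_mem hm (hj n _ (hq n m hm)))
  · ext x
    refine hinj ?_
    change i (p (i x)) = i x
    rw [hp, (hex (i x)).2 ⟨x, rfl⟩, map_zero, sub_zero]
  · ext x
    change i (p x) + j (q x) = x
    rw [hp, sub_add_cancel]

theorem IsBiprod.isFGProj_left {M' M M'' : GrMod.{u, v, v} 𝒜} (h : IsBiprod M' M M'') (hM : M.IsFGProj) :
    M'.IsFGProj := by
  obtain ⟨i, hi, p, hp, j, hj, q, hq, h1, h2, h3⟩ := h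
  obtain ⟨_, _⟩ := hM
  exact ⟨.of_surjective p fun x => ⟨i x, lcongr_fun h1 x⟩, .of_split i p h1⟩

theorem IsBiprod.symm {M' M M'' : GrMod.{u, v, v} 𝒜} (h : IsBiprod M' M M'') : IsBiprod M'' M M' := by
  obtain ⟨i, hi, p, hp, j, hj, q, hq, h1, h2, h3⟩ := h
  exact ⟨j, hj, q, hq, i, hi, p, hp, h2, h1, by rw [add_comm]; exact h3⟩

end Hom0

section K0
variable {K : Type u} [Field K] {A : Type v} [Ring A] [Algebra K A] {𝒜 : ℤ → Submodule K A}

/-- The zero module. -/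
def GrMod.zero (𝒜 : ℤ → Submodule K A) : GrMod.{u, v, v} 𝒜 where
  carrier := PUnit.{v+1}
  deg _ := ⊤
  isInternal := GrAux.isInternal_of _ (by simp) 0 fun n x _ => by
    exact (Finsupp.single_zero n).symm
  smul_mem _ _ _ _ _ _ := trivial

theorem GrMod.isFGProj_zero : (GrMod.zero 𝒜).IsFGProj :=
  ⟨inferInstanceAs (Module.Finite A PUnit.{v+1}), inferInstanceAs (Module.Projective A PUnit.{v+1})⟩

theorem K0.mk_shortExact {P' P P'' : FGProj 𝒜} (h : IsShortExact P'.1 P.1 P''.1) :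
    K0.mk P = K0.mk P' + K0.mk P'' := by
  have : (QuotientAddGroup.mk (FreeAbelianGroup.of P - FreeAbelianGroup.of P' - FreeAbelianGroup.of P'') :
      K0 𝒜) = 0 := (QuotientAddGroup.eq_zero_iff _).2 (AddSubgroup.subset_closure ⟨P', P, P'', h, rfl⟩)
  have e : K0.mk P - K0.mk P' - K0.mk P'' = 0 := this
  rw [sub_sub, sub_eq_zero] at e
  exact e

theorem K0.mk_biprod {P' P P'' : FGProj 𝒜} (h : IsBiprod P'.1 P.1 P''.1) :
    K0.mk P = K0.mk P' + K0.mk P'' := K0.mk_shortExact h.isShortExact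

theorem K0.mk_zero_of {P : FGProj 𝒜} (h : ∀ x : P.1, x = 0) : K0.mk P = 0 := by
  have e : (LinearMap.id : P.1 →ₗ[A] P.1) = 0 := by ext x; exact h x
  have := K0.mk_biprod (P' := P) (P := P) (P'' := P) ⟨0, zero_mem _, 0, zero_mem _, 0, zero_mem _, 0, zero_mem _, e.symm, e.symm,
    by rw [e]; ext x; exact (h _).trans rfl⟩
  simpa using this

theorem K0.mk_iso {P Q : FGProj 𝒜} (h : GrIso P.1 Q.1) : K0.mk P = K0.mk Q := by
  obtain ⟨e, he⟩ := h
  have := K0.mk_biprod (P' := P) (P := Q) (P'' := ⟨GrMod.zero 𝒜, GrMod.isFGProj_zero⟩)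
    ⟨e.toLinearMap, he, e.symm.toLinearMap, symm_mem_Hom0 he, 0, zero_mem _, 0, zero_mem _,
      by ext x; simp, by ext x; rfl, by ext x; simp⟩
  rw [this, K0.mk_zero_of (P := ⟨GrMod.zero 𝒜, GrMod.isFGProj_zero⟩) (fun x => rfl), add_zero]

theorem K0.induction {P : K0 𝒜 → Prop} (mk : ∀ X, P (K0.mk X)) (add : ∀ x y, P x → P y → P (x + y))
    (neg : ∀ x, P x → P (-x)) (x : K0 𝒜) : P x := by
  have zero : P 0 := by
    have := add _ _ (mk ⟨GrMod.zero 𝒜, GrMod.isFGProj_zero⟩) (neg _ (mk ⟨GrMod.zero 𝒜, GrMod.isFGProj_zero⟩))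
    rwa [add_neg_cancel] at this
  obtain ⟨z, rfl⟩ := QuotientAddGroup.mk_surjective x
  induction z using FreeAbelianGroup.induction_on with
  | zero => exact zero
  | of X => exact mk X
  | neg X h => exact neg _ h
  | add x y hx hy => exact add _ _ hx hy

theorem C_mul_T_smul {Z : Type*} [AddCommGroup Z] [Module ℤ[T;T⁻¹] Z] (a n : ℤ) (z : Z) :
    (LaurentPolynomial.C a * LaurentPolynomial.T n : ℤ[T;T⁻¹]) • z = a • (LaurentPolynomial.T n : ℤ[T;T⁻¹]) • z := by
  rw [mul_smul, show (LaurentPolynomial.C a : ℤ[T;T⁻¹]) = (a : ℤ[T;T⁻¹]) from map_intCast _ a, Int.cast_smul_eq_zsmul]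

theorem laurent_smul_eq {X Y : Type*} [AddCommGroup X] [Module ℤ[T;T⁻¹] X] [AddCommGroup Y] [Module ℤ[T;T⁻¹] Y]
    (f : X →+ Y) (h : ∀ (m : ℤ) x, f ((LaurentPolynomial.T m : ℤ[T;T⁻¹]) • x) = (LaurentPolynomial.T m : ℤ[T;T⁻¹]) • f x)
    (c : ℤ[T;T⁻¹]) (x : X) : f (c • x) = c • f x := by
  induction c using LaurentPolynomial.induction_on' with
  | add p q hp hq => rw [add_smul, map_add, add_smul, hp, hq]
  | C_mul_T n a =>
    rw [C_mul_T_smul, map_zsmul, h, C_mul_T_smul]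

/-- Additive maps out of `K0`. -/
def K0.liftAdd {X : Type*} [AddCommGroup X] (F : FGProj 𝒜 → X)
    (hF : ∀ P' P P'' : FGProj 𝒜, IsShortExact P'.1 P.1 P''.1 → F P = F P' + F P'') : K0 𝒜 →+ X :=
  QuotientAddGroup.lift (k0Rel 𝒜) (FreeAbelianGroup.lift F) (by
    rw [k0Rel, AddSubgroup.closure_le]
    rintro _ ⟨P', P, P'', h, rfl⟩
    simp [hF _ _ _ h])

@[simp] theorem K0.liftAdd_mk {X : Type*} [AddCommGroup X] (F : FGProj 𝒜 → X) (hF) (P : FGProj 𝒜) :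
    K0.liftAdd F hF (K0.mk P) = F P := by
  change FreeAbelianGroup.lift F (.of _) = _
  simp

/-- Linear maps out of `K0`. -/
def K0.lift {X : Type*} [AddCommGroup X] [Module ℤ[T;T⁻¹] X] (F : FGProj 𝒜 → X)
    (hF : ∀ P' P P'' : FGProj 𝒜, IsShortExact P'.1 P.1 P''.1 → F P = F P' + F P'')
    (hs : ∀ (P : FGProj 𝒜) m, F (P.shift m) = (LaurentPolynomial.T m : ℤ[T;T⁻¹]) • F P) : K0 𝒜 →ₗ[ℤ[T;T⁻¹]] X :=
  { K0.liftAdd F hF with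
    map_smul' := laurent_smul_eq (K0.liftAdd F hF) fun m x => by
      induction x using K0.induction with
      | mk P => rw [K0.T_smul_mk, K0.liftAdd_mk, K0.liftAdd_mk, hs]
      | add x y hx hy => rw [smul_add, map_add, map_add, smul_add, hx, hy]
      | neg x hx => rw [smul_neg, map_neg, map_neg, smul_neg, hx] }

@[simp] theorem K0.lift_mk {X : Type*} [AddCommGroup X] [Module ℤ[T;T⁻¹] X] (F : FGProj 𝒜 → X) (hF) (hs)
    (P : FGProj 𝒜) : K0.lift F hF hs (K0.mk P) = F P := K0.liftAdd_mk F hF P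

theorem K0.linear_ext {X : Type*} [AddCommGroup X] [Module ℤ[T;T⁻¹] X] {f g : K0 𝒜 →ₗ[ℤ[T;T⁻¹]] X}
    (h : ∀ P, f (K0.mk P) = g (K0.mk P)) : f = g := by
  ext x
  induction x using K0.induction with
  | mk P => exact h P
  | add | neg => simp_all

end K0
end Gr

namespace Gr

section DualBasis
variable {K : Type u} [Field K] {A : Type v} [Ring A] [Algebra K A] {𝒜 : ℤ → Submodule K A}

theorem GrMod.IsFGProj.exists_dualBasis {M : GrMod.{u, v, v} 𝒜} (h : M.IsFGProj) :
    ∃ (n : ℕ) (x : Fin n → M) (f : Fin n → M →ₗ[A] A), ∀ m, ∑ i, f i m • x i = m := by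
  obtain ⟨_, _⟩ := h
  obtain ⟨n, g, hg⟩ := Module.Finite.exists_fin' A M
  obtain ⟨s, hs⟩ := Module.projective_lifting_property g LinearMap.id hg
  refine ⟨n, fun i => g (Pi.single i 1), fun i => LinearMap.proj i ∘ₗ s, fun m => ?_⟩
  have h1 : g (s m) = m := lcongr_fun hs m
  conv_rhs => rw [← h1, pi_eq_sum_univ' (s m), map_sum]
  refine sum_congr rfl fun i _ => ?_
  rw [map_smul]
  congr 2

theorem GrMod.isFGProj_of_dualBasis {M : GrMod.{u, v, v} 𝒜} {ι : Type*} [Fintype ι] (x : ι → M)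
    (f : ι → M →ₗ[A] A) (h : ∀ m, ∑ i, f i m • x i = m) : M.IsFGProj := by
  let g : (ι → A) →ₗ[A] M := Fintype.linearCombination A x
  let s : M →ₗ[A] (ι → A) := LinearMap.pi f
  have hgs : g ∘ₗ s = .id := by
    ext m
    simpa [g, s, Fintype.linearCombination_apply] using h m
  exact ⟨.of_surjective g fun m => ⟨s m, lcongr_fun hgs m⟩, .of_split s g hgs⟩

end DualBasis

section BoxAPI
variable {K : Type u} [Field K] {A B : Type v} [Ring A] [Algebra K A] [Ring B] [Algebra K B]
  {𝒜 : ℤ → Submodule K A} {ℬ : ℤ → Submodule K B}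
  (M : GrMod.{u, v, v} 𝒜) (N : GrMod.{u, v, v} ℬ)

/-- The elementary tensors of an outer tensor product. -/
def boxMk : M →ₗ[K] N →ₗ[K] M.box N := TensorProduct.mk K M N

variable {M N}

theorem smul_boxMk (a : A) (b : B) (m : M) (n : N) :
    (a ⊗ₜ[K] b) • boxMk M N m n = boxMk M N (a • m) (b • n) := boxAct_tmul M N a b m n

theorem boxMk_mem {i j k : ℤ} (h : i + j = k) {m : M} {n : N} (hm : m ∈ M.deg i) (hn : n ∈ N.deg j) :
    boxMk M N m n ∈ (M.box N).deg k := h ▸ tmul_mem hm hn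

theorem box_induction {P : M.box N → Prop} (zero : P 0) (mk : ∀ m n, P (boxMk M N m n))
    (add : ∀ x y, P x → P y → P (x + y)) (x : M.box N) : P x :=
  induction_on x zero mk add

/-- Linear maps out of an outer tensor product. -/
def boxLift {X : Type*} [AddCommGroup X] [Module K X] (F : M →ₗ[K] N →ₗ[K] X) : M.box N →ₗ[K] X :=
  TensorProduct.lift F

@[simp] theorem boxLift_mk {X : Type*} [AddCommGroup X] [Module K X] (F : M →ₗ[K] N →ₗ[K] X) (m : M) (n : N) :
    boxLift F (boxMk M N m n) = F m n := rfl

theorem boxLift_mem {X : Type*} [AddCommGroup X] [Module K X] {deg : ℤ → Submodule K X} {F : M →ₗ[K] N →ₗ[K] X}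
    (hF : ∀ i j, ∀ m ∈ M.deg i, ∀ n ∈ N.deg j, F m n ∈ deg (i + j)) {k : ℤ} {x : M.box N}
    (hx : x ∈ (M.box N).deg k) : boxLift F x ∈ deg k := by
  induction hx using span_induction with
  | mem t ht =>
    obtain ⟨i, j, m, hm, n, hn, rfl, rfl⟩ := ht
    exact hF i j m hm n hn
  | zero => rw [map_zero]; exact zero_mem _
  | add a b _ _ ha hb => rw [map_add]; exact add_mem ha hb
  | smul c a _ ha => rw [map_smul]; exact Submodule.smul_mem _ c ha

theorem box_deg_le {k : ℤ} {S : Submodule K (M.box N)}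
    (h : ∀ i j, i + j = k → ∀ m ∈ M.deg i, ∀ n ∈ N.deg j, boxMk M N m n ∈ S) : (M.box N).deg k ≤ S :=
  span_le.2 fun _ ⟨i, j, m, hm, n, hn, e, h'⟩ => h' ▸ h i j e m hm n hn

theorem map_smul_of_box {X : Type*} [AddCommGroup X] [Module K X] [Module (A ⊗[K] B) X] (F : M.box N →ₗ[K] X)
    (h : ∀ (a : A) (b : B) m n, F (boxMk M N (a • m) (b • n)) = (a ⊗ₜ[K] b) • F (boxMk M N m n)) (c : A ⊗[K] B)
    (x : M.box N) : F (c • x) = c • F x := by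
  induction x using box_induction with
  | zero | add => simp_all [smul_add]
  | mk m n =>
    induction c using induction_on with
    | zero | add => simp_all [add_smul]
    | tmul a b => rw [smul_boxMk, h]

/-- The outer tensor product of two maps. -/
def boxMap {M' : GrMod.{u, v, v} 𝒜} {N' : GrMod.{u, v, v} ℬ} (f : M →ₗ[A] M') (g : N →ₗ[B] N') :
    M.box N →ₗ[A ⊗[K] B] M'.box N' :=
  { boxLift ((boxMk M' N').compl₁₂ (f.restrictScalars K) (g.restrictScalars K)) with
    map_smul' := map_smul_of_box _ fun a b m n =>
      (congrArg₂ (fun x y => boxMk M' N' x y) (f.map_smul a m) (g.map_smul b n)).trans (smul_boxMk ..).symm }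

@[simp] theorem boxMap_mk {M' : GrMod.{u, v, v} 𝒜} {N' : GrMod.{u, v, v} ℬ} (f : M →ₗ[A] M') (g : N →ₗ[B] N')
    (m : M) (n : N) : boxMap f g (boxMk M N m n) = boxMk M' N' (f m) (g n) := rfl

theorem boxMap_mem_Hom0 {M' : GrMod.{u, v, v} 𝒜} {N' : GrMod.{u, v, v} ℬ} {f : M →ₗ[A] M'} {g : N →ₗ[B] N'}
    (hf : f ∈ Hom0 M M') (hg : g ∈ Hom0 N N') : boxMap f g ∈ Hom0 (M.box N) (M'.box N') :=
  fun _ _ hx => boxLift_mem (M := M) (N := N) (X := M'.box N') (deg := (M'.box N').deg)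
    (F := (boxMk M' N').compl₁₂ (f.restrictScalars K) (g.restrictScalars K))
    (fun i j m hm n hn => boxMk_mem (M := M') (N := N') rfl (hf i m hm) (hg j n hn)) hx

theorem box_hom_ext {X : Type*} [AddCommGroup X] [Module (A ⊗[K] B) X] {f g : M.box N →ₗ[A ⊗[K] B] X}
    (h : ∀ m n, f (boxMk M N m n) = g (boxMk M N m n)) : f = g := by
  ext x
  induction x using box_induction with
  | zero | add => simp_all
  | mk m n => exact h m n

theorem IsBiprod.box_left {M' M M'' : GrMod.{u, v, v} 𝒜} (h : IsBiprod M' M M'') (N : GrMod.{u, v, v} ℬ) :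
    IsBiprod (M'.box N) (M.box N) (M''.box N) := by
  obtain ⟨i, hi, p, hp, j, hj, q, hq, h1, h2, h3⟩ := h
  refine ⟨boxMap i .id, boxMap_mem_Hom0 hi id_mem_Hom0, boxMap p .id, boxMap_mem_Hom0 hp id_mem_Hom0,
    boxMap j .id, boxMap_mem_Hom0 hj id_mem_Hom0, boxMap q .id, boxMap_mem_Hom0 hq id_mem_Hom0,
    box_hom_ext fun m n => ?_, box_hom_ext fun m n => ?_, box_hom_ext fun m n => ?_⟩
  · simpa using congrArg (boxMk M' N · n) (lcongr_fun h1 m)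
  · simpa using congrArg (boxMk M'' N · n) (lcongr_fun h2 m)
  · simpa using congrArg (boxMk M N · n) (lcongr_fun h3 m)

theorem IsBiprod.box_right {N' N N'' : GrMod.{u, v, v} ℬ} (h : IsBiprod N' N N'') (M : GrMod.{u, v, v} 𝒜) :
    IsBiprod (M.box N') (M.box N) (M.box N'') := by
  obtain ⟨i, hi, p, hp, j, hj, q, hq, h1, h2, h3⟩ := h
  refine ⟨boxMap .id i, boxMap_mem_Hom0 id_mem_Hom0 hi, boxMap .id p, boxMap_mem_Hom0 id_mem_Hom0 hp,
    boxMap .id j, boxMap_mem_Hom0 id_mem_Hom0 hj, boxMap .id q, boxMap_mem_Hom0 id_mem_Hom0 hq,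
    box_hom_ext fun m n => ?_, box_hom_ext fun m n => ?_, box_hom_ext fun m n => ?_⟩
  · simpa using congrArg (boxMk M N' m) (lcongr_fun h1 n)
  · simpa using congrArg (boxMk M N'' m) (lcongr_fun h2 n)
  · simpa using congrArg (boxMk M N m) (lcongr_fun h3 n)

theorem GrMod.IsFGProj.box (hM : M.IsFGProj) (hN : N.IsFGProj) : (M.box N).IsFGProj := by
  obtain ⟨_, x, f, hf⟩ := hM.exists_dualBasis
  obtain ⟨_, y, g, hg⟩ := hN.exists_dualBasis
  have hlin : ∀ i j, ∃ F : M.box N →ₗ[A ⊗[K] B] A ⊗[K] B, ∀ m n, F (boxMk M N m n) = f i m ⊗ₜ g j n :=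
    fun i j => ⟨{ boxLift ((TensorProduct.mk K A B).compl₁₂ ((f i).restrictScalars K) ((g j).restrictScalars K)) with
      map_smul' := map_smul_of_box _ fun a b m n => by simp }, fun m n => rfl⟩
  choose F hF using hlin
  refine isFGProj_of_dualBasis (ι := Fin _ × Fin _) (fun p => boxMk M N (x p.1) (y p.2)) (fun p => F p.1 p.2) fun t => ?_
  induction t using box_induction with
  | zero | add => simp_all [add_smul, sum_add_distrib]
  | mk m n =>
    simp only [hF, smul_boxMk]
    conv_rhs => rw [← hf m, ← hg n]
    simp only [map_sum, lsum_apply, Fintype.sum_prod_type]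
    exact sum_comm

theorem box_shift_left (m : ℤ) : GrIso ((M.shift m).box N) ((M.box N).shift m) :=
  ⟨.refl _ _, fun k x hx => by
    refine span_mono (M := M.box N) ?_ hx
    rintro _ ⟨i, j, a, ha, b, hb, h, rfl⟩
    exact ⟨i - m, j, a, ha, b, hb, by omega, rfl⟩⟩

theorem box_shift_right (m : ℤ) : GrIso (M.box (N.shift m)) ((M.box N).shift m) :=
  ⟨.refl _ _, fun k x hx => by
    refine span_mono (M := M.box N) ?_ hx
    rintro _ ⟨i, j, a, ha, b, hb, h, rfl⟩
    exact ⟨i, j - m, a, ha, b, hb, by omega, rfl⟩⟩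

end BoxAPI

section IndAPI
variable {K : Type u} [Field K] {A B : Type v} [Ring A] [Algebra K A] [Ring B] [Algebra K B]
  {𝒜 : ℤ → Submodule K A} {ℬ : ℤ → Submodule K B} [GradedAlgebra 𝒜] [GradedAlgebra ℬ]
  (φ : Hom 𝒜 ℬ) {M N N' : GrMod.{u, v, v} 𝒜}

theorem ind_hom_ext {X : Type*} [AddCommGroup X] [Module B X] {f g : ind φ N →ₗ[B] X}
    (h : ∀ n, f (indUnit φ N n) = g (indUnit φ N n)) : f = g := by
  ext x
  induction x using ind_induction with
  | zero | add => simp_all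
  | smul b n => rw [map_smul, map_smul, h]

theorem ind_hom_mem {X : GrMod.{u, v, v} ℬ} {f : ind φ N →ₗ[B] X}
    (h : ∀ k, ∀ n ∈ N.deg k, f (indUnit φ N n) ∈ X.deg k) : f ∈ Hom0 (ind φ N) X := by
  intro k x hx
  refine ind_deg_induction (P := fun x => f x ∈ X.deg k) ?_ ?_ ?_ ?_ hx
  · rw [map_zero]; exact zero_mem _
  · intro i j hij b hb n hn
    rw [map_smul, ← hij]
    exact X.smul_mem _ _ _ hb _ (h j n hn)
  · intro x y hx hy; rw [map_add]; exact add_mem hx hy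
  · intro c x hx
    rw [← LinearMap.restrictScalars_apply K, map_smul]; exact Submodule.smul_mem _ c hx

theorem exists_indMap (f : N →ₗ[A] N') : ∃ g : ind φ N →ₗ[B] ind φ N', ∀ n, g (indUnit φ N n) = indUnit φ N' (f n) :=
  exists_ind_lift' (φ := φ) (N := N) (indUnit φ N' ∘ₗ f.restrictScalars K) fun a n => by
    simp [smul_indUnit]

/-- Induction of maps. -/
def indMap (f : N →ₗ[A] N') : ind φ N →ₗ[B] ind φ N' := (exists_indMap φ f).choose
@[simp] theorem indMap_unit (f : N →ₗ[A] N') (n : N) : indMap φ f (indUnit φ N n) = indUnit φ N' (f n) :=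
  (exists_indMap φ f).choose_spec n

theorem indMap_mem_Hom0 {f : N →ₗ[A] N'} (hf : f ∈ Hom0 N N') : indMap φ f ∈ Hom0 (ind φ N) (ind φ N') :=
  ind_hom_mem φ fun k n hn => by rw [indMap_unit]; exact indUnit_mem (hf k n hn)

theorem IsBiprod.ind {M' M M'' : GrMod.{u, v, v} 𝒜} (h : IsBiprod M' M M'') :
    IsBiprod (ind φ M') (ind φ M) (ind φ M'') := by
  obtain ⟨i, hi, p, hp, j, hj, q, hq, h1, h2, h3⟩ := h
  refine ⟨indMap φ i, indMap_mem_Hom0 φ hi, indMap φ p, indMap_mem_Hom0 φ hp,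
    indMap φ j, indMap_mem_Hom0 φ hj, indMap φ q, indMap_mem_Hom0 φ hq,
    ind_hom_ext φ fun m => ?_, ind_hom_ext φ fun m => ?_, ind_hom_ext φ fun m => ?_⟩
  · simpa using congrArg (indUnit φ M') (lcongr_fun h1 m)
  · simpa using congrArg (indUnit φ M'') (lcongr_fun h2 m)
  · simpa using congrArg (indUnit φ M) (lcongr_fun h3 m)

theorem GrMod.IsFGProj.ind (hN : N.IsFGProj) : (ind φ N).IsFGProj := by
  obtain ⟨_, x, f, hf⟩ := hN.exists_dualBasis
  have := fun i => exists_ind_lift' (φ := φ) (N := N) (X := B) (φ.toLin ∘ₗ (f i).restrictScalars K) fun a n => by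
    simp [φ.map_mul]
  choose g hg using this
  refine isFGProj_of_dualBasis (fun i => indUnit φ N (x i)) g fun t => ?_
  induction t using ind_induction with
  | zero | add => simp_all [add_smul, sum_add_distrib]
  | smul b n =>
    conv_rhs => rw [← hf n, map_sum, smul_sum]
    refine sum_congr rfl fun i _ => ?_
    rw [map_smul, hg, smul_eq_mul, mul_smul, smul_indUnit]; rfl

theorem ind_shift (m : ℤ) : GrIso (Gr.ind φ (N.shift m)) ((Gr.ind φ N).shift m) :=
  ⟨.refl _ _, ind_hom_mem φ (N := N.shift m) (X := (Gr.ind φ N).shift m) (f := LinearMap.id (M := Gr.ind φ N)) fun _ _ hn =>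
    indUnit_mem (N := N) hn⟩

/-- A criterion for `M` to be isomorphic to the module induced from `N`. -/
theorem ind_iso_of {M : GrMod.{u, v, v} ℬ} (η : N →ₗ[K] M) (h1 : ∀ (a : A) n, η (a • n) = φ.toLin a • η n)
    (h2 : ∀ k, ∀ n ∈ N.deg k, η n ∈ M.deg k)
    (h3 : ∀ x : M, x ∈ span B (Set.range η)) (θ : M →ₗ[K] Gr.ind φ N)
    (h4 : ∀ (b : B) n, θ (b • η n) = b • indUnit φ N n) : GrIso (Gr.ind φ N) M := by
  obtain ⟨f, hf⟩ := exists_ind_lift' η h1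
  refine ⟨.ofBijective f ⟨?_, ?_⟩, ind_hom_mem φ fun k n hn => by
    change f (indUnit φ N n) ∈ _
    rw [hf]; exact h2 k n hn⟩
  · refine Function.LeftInverse.injective (g := θ) fun x => ?_
    induction x using ind_induction with
    | zero | add => simp_all
    | smul b n => rw [map_smul, hf, h4]
  · rw [← LinearMap.range_eq_top, eq_top_iff]
    rintro x -
    refine span_le.2 ?_ (h3 x)
    rintro _ ⟨n, rfl⟩
    exact ⟨indUnit φ N n, hf n⟩

variable {C D : Type v} [Ring C] [Algebra K C] [Ring D] [Algebra K D]
  {𝒞 : ℤ → Submodule K C} {𝒟 : ℤ → Submodule K D} [GradedAlgebra 𝒞] [GradedAlgebra 𝒟]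

/-- The identity. -/
def Hom.id (𝒜 : ℤ → Submodule K A) : Hom 𝒜 𝒜 := ⟨.id, fun _ _ => rfl, fun _ _ h => h⟩
/-- Composition. -/
def Hom.comp {𝒜 : ℤ → Submodule K A} {ℬ : ℤ → Submodule K B} {𝒞 : ℤ → Submodule K C} (ψ : Hom ℬ 𝒞) (φ : Hom 𝒜 ℬ) : Hom 𝒜 𝒞 :=
  ⟨ψ.toLin ∘ₗ φ.toLin, fun a b => by simp [φ.map_mul, ψ.map_mul], fun n a h => ψ.map_deg n _ (φ.map_deg n a h)⟩

theorem ind_id : GrIso (Gr.ind (Hom.id 𝒜) N) N :=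
  ind_iso_of _ .id (fun _ _ => rfl) (fun _ _ h => h) (fun x => subset_span ⟨x, rfl⟩) (indUnit _ N)
    fun b n => smul_indUnit (φ := Hom.id 𝒜) b n

theorem ind_ind (ψ : Hom ℬ 𝒞) : GrIso (Gr.ind (ψ.comp φ) N) (Gr.ind ψ (Gr.ind φ N)) := by
  obtain ⟨g, hg⟩ := exists_ind_lift (φ := φ) (N := N) (X := Gr.ind (ψ.comp φ) N)
    (((Algebra.lsmul K K (Gr.ind (ψ.comp φ) N)).toLinearMap ∘ₗ ψ.toLin).compl₂ (indUnit (ψ.comp φ) N))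
    fun b a n => by
      simp only [LinearMap.compl₂_apply, comp_apply, AlgHom.toLinearMap_apply, Algebra.lsmul_coe,
        ψ.map_mul, mul_smul, smul_indUnit]
      rfl
  have hg' : ∀ b x, g (b • x) = ψ.toLin b • g x := fun b x => by
    induction x using ind_induction with
    | zero | add => simp_all [smul_add]
    | smul c n =>
      rw [smul_smul, hg, hg]
      simp [ψ.map_mul, mul_smul]
  obtain ⟨θ, hθ⟩ := exists_ind_lift' (φ := ψ) g hg'
  refine ind_iso_of _ (indUnit ψ _ ∘ₗ indUnit φ N) ?_ ?_ ?_ (θ.restrictScalars K) ?_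
  · intro a n
    rw [comp_apply, smul_indUnit, smul_indUnit]; rfl
  · exact fun k n hn => indUnit_mem (indUnit_mem hn)
  · intro x
    induction x using ind_induction with
    | zero | add => simp_all [add_mem]
    | smul c x =>
      refine Submodule.smul_mem _ _ ?_
      induction x using ind_induction with
      | zero | add => simp_all [add_mem]
      | smul b n =>
        rw [smul_indUnit]
        exact Submodule.smul_mem _ _ (subset_span ⟨n, rfl⟩)
  · intro c n
    have h1 := hg 1 n
    rw [one_smul] at h1
    simp only [comp_apply, LinearMap.restrictScalars_apply, map_smul, hθ, h1, LinearMap.compl₂_apply,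
      AlgHom.toLinearMap_apply, Algebra.lsmul_coe]
    congr 1
    rw [← one_smul_indUnit n, smul_smul]
    change (ψ.toLin 1 * ψ.toLin (φ.toLin 1)) • _ = ψ.toLin (φ.toLin 1) • _
    rw [← ψ.map_mul, one_mul]

theorem ind_congr {N' : GrMod.{u, v, v} 𝒞} (φ' : Hom 𝒞 ℬ) (σ : A → C) (hσ : Function.Surjective σ)
    (h : ∀ a, φ'.toLin (σ a) = φ.toLin a) (e : N ≃ₗ[K] N') (he : ∀ (a : A) n, e (a • n) = σ a • e n)
    (hd : ∀ k, ∀ n ∈ N.deg k, e n ∈ N'.deg k) : GrIso (Gr.ind φ N) (Gr.ind φ' N') := by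
  obtain ⟨θ, hθ⟩ := exists_ind_lift' (φ := φ') (N := N') (indUnit φ N ∘ₗ e.symm.toLinearMap) fun c n => by
    obtain ⟨a, rfl⟩ := hσ c
    have : e.symm (σ a • n) = a • e.symm n := by
      rw [LinearEquiv.symm_apply_eq, he, e.apply_symm_apply]
    simp [this, smul_indUnit, h]
  refine ind_iso_of _ (indUnit φ' N' ∘ₗ e.toLinearMap) (fun a n => ?_)
    (fun k n hn => indUnit_mem (hd k n hn)) (fun x => ?_) (θ.restrictScalars K) fun b n => ?_
  · simp [he, smul_indUnit, h]
  · induction x using ind_induction with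
    | zero | add => simp_all [add_mem]
    | smul b n => exact Submodule.smul_mem _ _ (subset_span ⟨e.symm n, by simp⟩)
  · simp [hθ]

theorem ind_box (ψ : Hom 𝒞 𝒟) (Y : GrMod.{u, v, v} 𝒞) :
    GrIso (Gr.ind (φ.tensor ψ) (N.box Y)) ((Gr.ind φ N).box (Gr.ind ψ Y)) := by
  set Z := Gr.ind (φ.tensor ψ) (N.box Y)
  have hun : ∀ (b : B) (d : D) (a : A) (c : C) (n : N) (y : Y), ((b * φ.toLin a) ⊗ₜ[K] (d * ψ.toLin c)) •
      indUnit (φ.tensor ψ) (N.box Y) (boxMk N Y n y) =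
      (b ⊗ₜ[K] d) • indUnit (φ.tensor ψ) (N.box Y) (boxMk N Y (a • n) (c • y)) := by
    intro b d a c n y
    rw [← smul_boxMk, smul_indUnit, smul_smul]
    simp [Hom.tensor]
  let S : B ⊗[K] D →ₗ[K] N.box Y →ₗ[K] Z := (Algebra.lsmul K K Z).toLinearMap.compl₂ (indUnit (φ.tensor ψ) (N.box Y))
  let f : D →ₗ[K] Y →ₗ[K] B →ₗ[K] N →ₗ[K] Z := LinearMap.mk₂ K
    (fun d y => S.compl₁₂ ((TensorProduct.mk K B D).flip d) ((boxMk N Y).flip y))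
    (fun _ _ _ => by ext; simp) (fun _ _ _ => by ext; simp) (fun _ _ _ => by ext; simp) (fun _ _ _ => by ext; simp)
  have hf : ∀ d y b n, f d y b n = (b ⊗ₜ[K] d) • indUnit (φ.tensor ψ) (N.box Y) (boxMk N Y n y) := fun _ _ _ _ => rfl
  have hun1 : ∀ (b : B) (d : D) (n : N) (y : Y), (b ⊗ₜ[K] d) • indUnit (φ.tensor ψ) (N.box Y) (boxMk N Y n y) =
      ((b * φ.toLin 1) ⊗ₜ[K] (d * ψ.toLin 1)) • indUnit (φ.tensor ψ) (N.box Y) (boxMk N Y n y) := fun b d n y => by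
    rw [hun, one_smul, one_smul]
  obtain ⟨G, hG⟩ := exists_ind_lift (φ := ψ) (N := Y) f fun d c y => by
    ext b n
    rw [hf, hf, hun1, mul_assoc, ← ψ.map_mul, mul_one, hun, one_smul]
  let f2 : B →ₗ[K] N →ₗ[K] Gr.ind ψ Y →ₗ[K] Z := LinearMap.mk₂ K
    (fun b n => LinearMap.applyₗ n ∘ₗ LinearMap.applyₗ b ∘ₗ G)
    (fun _ _ _ => by ext; simp) (fun _ _ _ => by ext; simp) (fun _ _ _ => by ext; simp) (fun _ _ _ => by ext; simp)
  have hf2 : ∀ b n d y, f2 b n (d • indUnit ψ Y y) =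
      (b ⊗ₜ[K] d) • indUnit (φ.tensor ψ) (N.box Y) (boxMk N Y n y) := fun b n d y => by
    rw [← hf, ← hG]; rfl
  obtain ⟨G2, hG2⟩ := exists_ind_lift (φ := φ) (N := N) f2 fun b a n => by
    ext t
    induction t using ind_induction with
    | zero => simp
    | add x y hx hy => rw [map_add, map_add, hx, hy]
    | smul d y => rw [hf2, hf2, hun1, mul_assoc, ← φ.map_mul, mul_one, hun, one_smul]
  refine ind_iso_of _ (boxLift ((boxMk _ _).compl₁₂ (indUnit φ N) (indUnit ψ Y))) ?_ ?_ ?_ (boxLift G2) ?_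
  · intro c n
    induction n using box_induction with
    | zero => simp
    | add x y hx hy => simp only [map_add, smul_add, hx, hy]
    | mk m n =>
      induction c using induction_on with
      | zero => simp
      | add x y hx hy => simp only [map_add, add_smul, hx, hy]
      | tmul a c =>
        rw [smul_boxMk, boxLift_mk, boxLift_mk, LinearMap.compl₁₂_apply, LinearMap.compl₁₂_apply,
          smul_indUnit, smul_indUnit, ← smul_boxMk]
        rfl
  · exact fun k n hn => boxLift_mem (deg := ((Gr.ind φ N).box (Gr.ind ψ Y)).deg)
      (F := (boxMk _ _).compl₁₂ (indUnit φ N) (indUnit ψ Y))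
      (fun i j m hm n hn => boxMk_mem (M := Gr.ind φ N) (N := Gr.ind ψ Y) rfl (indUnit_mem hm) (indUnit_mem hn)) hn
  · intro x
    induction x using box_induction with
    | zero => exact zero_mem _
    | add x y hx hy => exact add_mem hx hy
    | mk m n =>
      induction m using ind_induction with
      | zero => simp
      | add x y hx hy => rw [map_add, ladd_apply]; exact add_mem hx hy
      | smul b m =>
        induction n using ind_induction with
        | zero => simp
        | add x y hx hy => rw [map_add]; exact add_mem hx hy
        | smul d n =>
          rw [← smul_boxMk]
          exact Submodule.smul_mem _ _ (subset_span ⟨boxMk N Y m n, rfl⟩)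
  · intro c n
    induction n using box_induction with
    | zero => simp
    | add x y hx hy => simp only [map_add, smul_add, hx, hy]
    | mk m n =>
      induction c using induction_on with
      | zero => simp
      | add x y hx hy => simp only [map_add, add_smul, hx, hy]
      | tmul b d =>
        rw [boxLift_mk, LinearMap.compl₁₂_apply, smul_boxMk, boxLift_mk, hG2, hf2]

end IndAPI

section ResAPI
variable {K : Type u} [Field K] {A B : Type v} [Ring A] [Algebra K A] [Ring B] [Algebra K B]
  {𝒜 : ℤ → Submodule K A} {ℬ : ℤ → Submodule K B} [GradedAlgebra 𝒜] [GradedAlgebra ℬ]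
  (φ : Hom 𝒜 ℬ) {M N N' : GrMod.{u, v, v} ℬ}

/-- Restriction of maps. -/
def resMap (f : N →ₗ[B] N') : res φ N →ₗ[A] res φ N' :=
  { resProj φ N' ∘ₗ f.restrictScalars K ∘ₗ resIncl φ N with
    map_smul' := fun a x => resIncl_injective (by
      change φ.toLin 1 • f (φ.toLin a • resIncl φ N x) = φ.toLin a • φ.toLin 1 • f (resIncl φ N x)
      rw [map_smul, smul_smul, smul_smul, ← φ.map_mul, ← φ.map_mul, one_mul, mul_one]) }

theorem resIncl_resMap (f : N →ₗ[B] N') (x : res φ N) : resIncl φ N' (resMap φ f x) = f (resIncl φ N x) := by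
  change φ.toLin 1 • f (resIncl φ N x) = _
  rw [← map_smul, one_smul_resIncl]

theorem resMap_mem_Hom0 {f : N →ₗ[B] N'} (hf : f ∈ Hom0 N N') : resMap φ f ∈ Hom0 (res φ N) (res φ N') :=
  fun n x hx => by
    rw [mem_res_deg, resIncl_resMap]; exact hf n _ hx

theorem IsBiprod.res {M' M M'' : GrMod.{u, v, v} ℬ} (h : IsBiprod M' M M'') :
    IsBiprod (res φ M') (res φ M) (res φ M'') := by
  obtain ⟨i, hi, p, hp, j, hj, q, hq, h1, h2, h3⟩ := h
  refine ⟨resMap φ i, resMap_mem_Hom0 φ hi, resMap φ p, resMap_mem_Hom0 φ hp,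
    resMap φ j, resMap_mem_Hom0 φ hj, resMap φ q, resMap_mem_Hom0 φ hq,
    lin_ext fun m => resIncl_injective ?_, lin_ext fun m => resIncl_injective ?_,
    lin_ext fun m => resIncl_injective ?_⟩
  · simpa [resIncl_resMap] using lcongr_fun h1 _
  · simpa [resIncl_resMap] using lcongr_fun h2 _
  · simpa [resIncl_resMap] using lcongr_fun h3 _

theorem res_shift (m : ℤ) : GrIso (Gr.res φ (N.shift m)) ((Gr.res φ N).shift m) :=
  ⟨.refl _ _, fun _ _ h => h⟩

/-- A finite generating system, with coordinates, of `φ(1) B` as a left module. -/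
def HasLeftBasis : Prop := ∃ (n : ℕ) (x : Fin n → B) (F : Fin n → B →ₗ[K] A),
  (∀ s, φ.toLin 1 * x s = x s) ∧ (∀ s a y, F s (φ.toLin a * y) = a * F s y) ∧
  ∀ y, ∑ s, φ.toLin (F s y) * x s = φ.toLin 1 * y

variable {φ}
theorem GrMod.IsFGProj.res (hφ : HasLeftBasis φ) (hN : N.IsFGProj) : (res φ N).IsFGProj := by
  obtain ⟨k, x, F, h1, h2, h3⟩ := hφ
  obtain ⟨l, y, f, hf⟩ := hN.exists_dualBasis
  have hx : ∀ p : Fin k × Fin l, ∃ z : Gr.res φ N, resIncl φ N z = x p.1 • y p.2 := fun p =>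
    exists_resIncl (by rw [smul_smul, h1])
  choose z hz using hx
  let g : Fin k × Fin l → Gr.res φ N →ₗ[A] A := fun p =>
    { F p.1 ∘ₗ (f p.2).restrictScalars K ∘ₗ resIncl φ N with
      map_smul' := fun a m => by
        change F p.1 (f p.2 (φ.toLin a • resIncl φ N m)) = a * F p.1 (f p.2 (resIncl φ N m))
        rw [map_smul, smul_eq_mul, h2] }
  refine isFGProj_of_dualBasis z g fun m => resIncl_injective ?_
  have h4 : ∀ p, resIncl φ N (g p m • z p) = (φ.toLin (F p.1 (f p.2 (resIncl φ N m))) * x p.1) • y p.2 := fun p => by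
    rw [resIncl_smul, hz, smul_smul]; rfl
  simp only [map_sum, h4, Fintype.sum_prod_type]
  rw [sum_comm]
  simp only [← Finset.sum_smul, h3]
  simp only [mul_smul]
  rw [← smul_sum, hf, one_smul_resIncl]

variable {C D : Type v} [Ring C] [Algebra K C] [Ring D] [Algebra K D]
  {𝒞 : ℤ → Submodule K C} {𝒟 : ℤ → Submodule K D} [GradedAlgebra 𝒞] [GradedAlgebra 𝒟]

theorem HasLeftBasis.tensor {φ : Hom 𝒜 ℬ} {ψ : Hom 𝒞 𝒟} (hφ : HasLeftBasis φ) (hψ : HasLeftBasis ψ) :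
    HasLeftBasis (φ.tensor ψ) := by
  obtain ⟨k, x, F, h1, h2, h3⟩ := hφ
  obtain ⟨l, y, G, h4, h5, h6⟩ := hψ
  refine ⟨k * l, fun p => x (finProdFinEquiv.symm p).1 ⊗ₜ y (finProdFinEquiv.symm p).2,
    fun p => TensorProduct.map (F (finProdFinEquiv.symm p).1) (G (finProdFinEquiv.symm p).2), ?_, ?_, ?_⟩
  · intro p; simp [Hom.tensor, one_def, h1, h4]
  · intro p a y
    induction y using induction_on with
    | zero | add => simp_all [mul_add]
    | tmul y z =>
      induction a using induction_on with
      | zero | add => simp_all [add_mul]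
      | tmul a c => simp [Hom.tensor, h2, h5]
  · intro t
    rw [finProdFinEquiv.symm.sum_comp (fun p : Fin k × Fin l =>
      (φ.tensor ψ).toLin (TensorProduct.map (F p.1) (G p.2) t) * x p.1 ⊗ₜ[K] y p.2), Fintype.sum_prod_type]
    induction t using induction_on with
    | zero | add => simp_all [add_mul, mul_add, sum_add_distrib]
    | tmul b d =>
      simp only [Hom.tensor, map_tmul, tmul_mul_tmul,
        one_def, ← h3 b, ← h6 d]
      rw [sum_tmul]
      exact sum_congr rfl fun s _ => by rw [tmul_sum]

theorem HasLeftBasis.of_equiv (h1 : φ.toLin 1 = 1) (e : B →ₗ[K] A) (h : ∀ a, e (φ.toLin a) = a)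
    (h' : ∀ b, φ.toLin (e b) = b) : HasLeftBasis φ := by
  refine ⟨1, fun _ => 1, fun _ => e, fun _ => by rw [mul_one, h1], fun _ a y => ?_, fun y => ?_⟩
  · conv_lhs => rw [← h' y, ← φ.map_mul, h]
  · simp [h', h1]

theorem res_box (ψ : Hom 𝒞 𝒟) (Y : GrMod.{u, v, v} 𝒟) :
    GrIso (Gr.res (φ.tensor ψ) (N.box Y)) ((Gr.res φ N).box (Gr.res ψ Y)) := by
  let f : (Gr.res φ N).box (Gr.res ψ Y) →ₗ[K] Gr.res (φ.tensor ψ) (N.box Y) :=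
    resProj (φ.tensor ψ) (N.box Y) ∘ₗ boxLift ((boxMk N Y).compl₁₂ (resIncl φ N) (resIncl ψ Y))
  have hone : (φ.tensor ψ).toLin 1 = φ.toLin 1 ⊗ₜ ψ.toLin 1 := rfl
  have hf : ∀ n y, resIncl _ _ (f (boxMk _ _ n y)) = boxMk N Y (resIncl φ N n) (resIncl ψ Y y) := fun n y => by
    simp only [f, comp_apply, resIncl_resProj, boxLift_mk, LinearMap.compl₁₂_apply, hone, smul_boxMk,
      one_smul_resIncl]
  let g : N.box Y →ₗ[K] (Gr.res φ N).box (Gr.res ψ Y) := boxLift ((boxMk _ _).compl₁₂ (resProj φ N) (resProj ψ Y))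
  have hfg : ∀ t, resIncl _ _ (f (g t)) = (φ.tensor ψ).toLin 1 • t := fun t => by
    induction t using box_induction with
    | zero | add => simp_all [smul_add]
    | mk n y => rw [hone, smul_boxMk]; exact hf _ _
  have hgf : ∀ t, g (resIncl _ _ (f t)) = t := fun t => by
    induction t using box_induction with
    | zero | add => simp_all
    | mk n y =>
      rw [hf]
      simp only [g, boxLift_mk, LinearMap.compl₁₂_apply]
      congr 1
      · congr 1
        exact resIncl_injective (one_smul_resIncl n)
      · exact resIncl_injective (one_smul_resIncl y)
  have hlin : ∀ (c : A ⊗[K] C) x, f (c • x) = c • f x := map_smul_of_box f fun a c n y => by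
    refine resIncl_injective ?_
    rw [resIncl_smul, hf, hf, show (φ.tensor ψ).toLin (a ⊗ₜ c) = φ.toLin a ⊗ₜ ψ.toLin c from rfl, smul_boxMk,
      resIncl_smul, resIncl_smul]
  refine GrIso.symm ⟨.ofBijective { f with map_smul' := hlin } ⟨?_, ?_⟩, fun k x hx => ?_⟩
  · exact Function.LeftInverse.injective (g := fun x => g (resIncl _ _ x)) hgf
  · exact fun x => ⟨g (resIncl _ _ x), resIncl_injective ((hfg _).trans (one_smul_resIncl x))⟩
  · change resIncl _ _ (f x) ∈ (N.box Y).deg k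
    have e : resIncl _ _ ∘ₗ f = boxLift ((boxMk N Y).compl₁₂ (resIncl φ N) (resIncl ψ Y)) :=
      lin_ext fun x => by
        induction x using box_induction with
        | zero | add => simp_all
        | mk m n => exact hf m n
    rw [← comp_apply, e]
    exact boxLift_mem (deg := (N.box Y).deg) (F := (boxMk N Y).compl₁₂ (resIncl φ N) (resIncl ψ Y))
      (fun i j m hm n hn => boxMk_mem (M := N) (N := Y) rfl hm hn) hx

theorem hasLeftBasis_swapMiddle : HasLeftBasis (Hom.swapMiddle 𝒜 ℬ 𝒞 𝒟) :=
  .of_equiv (map_one (tensorTensorTensorComm K K K K A B C D))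
    (tensorTensorTensorComm K K K K A B C D).symm.toLinearMap
    (tensorTensorTensorComm K K K K A B C D).symm_apply_apply
    (tensorTensorTensorComm K K K K A B C D).apply_symm_apply

theorem tensor_box_ext {X : GrMod.{u, v, v} 𝒜} {Y : GrMod.{u, v, v} 𝒞} {Z : GrMod.{u, v, v} ℬ} {W : GrMod.{u, v, v} 𝒟}
    {P : Type*} [AddCommGroup P] [Module K P]
    {f g : (A ⊗[K] B) ⊗[K] (C ⊗[K] D) →ₗ[K] (X.box Z).box (Y.box W) →ₗ[K] P}
    (h : ∀ a b c d x z y w, f ((a ⊗ₜ b) ⊗ₜ (c ⊗ₜ d)) (boxMk _ _ (boxMk X Z x z) (boxMk Y W y w)) =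
      g ((a ⊗ₜ b) ⊗ₜ (c ⊗ₜ d)) (boxMk _ _ (boxMk X Z x z) (boxMk Y W y w))) : f = g := by
  refine TensorProduct.ext_fourfold' fun a b c d => lin_ext fun t => ?_
  induction t using box_induction with
  | zero | add => simp_all
  | mk s t =>
  induction s using box_induction with
  | zero | add => simp_all
  | mk x z =>
  induction t using box_induction with
  | zero | add => simp_all
  | mk y w => exact h a b c d x z y w

theorem swap_box (X : GrMod.{u, v, v} 𝒜) (Y : GrMod.{u, v, v} 𝒞) (Z : GrMod.{u, v, v} ℬ) (W : GrMod.{u, v, v} 𝒟) :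
    GrIso (Gr.res (Hom.swapMiddle 𝒜 ℬ 𝒞 𝒟) ((X.box Y).box (Z.box W))) ((X.box Z).box (Y.box W)) := by
  have hone : (Hom.swapMiddle 𝒜 ℬ 𝒞 𝒟).toLin 1 = 1 := map_one (tensorTensorTensorComm K K K K A B C D)
  let E : (X.box Z).box (Y.box W) ≃ₗ[K] (X.box Y).box (Z.box W) := TensorProduct.tensorTensorTensorComm K X Z Y W
  have hE : ∀ x z y w, E (boxMk _ _ (boxMk _ _ x z) (boxMk _ _ y w)) = boxMk _ _ (boxMk _ _ x y) (boxMk _ _ z w) :=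
    fun x z y w => rfl
  let E' : (X.box Z).box (Y.box W) →ₗ[K] Gr.res (Hom.swapMiddle 𝒜 ℬ 𝒞 𝒟) ((X.box Y).box (Z.box W)) :=
    resProj _ _ ∘ₗ E.toLinearMap
  have hE' : ∀ t, resIncl _ _ (E' t) = E t := fun t => by
    change (Hom.swapMiddle 𝒜 ℬ 𝒞 𝒟).toLin 1 • E t = E t
    rw [hone, one_smul]
  let L₁ : (A ⊗[K] B) ⊗[K] (C ⊗[K] D) →ₗ[K] (X.box Z).box (Y.box W) →ₗ[K] (X.box Y).box (Z.box W) :=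
    (Algebra.lsmul K K ((X.box Z).box (Y.box W))).toLinearMap.compr₂ E.toLinearMap
  let L₂ : (A ⊗[K] B) ⊗[K] (C ⊗[K] D) →ₗ[K] (X.box Z).box (Y.box W) →ₗ[K] (X.box Y).box (Z.box W) :=
    (Algebra.lsmul K K ((X.box Y).box (Z.box W))).toLinearMap.compl₁₂ (Hom.swapMiddle 𝒜 ℬ 𝒞 𝒟).toLin E.toLinearMap
  have hL : L₁ = L₂ := tensor_box_ext fun a b c d x z y w => by
    change E (((a ⊗ₜ b) ⊗ₜ (c ⊗ₜ d) : (A ⊗[K] B) ⊗[K] (C ⊗[K] D)) • boxMk _ _ (boxMk X Z x z) (boxMk Y W y w)) =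
      ((a ⊗ₜ c) ⊗ₜ (b ⊗ₜ d) : (A ⊗[K] C) ⊗[K] (B ⊗[K] D)) • E (boxMk _ _ (boxMk X Z x z) (boxMk Y W y w))
    rw [smul_boxMk, smul_boxMk, smul_boxMk, hE, hE, smul_boxMk, smul_boxMk, smul_boxMk]
  have hlin : ∀ (c : (A ⊗[K] B) ⊗[K] (C ⊗[K] D)) x, E' (c • x) = c • E' x := fun c t => resIncl_injective (by
    rw [resIncl_smul, hE', hE']
    exact lcongr_fun (lcongr_fun hL c) t)
  refine GrIso.symm ⟨.ofBijective { E' with map_smul' := hlin } ⟨?_, ?_⟩, fun k x hx => ?_⟩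
  · exact Function.LeftInverse.injective (g := fun x => E.symm (resIncl _ _ x)) fun t => by
      change E.symm (resIncl _ _ (E' t)) = t
      rw [hE', E.symm_apply_apply]
  · exact fun x => ⟨E.symm (resIncl _ _ x), resIncl_injective ((hE' _).trans (E.apply_symm_apply _))⟩
  · change resIncl _ _ (E' x) ∈ ((X.box Y).box (Z.box W)).deg k
    rw [hE']
    refine box_deg_le (S := (((X.box Y).box (Z.box W)).deg k).comap E.toLinearMap) ?_ hx
    rintro i j rfl s hs t ht
    refine box_deg_le (S := (((X.box Y).box (Z.box W)).deg (i + j)).comap (E.toLinearMap ∘ₗ (boxMk _ _).flip t)) ?_ hs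
    rintro i i' rfl x hx' z hz
    refine box_deg_le (S := (((X.box Y).box (Z.box W)).deg (i + i' + j)).comap (E.toLinearMap ∘ₗ boxMk _ _ _)) ?_ ht
    rintro j j' rfl y hy w hw
    have := boxMk_mem (M := X.box Y) (N := Z.box W) (i := i + j) (j := i' + j') (k := i + i' + (j + j')) (by ring)
      (boxMk_mem rfl hx' hy) (boxMk_mem rfl hz hw)
    rwa [← hE] at this

end ResAPI
end Gr

namespace Gr

section K0Maps
variable {K : Type u} [Field K] {A B C D : Type v} [Ring A] [Algebra K A] [Ring B] [Algebra K B]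
  {𝒜 : ℤ → Submodule K A} {ℬ : ℤ → Submodule K B} [GradedAlgebra 𝒜] [GradedAlgebra ℬ]
  (φ : Hom 𝒜 ℬ)

/-- Induction of finitely generated projective modules. -/
def FGProj.ind (P : FGProj 𝒜) : FGProj ℬ := ⟨Gr.ind φ P.1, P.2.ind φ⟩
/-- Restriction of finitely generated projective modules. -/
def FGProj.res (hφ : HasLeftBasis φ) (P : FGProj ℬ) : FGProj 𝒜 := ⟨Gr.res φ P.1, P.2.res hφ⟩
/-- The outer tensor product of finitely generated projective modules. -/
def FGProj.box (P : FGProj 𝒜) (Q : FGProj ℬ) : FGProj (tensorDeg 𝒜 ℬ) := ⟨P.1.box Q.1, P.2.box Q.2⟩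

/-- Induction on Grothendieck groups. -/
def indK : K0 𝒜 →ₗ[ℤ[T;T⁻¹]] K0 ℬ :=
  K0.lift (fun P => K0.mk (P.ind φ)) (fun _ _ P'' h => K0.mk_biprod ((h.isBiprod P''.2).ind φ))
    fun P m => (K0.mk_iso (ind_shift φ m)).trans (K0.T_smul_mk m (P.ind φ)).symm
@[simp] theorem indK_mk (P : FGProj 𝒜) : indK φ (K0.mk P) = K0.mk (P.ind φ) := K0.lift_mk ..

/-- Restriction on Grothendieck groups. -/
def resK (hφ : HasLeftBasis φ) : K0 ℬ →ₗ[ℤ[T;T⁻¹]] K0 𝒜 :=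
  K0.lift (fun P => K0.mk (P.res φ hφ)) (fun _ _ P'' h => K0.mk_biprod ((h.isBiprod P''.2).res φ))
    fun P m => (K0.mk_iso (res_shift φ m)).trans (K0.T_smul_mk m (P.res φ hφ)).symm
@[simp] theorem resK_mk (hφ : HasLeftBasis φ) (P : FGProj ℬ) : resK φ hφ (K0.mk P) = K0.mk (P.res φ hφ) :=
  K0.lift_mk ..

variable (𝒜 ℬ) in
/-- Outer tensor products on Grothendieck groups. -/
def boxK : K0 𝒜 →ₗ[ℤ[T;T⁻¹]] K0 ℬ →ₗ[ℤ[T;T⁻¹]] K0 (tensorDeg 𝒜 ℬ) :=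
  K0.lift (fun P => K0.lift (fun Q => K0.mk (P.box Q))
      (fun _ _ Q'' h => K0.mk_biprod ((h.isBiprod Q''.2).box_right P.1))
      fun Q m => (K0.mk_iso (box_shift_right m)).trans (K0.T_smul_mk m (P.box Q)).symm)
    (fun P' P P'' h => K0.linear_ext fun Q => by
      rw [ladd_apply, K0.lift_mk, K0.lift_mk, K0.lift_mk]
      exact K0.mk_biprod ((h.isBiprod P''.2).box_left Q.1))
    fun P m => K0.linear_ext fun Q => by
      rw [lsmul_apply, K0.lift_mk, K0.lift_mk]
      exact (K0.mk_iso (box_shift_left m)).trans (K0.T_smul_mk m (P.box Q)).symm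
@[simp] theorem boxK_mk (P : FGProj 𝒜) (Q : FGProj ℬ) :
    boxK 𝒜 ℬ (K0.mk P) (K0.mk Q) = K0.mk (P.box Q) := by
  rw [boxK, K0.lift_mk, K0.lift_mk]

end K0Maps
end Gr

namespace QHA
open Gr

variable {K : Type u} [Field K] {I : Type v} [Finite I] {D : BorcherdsDatum I} {ν ω : I →₀ ℕ}

/-- Reflection of an elementary diagram in a horizontal line. -/
def Gen.flip : Gen I → Gen I
  | .e l => .e l
  | .x l i r => .x l i r
  | .τ l i j r => .τ l j i r

theorem Gen.flip_flip (g : Gen I) : g.flip.flip = g := by cases g <;> rfl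
theorem Gen.top_flip (g : Gen I) : g.flip.top = g.bot := by cases g <;> rfl
theorem Gen.bot_flip (g : Gen I) : g.flip.bot = g.top := by cases g <;> rfl
theorem Gen.ctx_flip (p : List I) (g : Gen I) (s : List I) : (g.ctx p s).flip = g.flip.ctx p s := by cases g <;> rfl

open MulOpposite in
theorem flip_rel {p q : FreeAlgebra K (Gen I)} (h : Rel K D ν p q) :
    FreeAlgebra.lift K (fun g : Gen I => op (gen K D ν g.flip)) p =
      FreeAlgebra.lift K (fun g : Gen I => op (gen K D ν g.flip)) q := by
  have hx : ∀ (l : List I) (i : I) (m : List I) (j : I) (r : List I) (c d : ℕ),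
      gen K D ν (.x (l ++ i :: m) j r) ^ d * (gen K D ν (.x l i (m ++ j :: r)) ^ c * gen K D ν (.e (l ++ i :: (m ++ j :: r)))) =
        gen K D ν (.e (l ++ i :: (m ++ j :: r))) * gen K D ν (.x l i (m ++ j :: r)) ^ c * gen K D ν (.x (l ++ i :: m) j r) ^ d := by
    intro l i m j r c d
    have h1 : Commute (gen K D ν (.x l i (m ++ j :: r))) (gen K D ν (.x (l ++ i :: m) j r)) := x_comm_x l i m j r
    have h2 : Commute (gen K D ν (.e (l ++ i :: (m ++ j :: r)))) (gen K D ν (.x l i (m ++ j :: r))) := by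
      rw [Commute, SemiconjBy, e_mul (by simp [Gen.top]), mul_e (by simp [Gen.bot])]
    have h3 : Commute (gen K D ν (.e (l ++ i :: (m ++ j :: r)))) (gen K D ν (.x (l ++ i :: m) j r)) := by
      rw [Commute, SemiconjBy, e_mul (by simp [Gen.top]), mul_e (by simp [Gen.bot])]
    rw [((h1.pow_pow c d).symm.mul_right (h3.pow_right d).symm).eq, (h2.pow_right c).eq]
  have hxe : ∀ (l : List I) (i : I) (r : List I) (c : ℕ),
      gen K D ν (.x l i r) ^ c * gen K D ν (.e (l ++ i :: r)) =
        gen K D ν (.e (l ++ i :: r)) * gen K D ν (.x l i r) ^ c := by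
    intro l i r c
    have h2 : Commute (gen K D ν (.e (l ++ i :: r))) (gen K D ν (.x l i r)) := by
      rw [Commute, SemiconjBy, e_mul (by simp [Gen.top]), mul_e (by simp [Gen.bot])]
    exact (h2.pow_right c).eq.symm
  have hxe' : ∀ (l : List I) (i j : I) (r : List I) (c : ℕ),
      gen K D ν (.x (l ++ [i]) j r) ^ c * gen K D ν (.e (l ++ i :: j :: r)) =
        gen K D ν (.e (l ++ i :: j :: r)) * gen K D ν (.x (l ++ [i]) j r) ^ c := fun l i j r c => by
    simpa using hxe (l ++ [i]) j r c
  have key := fun {p q : FreeAlgebra K (Gen I)} (h : Rel K D ν p q) => proj_rel h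
  refine unop_injective ?_
  cases h with
  | weight l h => simpa [fe, Gen.flip] using key (.weight l h)
  | one => simpa [fe, Gen.flip] using key .one
  | orth l l' h => simpa [fe, Gen.flip] using key (.orth l' l (Ne.symm h))
  | top g =>
    have := key (.bot g.flip)
    rw [Gen.bot_flip, map_mul] at this
    simp only [map_mul, fe, FreeAlgebra.lift_ι_apply, unop_mul, unop_op]
    exact this
  | bot g =>
    have := key (.top g.flip)
    rw [Gen.top_flip, map_mul] at this
    simp only [map_mul, fe, FreeAlgebra.lift_ι_apply, unop_mul, unop_op]
    exact this
  | interchange g g' =>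
    have := key (.interchange g.flip g'.flip)
    simp only [Gen.top_flip, Gen.bot_flip, map_mul, proj_ι] at this
    simp [Gen.ctx_flip, this]
  | quad_same l i r => simpa [fτ, Gen.flip] using key (.quad_same l i r)
  | quad_zero l i j r hij h => simpa [fe, fτ, Gen.flip] using key (.quad_zero l i j r hij h)
  | quad l i j r hij h => simpa [fe, fx, fτ, Gen.flip, hxe, hxe'] using key (.quad l i j r hij h)
  | slide_left l i j r h =>
    have h' : j ≠ i ∨ D.a j j ≤ 0 := by
      by_cases hij : j = i
      · subst hij; simpa using h
      · exact .inl hij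
    simpa [fx, fτ, Gen.flip] using key (.slide_right l j i r h')
  | slide_right l i j r h =>
    have h' : j ≠ i ∨ D.a j j ≤ 0 := by
      by_cases hij : j = i
      · subst hij; simpa using h
      · exact .inl hij
    simpa [fx, fτ, Gen.flip] using key (.slide_left l j i r h')
  | nil_left l i r h => simpa [fe, fx, fτ, Gen.flip] using key (.nil_right l i r h)
  | nil_right l i r h => simpa [fe, fx, fτ, Gen.flip] using key (.nil_left l i r h)
  | braid l i j r h hij hd =>
    have := key (.braid l i j r h hij hd)
    have hx' := fun c d => hx l i [j] i r c d
    simp only [cons_append, nil_append] at hx'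
    simpa [fe, fx, fτ, Gen.flip, mul_assoc, hx'] using this
  | braid_zero l i j k r h =>
    have := key (.braid_zero l k j i r (by rintro ⟨rfl, h'⟩; exact h ⟨rfl, h'⟩))
    simpa [fe, fx, fτ, Gen.flip, mul_assoc] using this

/-- The anti-involution of `R(ν)` reflecting diagrams in a horizontal line. -/
def flip : Alg K D ν →ₗ[K] Alg K D ν :=
  (MulOpposite.opLinearEquiv K).symm.toLinearMap ∘ₗ
    (lift K D ν (fun g => MulOpposite.op (gen K D ν g.flip)) fun _ _ h => flip_rel h).toLinearMap

theorem flip_one : flip (1 : Alg K D ν) = 1 := by simp [flip]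
theorem flip_gen (g : Gen I) : flip (gen K D ν g) = gen K D ν g.flip := by simp [flip, lift_gen]
theorem flip_mul (a b : Alg K D ν) : flip (a * b) = flip b * flip a := by simp [flip]
theorem flip_flip (a : Alg K D ν) : flip (flip a) = a := by
  induction a using Alg.induction with
  | one => rw [flip_one, flip_one]
  | add a b ha hb => rw [map_add, map_add, ha, hb]
  | smul c a ha => rw [map_smul, map_smul, ha]
  | mul g a ha => rw [flip_mul, flip_mul, ha, flip_gen, flip_gen, Gen.flip_flip]

variable {ν' : I →₀ ℕ} (h : ν + ν' = ω)

theorem flip_leftHom (a : Alg K D ν) : flip (leftHom h a) = leftHom h (flip a) := by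
  induction a using Alg.induction with
  | one =>
    rw [flip_one, leftHom_one]
    simp only [map_sum, flip_gen]; rfl
  | add a b ha hb => rw [map_add, map_add, map_add, map_add, ha, hb]
  | smul c a ha => rw [map_smul, map_smul, map_smul, map_smul, ha]
  | mul g a ha =>
    rw [leftHom_mul, flip_mul, ha, flip_mul, leftHom_mul, flip_gen, leftHom_gen, leftHom_gen, map_sum]
    simp only [flip_gen, Gen.ctx_flip]

theorem flip_rightHom (a : Alg K D ν') : flip (rightHom h a) = rightHom h (flip a) := by
  induction a using Alg.induction with
  | one =>
    rw [flip_one, rightHom_one]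
    simp only [map_sum, flip_gen]; rfl
  | add a b ha hb => rw [map_add, map_add, map_add, map_add, ha, hb]
  | smul c a ha => rw [map_smul, map_smul, map_smul, map_smul, ha]
  | mul g a ha =>
    rw [rightHom_mul, flip_mul, ha, flip_mul, rightHom_mul, flip_gen, rightHom_gen, rightHom_gen, map_sum]
    simp only [flip_gen, Gen.ctx_flip]

/-- The anti-involution of `R(ν) ⊗ R(ν')`. -/
def flip₂ : Alg K D ν ⊗[K] Alg K D ν' →ₗ[K] Alg K D ν ⊗[K] Alg K D ν' := TensorProduct.map flip flip

theorem flip₂_mul (a b : Alg K D ν ⊗[K] Alg K D ν') : flip₂ (a * b) = flip₂ b * flip₂ a := by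
  induction a using induction_on with
  | zero | add => simp_all [add_mul, mul_add]
  | tmul x y =>
    induction b using induction_on with
    | zero | add => simp_all [add_mul, mul_add]
    | tmul x' y' => simp [flip₂, flip_mul]

theorem flip₂_flip₂ (a : Alg K D ν ⊗[K] Alg K D ν') : flip₂ (flip₂ a) = a := by
  induction a using induction_on with
  | zero | add => simp_all
  | tmul x y => simp [flip₂, flip_flip]

theorem flip_block (a : Alg K D ν ⊗[K] Alg K D ν') : flip ((block h).toLin a) = (block h).toLin (flip₂ a) := by
  induction a using induction_on with
  | zero | add => simp_all
  | tmul x y =>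
    rw [block_tmul, flip_mul, flip_leftHom, flip_rightHom, ← left_right_comm]
    exact (block_tmul ..).symm

theorem hasLeftBasis_block : HasLeftBasis (block (K := K) (D := D) h) := by
  let R := blockBasis K D h
  let e := Fintype.equivFin R.ι
  have h1 : flip ((block (K := K) (D := D) h).toLin 1) = (block h).toLin 1 := by
    rw [flip_block, one_def, flip₂, map_tmul, flip_one, flip_one]
  refine ⟨_, fun s => flip (R.b (e.symm s)), fun s => flip₂ ∘ₗ R.coord (e.symm s) ∘ₗ flip, fun s => ?_,
    fun s a y => ?_, fun y => ?_⟩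
  · rw [← h1, ← flip_mul, ← R.b_mul, mul_assoc, ← (block h).map_mul, mul_one]
    exact congrArg flip (R.b_mul _)
  · simp only [comp_apply, flip_mul, flip_block, R.coord_mul, flip₂_mul, flip₂_flip₂]
  · rw [e.symm.sum_comp fun s => (block h).toLin ((flip₂ ∘ₗ R.coord s ∘ₗ flip) y) * flip (R.b s)]
    simp only [comp_apply, ← flip_block, ← flip_mul]
    rw [← map_sum, R.sum_coord, flip_mul, flip_flip, h1]

end QHA

namespace Gr

section ScalarNil
variable (K : Type u) [Field K] (E : Type v) [Ring E] [Algebra K E]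

/-- Every element of the nontrivial algebra `E` is the sum of a scalar and a nilpotent element. -/
def ScalarNil : Prop := Nontrivial E ∧ ∀ x : E, ∃ c : K, IsNilpotent (x - algebraMap K E c)

variable {K E}

theorem ScalarNil.nilpotent_mul (h : ScalarNil K E) {n : E} (hn : IsNilpotent n) (y : E) : IsNilpotent (n * y) := by
  have := h.1
  obtain ⟨c, hc⟩ := h.2 (n * y)
  by_cases h0 : c = 0
  · simpa [h0] using hc
  exfalso
  have hu : IsUnit (n * y) := by
    have := hc.isUnit_add_right_of_commute ((IsUnit.mk0 c h0).map (algebraMap K E)) (Algebra.commutes c _).symm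
    rwa [sub_add_cancel] at this
  obtain ⟨z, hz⟩ := hu.exists_right_inv
  rw [mul_assoc] at hz
  have hk : ∀ k, n ^ k * (y * z) ^ k = 1 := fun k => by
    induction k with
    | zero => simp
    | succ k ih => rw [pow_succ, pow_succ', mul_assoc, ← mul_assoc n, hz, one_mul, ih]
  obtain ⟨k, hk'⟩ := hn
  have := hk k
  rw [hk', zero_mul] at this
  exact zero_ne_one this

theorem ScalarNil.mul_nilpotent (h : ScalarNil K E) {n : E} (hn : IsNilpotent n) (y : E) : IsNilpotent (y * n) := by
  obtain ⟨k, hk⟩ := h.nilpotent_mul hn y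
  refine ⟨k + 1, ?_⟩
  rw [show (y * n) ^ (k + 1) = y * (n * y) ^ k * n by
    clear hk
    induction k with
    | zero => simp
    | succ k ih => rw [pow_succ, ih, pow_succ (n * y)]; simp only [mul_assoc], hk, mul_zero, zero_mul]

theorem ScalarNil.nilpotent_add (h : ScalarNil K E) {m n : E} (hm : IsNilpotent m) (hn : IsNilpotent n) :
    IsNilpotent (m + n) := by
  have := h.1
  obtain ⟨c, hc⟩ := h.2 (m + n)
  by_cases h0 : c = 0
  · simpa [h0] using hc
  exfalso
  have hu : IsUnit (m + n) := by
    have := hc.isUnit_add_right_of_commute ((IsUnit.mk0 c h0).map (algebraMap K E)) (Algebra.commutes c _).symm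
    rwa [sub_add_cancel] at this
  obtain ⟨z, hz⟩ := hu.exists_left_inv
  rw [mul_add] at hz
  have h1 := (h.mul_nilpotent hm z).isUnit_one_sub
  rw [← hz, add_sub_cancel_left] at h1
  exact h1.not_isNilpotent (h.mul_nilpotent hn z)

theorem ScalarNil.exists_hom (h : ScalarNil K E) : ∃ χ : E →ₐ[K] K, ∀ x, χ x = 0 ↔ IsNilpotent x := by
  have := h.1
  choose c hc using h.2
  have huniq : ∀ x d, IsNilpotent (x - algebraMap K E d) → c x = d := fun x d hd => by
    have := h.nilpotent_add hd ((hc x).neg)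
    rw [show x - algebraMap K E d + -(x - algebraMap K E (c x)) = algebraMap K E (c x - d) by rw [map_sub]; abel,
      IsNilpotent.map_iff (algebraMap K E).injective, isNilpotent_iff_eq_zero, sub_eq_zero] at this
    exact this
  refine ⟨{ toFun := c, map_one' := ?_, map_zero' := ?_, map_mul' := fun x y => ?_, map_add' := fun x y => ?_, commutes' := fun k => ?_ },
    fun x => ⟨fun hx => ?_, fun hx => ?_⟩⟩
  · exact huniq _ _ (by simp)
  · refine huniq _ _ ?_
    rw [show x * y - algebraMap K E (c x * c y) = (x - algebraMap K E (c x)) * y + algebraMap K E (c x) * (y - algebraMap K E (c y)) by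
      rw [map_mul, sub_mul, mul_sub]; abel]
    exact h.nilpotent_add (h.nilpotent_mul (hc x) y) (h.mul_nilpotent (hc y) _)
  · exact huniq _ _ (by simp)
  · refine huniq _ _ ?_
    rw [map_add, add_sub_add_comm]
    exact h.nilpotent_add (hc x) (hc y)
  · exact huniq _ _ (by simp)
  · have := hc x
    rwa [show c x = 0 from hx, map_zero, sub_zero] at this
  · exact huniq _ _ (by simpa using hx)

theorem exists_idempotent [IsAlgClosed K] [FiniteDimensional K E] [Nontrivial E] (h : ¬ ScalarNil K E) :
    ∃ e : E, e * e = e ∧ e ≠ 0 ∧ e ≠ 1 := by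
  have : ∃ x : E, ∀ c : K, ¬ IsNilpotent (x - algebraMap K E c) := by
    by_contra! h'
    exact h ⟨inferInstance, h'⟩
  obtain ⟨x, hx⟩ := this
  obtain ⟨c, hc⟩ := spectrum.nonempty_of_isAlgClosed_of_finiteDimensional K x
  set y := x - algebraMap K E c with hy
  have hu : ¬ IsUnit y := by
    rw [spectrum.mem_iff, ← IsUnit.neg_iff, neg_sub] at hc
    exact hc
  obtain ⟨n, hn⟩ := Filter.eventually_atTop.1 (LinearMap.eventually_isCompl_ker_pow_range_pow (mulLeft K y))
  have hcompl := hn (n + 1) (by omega)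
  rw [LinearMap.pow_mulLeft] at hcompl
  have hker : ∀ z : E, z ∈ LinearMap.ker (mulLeft K (y ^ (n + 1))) ↔ y ^ (n + 1) * z = 0 := fun z => Iff.rfl
  have h1 : (1 : E) ∈ LinearMap.ker (mulLeft K (y ^ (n + 1))) ⊔ range (mulLeft K (y ^ (n + 1))) := by
    rw [hcompl.sup_eq_top]; trivial
  obtain ⟨a, ha, b, ⟨z, hz⟩, hab⟩ := Submodule.mem_sup.1 h1
  rw [LinearMap.mulLeft_apply] at hz
  rw [hker] at ha
  refine ⟨a, ?_, ?_, ?_⟩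
  · have h2 : a - a * a = b * a := by rw [show b = 1 - a by rw [← hab]; abel, sub_mul, one_mul]
    have h3 : a - a * a ∈ (⊥ : Submodule K E) := by
      rw [← hcompl.inf_eq_bot]
      refine ⟨(hker _).2 ?_, ?_⟩
      · rw [mul_sub, ← mul_assoc, ha, zero_mul, sub_zero]
      · rw [h2, ← hz, mul_assoc]; exact ⟨z * a, rfl⟩
    exact (sub_eq_zero.1 h3).symm
  · rintro rfl
    rw [zero_add] at hab
    rw [hab, pow_succ', mul_assoc] at hz
    have : IsArtinianRing E := IsArtinianRing.of_finite K E
    have : IsNoetherianRing E := inferInstance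
    exact hu (IsUnit.of_mul_eq_one _ hz)
  · rintro rfl
    exact hx c ⟨n + 1, by simpa using ha⟩

theorem isNilpotent_of_mem_span [IsAlgClosed K] [FiniteDimensional K E] {S : Set E} (hS : ∀ s ∈ S, IsNilpotent s)
    (hmul : ∀ s ∈ S, ∀ y, s * y ∈ span K S) {x : E} (hx : x ∈ span K S) : IsNilpotent x := by
  classical
  have hart : IsArtinianRing E := IsArtinianRing.of_finite K E
  let J := Ring.jacobson E
  let π : E →ₐ[K] E ⧸ J := Ideal.Quotient.mkₐ K J
  have hfd : FiniteDimensional K (E ⧸ J) := .of_surjective π.toLinearMap Ideal.Quotient.mk_surjective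
  obtain ⟨n, d, hd, ⟨f⟩⟩ := IsSemisimpleRing.exists_algEquiv_pi_matrix_of_isAlgClosed K (E ⧸ J)
  have htr : ∀ y ∈ span K S, ∀ i, (f (π y) i).trace = 0 := by
    intro y hy i
    induction hy using span_induction with
    | zero | add => simp_all
    | smul c a _ ha => simp [ha]
    | mem s hs =>
      have h1 : IsNilpotent (f (π s) i) := (((hS s hs).map π).map f).map (Pi.evalRingHom _ i)
      exact (Matrix.isNilpotent_trace_of_isNilpotent h1).eq_zero
  have hmul' : ∀ y ∈ span K S, ∀ z, y * z ∈ span K S := by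
    intro y hy z
    induction hy using span_induction with
    | zero | add => simp_all [add_mul, add_mem]
    | smul c a _ ha => rw [smul_mul_assoc]; exact Submodule.smul_mem _ _ ha
    | mem s hs => exact hmul s hs z
  have hx0 : π x = 0 := by
    refine f.injective ?_
    rw [map_zero]
    funext i
    ext a b
    obtain ⟨z, hz⟩ := Ideal.Quotient.mk_surjective (I := J) (f.symm (Pi.single i (Matrix.single b a 1)))
    have h1 := htr _ (hmul' x hx z) i
    have h2 : f (π z) = Pi.single i (Matrix.single b a 1) := by
      rw [show π z = _ from hz, f.apply_symm_apply]
    rw [map_mul, map_mul, h2, Pi.mul_apply, Pi.single_eq_same] at h1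
    rw [Matrix.trace_mul_comm, Matrix.trace_single_mul] at h1
    simpa using h1
  have hxJ : x ∈ J := Ideal.Quotient.eq_zero_iff_mem.1 hx0
  obtain ⟨k, hk⟩ := IsSemiprimaryRing.isNilpotent (R := E)
  exact ⟨k, by
    have := Ideal.pow_mem_pow hxJ k
    rw [show J ^ k = 0 from hk] at this
    simpa using this⟩
end ScalarNil
end Gr

namespace Gr

section HomD
variable {K : Type u} [Field K] {A : Type v} [Ring A] [Algebra K A] {𝒜 : ℤ → Submodule K A}

/-- The homomorphisms of degree `i`. -/
def HomD (i : ℤ) (M N : GrMod.{u, v, v} 𝒜) : Submodule K (M →ₗ[A] N) where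
  carrier := {f | ∀ n, ∀ m ∈ M.deg n, f m ∈ N.deg (n + i)}
  zero_mem' _ _ _ := zero_mem _
  add_mem' hf hg n m hm := add_mem (hf n m hm) (hg n m hm)
  smul_mem' c _ hf n m hm := Submodule.smul_mem _ c (hf n m hm)

variable {L M N P : GrMod.{u, v, v} 𝒜}

theorem mem_HomD_zero {f : M →ₗ[A] N} : f ∈ HomD 0 M N ↔ f ∈ Hom0 M N :=
  ⟨fun h n m hm => by simpa using h n m hm, fun h n m hm => by simpa using h n m hm⟩
theorem comp_mem_HomD {i j k : ℤ} (h : i + j = k) {g : N →ₗ[A] P} {f : M →ₗ[A] N} (hg : g ∈ HomD j N P)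
    (hf : f ∈ HomD i M N) : g ∘ₗ f ∈ HomD k M P := fun n m hm => by
  rw [← h, ← add_assoc]; exact hg _ _ (hf n m hm)
theorem pow_mem_HomD {i : ℤ} {f : Module.End A M} (hf : f ∈ HomD i M M) (k : ℕ) : f ^ k ∈ HomD (k * i) M M := by
  induction k with
  | zero => rw [pow_zero, Nat.cast_zero, zero_mul]; exact mem_HomD_zero.2 id_mem_Hom0
  | succ k ih =>
    rw [pow_succ]
    exact comp_mem_HomD (by push_cast; ring) ih hf

variable (M) in
/-- The algebra of endomorphisms of degree `0`. -/
def End0 : Subalgebra K (Module.End A M) where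
  carrier := Hom0 M M
  mul_mem' hf hg := comp_mem_Hom0 hf hg
  add_mem' hf hg := add_mem hf hg
  algebraMap_mem' c := Submodule.smul_mem (Hom0 M M) c id_mem_Hom0

/-- The module is nonzero and every endomorphism of degree `0` is the sum of a scalar and a nilpotent
endomorphism. -/
def IsLocal (M : GrMod.{u, v, v} 𝒜) : Prop :=
  (∃ x : M, x ≠ 0) ∧ ∀ f ∈ Hom0 M M, ∃ c : K, IsNilpotent (f - c • 1 : Module.End A M)

theorem isNilpotent_val {x : End0 M} : IsNilpotent x.1 ↔ IsNilpotent x :=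
  IsNilpotent.map_iff (f := (End0 M).val) Subtype.val_injective

theorem isLocal_iff : IsLocal M ↔ ScalarNil K (End0 M) := by
  have h : ∀ (x : End0 M) (c : K), IsNilpotent (x.1 - c • 1 : Module.End A M) ↔ IsNilpotent (x - algebraMap K _ c) :=
    fun x c => isNilpotent_val (x := x - algebraMap K _ c)
  have h2 : (∃ x : M, x ≠ 0) ↔ Nontrivial (End0 M) := by
    rw [nontrivial_iff_exists_ne (0 : End0 M)]
    constructor
    · rintro ⟨x, hx⟩
      exact ⟨1, fun h => hx (lcongr_fun (congrArg Subtype.val h) x)⟩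
    · rintro ⟨f, hf⟩
      by_contra! h
      exact hf (Subtype.ext (lin_ext fun x => h _))
  exact ⟨fun ⟨h1, h3⟩ => ⟨h2.1 h1, fun x => (h3 x.1 x.2).imp fun c hc => (h x c).1 hc⟩,
    fun ⟨h1, h3⟩ => ⟨h2.2 h1, fun f hf => (h3 ⟨f, hf⟩).imp fun c hc => (h ⟨f, hf⟩ c).2 hc⟩⟩

theorem IsLocal.shift (h : IsLocal M) (m : ℤ) : IsLocal (M.shift m) :=
  ⟨h.1, fun f hf => h.2 f fun n x hx => by
    have h1 := hf (n + m) x (by change x ∈ M.deg (n + m - m); rwa [add_sub_cancel_right])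
    change _ ∈ M.deg (n + m - m) at h1
    rwa [add_sub_cancel_right] at h1⟩

theorem IsLocal.isUnit (hM : IsLocal M) {x : End0 M} (hx : ¬ IsNilpotent x) : IsUnit x := by
  obtain ⟨c, hc⟩ := (isLocal_iff.1 hM).2 x
  have h0 : c ≠ 0 := by rintro rfl; exact hx (by simpa using hc)
  have := hc.isUnit_add_right_of_commute ((IsUnit.mk0 c h0).map (algebraMap K (End0 M))) (Algebra.commutes c _).symm
  rwa [sub_add_cancel] at this

theorem IsLocal.idempotent (hM : IsLocal M) {e : End0 M} (he : e * e = e) (h0 : e ≠ 0) : e = 1 := by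
  have hn : ¬ IsNilpotent e := by
    rintro ⟨k, hk⟩
    have : ∀ k, e ^ (k + 1) = e := fun k => by
      induction k with
      | zero => simp
      | succ k ih => rw [pow_succ, ih, he]
    exact h0 ((this k).symm.trans (by rw [pow_succ, hk, zero_mul]))
  exact (hM.isUnit hn).mul_left_cancel (by rw [he, mul_one])

theorem IsLocal.grIso (hL : IsLocal L) (hM : IsLocal M) {f : L →ₗ[A] M} {g : M →ₗ[A] L} (hf : f ∈ Hom0 L M)
    (hg : g ∈ Hom0 M L) (h : ¬ IsNilpotent (g ∘ₗ f : Module.End A L)) : GrIso L M := by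
  let x : End0 L := ⟨g ∘ₗ f, comp_mem_Hom0 hg hf⟩
  obtain ⟨z, hz⟩ := (hL.isUnit (x := x) fun hx => h (isNilpotent_val.2 hx)).exists_right_inv
  have h1 : g ∘ₗ (f ∘ₗ z.1) = .id := congrArg Subtype.val hz
  have hf' : f ∘ₗ z.1 ∈ Hom0 L M := comp_mem_Hom0 hf z.2
  have h1' : ∀ x, g (f (z.1 x)) = x := fun x => lcongr_fun h1 x
  let e : End0 M := ⟨(f ∘ₗ z.1) ∘ₗ g, comp_mem_Hom0 hf' hg⟩
  have he : e = 1 := by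
    refine hM.idempotent ?_ fun h0 => ?_
    · refine Subtype.ext (lin_ext fun x => ?_)
      change f (z.1 (g (f (z.1 (g x))))) = f (z.1 (g x))
      rw [h1']
    · obtain ⟨x, hx⟩ := hL.1
      have : f (z.1 (g (f (z.1 x)))) = 0 := lcongr_fun (congrArg Subtype.val h0) (f (z.1 x))
      rw [h1'] at this
      have h2 := h1' x
      rw [this, map_zero] at h2
      exact hx h2.symm
  exact .of_comp hf' h1 (congrArg Subtype.val he)

theorem IsLocal.grIso_shift (hL : IsLocal L) (hM : IsLocal M) {i j : ℤ} (hij : i + j = 0) {f : L →ₗ[A] M} {g : M →ₗ[A] L}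
    (hf : f ∈ HomD i L M) (hg : g ∈ HomD j M L) (h : ¬ IsNilpotent (g ∘ₗ f : Module.End A L)) :
    GrIso L (M.shift (-i)) :=
  hL.grIso (hM.shift (-i)) (f := f) (g := g) (fun n m hm => by
      have := hf n m hm
      rwa [← sub_neg_eq_add] at this)
    (fun n m hm => by
      have := hg _ m hm
      rwa [show n - -i + j = n by omega] at this) h

/-- The homogeneous parts are finite dimensional, and vanish in low degrees. -/
def LocFin {V : Type*} [AddCommGroup V] [Module K V] (deg : ℤ → Submodule K V) : Prop :=
  (∀ n, FiniteDimensional K (deg n)) ∧ ∃ b, ∀ n < b, deg n = ⊥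

theorem IsLocal.shift_eq_zero (hM : IsLocal M) (hfin : LocFin M.deg) {m : ℤ} (h : GrIso M (M.shift m)) : m = 0 := by
  obtain ⟨e, he⟩ := h
  have he' : ∀ n, ∀ x ∈ M.deg n, (e.symm : M → M) x ∈ M.deg (n + m) := fun n x hx =>
    symm_mem_Hom0 (e := e) he (n + m) x (by change x ∈ M.deg (n + m - m); rwa [add_sub_cancel_right])
  obtain ⟨b, hb⟩ := hfin.2
  have hne : ∃ n, ∃ x ∈ M.deg n, x ≠ 0 := by
    by_contra! h
    obtain ⟨x, hx⟩ := hM.1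
    exact hx (GrAux.eq_zero_of_proj M.isInternal fun n => h n _ (GrAux.proj_mem _ n x))
  obtain ⟨n, x, hx, hx0⟩ := hne
  have key : ∀ k : ℕ, ∃ y ∈ M.deg (n - k * m), y ≠ 0 := fun k => by
    induction k with
    | zero => exact ⟨x, by simpa using hx, hx0⟩
    | succ k ih =>
      obtain ⟨y, hy, hy0⟩ := ih
      refine ⟨e y, ?_, fun h => hy0 (e.map_eq_zero_iff.1 h)⟩
      have := he _ y hy
      rw [show n - ((k + 1 : ℕ) : ℤ) * m = n - k * m - m by push_cast; ring]
      exact this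
  have key' : ∀ k : ℕ, ∃ y ∈ M.deg (n + k * m), y ≠ 0 := fun k => by
    induction k with
    | zero => exact ⟨x, by simpa using hx, hx0⟩
    | succ k ih =>
      obtain ⟨y, hy, hy0⟩ := ih
      refine ⟨e.symm y, ?_, fun h => hy0 (e.symm.map_eq_zero_iff.1 h)⟩
      rw [show n + ((k + 1 : ℕ) : ℤ) * m = n + k * m + m by push_cast; ring]
      exact he' _ y hy
  have hlt : ∀ k : ℕ, b ≤ n - k * m ∧ b ≤ n + k * m := fun k => by
    constructor
    · by_contra! h
      obtain ⟨y, hy, hy0⟩ := key k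
      rw [hb _ h] at hy; exact hy0 hy
    · by_contra! h
      obtain ⟨y, hy, hy0⟩ := key' k
      rw [hb _ h] at hy; exact hy0 hy
  obtain ⟨h1, h2⟩ := hlt (n - b + 1).toNat
  have h3 : (0 : ℤ) ≤ n - b := by have := hlt 0; simp at this; omega
  rw [Int.toNat_of_nonneg (by omega)] at h1 h2
  by_contra hm
  rcases lt_or_gt_of_ne hm with h | h <;> nlinarith

end HomD

section HomDual
variable {K : Type u} [Field K] {A : Type v} [Ring A] [Algebra K A] {𝒜 : ℤ → Submodule K A} [GradedAlgebra 𝒜]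
  {M N : GrMod.{u, v, v} 𝒜}

theorem proj_shift (s k : ℤ) (x : M) :
    GrAux.proj (M.shift s).isInternal k (x : M.shift s) = GrAux.proj M.isInternal (k - s) x := by
  induction x using GrAux.induction (GrAux.iSup_eq_top M.isInternal) with
  | zero => exact (map_zero _).trans (map_zero _).symm
  | add x y hx hy => exact (map_add (GrAux.proj (M.shift s).isInternal k) x y).trans ((congrArg₂ (· + ·) hx hy).trans (map_add _ x y).symm)
  | hom n x hx =>
    have hx' : x ∈ (M.shift s).deg (n + s) := by change x ∈ M.deg (n + s - s); rwa [add_sub_cancel_right]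
    by_cases h : n = k - s
    · subst h
      rw [GrAux.proj_same _ hx, sub_add_cancel] at *
      exact GrAux.proj_same (M.shift s).isInternal hx'
    · rw [GrAux.proj_ne _ h hx]
      exact GrAux.proj_ne (M.shift s).isInternal (by omega) hx'

theorem GrMod.IsFGProj.exists_homDualBasis (h : M.IsFGProj) :
    ∃ (ι : Type) (_ : Fintype ι) (d : ι → ℤ) (x : ι → M) (f : ι → M →ₗ[A] A),
      (∀ i, x i ∈ M.deg (d i)) ∧ (∀ i k, ∀ m ∈ M.deg k, f i m ∈ 𝒜 (k - d i)) ∧ ∀ m, ∑ i, f i m • x i = m := by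
  classical
  obtain ⟨n, x, f, hf⟩ := h.exists_dualBasis
  choose S hS using fun i => GrAux.exists_sum_proj M.isInternal (x i)
  let T := Finset.univ.biUnion S
  have hex : ∀ (i : Fin n) (s : ℤ), ∃ g : M →ₗ[A] A, (∀ k, ∀ m ∈ M.deg k, g m ∈ 𝒜 (k - s)) ∧ ∀ k, ∀ m ∈ M.deg k,
      g m = GrAux.proj (DirectSum.Decomposition.isInternal 𝒜) (k - s) (f i m) := fun i s => by
    obtain ⟨g, hg, hg'⟩ := exists_degZero (M := M) (N := (GrMod.self 𝒜).shift s) (f i)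
    exact ⟨g, hg, fun k m hm => (hg' k m hm).trans (proj_shift (M := GrMod.self 𝒜) s k (f i m))⟩
  choose f₀ hf₀ hf₁ using hex
  refine ⟨Fin n × T, inferInstance, fun p => p.2, fun p => GrAux.proj M.isInternal p.2 (x p.1), fun p => f₀ p.1 p.2,
    fun p => GrAux.proj_mem _ _ _, fun p k m hm => hf₀ _ _ k m hm, fun m => ?_⟩
  induction m using GrAux.induction (GrAux.iSup_eq_top M.isInternal) with
  | zero | add => simp_all [add_smul, sum_add_distrib]
  | hom k m hm =>
    have h1 : ∀ (i : Fin n) (s : ℤ), f₀ i s m • GrAux.proj M.isInternal s (x i) =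
        GrAux.proj M.isInternal k (f i m • GrAux.proj M.isInternal s (x i)) := fun i s => by
      have h2 := GrAux.proj_map (DirectSum.Decomposition.isInternal 𝒜) M.isInternal
        ((Algebra.lsmul K K M).toLinearMap.flip (GrAux.proj M.isInternal s (x i))) s
        (fun j a ha => M.smul_mem j s a ha _ (GrAux.proj_mem _ _ _)) (k - s) (f i m)
      rw [sub_add_cancel] at h2
      refine Eq.trans ?_ h2.symm
      rw [hf₁ i s k m hm]; rfl
    have h3 : ∀ i, ∑ s : T, GrAux.proj M.isInternal s (x i) = x i := fun i =>
      (Finset.sum_coe_sort T fun s => GrAux.proj M.isInternal s (x i)).trans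
        (hS i T (Finset.subset_biUnion_of_mem S (mem_univ i)))
    rw [Fintype.sum_prod_type]
    simp only [h1, ← map_sum, ← smul_sum, h3]
    rw [hf, GrAux.proj_same M.isInternal hm]

theorem GrMod.IsFGProj.locFin (h : M.IsFGProj) (h𝒜 : LocFin 𝒜) : LocFin M.deg := by
  obtain ⟨ι, _, d, x, f, hx, hf, hfx⟩ := h.exists_homDualBasis
  obtain ⟨h1, b, hb⟩ := h𝒜
  refine ⟨fun n => ?_, ?_⟩
  · let F : M.deg n →ₗ[K] (∀ i, 𝒜 (n - d i)) := LinearMap.pi fun i =>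
      ((f i).restrictScalars K ∘ₗ (M.deg n).subtype).codRestrict _ fun m => hf i n m.1 m.2
    refine FiniteDimensional.of_injective F fun m m' hm => Subtype.ext ?_
    rw [← hfx m, ← hfx m']
    exact sum_congr rfl fun i _ => congrArg (· • x i) (congrArg Subtype.val (congrFun hm i))
  · obtain ⟨c, hc⟩ := (Set.finite_range d).bddBelow
    refine ⟨b + c, fun n hn => (Submodule.eq_bot_iff _).2 fun m hm => ?_⟩
    rw [← hfx m]
    refine sum_eq_zero fun i _ => ?_
    have h2 := hf i n m hm
    have h3 : c ≤ d i := hc ⟨i, rfl⟩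
    rw [hb _ (by omega)] at h2
    rw [(mem_bot K).1 h2, zero_smul]

theorem finite_Hom0 (h : M.IsFGProj) (hN : LocFin N.deg) : FiniteDimensional K (Hom0 M N) := by
  obtain ⟨ι, _, d, x, f, hx, hf, hfx⟩ := h.exists_homDualBasis
  have := hN.1
  let F : Hom0 M N →ₗ[K] (∀ i, N.deg (d i)) :=
    { toFun := fun g i => ⟨g.1 (x i), g.2 _ _ (hx i)⟩
      map_add' := fun _ _ => rfl
      map_smul' := fun _ _ => rfl }
  refine FiniteDimensional.of_injective F fun g g' hg => Subtype.ext (lin_ext fun m => ?_)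
  rw [← hfx m, map_sum, map_sum]
  refine sum_congr rfl fun i _ => ?_
  rw [map_smul, map_smul, show g.1 (x i) = g'.1 (x i) from congrArg Subtype.val (congrFun hg i)]

theorem exists_HomD_eq_zero (h : M.IsFGProj) (hN : LocFin N.deg) : ∃ b, ∀ k < b, ∀ g ∈ HomD k M N, g = 0 := by
  obtain ⟨ι, _, d, x, f, hx, hf, hfx⟩ := h.exists_homDualBasis
  obtain ⟨-, b, hb⟩ := hN
  obtain ⟨c, hc⟩ := (Set.finite_range d).bddAbove
  refine ⟨b - c, fun k hk g hg => lin_ext fun m => ?_⟩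
  rw [← hfx m, map_sum]
  refine sum_eq_zero fun i _ => ?_
  have h2 := hg _ _ (hx i)
  have h3 : d i ≤ c := hc ⟨i, rfl⟩
  rw [hb _ (by omega)] at h2
  rw [map_smul, (mem_bot K).1 h2, smul_zero]

theorem nilpotent_of_neg (h : M.IsFGProj) (hM : LocFin M.deg) {i : ℤ} (hi : i < 0) {f : Module.End A M}
    (hf : f ∈ HomD i M M) : IsNilpotent f := by
  obtain ⟨b, hb⟩ := exists_HomD_eq_zero h hM
  refine ⟨(-b).toNat + 1, hb _ ?_ _ (pow_mem_HomD hf _)⟩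
  have : -b ≤ (-b).toNat := Int.self_le_toNat _
  push_cast
  nlinarith

theorem finrank_range_add {K V V' V'' E E' E'' : Type*} [Field K] [AddCommGroup V] [AddCommGroup V'] [AddCommGroup V'']
    [AddCommGroup E] [AddCommGroup E'] [AddCommGroup E''] [Module K V] [Module K V'] [Module K V''] [Module K E]
    [Module K E'] [Module K E''] [FiniteDimensional K V'] [FiniteDimensional K V''] {Φ : V →ₗ[K] E}
    {Φ' : V' →ₗ[K] E'} {Φ'' : V'' →ₗ[K] E''} {a' : V → V'} {a'' : V → V''} {b' : E' →ₗ[K] E} {b'' : E'' →ₗ[K] E}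
    (h : ∀ v, Φ v = b' (Φ' (a' v)) + b'' (Φ'' (a'' v))) (ha : ∀ x y, ∃ v, a' v = x ∧ a'' v = y)
    (hb : ∀ x y, b' x + b'' y = 0 → x = 0 ∧ y = 0) :
    Module.finrank K (range Φ) = Module.finrank K (range Φ') + Module.finrank K (range Φ'') := by
  let R : range Φ' × range Φ'' →ₗ[K] E :=
    LinearMap.coprod (b' ∘ₗ Submodule.subtype _) (b'' ∘ₗ Submodule.subtype _)
  have hR : Function.Injective R := (injective_iff_map_eq_zero R).2 fun y hy => by
    obtain ⟨h1, h2⟩ := hb y.1 y.2 hy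
    exact Prod.ext (Subtype.ext h1) (Subtype.ext h2)
  have hran : range R = range Φ := by
    apply le_antisymm
    · rintro _ ⟨⟨⟨_, x, rfl⟩, ⟨_, y, rfl⟩⟩, rfl⟩
      obtain ⟨v, rfl, rfl⟩ := ha x y
      exact ⟨v, h v⟩
    · rintro _ ⟨v, rfl⟩
      exact ⟨(⟨_, a' v, rfl⟩, ⟨_, a'' v, rfl⟩), (h v).symm⟩
  rw [← hran, LinearMap.finrank_range_of_inj hR, Module.finrank_prod]

/-- The finite-dimensional pairing computing the multiplicity of a local module. -/
theorem exists_mult (h𝒜 : LocFin 𝒜) {L : GrMod.{u, v, v} 𝒜} (hP : L.IsFGProj) (hL : IsLocal L) :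
    ∃ θ : K0 𝒜 →+ ℤ, ∀ M : FGProj 𝒜,
      (θ (K0.mk M) ≠ 0 ↔ ∃ f ∈ Hom0 L M.1, ∃ g ∈ Hom0 M.1 L, ¬ IsNilpotent (g ∘ₗ f : Module.End A L)) ∧
      (GrIso L M.1 → θ (K0.mk M) = 1) := by
  obtain ⟨χ, hχ⟩ := (isLocal_iff.1 hL).exists_hom
  let Φ : ∀ M : GrMod.{u, v, v} 𝒜, Hom0 M L →ₗ[K] Hom0 L M →ₗ[K] K := fun M => LinearMap.mk₂ K
    (fun g f => χ ⟨g.1 ∘ₗ f.1, comp_mem_Hom0 g.2 f.2⟩)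
    (fun g g' f => (map_add χ ⟨g.1 ∘ₗ f.1, comp_mem_Hom0 g.2 f.2⟩ ⟨g'.1 ∘ₗ f.1, comp_mem_Hom0 g'.2 f.2⟩))
    (fun c g f => (map_smul χ c ⟨g.1 ∘ₗ f.1, comp_mem_Hom0 g.2 f.2⟩))
    (fun g f f' => by
      rw [← map_add]; congr 1; exact Subtype.ext (comp_add _ _ _))
    (fun c g f => by
      rw [← map_smul]; congr 1; exact Subtype.ext (lin_ext fun x => map_smul (g.1.restrictScalars K) c (f.1 x)))
  have hfin : ∀ M : FGProj 𝒜, FiniteDimensional K (Hom0 M.1 L) := fun M => finite_Hom0 M.2 (hP.locFin h𝒜)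
  have hadd : ∀ P' P P'' : FGProj 𝒜, IsShortExact P'.1 P.1 P''.1 →
      (Module.finrank K (range (Φ P.1)) : ℤ) =
        Module.finrank K (range (Φ P'.1)) + Module.finrank K (range (Φ P''.1)) := by
    intro P' P P'' h
    obtain ⟨i, hi, p, hp, j, hj, q, hq, h1, h2, h3⟩ := h.isBiprod P''.2
    have := hfin P
    have := hfin P'
    have := hfin P''
    let pc : ∀ {P P' : GrMod.{u, v, v} 𝒜} (p : P →ₗ[A] P'), p ∈ Hom0 P P' → Hom0 L P →ₗ[K] Hom0 L P' :=
      fun {P P'} p hp =>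
        { toFun := fun f => ⟨p ∘ₗ f.1, comp_mem_Hom0 hp f.2⟩
          map_add' := fun f g => Subtype.ext (comp_add _ _ _)
          map_smul' := fun c f => Subtype.ext (lin_ext fun x => map_smul (p.restrictScalars K) c (f.1 x)) }
    have hpj : p ∘ₗ j = 0 := (isBiprod_comp h1 h2 h3).2
    have hqi : q ∘ₗ i = 0 := (isBiprod_comp h1 h2 h3).1
    rw [← Nat.cast_add, Nat.cast_inj]
    refine finrank_range_add (a' := fun g => ⟨g.1 ∘ₗ i, comp_mem_Hom0 g.2 hi⟩)
      (a'' := fun g => ⟨g.1 ∘ₗ j, comp_mem_Hom0 g.2 hj⟩) (b' := lcomp K K (pc p hp))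
      (b'' := lcomp K K (pc q hq)) (fun g => lin_ext fun f => ?_)
      (fun x y => ⟨⟨x.1 ∘ₗ p + y.1 ∘ₗ q, add_mem (comp_mem_Hom0 x.2 hp) (comp_mem_Hom0 y.2 hq)⟩,
        Subtype.ext ?_, Subtype.ext ?_⟩)
      (fun x y hxy => ⟨lin_ext fun f => ?_, lin_ext fun f => ?_⟩)
    · change χ _ = χ _ + χ _
      rw [← map_add]
      congr 1
      refine Subtype.ext ?_
      change g.1 ∘ₗ f.1 = (g.1 ∘ₗ i) ∘ₗ p ∘ₗ f.1 + (g.1 ∘ₗ j) ∘ₗ q ∘ₗ f.1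
      conv_lhs => rw [← LinearMap.id_comp f.1, ← h3]
      rw [add_comp, comp_add]; rfl
    · change (x.1 ∘ₗ p + y.1 ∘ₗ q) ∘ₗ i = _
      rw [add_comp, comp_assoc, comp_assoc, h1, hqi, LinearMap.comp_id, LinearMap.comp_zero, add_zero]
    · change (x.1 ∘ₗ p + y.1 ∘ₗ q) ∘ₗ j = _
      rw [add_comp, comp_assoc, comp_assoc, h2, hpj, LinearMap.comp_id, LinearMap.comp_zero, zero_add]
    · have := lcongr_fun hxy (pc i hi f)
      change x (pc p hp (pc i hi f)) + y (pc q hq (pc i hi f)) = 0 at this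
      rwa [show pc p hp (pc i hi f) = f from Subtype.ext (by
          change p ∘ₗ i ∘ₗ f.1 = _; rw [← comp_assoc, h1, LinearMap.id_comp]),
        show pc q hq (pc i hi f) = 0 from Subtype.ext (by
          change q ∘ₗ i ∘ₗ f.1 = _; rw [← comp_assoc, hqi, LinearMap.zero_comp]; rfl), map_zero, add_zero] at this
    · have := lcongr_fun hxy (pc j hj f)
      change x (pc p hp (pc j hj f)) + y (pc q hq (pc j hj f)) = 0 at this
      rwa [show pc q hq (pc j hj f) = f from Subtype.ext (by
          change q ∘ₗ j ∘ₗ f.1 = _; rw [← comp_assoc, h2, LinearMap.id_comp]),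
        show pc p hp (pc j hj f) = 0 from Subtype.ext (by
          change p ∘ₗ j ∘ₗ f.1 = _; rw [← comp_assoc, hpj, LinearMap.zero_comp]; rfl), map_zero, zero_add] at this
  have hΦ : ∀ (M : GrMod.{u, v, v} 𝒜) (g : Hom0 M L) (f : Hom0 L M),
      Φ M g f = 0 ↔ IsNilpotent (g.1 ∘ₗ f.1 : Module.End A L) := fun M g f =>
    (hχ _).trans (isNilpotent_val (x := ⟨g.1 ∘ₗ f.1, comp_mem_Hom0 g.2 f.2⟩)).symm
  refine ⟨K0.liftAdd (fun M => Module.finrank K (range (Φ M.1))) hadd, fun M => ⟨?_, fun h => ?_⟩⟩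
  · have := hfin M
    rw [K0.liftAdd_mk, Nat.cast_ne_zero, Ne, Submodule.finrank_eq_zero, LinearMap.range_eq_bot, not_iff_comm]
    push Not
    exact ⟨fun h => lin_ext fun g => lin_ext fun f => (hΦ _ g f).2 (h _ f.2 _ g.2),
      fun h f hf g hg => (hΦ _ ⟨g, hg⟩ ⟨f, hf⟩).1 (by rw [h]; rfl)⟩
  · rw [← K0.mk_iso (P := ⟨L, hP⟩) h]
    refine (K0.liftAdd_mk _ hadd _).trans (congrArg Nat.cast (?_ : Module.finrank K (range (Φ L)) = 1))
    have h1 : ∀ g f : End0 L, Φ L g f = χ g * χ f := fun g f => map_mul χ g f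
    have h3 : ∀ g : End0 L, Φ L g = χ g • Φ L (1 : End0 L) := fun g => lin_ext fun f => by
      refine (h1 g f).trans ?_
      rw [lsmul_apply]
      refine congrArg (χ g * ·) ?_
      exact ((h1 1 f).trans (by rw [map_one, one_mul])).symm
    have h2 : range (Φ L) = span K {Φ L (1 : End0 L)} := by
      apply le_antisymm
      · rintro _ ⟨g, rfl⟩
        exact (h3 g).symm ▸ Submodule.smul_mem _ _ (Submodule.mem_span_singleton_self _)
      · rw [Submodule.span_singleton_le_iff_mem]
        exact ⟨_, rfl⟩
    rw [h2]
    refine finrank_span_singleton fun h0 => ?_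
    have : χ 1 * χ 1 = 0 := (h1 1 1).symm.trans (lcongr_fun h0 (1 : End0 L))
    simp at this

end HomDual
end Gr

open LaurentPolynomial
namespace Gr

section Sub
variable {K : Type u} [Field K] {A : Type v} [Ring A] [Algebra K A] {𝒜 : ℤ → Submodule K A}

theorem GrMod.IsHomogeneous.proj_mem {M : GrMod.{u, v, v} 𝒜} {F : Submodule A M} (hF : M.IsHomogeneous F) (n : ℤ) {x : M}
    (hx : x ∈ F) : GrAux.proj M.isInternal n x ∈ F := by
  have hx' : x ∈ ⨆ n, F.restrictScalars K ⊓ M.deg n := by rw [← hF]; exact hx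
  induction hx' using Submodule.iSup_induction' with
  | mem k x h =>
    by_cases hk : k = n
    · subst hk; rw [GrAux.proj_same _ h.2]; exact h.1
    · rw [GrAux.proj_ne _ hk h.2]; exact zero_mem _
  | zero => rw [map_zero]; exact zero_mem _
  | add a b ha hb iha ihb =>
    rw [← hF] at ha hb
    rw [map_add]; exact add_mem (iha ha) (ihb hb)

/-- A homogeneous submodule, as a graded module. -/
def GrMod.sub (M : GrMod.{u, v, v} 𝒜) (F : Submodule A M) (hF : ∀ n, ∀ x ∈ F, GrAux.proj M.isInternal n x ∈ F) :
    GrMod.{u, v, v} 𝒜 where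
  carrier := F
  deg n := (M.deg n).comap (F.subtype.restrictScalars K)
  isInternal := by
    obtain ⟨c, hc⟩ := GrAux.exists_coaction M.isInternal
    obtain ⟨r, hr⟩ := LinearMap.exists_leftInverse_of_injective (F.subtype.restrictScalars K)
      (LinearMap.ker_eq_bot.2 Subtype.val_injective)
    refine GrAux.isInternal_of _ ?_ (Finsupp.mapRange.linearMap r ∘ₗ c ∘ₗ F.subtype.restrictScalars K) fun n x hx => ?_
    · rw [eq_top_iff]
      rintro x -
      obtain ⟨S, hS⟩ := GrAux.exists_sum_proj M.isInternal x.1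
      have : x = ∑ s ∈ S, ⟨_, hF s x.1 x.2⟩ := Subtype.ext (by
        rw [Submodule.coe_sum]; exact (hS S subset_rfl).symm)
      rw [this]
      exact sum_mem fun s _ => mem_iSup_of_mem s (GrAux.proj_mem M.isInternal s x.1)
    · rw [comp_apply, comp_apply, hc n _ hx, Finsupp.mapRange.linearMap_apply, Finsupp.mapRange_single]
      exact congrArg _ (lcongr_fun hr x)
  smul_mem i j a ha m hm := M.smul_mem i j a ha m hm

variable {M : GrMod.{u, v, v} 𝒜}

theorem exists_isBiprod_of_idempotent {e : End0 M} (he : e * e = e) (h0 : e ≠ 0) (h1 : e ≠ 1) :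
    ∃ M' M'' : GrMod.{u, v, v} 𝒜, IsBiprod M' M M'' ∧ (∃ x : M', x ≠ 0) ∧ ∃ x : M'', x ≠ 0 := by
  have hee : ∀ x, e.1 (e.1 x) = e.1 x := fun x => lcongr_fun (congrArg Subtype.val he) x
  refine ⟨M.sub (range e.1) ?_, M.sub (LinearMap.ker e.1) ?_,
    ⟨(range e.1).subtype, fun _ _ h => h, e.1.rangeRestrict, fun n x hx => e.2 n x hx,
      (LinearMap.ker e.1).subtype, fun _ _ h => h,
      (LinearMap.id - e.1).codRestrict _ fun x => by simp [hee], fun n x hx => sub_mem hx (e.2 n x hx),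
      lin_ext ?_, lin_ext ?_, lin_ext fun x => ?_⟩, ?_, ?_⟩
  · rintro n _ ⟨x, rfl⟩
    exact ⟨_, (proj_hom e.2 n x).symm⟩
  · intro n x hx
    rw [LinearMap.mem_ker] at hx ⊢
    rw [← proj_hom e.2, hx, map_zero]
  · rintro ⟨_, x, rfl⟩
    exact Subtype.ext (hee x)
  · rintro ⟨x, hx⟩
    refine Subtype.ext ?_
    change x - e.1 x = x
    rw [show e.1 x = 0 from hx, sub_zero]
  · change e.1 x + (x - e.1 x) = x
    abel
  · by_contra! h
    exact h0 (Subtype.ext (lin_ext fun x => congrArg Subtype.val (h ⟨e.1 x, x, rfl⟩)))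
  · by_contra! h
    refine h1 (Subtype.ext (lin_ext fun x => ?_))
    have := congrArg Subtype.val (h ⟨x - e.1 x, by rw [LinearMap.mem_ker, map_sub, hee, sub_self]⟩)
    exact (sub_eq_zero.1 this).symm

theorem IsBiprod.isFGProj_right {M' M'' : GrMod.{u, v, v} 𝒜} (h : IsBiprod M' M M'') (hM : M.IsFGProj) : M''.IsFGProj :=
  h.symm.isFGProj_left hM

/-- The module is generated by elements with degrees in `S`. -/
def GenIn (S : Finset ℤ) (M : GrMod.{u, v, v} 𝒜) : Prop := ∀ F : Submodule A M, (∀ n ∈ S, ∀ m ∈ M.deg n, m ∈ F) → F = ⊤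

theorem GenIn.of_biprod {S : Finset ℤ} {M' M'' : GrMod.{u, v, v} 𝒜} (hS : GenIn S M) (h : IsBiprod M' M M'') :
    GenIn S M' := by
  obtain ⟨i, hi, p, hp, j, hj, q, hq, h1, h2, h3⟩ := h
  intro F hF
  have := hS (F.comap p) fun n hn m hm => hF n hn _ (hp n m hm)
  rw [eq_top_iff]
  intro x _
  have hx : i x ∈ F.comap p := this ▸ mem_top
  have h4 : p (i x) = x := lcongr_fun h1 x
  rw [← h4]; exact hx

variable [GradedAlgebra 𝒜]

theorem K0.mem_of_isLocal [IsAlgClosed K] (h𝒜 : LocFin 𝒜) (W : AddSubgroup (K0 𝒜))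
    (hW : ∀ L : FGProj 𝒜, IsLocal L.1 → K0.mk L ∈ W) (P : FGProj 𝒜) : K0.mk P ∈ W := by
  obtain ⟨ι, _, d, x, f, hx, -, hfx⟩ := P.2.exists_homDualBasis
  classical
  let S := Finset.univ.image d
  have hS : GenIn S P.1 := fun F hF => by
    rw [eq_top_iff]
    intro m _
    rw [← hfx m]
    exact sum_mem fun i _ => F.smul_mem _ (hF _ (Finset.mem_image_of_mem d (mem_univ i)) _ (hx i))
  clear_value S
  clear hfx hx x f d
  let μ : FGProj 𝒜 → ℕ := fun P => ∑ s ∈ S, Module.finrank K (P.1.deg s)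
  have hμ : ∀ P : FGProj 𝒜, GenIn S P.1 → (∃ x : P.1, x ≠ 0) → 0 < μ P := by
    intro P hP hx
    by_contra! h
    have h' : ∀ s ∈ S, P.1.deg s = ⊥ := fun s hs => by
      have := (P.2.locFin h𝒜).1 s
      exact Submodule.finrank_eq_zero.1 ((Finset.sum_eq_zero_iff).1 (Nat.le_zero.1 h) s hs)
    obtain ⟨x, hx⟩ := hx
    have : x ∈ (⊥ : Submodule A P.1) := by
      rw [hP ⊥ fun n hn m hm => by rw [h' n hn] at hm; rw [(mem_bot K).1 hm]; exact zero_mem _]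
      exact mem_top
    exact hx ((mem_bot A).1 this)
  induction hn : μ P using Nat.strong_induction_on generalizing P with
  | _ n ih =>
  subst hn
  by_cases h0 : ∃ x : P.1, x ≠ 0
  swap
  · push Not at h0
    rw [K0.mk_zero_of h0]; exact zero_mem _
  by_cases hl : IsLocal P.1
  · exact hW P hl
  have := finite_Hom0 P.2 (P.2.locFin h𝒜)
  have : Module.Finite K (End0 P.1) := this
  have : Nontrivial (End0 P.1) := by
    obtain ⟨x, hx⟩ := h0
    exact ⟨1, 0, fun h => hx (lcongr_fun (congrArg Subtype.val h) x)⟩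
  obtain ⟨e, he, he0, he1⟩ := exists_idempotent (mt isLocal_iff.2 hl)
  obtain ⟨M', M'', hb, h1, h2⟩ := exists_isBiprod_of_idempotent he he0 he1
  let P' : FGProj 𝒜 := ⟨M', hb.isFGProj_left P.2⟩
  let P'' : FGProj 𝒜 := ⟨M'', hb.isFGProj_right P.2⟩
  have hg' : GenIn S P'.1 := hS.of_biprod hb
  have hg'' : GenIn S P''.1 := hS.of_biprod hb.symm
  have hle : μ P' + μ P'' ≤ μ P := by
    rw [← sum_add_distrib]
    refine Finset.sum_le_sum fun s _ => ?_
    obtain ⟨i, hi, p, hp, j, hj, q, hq, h1, h2, h3⟩ := hb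
    have := (P.2.locFin h𝒜).1 s
    have := (P'.2.locFin h𝒜).1 s
    have := (P''.2.locFin h𝒜).1 s
    rw [← Module.finrank_prod]
    let F : M'.deg s × M''.deg s →ₗ[K] P.1.deg s := LinearMap.coprod
      ((i.restrictScalars K).restrict (hi s)) ((j.restrictScalars K).restrict (hj s))
    refine LinearMap.finrank_le_finrank_of_injective (f := F) ((injective_iff_map_eq_zero F).2 fun y hy => ?_)
    have hy' : i y.1.1 + j y.2.1 = 0 := congrArg Subtype.val hy
    obtain ⟨hqi, hpj⟩ := isBiprod_comp h1 h2 h3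
    refine Prod.ext (Subtype.ext ?_) (Subtype.ext ?_)
    · have := congrArg p hy'
      rw [map_add, map_zero, show p (j y.2.1) = 0 from lcongr_fun hpj _, add_zero] at this
      exact (lcongr_fun h1 _).symm.trans this
    · have := congrArg q hy'
      rw [map_add, map_zero, show q (i y.1.1) = 0 from lcongr_fun hqi _, zero_add] at this
      exact (lcongr_fun h2 _).symm.trans this
  have := hμ P' hg' h1
  have := hμ P'' hg'' h2
  rw [K0.mk_biprod (P' := P') (P'' := P'') hb]
  exact add_mem (ih _ (by omega) P' hg' rfl) (ih _ (by omega) P'' hg'' rfl)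

/-- A system of representatives of the indecomposable projective modules, up to shifts. -/
structure IsLocalSystem {ι : Type*} (X : ι → FGProj 𝒜) : Prop where
  isLocal : ∀ i, IsLocal (X i).1
  inj : ∀ i j m, GrIso (X i).1 ((X j).1.shift m) → i = j ∧ m = 0
  exists_grIso : ∀ L : FGProj 𝒜, IsLocal L.1 → ∃ i m, GrIso L.1 ((X i).1.shift m)

theorem GrIso.of_shift {L N : GrMod.{u, v, v} 𝒜} {m k : ℤ} (h : GrIso (L.shift m) (N.shift k)) : GrIso L (N.shift (k - m)) := by
  have := h.shift (-m)
  rwa [GrMod.shift_shift, GrMod.shift_shift, neg_add_cancel, GrMod.shift_zero, neg_add_eq_sub] at this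

theorem exists_isLocalSystem (h𝒜 : LocFin 𝒜) : ∃ (ι : Type (max u (v + 1))) (X : ι → FGProj 𝒜), IsLocalSystem X := by
  let s : Setoid {L : FGProj 𝒜 // IsLocal L.1} :=
    { r := fun L L' => ∃ m, GrIso L.1.1 (L'.1.1.shift m)
      iseqv := ⟨fun L => ⟨0, by rw [GrMod.shift_zero]; exact .refl _⟩,
        fun {L L'} ⟨m, h⟩ => ⟨-m, by
          rw [← GrMod.shift_zero L.1.1] at h
          have := h.symm.of_shift; rwa [zero_sub] at this⟩,
        fun {L L' L''} ⟨m, h⟩ ⟨m', h'⟩ => ⟨m + m', by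
          rw [← GrMod.shift_shift]; exact h.trans (h'.shift m)⟩⟩ }
  refine ⟨Quotient s, fun q => q.out.1, fun q => q.out.2, fun q q' m h => ?_, fun L hL => ?_⟩
  · have : q = q' := by
      rw [← q.out_eq, ← q'.out_eq]; exact Quotient.sound ⟨m, h⟩
    subst this
    exact ⟨rfl, q.out.2.shift_eq_zero (q.out.1.2.locFin h𝒜) h⟩
  · exact ⟨⟦⟨L, hL⟩⟧, Setoid.symm (Quotient.mk_out (s := s) ⟨L, hL⟩)⟩

variable {ι : Type*} {X : ι → FGProj 𝒜}

theorem IsLocalSystem.linearIndependent (h𝒜 : LocFin 𝒜) (hX : IsLocalSystem X) :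
    LinearIndependent ℤ[T;T⁻¹] fun i => K0.mk (X i) := by
  classical
  rw [linearIndependent_iff']
  intro s p hp i hi
  ext m
  obtain ⟨θ, hθ⟩ := exists_mult h𝒜 (L := (X i).1.shift m) ((X i).shift m).2 ((hX.isLocal i).shift m)
  have key : ∀ j n, θ ((T n : ℤ[T;T⁻¹]) • K0.mk (X j)) = if j = i ∧ n = m then 1 else 0 := fun j n => by
    rw [K0.T_smul_mk]
    split_ifs with h
    · obtain ⟨rfl, rfl⟩ := h
      exact (hθ _).2 (.refl _)
    · by_contra h0
      obtain ⟨f, hf, g, hg, hn⟩ := (hθ _).1.1 h0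
      have := (((hX.isLocal i).shift m).grIso ((hX.isLocal j).shift n) hf hg hn).of_shift
      obtain ⟨rfl, h'⟩ := hX.inj _ _ _ this
      exact h ⟨rfl, by omega⟩
  have key2 : ∀ j (p : ℤ[T;T⁻¹]), θ (p • K0.mk (X j)) = if j = i then p.coeff m else 0 := fun j p => by
    induction p using LaurentPolynomial.induction_on' with
    | add p q hp hq => rw [add_smul, map_add, hp, hq]; split_ifs <;> simp
    | C_mul_T n a =>
      rw [C_mul_T_smul, map_zsmul, key]
      have : (C a * T n : ℤ[T;T⁻¹]).coeff m = if n = m then a else 0 := by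
        rw [← LaurentPolynomial.single_eq_C_mul_T]
        exact Finsupp.single_apply
      rw [this]
      by_cases h : j = i <;> by_cases h' : n = m <;> simp [h, h']
  have := congrArg θ hp
  rw [map_sum, map_zero] at this
  simp only [key2] at this
  simpa [hi] using this

theorem IsLocalSystem.spans [IsAlgClosed K] (h𝒜 : LocFin 𝒜) (hX : IsLocalSystem X) :
    ⊤ ≤ span ℤ[T;T⁻¹] (Set.range fun i => K0.mk (X i)) := by
  rintro x -
  induction x using K0.induction with
  | mk P =>
    refine K0.mem_of_isLocal h𝒜 (span ℤ[T;T⁻¹] (Set.range fun i => K0.mk (X i))).toAddSubgroup (fun L hL => ?_) P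
    obtain ⟨i, m, h⟩ := hX.exists_grIso L hL
    rw [K0.mk_iso (Q := (X i).shift m) h, ← K0.T_smul_mk]
    exact Submodule.smul_mem _ _ (subset_span ⟨i, rfl⟩)
  | add x y hx hy => exact add_mem hx hy
  | neg x hx => exact neg_mem hx

end Sub
end Gr

open LaurentPolynomial
namespace Gr

section BoxLocal
variable {K : Type u} [Field K] {A B : Type v} [Ring A] [Algebra K A] [Ring B] [Algebra K B]
  {𝒜 : ℤ → Submodule K A} {ℬ : ℤ → Submodule K B}
  {P P' P'' : GrMod.{u, v, v} 𝒜} {Q Q' Q'' : GrMod.{u, v, v} ℬ}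

theorem boxMap_mem_HomD {i j k : ℤ} (hk : i + j = k) {f : P →ₗ[A] P'} {g : Q →ₗ[B] Q'}
    (hf : f ∈ HomD i P P') (hg : g ∈ HomD j Q Q') : boxMap f g ∈ HomD k (P.box Q) (P'.box Q') :=
  fun n _ hx => boxLift_mem (M := P) (N := Q) (X := P'.box Q') (deg := fun n => (P'.box Q').deg (n + k))
    (F := (boxMk P' Q').compl₁₂ (f.restrictScalars K) (g.restrictScalars K))
    (fun a b m hm n hn => boxMk_mem (M := P') (N := Q') (by omega) (hf a m hm) (hg b n hn)) hx

theorem boxMap_comp (f : P →ₗ[A] P') (g : Q →ₗ[B] Q') (f' : P' →ₗ[A] P'') (g' : Q' →ₗ[B] Q'') :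
    boxMap f' g' ∘ₗ boxMap f g = boxMap (f' ∘ₗ f) (g' ∘ₗ g) := box_hom_ext fun _ _ => rfl

theorem boxMap_pow (f : Module.End A P) (g : Module.End B Q) (k : ℕ) :
    (boxMap f g ^ k : Module.End (A ⊗[K] B) (P.box Q)) = boxMap (f ^ k) (g ^ k) := by
  induction k with
  | zero => exact box_hom_ext fun _ _ => rfl
  | succ k ih => rw [pow_succ, ih, pow_succ, pow_succ]; exact boxMap_comp _ _ _ _

theorem isNilpotent_boxMap {f : Module.End A P} {g : Module.End B Q} (h : IsNilpotent f ∨ IsNilpotent g) :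
    IsNilpotent (boxMap f g : Module.End (A ⊗[K] B) (P.box Q)) := by
  rcases h with ⟨k, hk⟩ | ⟨k, hk⟩
  · exact ⟨k, (boxMap_pow f g k).trans (box_hom_ext fun x y => by rw [hk, boxMap_mk, lzero_apply, map_zero]; rfl)⟩
  · exact ⟨k, (boxMap_pow f g k).trans (box_hom_ext fun x y => by rw [hk, boxMap_mk, lzero_apply, map_zero]; rfl)⟩

/-- The outer tensor products of homogeneous maps with total degree `k`. -/
def boxMaps (k : ℤ) (P P' : GrMod.{u, v, v} 𝒜) (Q Q' : GrMod.{u, v, v} ℬ) : Set (P.box Q →ₗ[A ⊗[K] B] P'.box Q') :=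
  {t | ∃ i j, i + j = k ∧ ∃ f ∈ HomD i P P', ∃ g ∈ HomD j Q Q', t = boxMap f g}

/-- The outer tensor products that are nilpotent for obvious reasons. -/
def nilMaps (P : GrMod.{u, v, v} 𝒜) (Q : GrMod.{u, v, v} ℬ) : Set (P.box Q →ₗ[A ⊗[K] B] P.box Q) :=
  {t | ∃ i j, i + j = 0 ∧ ∃ f ∈ HomD i P P, ∃ g ∈ HomD j Q Q, t = boxMap f g ∧
    (i ≠ 0 ∨ IsNilpotent (f : Module.End A P) ∨ IsNilpotent (g : Module.End B Q))}

variable [GradedAlgebra 𝒜] [GradedAlgebra ℬ]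

theorem mem_span_boxMaps (hP : P.IsFGProj) (hQ : Q.IsFGProj) {k : ℤ} {h : P.box Q →ₗ[A ⊗[K] B] P'.box Q'}
    (hh : h ∈ HomD k (P.box Q) (P'.box Q')) : h ∈ span K (boxMaps k P P' Q Q') := by
  obtain ⟨ι, _, d, x, f, hx, hf, hfx⟩ := hP.exists_homDualBasis
  obtain ⟨κ, _, e, y, g, hy, hg, hgy⟩ := hQ.exists_homDualBasis
  have key : ∀ a b, ∃ t ∈ span K (boxMaps k P P' Q Q'), ∀ m n,
      t (boxMk P Q m n) = (f a m ⊗ₜ[K] g b n) • h (boxMk P Q (x a) (y b)) := fun a b => by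
    have hz : h (boxMk P Q (x a) (y b)) ∈ (P'.box Q').deg (d a + e b + k) := hh _ _ (boxMk_mem rfl (hx a) (hy b))
    generalize h (boxMk P Q (x a) (y b)) = z at hz
    refine span_induction (p := fun z _ => ∃ t ∈ span K (boxMaps k P P' Q Q'), ∀ m n,
      t (boxMk P Q m n) = (f a m ⊗ₜ[K] g b n) • z) ?_ ⟨0, zero_mem _, fun m n => (smul_zero _).symm⟩ ?_ ?_ hz
    · rintro _ ⟨i, j, p, hp, q, hq, hij, rfl⟩
      refine ⟨boxMap (LinearMap.toSpanSingleton A P' p ∘ₗ f a) (LinearMap.toSpanSingleton B Q' q ∘ₗ g b),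
        subset_span ⟨i - d a, j - e b, by omega, _, ?_, _, ?_, rfl⟩, fun m n => (smul_boxMk _ _ _ _).symm⟩
      · intro n m hm
        have := P'.smul_mem _ _ _ (hf a n m hm) p hp
        rwa [show n + (i - d a) = n - d a + i by ring]
      · intro n m hm
        have := Q'.smul_mem _ _ _ (hg b n m hm) q hq
        rwa [show n + (j - e b) = n - e b + j by ring]
    · rintro z z' - - ⟨t, ht, h1⟩ ⟨t', ht', h1'⟩
      exact ⟨t + t', add_mem ht ht', fun m n => by rw [ladd_apply, h1, h1', smul_add]⟩
    · rintro c z - ⟨t, ht, h1⟩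
      exact ⟨c • t, Submodule.smul_mem _ c ht, fun m n => (congrArg (c • ·) (h1 m n)).trans (smul_comm c _ z)⟩
  choose t ht h1 using key
  have : h = ∑ a, ∑ b, t a b := box_hom_ext fun m n => by
    have h2 : boxMk P Q m n = ∑ a, ∑ b, boxMk P Q (f a m • x a) (g b n • y b) := by
      conv_lhs => rw [← hfx m, ← hgy n]
      simp only [map_sum, lsum_apply]
      exact sum_comm
    conv_lhs => rw [h2]
    simp only [lsum_apply, h1, ← map_smul, smul_boxMk, map_sum]
  rw [this]
  exact sum_mem fun a _ => sum_mem fun b _ => ht a b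

variable (h𝒜 : LocFin 𝒜) (hℬ : LocFin ℬ) (hP : P.IsFGProj) (hQ : Q.IsFGProj) (lP : IsLocal P) (lQ : IsLocal Q)

include h𝒜 hℬ hP hQ in
theorem isNilpotent_of_mem_nilMaps {t} (ht : t ∈ nilMaps P Q) :
    IsNilpotent (t : Module.End (A ⊗[K] B) (P.box Q)) := by
  obtain ⟨i, j, hij, f, hf, g, hg, rfl, h⟩ := ht
  apply isNilpotent_boxMap
  rcases lt_trichotomy i 0 with hi | rfl | hi
  · exact .inl (nilpotent_of_neg hP (hP.locFin h𝒜) hi hf)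
  · simpa using h
  · exact .inr (nilpotent_of_neg hQ (hQ.locFin hℬ) (by omega) hg)

theorem IsLocal.nilpotent_mul {M : GrMod.{u, v, v} 𝒜} (h : IsLocal M) {f g : Module.End A M} (hf : f ∈ Hom0 M M) (hg : g ∈ Hom0 M M)
    (hn : IsNilpotent f) : IsNilpotent (f * g) :=
  isNilpotent_val.2 ((isLocal_iff.1 h).nilpotent_mul (n := (⟨f, hf⟩ : End0 M)) (isNilpotent_val.1 hn) ⟨g, hg⟩)

include h𝒜 hP lP in
theorem comp_nilpotent {i i' : ℤ} (hi : i ≠ 0) (hii : i' + i = 0) {f f' : Module.End A P} (hf : f ∈ HomD i P P)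
    (hf' : f' ∈ HomD i' P P) : IsNilpotent (f * f') := by
  by_contra hn
  have := lP.shift_eq_zero (hP.locFin h𝒜) (lP.grIso_shift lP hii hf' hf hn)
  omega

include h𝒜 hP lP hℬ hQ lQ in
theorem comp_mem_nilMaps {s t} (hs : s ∈ nilMaps P Q) (ht : t ∈ boxMaps 0 P P Q Q) : s ∘ₗ t ∈ nilMaps P Q := by
  obtain ⟨i, j, hij, f, hf, g, hg, rfl, h⟩ := hs
  obtain ⟨i', j', hij', f', hf', g', hg', rfl⟩ := ht
  refine ⟨i' + i, j' + j, by omega, _, comp_mem_HomD rfl hf hf', _, comp_mem_HomD rfl hg hg', boxMap_comp _ _ _ _, ?_⟩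
  by_cases hii : i' + i = 0
  swap
  · exact .inl hii
  right
  by_cases hi : i = 0
  · obtain rfl : i' = 0 := by omega
    obtain rfl : j = 0 := by omega
    obtain rfl : j' = 0 := by omega
    subst hi
    rcases h with h | h | h
    · exact absurd rfl h
    · exact .inl (lP.nilpotent_mul (mem_HomD_zero.1 hf) (mem_HomD_zero.1 hf') h)
    · exact .inr (lQ.nilpotent_mul (mem_HomD_zero.1 hg) (mem_HomD_zero.1 hg') h)
  · exact .inl (comp_nilpotent h𝒜 hP lP hi hii hf hf')

theorem mem_span_val {M : GrMod.{u, v, v} 𝒜} {S : Set (Module.End A M)} (hS : S ⊆ Hom0 M M) {x : End0 M} (hx : x.1 ∈ span K S) :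
    x ∈ span K {y : End0 M | y.1 ∈ S} := by
  have : span K S ≤ (span K {y : End0 M | y.1 ∈ S}).map (End0 M).val.toLinearMap :=
    span_le.2 fun s hs => ⟨⟨s, hS hs⟩, subset_span hs, rfl⟩
  obtain ⟨y, hy, hyx⟩ := this hx
  rwa [← show y = x from Subtype.ext hyx]

theorem boxMaps_subset : boxMaps 0 P P Q Q ⊆ Hom0 (P.box Q) (P.box Q) := by
  rintro _ ⟨i, j, hij, f, hf, g, hg, rfl⟩
  exact mem_HomD_zero.1 (boxMap_mem_HomD hij hf hg)
theorem nilMaps_subset : nilMaps P Q ⊆ boxMaps 0 P P Q Q := by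
  rintro _ ⟨i, j, hij, f, hf, g, hg, h, -⟩
  exact ⟨i, j, hij, f, hf, g, hg, h⟩

theorem LocFin.tensorDeg (h𝒜 : LocFin 𝒜) (hℬ : LocFin ℬ) : LocFin (tensorDeg 𝒜 ℬ) := by
  obtain ⟨h1, b, hb⟩ := h𝒜
  obtain ⟨h2, c, hc⟩ := hℬ
  have key : ∀ n, Gr.tensorDeg 𝒜 ℬ n ≤ ⨆ i : Finset.Icc b (n - c), Submodule.map₂ (TensorProduct.mk K A B) (𝒜 i) (ℬ (n - i)) := by
    intro n
    refine span_le.2 ?_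
    rintro _ ⟨i, j, x, hx, y, hy, rfl, rfl⟩
    by_cases hi : i < b
    · rw [hb i hi] at hx
      rw [(mem_bot K).1 hx, zero_tmul]; exact zero_mem _
    by_cases hj : j < c
    · rw [hc j hj] at hy
      rw [(mem_bot K).1 hy, tmul_zero]; exact zero_mem _
    refine mem_iSup_of_mem ⟨i, Finset.mem_Icc.2 ⟨by omega, by omega⟩⟩ (Submodule.apply_mem_map₂ _ hx ?_)
    rwa [add_sub_cancel_left]
  refine ⟨fun n => ?_, b + c, fun n hn => le_bot_iff.1 ((key n).trans (iSup_le fun i => ?_))⟩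
  · have : ∀ i : Finset.Icc b (n - c), FiniteDimensional K (Submodule.map₂ (TensorProduct.mk K A B) (𝒜 i) (ℬ (n - i))) :=
      fun i => Module.Finite.iff_fg.2 ((Module.Finite.iff_fg.1 (h1 i)).map₂ _ (Module.Finite.iff_fg.1 (h2 _)))
    exact Submodule.finiteDimensional_of_le (key n)
  · have := Finset.mem_Icc.1 i.2
    omega

variable [IsAlgClosed K]

include h𝒜 hℬ hP hQ lP lQ in
theorem isNilpotent_of_mem_span_nilMaps {x : Module.End (A ⊗[K] B) (P.box Q)} (hx : x ∈ span K (nilMaps P Q)) :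
    IsNilpotent x := by
  have := finite_Hom0 (hP.box hQ) ((hP.box hQ).locFin (h𝒜.tensorDeg hℬ))
  have : FiniteDimensional K (End0 (P.box Q)) := this
  have hsub := (nilMaps_subset (P := P) (Q := Q)).trans boxMaps_subset
  have hx0 : x ∈ Hom0 (P.box Q) (P.box Q) := span_le.2 hsub hx
  refine isNilpotent_val.2 (isNilpotent_of_mem_span (x := (⟨x, hx0⟩ : End0 (P.box Q)))
    (fun s hs => isNilpotent_val.1 (isNilpotent_of_mem_nilMaps h𝒜 hℬ hP hQ hs)) (fun s hs y => ?_)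
    (mem_span_val hsub hx))
  have hy := mem_span_val boxMaps_subset (mem_span_boxMaps hP hQ (mem_HomD_zero.2 y.2))
  induction hy using span_induction with
  | mem t ht => exact subset_span (comp_mem_nilMaps h𝒜 hℬ hP hQ lP lQ hs ht)
  | zero | add => simp_all [mul_add, add_mem]
  | smul c a _ ha => rw [mul_smul_comm]; exact Submodule.smul_mem _ c ha

theorem boxMk_ne_zero {x : P} {y : Q} (hx : x ≠ 0) (hy : y ≠ 0) : boxMk P Q x y ≠ 0 := fun h => by
  obtain ⟨f, hf⟩ := Module.Projective.exists_dual_ne_zero K hx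
  obtain ⟨g, hg⟩ := Module.Projective.exists_dual_ne_zero K hy
  have := congrArg (boxLift ((LinearMap.mul K K).compl₁₂ f g)) h
  rw [boxLift_mk, map_zero] at this
  exact mul_ne_zero hf hg this

include h𝒜 hℬ hP hQ in
theorem IsLocal.box (lP : IsLocal P) (lQ : IsLocal Q) : IsLocal (P.box Q) := by
  obtain ⟨x, hx⟩ := lP.1
  obtain ⟨y, hy⟩ := lQ.1
  refine ⟨⟨_, boxMk_ne_zero hx hy⟩, fun f hf => ?_⟩
  suffices H : ∃ c : K, f - c • 1 ∈ span K (nilMaps P Q) from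
    H.imp fun c hc => isNilpotent_of_mem_span_nilMaps h𝒜 hℬ hP hQ lP lQ hc
  have hf' := mem_span_boxMaps hP hQ (mem_HomD_zero.2 hf)
  clear hf
  induction hf' using span_induction with
  | mem t ht =>
    obtain ⟨i, j, hij, f, hf, g, hg, rfl⟩ := ht
    by_cases hi : i = 0
    · subst hi
      obtain rfl : j = 0 := by omega
      obtain ⟨c, hc⟩ := lP.2 f (mem_HomD_zero.1 hf)
      obtain ⟨d, hd⟩ := lQ.2 g (mem_HomD_zero.1 hg)
      have h1 : (1 : Module.End A P) ∈ HomD 0 P P := mem_HomD_zero.2 id_mem_Hom0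
      have h2 : (1 : Module.End B Q) ∈ HomD 0 Q Q := mem_HomD_zero.2 id_mem_Hom0
      have h3 : (boxMap f g - (c * d) • 1 : Module.End (A ⊗[K] B) (P.box Q)) =
          boxMap (f - c • 1 : Module.End A P) g + boxMap (c • 1 : Module.End A P) (g - d • 1 : Module.End B Q) :=
        box_hom_ext fun x y => by
          change boxMk P Q (f x) (g y) - (c * d) • boxMk P Q x y =
            boxMk P Q (f x - c • x) (g y) + boxMk P Q (c • x) (g y - d • y)
          simp only [map_sub, lsub_apply, map_smul, lsmul_apply, smul_sub, mul_smul]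
          rw [smul_comm d c]
          abel
      refine ⟨c * d, ?_⟩
      rw [h3]
      exact add_mem (subset_span ⟨0, 0, rfl, _, sub_mem hf (Submodule.smul_mem _ c h1), _, hg, rfl, .inr (.inl hc)⟩)
        (subset_span ⟨0, 0, rfl, _, Submodule.smul_mem _ c h1, _, sub_mem hg (Submodule.smul_mem _ d h2), rfl, .inr (.inr hd)⟩)
    · exact ⟨0, by rw [zero_smul, sub_zero]; exact subset_span ⟨i, j, hij, f, hf, g, hg, rfl, .inl hi⟩⟩
  | zero => exact ⟨0, by rw [zero_smul, sub_zero]; exact zero_mem _⟩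
  | add a b _ _ ha hb =>
    obtain ⟨c, hc⟩ := ha
    obtain ⟨d, hd⟩ := hb
    exact ⟨c + d, by rw [add_smul, add_sub_add_comm]; exact add_mem hc hd⟩
  | smul k a _ ha =>
    obtain ⟨c, hc⟩ := ha
    exact ⟨k * c, by rw [mul_smul, ← smul_sub]; exact Submodule.smul_mem _ k hc⟩

include h𝒜 hℬ hP hQ lP lQ in
theorem GrIso.of_box (hP' : P'.IsFGProj) (hQ' : Q'.IsFGProj) (lP' : IsLocal P') (lQ' : IsLocal Q') {m : ℤ}
    (h : GrIso (P.box Q) ((P'.box Q').shift m)) : ∃ a, GrIso P (P'.shift a) ∧ GrIso Q (Q'.shift (m - a)) := by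
  by_contra! hcon
  obtain ⟨e, he⟩ := h
  let e₁ : P.box Q →ₗ[A ⊗[K] B] P'.box Q' := e.toLinearMap
  let e₂ : P'.box Q' →ₗ[A ⊗[K] B] P.box Q := e.symm.toLinearMap
  have h1 : e₁ ∈ HomD (-m) (P.box Q) (P'.box Q') := fun n x hx => he n x hx
  have h2 : e₂ ∈ HomD m (P'.box Q') (P.box Q) := fun n x hx =>
    symm_mem_Hom0 (e := e) he (n + m) x (by change x ∈ (P'.box Q').deg (n + m - m); rwa [add_sub_cancel_right])
  have key : ∀ t ∈ boxMaps (-m) P P' Q Q', ∀ s ∈ boxMaps m P' P Q' Q, s ∘ₗ t ∈ nilMaps P Q := by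
    rintro _ ⟨i, j, hij, f, hf, g, hg, rfl⟩ _ ⟨i', j', hij', f', hf', g', hg', rfl⟩
    refine ⟨i + i', j + j', by omega, _, comp_mem_HomD rfl hf' hf, _, comp_mem_HomD rfl hg' hg, boxMap_comp _ _ _ _, ?_⟩
    by_contra! h
    obtain ⟨h3, h4, h5⟩ := h
    refine hcon (-i) (lP.grIso_shift lP' h3 hf hf' h4) ?_
    rw [show m - -i = -j by omega]
    exact lQ.grIso_shift lQ' (by omega) hg hg' h5
  have key2 : ∀ t ∈ span K (boxMaps (-m) P P' Q Q'), ∀ s ∈ span K (boxMaps m P' P Q' Q),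
      s ∘ₗ t ∈ span K (nilMaps P Q) := fun t ht s hs => by
    induction ht using span_induction with
    | mem t ht =>
      induction hs using span_induction with
      | mem s hs => exact subset_span (key t ht s hs)
      | zero => rw [LinearMap.zero_comp]; exact zero_mem _
      | add a b _ _ ha hb => rw [add_comp]; exact add_mem ha hb
      | smul c a _ ha => exact Submodule.smul_mem _ c ha
    | zero => rw [LinearMap.comp_zero]; exact zero_mem _
    | add a b _ _ ha hb => rw [comp_add]; exact add_mem ha hb
    | smul c a _ ha =>
      rw [show s ∘ₗ (c • a) = c • (s ∘ₗ a) from lin_ext fun x => map_smul (s.restrictScalars K) c (a x)]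
      exact Submodule.smul_mem _ c ha
  have := key2 _ (mem_span_boxMaps hP hQ h1) _ (mem_span_boxMaps hP' hQ' h2)
  obtain ⟨k, hk⟩ := isNilpotent_of_mem_span_nilMaps h𝒜 hℬ hP hQ lP lQ this
  rw [show (e₂ ∘ₗ e₁ : Module.End (A ⊗[K] B) (P.box Q)) = 1
    from lin_ext fun x => e.symm_apply_apply x, one_pow] at hk
  obtain ⟨x, hx⟩ := (lP.box h𝒜 hℬ hP hQ lQ).1
  exact hx (lcongr_fun hk x)

end BoxLocal
end Gr

open LaurentPolynomial
namespace Gr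

section BoxEquiv
variable {K : Type u} [Field K] {A B : Type v} [Ring A] [Algebra K A] [Ring B] [Algebra K B]
  {𝒜 : ℤ → Submodule K A} {ℬ : ℤ → Submodule K B} [GradedAlgebra 𝒜] [GradedAlgebra ℬ]

theorem exists_self_hom {L : GrMod.{u, v, v} 𝒜} (hL : L.IsFGProj) (lL : IsLocal L) : ∃ d, ∃ f ∈ Hom0 L ((GrMod.self 𝒜).shift d),
    ∃ g ∈ Hom0 ((GrMod.self 𝒜).shift d) L, ¬ IsNilpotent (g ∘ₗ f : Module.End A L) := by
  obtain ⟨ι, _, d, x, f, hx, hf, hfx⟩ := hL.exists_homDualBasis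
  let F : ∀ i, L →ₗ[A] (GrMod.self 𝒜).shift (d i) := fun i => f i
  let G : ∀ i, (GrMod.self 𝒜).shift (d i) →ₗ[A] L := fun i => LinearMap.toSpanSingleton A L (x i)
  have hF : ∀ i, F i ∈ Hom0 L ((GrMod.self 𝒜).shift (d i)) := fun i k m hm => hf i k m hm
  have hG : ∀ i, G i ∈ Hom0 ((GrMod.self 𝒜).shift (d i)) L := fun i k a ha => by
    have := L.smul_mem _ _ a ha _ (hx i)
    rwa [sub_add_cancel] at this
  by_contra! h
  let y : ι → End0 L := fun i => ⟨G i ∘ₗ F i, comp_mem_Hom0 (hG i) (hF i)⟩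
  have hy : ∀ s : Finset ι, IsNilpotent (∑ i ∈ s, y i) := fun s => by
    classical
    induction s using Finset.induction_on with
    | empty => rw [Finset.sum_empty]; exact .zero
    | insert i s hi ih =>
      rw [Finset.sum_insert hi]
      exact (isLocal_iff.1 lL).nilpotent_add (isNilpotent_val.1 (h _ _ (hF i) _ (hG i))) ih
  have h1 : ∑ i, y i = 1 := Subtype.ext (lin_ext fun m => by
    refine Eq.trans ?_ (hfx m)
    rw [AddSubmonoidClass.coe_finsetSum, lsum_apply]; rfl)
  have := hy Finset.univ
  rw [h1] at this
  have := (isLocal_iff.1 lL).1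
  exact not_isNilpotent_one ‹_›

theorem box_self : GrIso ((GrMod.self 𝒜).box (GrMod.self ℬ)) (GrMod.self (tensorDeg 𝒜 ℬ)) :=
  ⟨{ (LinearEquiv.refl K (A ⊗[K] B) : (GrMod.self 𝒜).box (GrMod.self ℬ) ≃ₗ[K] GrMod.self (tensorDeg 𝒜 ℬ)) with
      map_smul' := map_smul_of_box (M := GrMod.self 𝒜) (N := GrMod.self ℬ) (X := A ⊗[K] B)
        (LinearMap.id : A ⊗[K] B →ₗ[K] A ⊗[K] B) fun (a : A) (b : B) (m : A) (n : B) =>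
          (tmul_mul_tmul (R := K) a m b n).symm },
    fun _ _ h => h⟩

variable [IsAlgClosed K] {ι κ : Type*} {X : ι → FGProj 𝒜} {Y : κ → FGProj ℬ}

theorem IsLocalSystem.box (h𝒜 : LocFin 𝒜) (hℬ : LocFin ℬ) (hX : IsLocalSystem X) (hY : IsLocalSystem Y) :
    IsLocalSystem fun p : ι × κ => (X p.1).box (Y p.2) where
  isLocal p := (hX.isLocal p.1).box h𝒜 hℬ (X p.1).2 (Y p.2).2 (hY.isLocal p.2)
  inj p q m h := by
    obtain ⟨a, h1, h2⟩ := h.of_box h𝒜 hℬ (X p.1).2 (Y p.2).2 (hX.isLocal p.1) (hY.isLocal p.2) (X q.1).2 (Y q.2).2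
      (hX.isLocal q.1) (hY.isLocal q.2)
    obtain ⟨h3, h4⟩ := hX.inj _ _ _ h1
    obtain ⟨h5, h6⟩ := hY.inj _ _ _ h2
    exact ⟨Prod.ext h3 h5, by omega⟩
  exists_grIso L hL := by
    obtain ⟨θ, hθ⟩ := exists_mult (h𝒜.tensorDeg hℬ) L.2 hL
    obtain ⟨d, hd⟩ := exists_self_hom L.2 hL
    by_contra! hcon
    have key : ∀ p q n, θ ((T n : ℤ[T;T⁻¹]) • boxK 𝒜 ℬ (K0.mk (X p)) (K0.mk (Y q))) = 0 := fun p q n => by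
      rw [boxK_mk, K0.T_smul_mk]
      by_contra h0
      obtain ⟨f, hf, g, hg, hn⟩ := (hθ _).1.1 h0
      exact hcon (p, q) n (hL.grIso (((hX.isLocal p).box h𝒜 hℬ (X p).2 (Y q).2 (hY.isLocal q)).shift n) hf hg hn)
    have key2 : ∀ x y, ∀ a : ℤ[T;T⁻¹], θ (a • boxK 𝒜 ℬ x y) = 0 := fun x y => by
      have hx := hX.spans h𝒜 (mem_top (x := x))
      have hy := hY.spans hℬ (mem_top (x := y))
      induction hx using span_induction with
      | mem x hx =>
        obtain ⟨p, rfl⟩ := hx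
        induction hy using span_induction with
        | mem y hy =>
          obtain ⟨q, rfl⟩ := hy
          intro a
          induction a using LaurentPolynomial.induction_on' with
          | add a b ha hb => rw [add_smul, map_add, ha, hb, add_zero]
          | C_mul_T n a => rw [C_mul_T_smul, map_zsmul, key, smul_zero]
        | zero => intro a; rw [map_zero, smul_zero, map_zero]
        | add b c _ _ hb hc => intro a; rw [map_add, smul_add, map_add, hb, hc, add_zero]
        | smul c b _ hb => intro a; rw [map_smul (boxK 𝒜 ℬ _), smul_smul, hb]
      | zero => intro a; rw [map_zero, lzero_apply, smul_zero, map_zero]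
      | add b c _ _ hb hc => intro a; rw [map_add, ladd_apply, smul_add, map_add, hb, hc, add_zero]
      | smul c b _ hb => intro a; rw [map_smul (boxK 𝒜 ℬ), lsmul_apply, smul_smul, hb]
    have hs : ((GrMod.self (tensorDeg 𝒜 ℬ)).shift d).IsFGProj := isFGProj_self (tensorDeg 𝒜 ℬ)
    refine (hθ ⟨(GrMod.self (tensorDeg 𝒜 ℬ)).shift d, hs⟩).1.2 hd ?_
    let P : FGProj 𝒜 := ⟨GrMod.self 𝒜, isFGProj_self 𝒜⟩
    let Q : FGProj ℬ := ⟨GrMod.self ℬ, isFGProj_self ℬ⟩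
    have := key2 (K0.mk P) (K0.mk Q) (T d)
    rwa [boxK_mk, K0.T_smul_mk, K0.mk_iso (Q := ⟨(GrMod.self (tensorDeg 𝒜 ℬ)).shift d, hs⟩)
      (box_self.shift d)] at this

theorem boxK_bijective (h𝒜 : LocFin 𝒜) (hℬ : LocFin ℬ) : Function.Bijective (TensorProduct.lift (boxK 𝒜 ℬ)) := by
  obtain ⟨ι, X, hX⟩ := exists_isLocalSystem h𝒜
  obtain ⟨κ, Y, hY⟩ := exists_isLocalSystem hℬ
  have hXY := hX.box h𝒜 hℬ hY
  let b := Module.Basis.mk (hX.linearIndependent h𝒜) (hX.spans h𝒜)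
  let c := Module.Basis.mk (hY.linearIndependent hℬ) (hY.spans hℬ)
  let d := Module.Basis.mk (hXY.linearIndependent (h𝒜.tensorDeg hℬ)) (hXY.spans (h𝒜.tensorDeg hℬ))
  have : TensorProduct.lift (boxK 𝒜 ℬ) = ((b.tensorProduct c).equiv d (.refl _)).toLinearMap :=
    (b.tensorProduct c).ext fun p => by
      rw [LinearEquiv.coe_coe, Module.Basis.equiv_apply, Module.Basis.tensorProduct_apply, TensorProduct.lift.tmul]
      simp only [b, c, d, Module.Basis.mk_apply, boxK_mk, Equiv.refl_apply]
  rw [this]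
  exact LinearEquiv.bijective _

end BoxEquiv
end Gr

namespace Gr

section
variable {K : Type u} [Field K] {W : Type v} [AddCommGroup W] [Module K W] {deg : ℤ → Submodule K W}

theorem LocFin.of_le {ι : Type*} [Finite ι] {V : ι → Type*} [∀ i, AddCommGroup (V i)] [∀ i, Module K (V i)]
    {degV : ∀ i, ℤ → Submodule K (V i)} (hV : ∀ i, LocFin (degV i)) (f : ∀ i, V i →ₗ[K] W) (d : ι → ℤ)
    (h : ∀ n, deg n ≤ ⨆ i, (degV i (n - d i)).map (f i)) : LocFin deg := by
  choose h1 b hb using hV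
  obtain ⟨c, hc⟩ := (Set.finite_range fun i => b i + d i).bddBelow
  refine ⟨fun n => ?_, c, fun n hn => le_bot_iff.1 ((h n).trans (iSup_le fun i => ?_))⟩
  · have : ∀ i, FiniteDimensional K (degV i (n - d i)) := fun i => h1 i _
    exact Submodule.finiteDimensional_of_le (h n)
  · have := hc ⟨i, rfl⟩
    rw [hb i _ (by dsimp only at this; omega), Submodule.map_bot]

theorem LocFin.of_span (hdeg : DirectSum.IsInternal deg) (x : ℕ → W) (e : ℕ → ℤ) (he : ∀ k : ℕ, k ≤ e k)
    (hx : ∀ k, x k ∈ deg (e k)) (h : ∀ y, y ∈ span K (Set.range x)) : LocFin deg := by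
  have key : ∀ n, deg n ≤ span K (x '' {k : ℕ | (k : ℤ) ≤ n}) := fun n y hy => by
    rw [← GrAux.proj_same hdeg hy]
    clear hy
    have := h y
    induction this using span_induction with
    | mem y hy =>
      obtain ⟨k, rfl⟩ := hy
      by_cases hk : e k = n
      · rw [← hk, GrAux.proj_same _ (hx k)]
        exact subset_span ⟨k, he k, rfl⟩
      · rw [GrAux.proj_ne _ hk (hx k)]; exact zero_mem _
    | zero | add => simp_all [add_mem]
    | smul c a _ ha => rw [map_smul]; exact Submodule.smul_mem _ c ha
  refine ⟨fun n => ?_, 0, fun n hn => le_bot_iff.1 ((key n).trans (span_le.2 ?_))⟩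
  · have hfin : {k : ℕ | (k : ℤ) ≤ n}.Finite := (Set.finite_Iic n.toNat).subset fun k hk => by
      simp only [Set.mem_ofPred_eq, Set.mem_Iic] at hk ⊢; omega
    have := FiniteDimensional.span_of_finite K (hfin.image x)
    exact Submodule.finiteDimensional_of_le (key n)
  · rintro _ ⟨k, hk, rfl⟩
    simp only [Set.mem_ofPred_eq] at hk; omega
end
end Gr

namespace QHA
open Gr
variable {K : Type u} [Field K] {I : Type v} [Finite I] {D : BorcherdsDatum I} {ω : I →₀ ℕ}

theorem e_eq_one {l : List I} (h : ∀ l', wt l' = ω → l' = l) : gen K D ω (.e l) = 1 := by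
  rw [← sum_e]
  by_cases hl : wt l = ω
  · rw [sum_eq_single l (fun l' hl' hne => absurd (h l' (mem_Seq.1 hl')) hne) fun hn => absurd (mem_Seq.2 hl) hn]
  · rw [e_weight hl, sum_eq_zero fun l' hl' => e_weight (h l' (mem_Seq.1 hl') ▸ hl)]

theorem eq_nil_of_wt {l : List I} (h : wt l = 0) : l = [] := by
  have := degree_wt l
  rw [h] at this
  exact List.length_eq_zero_iff.1 (by simpa using this.symm)

theorem exists_smul_one (a : Alg K D 0) : ∃ c : K, a = c • 1 := by
  induction a using Alg.induction with
  | one => exact ⟨1, (one_smul _ _).symm⟩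
  | add a b ha hb =>
    obtain ⟨c, rfl⟩ := ha
    obtain ⟨d, rfl⟩ := hb
    exact ⟨c + d, (add_smul _ _ _).symm⟩
  | smul k a ha =>
    obtain ⟨c, rfl⟩ := ha
    exact ⟨k * c, (mul_smul _ _ _).symm⟩
  | mul g a ha =>
    by_cases hg : wt g.top = 0
    · cases g with
      | e l => rwa [eq_nil_of_wt (l := l) hg, e_eq_one fun _ => eq_nil_of_wt, one_mul]
      | x l i r => simpa [Gen.top] using eq_nil_of_wt hg
      | τ l i j r => simpa [Gen.top] using eq_nil_of_wt hg
    · exact ⟨0, by rw [gen_weight hg, zero_mul, zero_smul]⟩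

theorem eq_singleton_of_wt {l : List I} {i : I} (h : wt l = single i 1) : l = [i] := by
  have := degree_wt l
  rw [h, Finsupp.degree_single] at this
  obtain ⟨j, rfl⟩ := List.length_eq_one_iff.1 this.symm
  have h2 : single j 1 = single i 1 := by simpa using h
  rw [Finsupp.single_left_injective one_ne_zero h2]

theorem locFin_single (i : I) : LocFin (deg K D (single i 1)) := by
  let X := gen K D (single i 1) (.x [] i [])
  refine .of_span (DirectSum.Decomposition.isInternal _) (fun k => X ^ k) (fun k => k * (2 * D.r i)) (fun k => ?_)
    (fun k => by
      have := SetLike.pow_mem_graded k (gen_mem_deg (K := K) (D := D) (ν := single i 1) (Gen.x [] i []))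
      rwa [nsmul_eq_mul] at this) fun a => ?_
  · have := D.r_pos i
    nlinarith
  induction a using Alg.induction with
  | one => exact subset_span ⟨0, pow_zero _⟩
  | add a b ha hb => exact add_mem ha hb
  | smul k a ha => exact Submodule.smul_mem _ k ha
  | mul g a ha =>
    by_cases hg : wt g.top = single i 1
    · cases g with
      | e l => rwa [eq_singleton_of_wt (l := l) hg, e_eq_one fun _ => eq_singleton_of_wt, one_mul]
      | x l j r =>
        have h : l ++ j :: r = [i] := eq_singleton_of_wt hg
        obtain ⟨rfl, rfl, rfl⟩ : l = [] ∧ j = i ∧ r = [] := by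
          cases l <;> simp_all
        induction ha using span_induction with
        | mem a ha =>
          obtain ⟨k, rfl⟩ := ha
          exact subset_span ⟨k + 1, pow_succ' _ _⟩
        | zero | add => simp_all [mul_add, add_mem]
        | smul c a _ ha => rw [mul_smul_comm]; exact Submodule.smul_mem _ c ha
      | τ l j k r => exact absurd (congrArg List.length (eq_singleton_of_wt hg)) (by simp [Gen.top]; omega)
    · rw [gen_weight hg, zero_mul]; exact zero_mem _

theorem locFin_deg (ω : I →₀ ℕ) : LocFin (deg K D ω) := by
  induction hn : ω.degree generalizing ω with
  | zero =>
    obtain rfl : ω = 0 := (Finsupp.degree_eq_zero_iff ω).1 hn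
    refine .of_span (DirectSum.Decomposition.isInternal _) (fun k => if k = 0 then 1 else 0) (fun k => k) (fun k => le_rfl)
      (fun k => ?_) fun a => ?_
    · split_ifs with h
      · rw [h, Nat.cast_zero]; exact SetLike.one_mem_graded _
      · exact zero_mem _
    · obtain ⟨c, rfl⟩ := exists_smul_one a
      exact Submodule.smul_mem _ c (subset_span ⟨0, rfl⟩)
  | succ n ih =>
    have hle : ∀ i : {i // single i 1 ≤ ω}, ω - single i.1 1 + single i.1 1 = ω := fun i =>
      tsub_add_cancel_of_le i.2
    have hdeg : ∀ i : {i // single i 1 ≤ ω}, (ω - single i.1 1).degree = n := fun i => by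
      have := congrArg Finsupp.degree (hle i)
      rw [map_add, Finsupp.degree_single, hn] at this
      omega
    refine .of_le (ι := Σ i : {i // single i 1 ≤ ω}, (blockBasis K D (hle i)).ι)
      (fun s => (ih _ (hdeg s.1)).tensorDeg (locFin_single s.1.1))
      (fun s => mulLeft K ((blockBasis K D (hle s.1)).b s.2) ∘ₗ (block (hle s.1)).toLin)
      (fun s => (blockBasis K D (hle s.1)).d s.2) fun m y hy => ?_
    rw [← mul_one y, ← sum_e, mul_sum]
    refine sum_mem fun l hl => ?_
    rcases List.eq_nil_or_concat' l with rfl | ⟨l', i, rfl⟩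
    · rw [mem_Seq, wt_nil] at hl
      rw [← hl] at hn; simp at hn
    have hl' : wt l' + single i 1 = ω := by simpa using mem_Seq.1 hl
    have hi : single i 1 ≤ ω := hl' ▸ le_add_self
    have h1 : wt l' = ω - single i 1 := by rw [← hl', add_tsub_cancel_right]
    let R := blockBasis K D (hle ⟨i, hi⟩)
    let t := gen K D (ω - single i 1) (.e l') ⊗ₜ[K] gen K D (single i 1) (.e [i])
    have ht : (block (hle ⟨i, hi⟩)).toLin t = gen K D ω (.e (l' ++ [i])) := block_e _ h1 (by simp)
    have ht0 : t ∈ tensorDeg (deg K D (ω - single i 1)) (deg K D (single i 1)) 0 := by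
      have := tmul_mem (gen_mem_deg (K := K) (D := D) (ν := ω - single i 1) (.e l'))
        (gen_mem_deg (K := K) (D := D) (ν := single i 1) (.e [i]))
      rwa [show Gen.deg D (.e l') + Gen.deg D (.e [i]) = 0 from add_zero 0] at this
    have key : y * gen K D ω (.e (l' ++ [i])) = ∑ s, R.b s * (block (hle ⟨i, hi⟩)).toLin (R.coord s y * t) := by
      rw [← ht, ← one_mul t, Hom.map_mul, ← mul_assoc, ← R.sum_coord, sum_mul, one_mul]
      exact sum_congr rfl fun s _ => by rw [Hom.map_mul, mul_assoc]
    rw [key]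
    refine sum_mem fun s _ => mem_iSup_of_mem (⟨⟨i, hi⟩, s⟩ : Σ i, (blockBasis K D (hle i)).ι)
      (Submodule.mem_map.2 ⟨R.coord s y * t, ?_, rfl⟩)
    have := SetLike.mul_mem_graded (R.coord_mem s m hy) ht0
    rwa [add_zero] at this

end QHA

namespace Gr

section K0Maps
variable {K : Type u} [Field K] {A B C D : Type v} [Ring A] [Algebra K A] [Ring B] [Algebra K B] [Ring C] [Algebra K C]
  [Ring D] [Algebra K D] {𝒜 : ℤ → Submodule K A} {ℬ : ℤ → Submodule K B} {𝒞 : ℤ → Submodule K C} {𝒟 : ℤ → Submodule K D}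
  [GradedAlgebra 𝒜] [GradedAlgebra ℬ] [GradedAlgebra 𝒞] [GradedAlgebra 𝒟]

theorem K0.ext₂ {X : Type*} [AddCommGroup X] [Module ℤ[T;T⁻¹] X] {f g : K0 𝒜 →ₗ[ℤ[T;T⁻¹]] K0 ℬ →ₗ[ℤ[T;T⁻¹]] X}
    (h : ∀ P Q, f (K0.mk P) (K0.mk Q) = g (K0.mk P) (K0.mk Q)) (x : K0 𝒜) (y : K0 ℬ) : f x y = g x y := by
  rw [K0.linear_ext fun P => K0.linear_ext fun Q => h P Q]

theorem boxK_indK (φ : Hom 𝒜 ℬ) (ψ : Hom 𝒞 𝒟) (x : K0 𝒜) (y : K0 𝒞) :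
    boxK ℬ 𝒟 (indK φ x) (indK ψ y) = indK (φ.tensor ψ) (boxK 𝒜 𝒞 x y) :=
  K0.ext₂ (f := (boxK ℬ 𝒟).compl₁₂ (indK φ) (indK ψ)) (g := (boxK 𝒜 𝒞).compr₂ (indK (φ.tensor ψ)))
    (fun P Q => by simpa using K0.mk_iso (ind_box φ ψ Q.1).symm) x y

theorem boxK_resK {φ : Hom 𝒜 ℬ} {ψ : Hom 𝒞 𝒟} (hφ : HasLeftBasis φ) (hψ : HasLeftBasis ψ) (x : K0 ℬ) (y : K0 𝒟) :
    boxK 𝒜 𝒞 (resK φ hφ x) (resK ψ hψ y) = resK (φ.tensor ψ) (hφ.tensor hψ) (boxK ℬ 𝒟 x y) :=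
  K0.ext₂ (f := (boxK 𝒜 𝒞).compl₁₂ (resK φ hφ) (resK ψ hψ)) (g := (boxK ℬ 𝒟).compr₂ (resK (φ.tensor ψ) (hφ.tensor hψ)))
    (fun P Q => by simpa using K0.mk_iso (res_box (φ := φ) ψ Q.1).symm) x y

theorem resK_swap (x : K0 𝒜) (y : K0 𝒞) (z : K0 ℬ) (w : K0 𝒟) :
    resK (Hom.swapMiddle 𝒜 ℬ 𝒞 𝒟) hasLeftBasis_swapMiddle (boxK (tensorDeg 𝒜 𝒞) (tensorDeg ℬ 𝒟) (boxK 𝒜 𝒞 x y) (boxK ℬ 𝒟 z w)) =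
      boxK (tensorDeg 𝒜 ℬ) (tensorDeg 𝒞 𝒟) (boxK 𝒜 ℬ x z) (boxK 𝒞 𝒟 y w) := by
  induction x using K0.induction with
  | add | neg => simp_all
  | mk X =>
  induction y using K0.induction with
  | add | neg => simp_all
  | mk Y =>
  induction z using K0.induction with
  | add | neg => simp_all
  | mk Z =>
  induction w using K0.induction with
  | add | neg => simp_all
  | mk W =>
  simp only [boxK_mk, resK_mk]
  exact K0.mk_iso (swap_box X.1 Y.1 Z.1 W.1)

/-- Induction along a unital map killing a factor which consists of scalars. -/
theorem exists_eq_one_tmul {V W : Type*} [AddCommGroup V] [Module K V] [AddCommGroup W] [Module K W] {v₀ : V}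
    (h : ∀ v, ∃ c : K, v = c • v₀) (t : V ⊗[K] W) : ∃ w, t = v₀ ⊗ₜ w := by
  induction t using induction_on with
  | zero => exact ⟨0, (tmul_zero _ _).symm⟩
  | add x y hx hy =>
    obtain ⟨w, rfl⟩ := hx
    obtain ⟨w', rfl⟩ := hy
    exact ⟨w + w', (tmul_add _ _ _).symm⟩
  | tmul v w =>
    obtain ⟨c, rfl⟩ := h v
    exact ⟨c • w, TensorProduct.smul_tmul _ _ _⟩

theorem exists_eq_tmul_one {V W : Type*} [AddCommGroup V] [Module K V] [AddCommGroup W] [Module K W] {v₀ : V}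
    (h : ∀ v, ∃ c : K, v = c • v₀) (t : W ⊗[K] V) : ∃ w, t = w ⊗ₜ v₀ := by
  obtain ⟨w, hw⟩ := exists_eq_one_tmul h (TensorProduct.comm K W V t)
  exact ⟨w, (TensorProduct.comm K W V).injective hw⟩

variable (h𝒜 : ∀ a : A, ∃ c : K, a = c • 1) {P : GrMod.{u, v, v} ℬ}

include h𝒜 in
theorem ind_unit_left (φ : Hom (tensorDeg 𝒜 ℬ) ℬ) (hφ : ∀ b, φ.toLin (1 ⊗ₜ b) = b) :
    GrIso (ind φ ((GrMod.self 𝒜).box P)) P := by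
  let η : (GrMod.self 𝒜).box P →ₗ[K] P := boxLift ((Algebra.lsmul K K P).toLinearMap ∘ₗ φ.toLin ∘ₗ (TensorProduct.mk K A B).flip 1)
  let ι : P →ₗ[K] (GrMod.self 𝒜).box P := boxMk (GrMod.self 𝒜) P (1 : A)
  have hη : ∀ p, η (ι p) = p := fun p => by
    change φ.toLin (1 ⊗ₜ 1) • p = p
    rw [hφ, one_smul]
  have hι : ∀ n, ∃ p, n = ι p := exists_eq_one_tmul h𝒜
  have hs : ∀ b p, ((1 : A) ⊗ₜ[K] b) • ι p = ι (b • p) := fun b p =>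
    (smul_boxMk (M := GrMod.self 𝒜) (1 : A) b (1 : A) p).trans (congrArg (boxMk (GrMod.self 𝒜) P · (b • p)) (one_smul A (1 : A)))
  refine ind_iso_of φ η (fun t n => ?_) (fun k n hn => boxLift_mem (M := GrMod.self 𝒜) (deg := P.deg)
    (fun i j a ha p hp => ?_) hn) (fun x => subset_span ⟨ι x, hη x⟩) (indUnit φ _ ∘ₗ ι) (fun b n => ?_)
  · obtain ⟨b, rfl⟩ := exists_eq_one_tmul h𝒜 t
    obtain ⟨p, rfl⟩ := hι n
    rw [hs, hη, hη, hφ]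
  · have := φ.map_deg _ _ (tmul_mem (show a ∈ 𝒜 i from ha) (SetLike.one_mem_graded ℬ))
    rw [add_zero] at this
    exact P.smul_mem i j _ this p hp
  · obtain ⟨p, rfl⟩ := hι n
    rw [hη, comp_apply, ← hs, smul_indUnit, hφ]

include h𝒜 in
theorem ind_unit_right (φ : Hom (tensorDeg ℬ 𝒜) ℬ) (hφ : ∀ b, φ.toLin (b ⊗ₜ 1) = b) :
    GrIso (ind φ (P.box (GrMod.self 𝒜))) P := by
  let η : P.box (GrMod.self 𝒜) →ₗ[K] P :=
    boxLift ((Algebra.lsmul K K P).toLinearMap ∘ₗ φ.toLin ∘ₗ TensorProduct.mk K B A 1).flip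
  let ι : P →ₗ[K] P.box (GrMod.self 𝒜) := (boxMk P (GrMod.self 𝒜)).flip (1 : A)
  have hη : ∀ p, η (ι p) = p := fun p => by
    change φ.toLin (1 ⊗ₜ 1) • p = p
    rw [hφ, one_smul]
  have hι : ∀ n, ∃ p, n = ι p := exists_eq_tmul_one h𝒜
  have hs : ∀ b p, (b ⊗ₜ[K] (1 : A)) • ι p = ι (b • p) := fun b p =>
    (smul_boxMk (N := GrMod.self 𝒜) b (1 : A) p (1 : A)).trans (congrArg (boxMk P (GrMod.self 𝒜) (b • p)) (one_smul A (1 : A)))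
  refine ind_iso_of φ η (fun t n => ?_) (fun k n hn => boxLift_mem (N := GrMod.self 𝒜) (deg := P.deg)
    (fun i j p hp a ha => ?_) hn) (fun x => subset_span ⟨ι x, hη x⟩) (indUnit φ _ ∘ₗ ι) (fun b n => ?_)
  · obtain ⟨b, rfl⟩ := exists_eq_tmul_one h𝒜 t
    obtain ⟨p, rfl⟩ := hι n
    rw [hs, hη, hη, hφ]
  · have := φ.map_deg _ _ (tmul_mem (SetLike.one_mem_graded ℬ) (show a ∈ 𝒜 j from ha))
    rw [zero_add] at this
    rw [add_comm]
    exact P.smul_mem j i _ this p hp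
  · obtain ⟨p, rfl⟩ := hι n
    rw [hη, comp_apply, ← hs, smul_indUnit, hφ]

end K0Maps

section Filtration
variable {K : Type u} [Field K] {A : Type v} [Ring A] [Algebra K A] {𝒜 : ℤ → Submodule K A} [GradedAlgebra 𝒜]

theorem K0.mk_filtration {M : FGProj 𝒜} {r : ℕ} {F : Fin (r + 1) → Submodule A M.1} (hF : Monotone F) (h0 : F 0 = ⊥)
    (h1 : F (Fin.last r) = ⊤) (hh : ∀ k, M.1.IsHomogeneous (F k)) (L : Fin r → FGProj 𝒜)
    (hL : ∀ k : Fin r, M.1.SubquotientIso (F k.castSucc) (F k.succ) (L k).1) : K0.mk M = ∑ k, K0.mk (L k) := by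
  let N : Fin (r + 1) → GrMod.{u, v, v} 𝒜 := fun k => M.1.sub (F k) fun n _ hx => (hh k).proj_mem n hx
  have hN : ∀ k : Fin r, IsShortExact (N k.castSucc) (N k.succ) (L k).1 := fun k => by
    obtain ⟨e, he⟩ := hL k
    refine ⟨Submodule.inclusion (hF (Fin.castSucc_lt_succ (i := k)).le), e.toLinearMap ∘ₗ Submodule.mkQ _, fun n m hm => hm,
      fun n m hm => he n m hm, Submodule.inclusion_injective _, fun x => ?_,
      e.surjective.comp (Submodule.mkQ_surjective _)⟩
    change e (Submodule.Quotient.mk x) = 0 ↔ _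
    exact (e.map_eq_zero_iff.trans (Submodule.Quotient.mk_eq_zero _)).trans ⟨fun h => ⟨⟨x.1, h⟩, rfl⟩, fun ⟨y, hy⟩ => hy ▸ y.2⟩
  have htop : GrIso (N (Fin.last r)) M.1 :=
    ⟨(LinearEquiv.ofEq _ _ h1).trans Submodule.topEquiv, fun n m hm => hm⟩
  have hfg : ∀ k, (N k).IsFGProj := fun k => by
    induction k using Fin.reverseInduction with
    | last => exact htop.symm.isFGProj M.2
    | cast k ih => exact ((hN k).isBiprod (L k).2).isFGProj_left ih
  have key : ∀ {G : Type (max u (v + 1))} [AddCommGroup G] {r : ℕ} (c : Fin (r + 1) → G) (d : Fin r → G),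
      (∀ k : Fin r, c k.succ = c k.castSucc + d k) → c (Fin.last r) = c 0 + ∑ k, d k := by
    intro G _ r
    induction r with
    | zero => intro c d _; simp
    | succ r ih =>
      intro c d h
      rw [Fin.sum_univ_castSucc, ← add_assoc]
      exact (h (Fin.last r)).trans
        (congrArg (· + d (Fin.last r)) (ih (fun k => c k.castSucc) (fun k => d k.castSucc) fun k => h k.castSucc))
  have := key (fun k => K0.mk ⟨N k, hfg k⟩) (fun k => K0.mk (L k)) fun k =>
    K0.mk_shortExact (P' := ⟨N k.castSucc, hfg _⟩) (P := ⟨N k.succ, hfg _⟩) (hN k)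
  have e1 : K0.mk (⟨N (Fin.last r), hfg _⟩ : FGProj 𝒜) = K0.mk M := K0.mk_iso htop
  have e2 : K0.mk (⟨N 0, hfg 0⟩ : FGProj 𝒜) = 0 := K0.mk_zero_of fun x => Subtype.ext ((mem_bot A).1 (h0.le x.2))
  exact e1.symm.trans (this.trans ((congrArg (· + _) e2).trans (zero_add _)))

end Filtration
end Gr

namespace Gr

section
variable {K : Type u} [Field K] {A B C D : Type v} [Ring A] [Algebra K A] [Ring B] [Algebra K B] [Ring C] [Algebra K C]
  [Ring D] [Algebra K D] {𝒜 : ℤ → Submodule K A} {ℬ : ℤ → Submodule K B} {𝒞 : ℤ → Submodule K C} {𝒟 : ℤ → Submodule K D}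
  [GradedAlgebra 𝒜] [GradedAlgebra ℬ] [GradedAlgebra 𝒞] [GradedAlgebra 𝒟]

theorem ind_assoc (φ : Hom (tensorDeg (tensorDeg 𝒜 ℬ) 𝒞) 𝒟) (φ' : Hom (tensorDeg 𝒜 (tensorDeg ℬ 𝒞)) 𝒟)
    (h : ∀ a b c, φ'.toLin (a ⊗ₜ (b ⊗ₜ c)) = φ.toLin ((a ⊗ₜ b) ⊗ₜ c)) (X : GrMod.{u, v, v} 𝒜) (Y : GrMod.{u, v, v} ℬ)
    (Z : GrMod.{u, v, v} 𝒞) : GrIso (ind φ ((X.box Y).box Z)) (ind φ' (X.box (Y.box Z))) := by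
  let E : (X.box Y).box Z ≃ₗ[K] X.box (Y.box Z) := TensorProduct.assoc K X Y Z
  have hE : ∀ x y z, E (boxMk (X.box Y) Z (boxMk X Y x y) z) = boxMk X (Y.box Z) x (boxMk Y Z y z) := fun _ _ _ => rfl
  refine ind_congr φ φ' (TensorProduct.assoc K A B C) (LinearEquiv.surjective _) (fun t => ?_) E (fun t n => ?_) fun k n hn => ?_
  · induction t using induction_on with
    | zero | add => simp_all
    | tmul t c =>
    induction t using induction_on with
    | zero | add => simp_all [add_tmul]
    | tmul a b => exact h a b c
  · induction t using induction_on with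
    | zero =>
      rw [map_zero]
      exact (congrArg E (zero_smul (A ⊗[K] B ⊗[K] C) n)).trans
        (E.map_zero.trans (zero_smul (A ⊗[K] (B ⊗[K] C)) (E n)).symm)
    | add x y hx hy => simp only [map_add, add_smul, hx, hy]
    | tmul t c =>
    induction t using induction_on with
    | zero =>
      rw [zero_tmul, map_zero]
      exact (congrArg E (zero_smul (A ⊗[K] B ⊗[K] C) n)).trans
        (E.map_zero.trans (zero_smul (A ⊗[K] (B ⊗[K] C)) (E n)).symm)
    | add x y hx hy => simp only [add_tmul, map_add, add_smul, hx, hy]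
    | tmul a b =>
    induction n using box_induction with
    | zero | add => simp_all [smul_add]
    | mk n z =>
    induction n using box_induction with
    | zero | add => simp_all [smul_add]
    | mk x y =>
    rw [smul_boxMk, smul_boxMk, hE, hE, assoc_tmul, smul_boxMk, smul_boxMk]
  · refine box_deg_le (S := ((X.box (Y.box Z)).deg k).comap E.toLinearMap) ?_ hn
    rintro i j rfl s hs z hz
    refine box_deg_le (S := ((X.box (Y.box Z)).deg (i + j)).comap (E.toLinearMap ∘ₗ (boxMk _ _).flip z)) ?_ hs
    rintro i i' rfl x hx y hy
    exact boxMk_mem (N := Y.box Z) (add_assoc _ _ _).symm hx (boxMk_mem rfl hy hz)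

theorem indK_id (x : K0 𝒜) : indK (Hom.id 𝒜) x = x :=
  lcongr_fun (f := indK (Hom.id 𝒜)) (g := .id)
    (K0.linear_ext fun P => (indK_mk _ P).trans (K0.mk_iso ind_id)) x

theorem indK_indK (φ : Hom 𝒜 ℬ) (ψ : Hom ℬ 𝒞) (x : K0 𝒜) : indK ψ (indK φ x) = indK (ψ.comp φ) x :=
  lcongr_fun (f := indK ψ ∘ₗ indK φ) (K0.linear_ext fun P => by
    simpa using (K0.mk_iso (ind_ind (φ := φ) (N := P.1) ψ)).symm) x

end
end Gr

namespace QHA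
open Gr LaurentPolynomial
variable {K : Type u} [Field K] {I : Type v} [Finite I] {D : BorcherdsDatum I}

section Assoc
variable {ν α β γ ω αβ βγ : I →₀ ℕ}

theorem eq_of_gen {R : Type*} [Ring R] [Algebra K R] (f g : Alg K D ν →ₗ[K] R) (hf : ∀ a b, f (a * b) = f a * f b)
    (hg : ∀ a b, g (a * b) = g a * g b) (h : ∀ x : Gen I, wt x.bot = ν → f (gen K D ν x) = g (gen K D ν x))
    (a : Alg K D ν) : f a = g a :=
  Alg.sum_gen_e_induction (P := fun a => f a = g a) (fun a b ha hb => by rw [map_add, map_add, ha, hb])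
    (fun c a ha => by rw [map_smul, map_smul, ha]) (by rw [map_zero, map_zero])
    (fun a b ha hb => by rw [hf, hg, ha, hb]) h a

theorem block_assoc (h1 : α + β = αβ) (h2 : αβ + γ = ω) (h3 : β + γ = βγ) (h4 : α + βγ = ω) (a : Alg K D α)
    (b : Alg K D β) (c : Alg K D γ) : (block h4).toLin (a ⊗ₜ (block h3).toLin (b ⊗ₜ c)) =
      (block h2).toLin ((block h1).toLin (a ⊗ₜ b) ⊗ₜ c) := by
  let F := curry (curry ((block (K := K) (D := D) h4).toLin ∘ₗ
    TensorProduct.map .id (block h3).toLin ∘ₗ (TensorProduct.assoc K _ _ _).toLinearMap))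
  let G := curry (curry ((block (K := K) (D := D) h2).toLin ∘ₗ
    TensorProduct.map (block h1).toLin .id))
  have hF : ∀ a a' b b' c c', F (a * a') (b * b') (c * c') = F a b c * F a' b' c' := fun a a' b b' c c' => by
    simp [F, ← Hom.map_mul]
  have hG : ∀ a a' b b' c c', G (a * a') (b * b') (c * c') = G a b c * G a' b' c' := fun a a' b b' c c' => by
    simp [G, ← Hom.map_mul]
  have k1 := fun l r (hl : wt l = β) (hr : wt r = γ) a => eq_of_gen ((F.flip (gen _ _ _ (.e l))).flip (gen _ _ _ (.e r))) ((G.flip (gen _ _ _ (.e l))).flip (gen _ _ _ (.e r)))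
    (fun a b => by simp [← hF, e_idem]) (fun a b => by simp [← hG, e_idem]) (fun x hx => by
      simp only [F, G, LinearMap.flip_apply, curry_apply, comp_apply, LinearEquiv.coe_coe,
        assoc_tmul, map_tmul, id_apply]
      rw [block_e h3 hl hr, block_left h1 hx hl, block_left h4 hx (by simp [hl, hr, h3]), block_left h2 (by simp [hx, hl, h1, Gen.bot_ctx]) hr, Gen.ctx_ctx]
      simp) a
  have k2 := fun l r (hl : wt l = α) (hr : wt r = γ) a => eq_of_gen ((F (gen _ _ _ (.e l))).flip (gen _ _ _ (.e r))) ((G (gen _ _ _ (.e l))).flip (gen _ _ _ (.e r)))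
    (fun a b => by simp [← hF, e_idem]) (fun a b => by simp [← hG, e_idem]) (fun x hx => by
      simp only [F, G, LinearMap.flip_apply, curry_apply, comp_apply, LinearEquiv.coe_coe,
        assoc_tmul, map_tmul, id_apply]
      rw [block_right h1 hl hx, block_left h3 hx hr, block_right h4 hl (by simp [Gen.bot_ctx, hx, hr, h3]), block_left h2 (by simp [hx, hl, h1, Gen.bot_ctx]) hr, Gen.ctx_ctx, Gen.ctx_ctx]
      simp) a
  have k3 := fun l r (hl : wt l = α) (hr : wt r = β) a => eq_of_gen (F (gen _ _ _ (.e l)) (gen _ _ _ (.e r))) (G (gen _ _ _ (.e l)) (gen _ _ _ (.e r)))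
    (fun a b => by simp [← hF, e_idem]) (fun a b => by simp [← hG, e_idem]) (fun x hx => by
      simp only [F, G, LinearMap.flip_apply, curry_apply, comp_apply, LinearEquiv.coe_coe,
        assoc_tmul, map_tmul, id_apply]
      rw [block_e h1 hl hr, block_right h3 hr hx, block_right h4 hl (by simp [Gen.bot_ctx, hx, hr, h3]), block_right h2 (by simp [hr, hl, h1]) hx, Gen.ctx_ctx]
      simp) a
  have e1 : F a 1 1 = G a 1 1 := by
    simp only [← sum_e, map_sum, lsum_apply]
    exact sum_congr rfl fun r hr => sum_congr rfl fun l hl => k1 _ _ (mem_Seq.1 (by assumption)) (mem_Seq.1 (by assumption)) a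
  have e2 : F 1 b 1 = G 1 b 1 := by
    simp only [← sum_e, map_sum, lsum_apply]
    exact sum_congr rfl fun r hr => sum_congr rfl fun l hl => k2 _ _ (mem_Seq.1 (by assumption)) (mem_Seq.1 (by assumption)) b
  have e3 : F 1 1 c = G 1 1 c := by
    simp only [← sum_e, map_sum, lsum_apply]
    exact sum_congr rfl fun r hr => sum_congr rfl fun l hl => k3 _ _ (mem_Seq.1 (by assumption)) (mem_Seq.1 (by assumption)) c
  change F a b c = G a b c
  have hf := hF a 1 1 b 1 c
  have hg := hG a 1 1 b 1 c
  have hf' := hF 1 1 b 1 1 c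
  have hg' := hG 1 1 b 1 1 c
  simp only [mul_one, one_mul] at hf hg hf' hg'
  rw [hf, hg, hf', hg', e1, e2, e3]

/-- The product of classes given by induction. -/
def mulK (h : α + β = ω) : K0 (deg K D α) →ₗ[ℤ[T;T⁻¹]] K0 (deg K D β) →ₗ[ℤ[T;T⁻¹]] K0 (deg K D ω) :=
  (boxK (deg K D α) (deg K D β)).compr₂ (indK (block h))

theorem mulK_assoc (h1 : α + β = αβ) (h2 : αβ + γ = ω) (h3 : β + γ = βγ) (h4 : α + βγ = ω) (x : K0 (deg K D α))
    (y : K0 (deg K D β)) (z : K0 (deg K D γ)) : mulK h2 (mulK h1 x y) z = mulK h4 x (mulK h3 y z) := by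
  change indK (block h2) (boxK _ _ (indK (block h1) (boxK _ _ x y)) z) =
    indK (block h4) (boxK _ _ x (indK (block h3) (boxK _ _ y z)))
  rw [← indK_id z, ← indK_id x, boxK_indK, boxK_indK, indK_id, indK_id, indK_indK, indK_indK]
  induction x using K0.induction with
  | add | neg => simp_all
  | mk X =>
  induction y using K0.induction with
  | add | neg => simp_all
  | mk Y =>
  induction z using K0.induction with
  | add | neg => simp_all
  | mk Z =>
  simp only [boxK_mk, indK_mk]
  exact K0.mk_iso (ind_assoc _ _ (block_assoc h1 h2 h3 h4) X.1 Y.1 Z.1)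

end Assoc
end QHA

namespace Twist
open DirectSum
variable {R : Type*} [CommRing R] {ι : Type*} [DecidableEq ι] {V : ι → Type*} [∀ i, AddCommGroup (V i)]
  [∀ i, Module R (V i)] (m : (⨁ i, V i) →ₗ[R] (⨁ i, V i) →ₗ[R] ⨁ i, V i) (χ : ι → ι → R)

theorem ind₂ {P : (⨁ i, V i) ⊗[R] (⨁ i, V i) → Prop} (zero : P 0) (add : ∀ x y, P x → P y → P (x + y))
    (mk : ∀ i j x y, P (lof R ι V i x ⊗ₜ lof R ι V j y)) (t) : P t := by
  induction t using induction_on with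
  | zero => exact zero
  | add x y hx hy => exact add x y hx hy
  | tmul x y =>
  induction x using DirectSum.induction_on with
  | zero => rwa [zero_tmul]
  | add x y hx hy => rw [add_tmul]; exact add _ _ hx hy
  | of i x =>
  induction y using DirectSum.induction_on with
  | zero => rwa [tmul_zero]
  | add x y hx hy => rw [tmul_add]; exact add _ _ hx hy
  | of j y => exact mk i j x y

/-- Multiplication of the summand of degree `μ` by `χ ν μ`. -/
def scale (ν : ι) : (⨁ i, V i) →ₗ[R] ⨁ i, V i := toModule R ι _ fun μ => χ ν μ • lof R ι V μ

/-- The product on the tensor square twisted by `χ`. -/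
def twist : (⨁ i, V i) ⊗[R] (⨁ i, V i) →ₗ[R] (⨁ i, V i) ⊗[R] (⨁ i, V i) →ₗ[R] (⨁ i, V i) ⊗[R] (⨁ i, V i) :=
  TensorProduct.lift (LinearMap.flip (toModule R ι _ fun ν => LinearMap.flip
    ((TensorProduct.mapBilinear (.id R) _ _ _ _).compl₁₂ (lcomp R _ (scale χ ν) ∘ₗ m) (m ∘ₗ lof R ι V ν))))

variable {m χ}
theorem twist_tmul (ν μ : ι) (x₁ y₂ : ⨁ i, V i) (x₂ : V ν) (y₁ : V μ) :
    twist m χ (x₁ ⊗ₜ lof R ι V ν x₂) (lof R ι V μ y₁ ⊗ₜ y₂) =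
      χ ν μ • (m x₁ (lof R ι V μ y₁) ⊗ₜ m (lof R ι V ν x₂) y₂) := by
  simp [twist, scale, smul_tmul']

variable [AddMonoid ι]

theorem twist_assoc (hm : ∀ i j x y, ∃ z, m (lof R ι V i x) (lof R ι V j y) = lof R ι V (i + j) z)
    (h1 : ∀ i j k, χ (i + j) k = χ i k * χ j k) (h2 : ∀ i j k, χ i (j + k) = χ i j * χ i k)
    (ha : ∀ x y z, m (m x y) z = m x (m y z)) (x y z) :
    twist m χ (twist m χ x y) z = twist m χ x (twist m χ y z) := by
  induction x using ind₂ with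
  | zero | add => simp_all
  | mk i i' x x' =>
  induction y using ind₂ with
  | zero | add => simp_all
  | mk j j' y y' =>
  induction z using ind₂ with
  | zero | add => simp_all
  | mk k k' z z' =>
  obtain ⟨u, hu⟩ := hm i' j' x' y'
  obtain ⟨v, hv⟩ := hm j k y z
  simp only [twist_tmul, map_smul, lsmul_apply, hu, hv]
  rw [smul_smul, smul_smul, h1, h2, ← hu, ← hv, ha, ha]
  congr 1
  ring

theorem twist_one_left (e : V 0) (h : ∀ i, χ 0 i = 1) (he : ∀ x, m (lof R ι V 0 e) x = x) (x) :
    twist m χ (lof R ι V 0 e ⊗ₜ lof R ι V 0 e) x = x := by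
  induction x using ind₂ with
  | zero | add => simp_all
  | mk i j x y => rw [twist_tmul, h, one_smul, he, he]

theorem twist_one_right (e : V 0) (h : ∀ i, χ i 0 = 1) (he : ∀ x, m x (lof R ι V 0 e) = x) (x) :
    twist m χ x (lof R ι V 0 e ⊗ₜ lof R ι V 0 e) = x := by
  induction x using ind₂ with
  | zero | add => simp_all
  | mk i j x y => rw [twist_tmul, h, one_smul, he, he]

end Twist

namespace QHA
open Gr LaurentPolynomial
variable {K : Type u} [Field K] {I : Type v} [Finite I] {D : BorcherdsDatum I}

section Unit
variable {ν ω : I →₀ ℕ}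

theorem rightHom_zero (h : 0 + ν = ν) (a : Alg K D ν) : (block h).toLin (1 ⊗ₜ a) = a :=
  eq_of_gen ((block h).toLin ∘ₗ TensorProduct.mk K _ _ 1) .id (fun a b => by simp [← Hom.map_mul]) (fun _ _ => rfl)
    (fun x hx => by
      change (block h).toLin (1 ⊗ₜ _) = _
      rw [← e_eq_one (l := []) fun _ => eq_nil_of_wt, block_right h rfl hx, Gen.ctx_nil]; rfl) a

theorem leftHom_zero (h : ν + 0 = ν) (a : Alg K D ν) : (block h).toLin (a ⊗ₜ 1) = a :=
  eq_of_gen ((block h).toLin ∘ₗ (TensorProduct.mk K _ _).flip 1) .id (fun a b => by simp [← Hom.map_mul]) (fun _ _ => rfl)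
    (fun x hx => by
      change (block h).toLin (_ ⊗ₜ 1) = _
      rw [← e_eq_one (l := []) fun _ => eq_nil_of_wt, block_left h hx rfl, Gen.ctx_nil]; rfl) a

/-- The class of `R(0)`. -/
def oneK (K : Type u) [Field K] (D : BorcherdsDatum I) : K0 (deg K D 0) := K0.mk ⟨GrMod.self (deg K D 0), isFGProj_self _⟩

theorem mulK_one_left (h : 0 + ν = ν) (x : K0 (deg K D ν)) : mulK h (oneK K D) x = x :=
  lcongr_fun (f := mulK h (oneK K D)) (g := .id) (K0.linear_ext fun P => by
    exact (congrArg (indK (block h)) (boxK_mk _ P)).trans ((indK_mk _ _).trans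
      (K0.mk_iso (ind_unit_left exists_smul_one (block h) (rightHom_zero h))))) x

theorem mulK_one_right (h : ν + 0 = ν) (x : K0 (deg K D ν)) : mulK h x (oneK K D) = x :=
  lcongr_fun (f := (mulK h).flip (oneK K D)) (g := .id) (K0.linear_ext fun P => by
    exact (congrArg (indK (block h)) (boxK_mk P _)).trans ((indK_mk _ _).trans
      (K0.mk_iso (ind_unit_right exists_smul_one (block h) (leftHom_zero h))))) x

theorem resK_oneK (h : (0 : I →₀ ℕ) + 0 = 0) :
    resK (block h) (hasLeftBasis_block h) (oneK K D) = boxK _ _ (oneK K D) (oneK K D) := by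
  have hb : ∀ t : Alg K D 0 ⊗[K] Alg K D 0, ∃ a, t = 1 ⊗ₜ a := exists_eq_one_tmul exists_smul_one
  let f : ((GrMod.self (deg K D 0)).box (GrMod.self (deg K D 0))) →ₗ[Alg K D 0 ⊗[K] Alg K D 0]
      res (block h) (GrMod.self (deg K D 0)) :=
    { toFun := fun t => ⟨(block h).toLin t,
        ((block h).map_mul 1 t).symm.trans (congrArg (block h).toLin (one_mul (M := Alg K D 0 ⊗[K] Alg K D 0) t))⟩
      map_add' := fun s t => Subtype.ext (map_add _ s t)
      map_smul' := fun s t => Subtype.ext (by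
        obtain ⟨a, rfl⟩ := hb s
        obtain ⟨b, rfl⟩ := hb t
        refine Eq.trans (congrArg (block h).toLin ?_) ((block h).map_mul (1 ⊗ₜ a) (1 ⊗ₜ b))
        rw [tmul_mul_tmul]
        exact smul_boxMk (M := GrMod.self (deg K D 0)) (N := GrMod.self (deg K D 0)) _ _ _ _) }
  refine (resK_mk _ _ _).trans (Eq.trans ?_ (boxK_mk _ _).symm)
  refine (K0.mk_iso ⟨.ofBijective f ⟨fun s t hst => ?_, fun x => ⟨(1 : Alg K D 0) ⊗ₜ x.1, Subtype.ext (rightHom_zero h x.1)⟩⟩,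
    fun n t ht => (block h).map_deg n t ht⟩).symm
  obtain ⟨a, rfl⟩ := hb s
  obtain ⟨b, rfl⟩ := hb t
  have := congrArg Subtype.val hst
  rw [show a = b from (rightHom_zero h a).symm.trans (this.trans (rightHom_zero h b))]
end Unit
end QHA

namespace QHA
open Gr LaurentPolynomial
variable {K : Type u} [Field K] {I : Type v} [Finite I] {D : BorcherdsDatum I} {ν ν' μ μ' ω : I →₀ ℕ}

theorem pairing_comm (ν μ : I →₀ ℕ) : D.pairing ν μ = D.pairing μ ν := by
  rw [BorcherdsDatum.pairing, BorcherdsDatum.pairing, Finsupp.sum_comm]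
  exact Finsupp.sum_congr fun i _ => Finsupp.sum_congr fun j _ => by rw [D.dot_comm, mul_comm (ν j : ℤ)]

theorem resK_indK [Fintype (MackeyIndex ν ν' μ μ')] (h : ν + ν' = μ + μ') (X : K0 (tensorDeg (deg K D μ) (deg K D μ'))) :
    resK (block h) (hasLeftBasis_block h) (indK (block (rfl : μ + μ' = μ + μ')) X) =
      ∑ lam : MackeyIndex ν ν' μ μ', (T (-D.pairing lam.lam (ν' + lam.lam - μ')) : ℤ[T;T⁻¹]) •
        indK ((block (mackey₁ lam)).tensor (block (mackey₂ lam))) (resK (Hom.swapMiddle (deg K D (ν - lam.lam))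
          (deg K D lam.lam) (deg K D (ν' + lam.lam - μ')) (deg K D (μ' - lam.lam))) hasLeftBasis_swapMiddle
          (resK ((block (mackey₃ h lam)).tensor (block (mackey₄ lam)))
            ((hasLeftBasis_block (mackey₃ h lam)).tensor (hasLeftBasis_block (mackey₄ lam))) X)) := by
  induction X using K0.induction with
  | add a b ha hb => simp only [map_add, ha, hb, smul_add, sum_add_distrib]
  | neg a ha => simp only [map_neg, ha, smul_neg, Finset.sum_neg_distrib]
  | mk P =>
  obtain ⟨r, lam, F, hF, h0, h1, hh, hL⟩ := exists_mackeyFilt h P.1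
  simp only [indK_mk, resK_mk, K0.T_smul_mk]
  rw [← lam.sum_comp]
  exact K0.mk_filtration hF h0 h1 hh _ hL

open scoped Classical

section Coproduct
variable [IsAlgClosed K]

/-- Outer tensor products of classes. -/
def extK (ν ν' : I →₀ ℕ) : K0 (deg K D ν) ⊗[ℤ[T;T⁻¹]] K0 (deg K D ν') ≃ₗ[ℤ[T;T⁻¹]]
    K0 (tensorDeg (deg K D ν) (deg K D ν')) :=
  LinearEquiv.ofBijective (TensorProduct.lift (boxK _ _)) (boxK_bijective (locFin_deg ν) (locFin_deg ν'))

theorem extK_tmul (x : K0 (deg K D ν)) (y : K0 (deg K D ν')) : extK ν ν' (x ⊗ₜ y) = boxK _ _ x y := TensorProduct.lift.tmul _ _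
theorem extK_symm (x : K0 (deg K D ν)) (y : K0 (deg K D ν')) : (extK ν ν').symm (boxK _ _ x y) = x ⊗ₜ y := by
  rw [LinearEquiv.symm_apply_eq, extK_tmul]

/-- The component of the coproduct in degrees `ν`, `ν'`. -/
def copK (ν ν' ω : I →₀ ℕ) : K0 (deg K D ω) →ₗ[ℤ[T;T⁻¹]] K0R K D ⊗[ℤ[T;T⁻¹]] K0R K D :=
  if h : ν + ν' = ω then
    TensorProduct.map (incl ν) (incl ν') ∘ₗ (extK ν ν').symm.toLinearMap ∘ₗ resK (block h) (hasLeftBasis_block h)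
  else 0

theorem copK_apply (h : ν + ν' = ω) (x : K0 (deg K D ω)) : copK ν ν' ω x =
    TensorProduct.map (incl ν) (incl ν') ((extK ν ν').symm (resK (block h) (hasLeftBasis_block h) x)) := by
  rw [copK, dif_pos h]; rfl

/-- The coproduct. -/
def cop (K : Type u) [Field K] [IsAlgClosed K] (D : BorcherdsDatum I) : K0R K D →ₗ[ℤ[T;T⁻¹]] K0R K D ⊗[ℤ[T;T⁻¹]] K0R K D :=
  toModule _ _ _ fun ω => ∑ p ∈ antidiagonal ω, copK p.1 p.2 ω

theorem cop_incl (x : K0 (deg K D ω)) : cop K D (incl ω x) = ∑ p ∈ antidiagonal ω, copK p.1 p.2 ω x := by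
  rw [cop, incl, DirectSum.toModule_lof, lsum_apply]

theorem comp_incl : comp (K := K) (D := D) ν ∘ₗ incl ν = .id := by
  ext x; exact DirectSum.component.lof_self (M := fun ν => K0 (deg K D ν)) ℤ[T;T⁻¹] ν x
theorem comp_incl_ne (h : ν ≠ μ) : comp (K := K) (D := D) μ ∘ₗ incl ν = 0 := by
  ext x
  exact (DirectSum.component.of (R := ℤ[T;T⁻¹]) ..).trans (dif_neg h)

theorem comp_copK (x : K0 (deg K D ω)) (h : (ν, ν') ≠ (μ, μ')) :
    TensorProduct.map (comp μ) (comp μ') (copK ν ν' ω x) = 0 := by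
  by_cases h' : ν + ν' = ω
  · rw [copK_apply h', ← comp_apply, ← TensorProduct.map_comp]
    by_cases h1 : ν = μ
    · rw [comp_incl_ne (ν := ν') (μ := μ') fun h2 => h (Prod.ext h1 h2), TensorProduct.map_zero_right, lzero_apply]
    · rw [comp_incl_ne h1, TensorProduct.map_zero_left, lzero_apply]
  · rw [copK, dif_neg h', lzero_apply, map_zero]

theorem isResCoproduct_cop : IsResCoproduct extK (cop K D) := by
  intro ω P ν ν'
  refine ⟨fun h => ⟨P.2.res (hasLeftBasis_block h), ?_⟩, fun h => ?_⟩
  · rw [cls, cop_incl, map_sum, sum_eq_single (ν, ν') (fun p _ hp => comp_copK _ hp)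
      fun hn => absurd (mem_antidiagonal.2 h) hn, copK_apply h, ← comp_apply (TensorProduct.map _ _),
      ← TensorProduct.map_comp, comp_incl, comp_incl, TensorProduct.map_id, id_apply, LinearEquiv.apply_symm_apply, resK_mk]
    rfl
  · rw [cls, cop_incl, map_sum]
    exact sum_eq_zero fun p hp => comp_copK _ fun hp' => h (by
      obtain rfl : p = (ν, ν') := hp'
      exact mem_antidiagonal.1 hp)

theorem isExternalProduct_extK : IsExternalProduct (extK (K := K) (D := D)) := fun _ _ P Q =>
  ⟨P.2.box Q.2, (extK_tmul _ _).trans (boxK_mk P Q)⟩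

end Coproduct

/-- The product given by induction. -/
def mulR (K : Type u) [Field K] (D : BorcherdsDatum I) : K0R K D →ₗ[ℤ[T;T⁻¹]] K0R K D →ₗ[ℤ[T;T⁻¹]] K0R K D :=
  toModule _ _ _ fun ν => LinearMap.flip (toModule _ _ _ fun ν' =>
    LinearMap.flip ((mulK (K := K) (D := D) (rfl : ν + ν' = ν + ν')).compr₂ (incl (ν + ν'))))

theorem mulR_incl (h : ν + ν' = ω) (x : K0 (deg K D ν)) (y : K0 (deg K D ν')) :
    mulR K D (incl ν x) (incl ν' y) = incl ω (mulK h x y) := by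
  subst h
  simp [mulR, incl]

theorem K0R.induction {P : K0R K D → Prop} (zero : P 0) (incl : ∀ ν x, P (incl ν x)) (add : ∀ x y, P x → P y → P (x + y))
    (x) : P x := by
  induction x using DirectSum.induction_on with
  | zero => exact zero
  | of ν x => exact incl ν x
  | add x y hx hy => exact add x y hx hy

theorem isIndProduct_mulR : IsIndProduct (mulR K D) := fun _ _ P Q =>
  ⟨(P.2.box Q.2).ind _, (mulR_incl rfl _ _).trans
    (congrArg (incl _) ((congrArg (indK (block _)) (boxK_mk P Q)).trans (indK_mk _ _)))⟩

theorem isAlgebraStructure_mulR : IsAlgebraStructure (mulR K D) (one K D) where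
  assoc x y z := by
    induction x using K0R.induction with
    | zero | add => simp_all
    | incl α x =>
    induction y using K0R.induction with
    | zero | add => simp_all
    | incl β y =>
    induction z using K0R.induction with
    | zero | add => simp_all
    | incl γ z =>
    rw [mulR_incl rfl, mulR_incl rfl, mulR_incl rfl, mulR_incl (add_assoc α β γ).symm, mulK_assoc rfl rfl rfl]
  one_mul x := by
    induction x using K0R.induction with
    | zero | add => simp_all
    | incl α x => exact (mulR_incl (zero_add α) (oneK K D) x).trans (congrArg _ (mulK_one_left _ x))
  mul_one x := by
    induction x using K0R.induction with
    | zero | add => simp_all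
    | incl α x => exact (mulR_incl (add_zero α) x (oneK K D)).trans (congrArg _ (mulK_one_right _ x))

/-- The twisted product. -/
def twR (K : Type u) [Field K] (D : BorcherdsDatum I) : K0R K D ⊗[ℤ[T;T⁻¹]] K0R K D →ₗ[ℤ[T;T⁻¹]]
    K0R K D ⊗[ℤ[T;T⁻¹]] K0R K D →ₗ[ℤ[T;T⁻¹]] K0R K D ⊗[ℤ[T;T⁻¹]] K0R K D :=
  Twist.twist (mulR K D) fun ν μ => T (-D.pairing ν μ)

theorem isTwistedProduct_twR : IsTwistedProduct (mulR K D) (twR K D) := fun ν μ x₁ y₂ x₂ y₁ =>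
  Twist.twist_tmul ν μ x₁ y₂ x₂ y₁

theorem isAlgebraStructure_twR : IsAlgebraStructure (twR K D) (one K D ⊗ₜ one K D) where
  assoc := Twist.twist_assoc (fun i j x y => ⟨_, mulR_incl rfl x y⟩)
    (fun i j k => by rw [pairing_add_left, neg_add, T_add])
    (fun i j k => by rw [pairing_add_right, neg_add, T_add]) isAlgebraStructure_mulR.assoc
  one_mul := Twist.twist_one_left _ (fun i => by rw [pairing_zero_left, neg_zero, T_zero]) isAlgebraStructure_mulR.one_mul
  mul_one := Twist.twist_one_right _ (fun i => by rw [pairing_zero_right, neg_zero, T_zero]) isAlgebraStructure_mulR.mul_one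

end QHA

namespace QHA
open Gr LaurentPolynomial
variable {K : Type u} [Field K] [IsAlgClosed K] {I : Type v} [Finite I] {D : BorcherdsDatum I} {ν ν' μ μ' ω a l c d : I →₀ ℕ}

theorem map_incl_layer (h1 : a + l = ν) (h2 : c + d = ν') (x : K0 (deg K D a) ⊗[ℤ[T;T⁻¹]] K0 (deg K D c))
    (y : K0 (deg K D l) ⊗[ℤ[T;T⁻¹]] K0 (deg K D d)) :
    (T (-D.pairing l c) : ℤ[T;T⁻¹]) • TensorProduct.map (incl ν) (incl ν') ((extK ν ν').symm
      (indK ((block h1).tensor (block h2)) (resK (Hom.swapMiddle _ _ _ _) hasLeftBasis_swapMiddle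
        (boxK _ _ (extK a c x) (extK l d y))))) =
      twR K D (TensorProduct.map (incl a) (incl c) x) (TensorProduct.map (incl l) (incl d) y) := by
  induction x using induction_on with
  | zero | add => simp_all [smul_add]
  | tmul x x' =>
  induction y using induction_on with
  | zero | add => simp_all [smul_add]
  | tmul y y' =>
  rw [extK_tmul, extK_tmul, resK_swap, ← boxK_indK, extK_symm, map_tmul, map_tmul,
    map_tmul, isTwistedProduct_twR, mulR_incl h1, mulR_incl h2, pairing_comm]
  rfl

theorem copK_mulK [Fintype (MackeyIndex ν ν' μ μ')] (h : ν + ν' = μ + μ') (x : K0 (deg K D μ)) (y : K0 (deg K D μ')) :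
    copK ν ν' _ (mulK rfl x y) = ∑ lam : MackeyIndex ν ν' μ μ', twR K D (copK (ν - lam.lam) (ν' + lam.lam - μ') μ x)
      (copK lam.lam (μ' - lam.lam) μ' y) := by
  rw [copK_apply h]
  refine (congrArg (fun z => TensorProduct.map (incl ν) (incl ν') ((extK ν ν').symm z)) (resK_indK h _)).trans ?_
  simp only [map_sum, map_smul]
  refine sum_congr rfl fun lam _ => ?_
  rw [copK_apply (mackey₃ h lam), copK_apply (mackey₄ lam), ← map_incl_layer (mackey₁ lam) (mackey₂ lam),
    LinearEquiv.apply_symm_apply, LinearEquiv.apply_symm_apply, boxK_resK]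

open scoped Classical in
theorem sum_mackeyIndex {X : Type*} [AddCommMonoid X] [∀ p : (I →₀ ℕ) × (I →₀ ℕ), Fintype (MackeyIndex p.1 p.2 μ μ')]
    (F : (I →₀ ℕ) → (I →₀ ℕ) → (I →₀ ℕ) → (I →₀ ℕ) → X) :
    ∑ p ∈ antidiagonal (μ + μ'), ∑ lam : MackeyIndex p.1 p.2 μ μ',
      F (p.1 - lam.lam) (p.2 + lam.lam - μ') lam.lam (μ' - lam.lam) =
    ∑ s ∈ antidiagonal μ, ∑ t ∈ antidiagonal μ', F s.1 s.2 t.1 t.2 := by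
  rw [Finset.sum_sigma', ← Finset.sum_product']
  refine Finset.sum_bij' (fun p _ => ((p.1.1 - p.2.lam, p.1.2 + p.2.lam - μ'), (p.2.lam, μ' - p.2.lam)))
    (fun q hq => ⟨(q.1.1 + q.2.1, q.1.2 + q.2.2), ⟨q.2.1, le_add_self, ?_, ?_⟩⟩) ?_ ?_ ?_ ?_ ?_
  · rw [← mem_antidiagonal.1 (mem_product.1 hq).2]; exact le_self_add
  · rw [← mem_antidiagonal.1 (mem_product.1 hq).2, add_assoc, add_comm q.2.1]; exact le_add_self
  · rintro ⟨p, lam⟩ hp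
    simp only [Finset.mem_sigma, mem_univ, and_true, mem_antidiagonal] at hp
    exact mem_product.2 ⟨mem_antidiagonal.2 (mackey₃ hp lam), mem_antidiagonal.2 (mackey₄ lam)⟩
  · rintro ⟨s, t⟩ hq
    simp only [mem_product, mem_antidiagonal] at hq
    simp only [Finset.mem_sigma, mem_univ, and_true, mem_antidiagonal]
    rw [← hq.1, ← hq.2, add_add_add_comm]
  · rintro ⟨p, lam⟩ hp
    have e : ∀ {p q : (I →₀ ℕ) × (I →₀ ℕ)} {j : MackeyIndex p.1 p.2 μ μ'} {k : MackeyIndex q.1 q.2 μ μ'}, p = q → j.lam = k.lam →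
        (⟨p, j⟩ : Σ p : (I →₀ ℕ) × (I →₀ ℕ), MackeyIndex p.1 p.2 μ μ') = ⟨q, k⟩ := by
      rintro p _ j k rfl h
      rw [MackeyIndex.ext' h]
    exact e (Prod.ext (mackey₁ lam) (mackey₂ lam)) rfl
  · rintro ⟨s, t⟩ hq
    simp only [mem_product, mem_antidiagonal] at hq
    simp only [← hq.2, add_tsub_cancel_right, add_tsub_cancel_left, add_assoc, add_comm t.2]
  · intros; rfl

theorem cop_mulR (x y : K0R K D) : cop K D (mulR K D x y) = twR K D (cop K D x) (cop K D y) := by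
  classical
  induction x using K0R.induction with
  | zero | add => simp_all
  | incl μ x =>
  induction y using K0R.induction with
  | zero | add => simp_all
  | incl μ' y =>
  let _ : ∀ p : (I →₀ ℕ) × (I →₀ ℕ), Fintype (MackeyIndex p.1 p.2 μ μ') := fun p => Fintype.ofFinite _
  rw [mulR_incl rfl, cop_incl, cop_incl, cop_incl]
  simp only [map_sum, lsum_apply]
  rw [sum_comm]
  rw [← sum_mackeyIndex fun s s' t t' => twR K D (copK s s' μ x) (copK t t' μ' y)]
  exact sum_congr rfl fun p hp => copK_mulK (mem_antidiagonal.1 hp) x y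

theorem cop_one : cop K D (one K D) = one K D ⊗ₜ one K D := by
  classical
  refine (cop_incl (oneK K D)).trans ?_
  rw [Finset.HasAntidiagonal.antidiagonal_zero, Finset.sum_singleton, copK_apply (add_zero 0), resK_oneK, extK_symm]
  rfl

end QHA

end

theorem mainTheorem10 {K : Type*} [Field K] [IsAlgClosed K] {I : Type*} [Finite I]
    (D : BorcherdsDatum I) :
    (∀ (ν ν' μ μ' : I →₀ ℕ) (h : ν + ν' = μ + μ') (M : QHA.RMod K D μ) (N : QHA.RMod K D μ'),
      ∃ (r : ℕ) (lam : Fin r ≃ QHA.MackeyIndex ν ν' μ μ')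
        (F : Fin (r + 1) → Submodule (QHA.Alg K D ν ⊗[K] QHA.Alg K D ν')
          (QHA.Res h (QHA.Ind (rfl : μ + μ' = μ + μ') (M.box N)))),
        Monotone F ∧ F 0 = ⊥ ∧ F (Fin.last r) = ⊤ ∧
        (∀ k, (QHA.Res h (QHA.Ind (rfl : μ + μ' = μ + μ') (M.box N))).IsHomogeneous (F k)) ∧
        ∀ k : Fin r, (QHA.Res h (QHA.Ind (rfl : μ + μ' = μ + μ') (M.box N))).SubquotientIso
          (F k.castSucc) (F k.succ) (QHA.mackeyTerm h (lam k) M N)) ∧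
    ∃ (mul : QHA.K0R K D →ₗ[ℤ[T;T⁻¹]] QHA.K0R K D →ₗ[ℤ[T;T⁻¹]] QHA.K0R K D)
      (ext : ∀ ν ν' : I →₀ ℕ, Gr.K0 (QHA.deg K D ν) ⊗[ℤ[T;T⁻¹]] Gr.K0 (QHA.deg K D ν')
        ≃ₗ[ℤ[T;T⁻¹]] Gr.K0 (Gr.tensorDeg (QHA.deg K D ν) (QHA.deg K D ν')))
      (Δ : QHA.K0R K D →ₗ[ℤ[T;T⁻¹]] QHA.K0R K D ⊗[ℤ[T;T⁻¹]] QHA.K0R K D)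
      (tw : QHA.K0R K D ⊗[ℤ[T;T⁻¹]] QHA.K0R K D →ₗ[ℤ[T;T⁻¹]]
        QHA.K0R K D ⊗[ℤ[T;T⁻¹]] QHA.K0R K D →ₗ[ℤ[T;T⁻¹]] QHA.K0R K D ⊗[ℤ[T;T⁻¹]] QHA.K0R K D),
      QHA.IsIndProduct mul ∧ QHA.IsExternalProduct ext ∧ QHA.IsResCoproduct ext Δ ∧
      QHA.IsTwistedProduct mul tw ∧
      QHA.IsAlgebraStructure mul (QHA.one K D) ∧
      QHA.IsAlgebraStructure tw (QHA.one K D ⊗ₜ QHA.one K D) ∧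
      Δ (QHA.one K D) = QHA.one K D ⊗ₜ QHA.one K D ∧
      ∀ x y, Δ (mul x y) = tw (Δ x) (Δ y) := by

  exact ⟨fun ν ν' μ μ' h M N => QHA.exists_mackeyFilt h (M.box N), QHA.mulR K D, QHA.extK, QHA.cop K D, QHA.twR K D,
    QHA.isIndProduct_mulR, QHA.isExternalProduct_extK, QHA.isResCoproduct_cop, QHA.isTwistedProduct_twR,
    QHA.isAlgebraStructure_mulR, QHA.isAlgebraStructure_twR, QHA.cop_one, QHA.cop_mulR⟩
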